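/- **Setting.** Let $Y=\,]-\frac12,\frac12[^3$ and let $\Sigma\subset Y$ be a connected compact set with Lipschitz boundary such that $\Sigma^*:=Y\setminus\Sigma$ is simply connected. Let $\omega,\varepsilon_0,\mu_0>0$, $k_0=\omega\sqrt{\varepsilon_0\mu_0}$, and $\varepsilon_r\in\mathbb C$ with $\operatorname{Im}\varepsilon_r>0$. Let $L^2_\sharp(Y)$ be the space of $\mathbb Z^3$-periodic functions in $L^2_{loc}(\mathbb R^3)$ and $W^{1,2}_\sharp(Y)$ the space of $f\in L^2_\sharp(Y)$ whose distributional derivatives on $\mathbb R^3$ belong to $L^2_\sharp(Y)$. Fields are identified when they agree almost everywhere; $a\cdot b=\sum_i a_ib_i$ is bilinear on $\mathbb C^3$. A vector $z\in\mathbb C^3$ is a *circulation vector* of a periodic field $u$, written $z=\oint u$, if $u=\nabla\psi+z$ a.e. in $\Sigma^*$ for some $\psi\in W^{1,2}_\sharp(Y)$. Let $X_0$ be the set of $v\in W^{1,2}_\sharp(Y;\mathbb C^3)$ with $\operatorname{curl}v=0$ in $\Sigma^*$ and $\oint v=0$, and let $X_0^{\rm div}=\{v\in X_0:\operatorname{div}v=0\text{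 in }Y\}$. Let $V$ be the set of all $w\in\mathbb C^3\oplus X_0^{\rm div}$ such that $$\int_\Sigma \operatorname{curl}w\cdot\operatorname{curl}v-\varepsilon_rk_0^2\int_Y w\cdot v=0\qquad\text{for all }v\in X_0 .$$ For $k=1,2,3$ let $u^k\in X_0^{\rm div}$ be the solution of $$\int_\Sigma\operatorname{curl}u^k\cdot\overline{\operatorname{curl}v}-\varepsilon_rk_0^2\int_Y u^k\cdot\overline v=\varepsilon_rk_0^2\int_Y e_k\cdot\overline v\qquad\text{for all }v\in X_0^{\rm div},$$ and put $H^k=e_k+u^k$, $J^k=\operatorname{curl}H^k$. **Proposition.** 1. For each $k$ the field $u^k$ exists and is unique. $V$ is a complex vector space of dimension three, and $(H^1,H^2,H^3)$ is a basis of it. Each $w\in V$ has exactly one circulation vector $z$, and $w=\sum_k z_kH^k$. Every $z\in\mathbb C^3$ is the circulation vector of exactly one $w\in V$. 2. Let $\Omega\subset\mathbb R^3$ be open with $\overline\Omega\subset B_R$, let $\varepsilon_e>0$, and let $\eta_n>0$, $\eta_n\to0$. For $\eta>0$ let $\Sigma_\eta$ be the union of the sets $\eta(k+\Sigma)$ over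 all $k\in\mathbb Z^3$ with $\eta(k+Y)\subset\Omega$, and let $\varepsilon_\eta=\varepsilon_r\eta^{-2}$ on $\Sigma_\eta$, $\varepsilon_\eta=\varepsilon_e$ on $\Omega\setminus\Sigma_\eta$, $\varepsilon_\eta=1$ on $\mathbb R^3\setminus\Omega$. For each $\eta=\eta_n$ let $E_\eta,H_\eta\in L^2_{loc}(\mathbb R^3;\mathbb C^3)$ satisfy, in the sense of distributions on $\mathbb R^3$, $$\operatorname{curl}E_\eta=i\omega\mu_0H_\eta,\qquad \operatorname{curl}H_\eta=-i\omega\varepsilon_0\varepsilon_\eta E_\eta,$$ and let $J_\eta=\eta\,\varepsilon_\eta E_\eta$. Assume that $(E_{\eta_n})$, $(H_{\eta_n})$, $(J_{\eta_n})$ are bounded in $L^2(B_R)$ and two-scale converge on $B_R$ to $E_0,H_0,J_0\in L^2(B_R\times Y;\mathbb C^3)$ respectively (extended periodically in $y$), that is, $\int_{B_R}f_{\eta_n}(x)\varphi(x,x/\eta_n)\,dx\to\int_{B_R\times Y}f_0(x,y)\varphi(x,y)\,dx\,dy$ for every smooth $\varphi(x,y)$ that is $\mathbb Z^3$-periodic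 in $y$ and vanishes for $x$ outside a compact subset of $B_R$. Then for a.e. $x\in\Omega$ the field $H_0(x,\cdot)$ has exactly one circulation vector $H(x)=\oint H_0(x,\cdot)$, and, with $H_k(x)=H(x)\cdot e_k$ and $J_k(x)=-\frac{1}{i\omega\varepsilon_0}H_k(x)$, $$H_0(x,y)=\sum_{k=1}^3H_k(x)H^k(y),\qquad J_0(x,y)=\sum_{k=1}^3J_k(x)J^k(y)\qquad\text{for a.e. }(x,y)\in\Omega\times Y .$$ -/

import Mathlib

open MeasureTheory Filter Topology Set
open scoped ComplexConjugate NNReal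

noncomputable section

namespace CellProblem

/-- The physical space `ℝ³` with its Euclidean norm. -/
abbrev E3 : Type := EuclideanSpace ℝ (Fin 3)

/-- The space `ℂ³` of values of the fields, with its Hermitian norm. -/
abbrev C3 : Type := EuclideanSpace ℂ (Fin 3)

/-! ### Vector algebra in `ℂ³` -/

/-- The bilinear product `a · b` (no conjugation). -/
def dot (a b : C3) : ℂ := ∑ i, a i * b i

/-- Componentwise complex conjugation. -/
def conjVec (a : C3) : C3 := WithLp.toLp 2 fun i => conj (a i)

/-- The canonical basis vector `e_k` of `ℂ³`. -/
def stdVec (k : Fin 3) : C3 := EuclideanSpace.single k 1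

/-! ### Geometry -/

/-- The open unit cell `Y = ]-1/2, 1/2[³`. -/
def cell : Set E3 := {y | ∀ i, y i ∈ Ioo (-(1 / 2) : ℝ) (1 / 2)}

/-- The lattice vector with integer coordinates `k`. -/
def latt (k : Fin 3 → ℤ) : E3 := WithLp.toLp 2 fun i => (k i : ℝ)

/-- A closed set with Lipschitz boundary: near each boundary point, in suitable Cartesian
coordinates, the set is the region below the graph of a Lipschitz function of two variables. -/
def HasLipschitzBoundary (K : Set E3) : Prop :=
  ∀ p ∈ frontier K, ∃ (A : E3 ≃ᵃⁱ[ℝ] E3) (r : ℝ) (C : ℝ≥0) (g : EuclideanSpace ℝ (Fin 2) → ℝ),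
    0 < r ∧ LipschitzWith C g ∧
      ∀ x ∈ Metric.ball p r, x ∈ K ↔ A x 2 ≤ g !₂[A x 0, A x 1]

/-- The standing assumptions on the reference inclusion `S`: a connected compact subset of the
open cell with Lipschitz boundary, whose complement in the cell is simply connected. -/
structure IsInclusion (S : Set E3) : Prop where
  isCompact : IsCompact S
  isConnected : IsConnected S
  subset_cell : S ⊆ cell
  lipschitz : HasLipschitzBoundary S
  simplyConnected : SimplyConnectedSpace (cell \ S : Set E3)

/-! ### Periodic Sobolev spaces -/

/-- Test functions on `ℝ³`: smooth with compact support. -/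
def IsTestFun (φ : E3 → ℝ) : Prop := ContDiff ℝ (⊤ : ℕ∞) φ ∧ HasCompactSupport φ

/-- The classical partial derivative `∂_i φ`. -/
def pderiv (i : Fin 3) (φ : E3 → ℝ) (x : E3) : ℝ := fderiv ℝ φ x (EuclideanSpace.single i 1)

/-- `L²_♯(Y)`: (almost everywhere) `ℤ³`-periodic functions that are square integrable on `Y`. -/
def L2per {F : Type*} [NormedAddCommGroup F] (f : E3 → F) : Prop :=
  (∀ k : Fin 3 → ℤ, ∀ᵐ y, f (y + latt k) = f y) ∧ MemLp f 2 (volume.restrict cell)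

/-- `∂_i f = g` in the sense of distributions on `ℝ³`. -/
def IsWeakPartial (i : Fin 3) (f g : E3 → ℂ) : Prop :=
  ∀ φ : E3 → ℝ, IsTestFun φ →
    ∫ x, (pderiv i φ x : ℂ) * f x = -∫ x, (φ x : ℂ) * g x

/-- `W^{1,2}_♯(Y)` for scalar functions. -/
def W12per (f : E3 → ℂ) : Prop :=
  L2per f ∧ ∀ i, ∃ g, L2per g ∧ IsWeakPartial i f g

/-- `W^{1,2}_♯(Y; ℂ³)`. -/
def W12perVec (u : E3 → C3) : Prop := ∀ j, W12per fun y => u y j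

/-- The distributional partial derivative of `f ∈ W^{1,2}_♯(Y)`, as an element of `L²_♯(Y)`
(unique up to a null set). -/
def weakPartial (i : Fin 3) (f : E3 → ℂ) : E3 → ℂ :=
  Classical.epsilon fun g => L2per g ∧ IsWeakPartial i f g

/-- The gradient of `ψ ∈ W^{1,2}_♯(Y)`. -/
def grad (ψ : E3 → ℂ) (y : E3) : C3 := WithLp.toLp 2 fun i => weakPartial i ψ y

/-- The divergence of `u ∈ W^{1,2}_♯(Y; ℂ³)`. -/
def divergence (u : E3 → C3) (y : E3) : ℂ := ∑ i, weakPartial i (fun x => u x i) y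

/-- The curl of `u ∈ W^{1,2}_♯(Y; ℂ³)`; indices are taken modulo 3, so that
`(curl u)_i = ∂_{i+1} u_{i+2} - ∂_{i+2} u_{i+1}`. -/
def curl (u : E3 → C3) (y : E3) : C3 :=
  WithLp.toLp 2 fun i =>
    weakPartial (i + 1) (fun x => u x (i + 2)) y - weakPartial (i + 2) (fun x => u x (i + 1)) y

/-! ### Circulation vector and the cell problem -/

/-- `u` is curl-free in `Y \ S`. -/
def CurlFreeOutside (S : Set E3) (u : E3 → C3) : Prop :=
  ∀ᵐ y ∂volume.restrict (cell \ S), curl u y = 0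

/-- `z` is a circulation vector of `u`: there is a periodic potential `ψ` with
`u = ∇ψ + z` in `Y \ S`. -/
def IsCirculation (S : Set E3) (u : E3 → C3) (z : C3) : Prop :=
  ∃ ψ : E3 → ℂ, W12per ψ ∧ ∀ᵐ y ∂volume.restrict (cell \ S), u y = grad ψ y + z

/-- The circulation vector `∮ u`. -/
def circulation (S : Set E3) (u : E3 → C3) : C3 := Classical.epsilon (IsCirculation S u)

/-- The admissible test fields of the cell equation: periodic `W^{1,2}` fields, curl-free in
`Y \ S`, with zero circulation vector. -/
structure X0 (S : Set E3) (v : E3 → C3) : Prop where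
  sobolev : W12perVec v
  curlFree : CurlFreeOutside S v
  circulation_zero : IsCirculation S v 0

/-- The space `X_0^div`: the divergence-free fields of `X0`. -/
structure X0div (S : Set E3) (u : E3 → C3) : Prop extends X0 S u where
  divFree : ∀ᵐ y ∂volume.restrict cell, divergence u y = 0

/-- The variational cell equation
`∫_S curl w · curl v - ε_r k₀² ∫_Y w · v = 0` for every admissible test field `v`. -/
def WeakForm (S : Set E3) (εr : ℂ) (k₀ : ℝ) (w : E3 → C3) : Prop :=
  ∀ v : E3 → C3, X0 S v →
    (∫ y in S, dot (curl w y) (curl v y)) - εr * (k₀ : ℂ) ^ 2 * ∫ y in cell, dot (w y) (v y) = 0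

/-- `w ∈ ℂ³ ⊕ X_0^div` and `w` satisfies the variational cell equation. -/
def IsSolution (S : Set E3) (εr : ℂ) (k₀ : ℝ) (w : E3 → C3) : Prop :=
  (∃ z : C3, X0div S fun y => w y - z) ∧ WeakForm S εr k₀ w

/-- `u ∈ X_0^div` solves
`b₀(u,v) - ε_r k₀² ∫_Y u · v̄ = ε_r k₀² ∫_Y z · v̄` for all `v ∈ X_0^div`,
with `b₀(u,v) = ∫_S curl u · conj (curl v)`. -/
def IsCorrector (S : Set E3) (εr : ℂ) (k₀ : ℝ) (z : C3) (u : E3 → C3) : Prop :=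
  X0div S u ∧ ∀ v : E3 → C3, X0div S v →
    (∫ y in S, dot (curl u y) (conjVec (curl v y)))
        - εr * (k₀ : ℂ) ^ 2 * ∫ y in cell, dot (u y) (conjVec (v y))
      = εr * (k₀ : ℂ) ^ 2 * ∫ y in cell, dot z (conjVec (v y))

/-- The corrector `u^k ∈ X_0^div`, the solution of the previous problem for `z = e_k`. -/
def corrector (S : Set E3) (εr : ℂ) (k₀ : ℝ) (k : Fin 3) : E3 → C3 :=
  Classical.epsilon (IsCorrector S εr k₀ (stdVec k))

/-- The shape magnetic field `H^k = e_k + u^k`. -/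
def shapeH (S : Set E3) (εr : ℂ) (k₀ : ℝ) (k : Fin 3) (y : E3) : C3 :=
  stdVec k + corrector S εr k₀ k y

/-- The shape current `J^k = curl H^k`. -/
def shapeJ (S : Set E3) (εr : ℂ) (k₀ : ℝ) (k : Fin 3) (y : E3) : C3 :=
  curl (shapeH S εr k₀ k) y

/-! ### The Maxwell system in the composite structure -/

/-- The small scatterers: the union of `η(k + S)` over the `k ∈ ℤ³` with `η(k + Y) ⊆ Ω`. -/
def scatterers (S Ω : Set E3) (η : ℝ) : Set E3 :=
  ⋃ k ∈ {k : Fin 3 → ℤ | (fun y => η • (latt k + y)) '' cell ⊆ Ω}, (fun y => η • (latt k + y)) '' S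

/-- The relative permittivity `ε_η`: `ε_r / η²` in the scatterers, `ε_e` in the rest of `Ω`, and
`1` outside `Ω`. -/
def permittivity (S Ω : Set E3) (εr : ℂ) (εe η : ℝ) (x : E3) : ℂ :=
  (scatterers S Ω η).indicator (fun _ => εr / (η : ℂ) ^ 2) x
    + (Ω \ scatterers S Ω η).indicator (fun _ => (εe : ℂ)) x
    + Ωᶜ.indicator (fun _ => (1 : ℂ)) x

/-- `L²_loc(ℝ³; ℂ³)`. -/
def L2loc (f : E3 → C3) : Prop :=
  ∀ K : Set E3, IsCompact K → MemLp f 2 (volume.restrict K)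

/-- `curl u = g` in the sense of distributions on `ℝ³` (indices modulo 3). -/
def IsWeakCurl (u g : E3 → C3) : Prop :=
  ∀ φ : E3 → ℝ, IsTestFun φ → ∀ i : Fin 3,
    ∫ x, ((pderiv (i + 1) φ x : ℂ) * u x (i + 2) - (pderiv (i + 2) φ x : ℂ) * u x (i + 1))
      = -∫ x, (φ x : ℂ) * g x i

/-- The time-harmonic Maxwell system `curl E = iωμ₀ H`, `curl H = -iωε₀ ε E` in `ℝ³`, for the
relative permittivity `ε`. -/
structure Maxwell (ω ε₀ μ₀ : ℝ) (ε : E3 → ℂ) (E H : E3 → C3) : Prop where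
  l2loc_E : L2loc E
  l2loc_H : L2loc H
  curl_E : IsWeakCurl E fun x => (Complex.I * ω * μ₀) • H x
  curl_H : IsWeakCurl H fun x => (-(Complex.I * ω * ε₀) * ε x) • E x

/-- The displacement current `J_η = η ε_η E_η`. -/
def current (η : ℝ) (ε : E3 → ℂ) (E : E3 → C3) (x : E3) : C3 := ((η : ℂ) * ε x) • E x

/-! ### Two-scale convergence -/

/-- Test functions in `C_c^∞(D; C_♯^∞(Y))`. -/
structure IsTwoScaleTest (D : Set E3) (φ : E3 → E3 → ℝ) : Prop where
  smooth : ContDiff ℝ (⊤ : ℕ∞) fun p : E3 × E3 => φ p.1 p.2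
  periodic : ∀ x y (k : Fin 3 → ℤ), φ x (y + latt k) = φ x y
  support : ∃ K ⊆ D, IsCompact K ∧ ∀ x ∉ K, ∀ y, φ x y = 0

/-- The sequence `f n ∈ L²(D)`, at scales `η n`, two-scale converges to `f₀ ∈ L²(D × Y)`; the
limit is extended `ℤ³`-periodically in its second variable. -/
structure TwoScaleConv (D : Set E3) (η : ℕ → ℝ) (f : ℕ → E3 → C3) (f₀ : E3 → E3 → C3) :
    Prop where
  memLp : ∀ n, MemLp (f n) 2 (volume.restrict D)
  memLp_limit : MemLp (fun p : E3 × E3 => f₀ p.1 p.2) 2 (volume.restrict (D ×ˢ cell))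
  periodic : ∀ x y (k : Fin 3 → ℤ), f₀ x (y + latt k) = f₀ x y
  tendsto : ∀ φ : E3 → E3 → ℝ, IsTwoScaleTest D φ →
    Tendsto (fun n => ∫ x in D, φ x ((η n)⁻¹ • x) • f n x) atTop
      (𝓝 (∫ p in D ×ˢ cell, φ p.1 p.2 • f₀ p.1 p.2))

/-- A sequence bounded in `L²(D)`. -/
def BoundedL2 (D : Set E3) (f : ℕ → E3 → C3) : Prop :=
  ∃ M : ℝ≥0, ∀ n, eLpNorm (f n) 2 (volume.restrict D) ≤ M

end CellProblem

end

open CellProblem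

noncomputable section

namespace CellProblem

-- Periodic fields are read on the torus, where the distributional derivative `∂_i` is
-- multiplication of the Fourier coefficients by `ik k i`. Potentials, the Helmholtz decomposition
-- and the `W^{1,2}` regularity of divergence-free fields with square integrable curl then reduce to
-- bounded multipliers (`isWeakPartial_of_fc`, `exists_potential_of_fc`, `w12perVec_of_curl`,
-- `exists_helmholtz`).
--
-- The geometry of the inclusion enters mainly through the circulation vector. For uniqueness, there
-- are smooth periodic weights `χ i` of mean one that vanish on `S` and do not depend on `y i`, and
-- for these `∫ χ i * u i = z i` (`IsCirculation.eq_integral`). For existence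
-- (`exists_isCirculation`), a Sobolev field that is curl-free outside `S` has local potentials
-- there, which glue because the complement in the cell is simply connected
-- (`exists_global_potential`); the Lipschitz boundary lets the potential be continued into `S`
-- (`exists_boundary_extension`, `exists_global_extension`). Replacing the field inside `S` by the
-- gradient of the continuation produces a periodic field that is curl-free everywhere, hence of the
-- form `∇ψ + z`. Consequently, for fields that are curl-free outside `S`, zero circulation is the
-- same as the vanishing of the weighted means, a closed condition in `L²`.
--
-- The pairs `(u, curl u)` with `u` in `X0div` thus form a closed subspace of `L²`. The sesquilinear
-- form of the corrector problem is coercive on it because `ε_r k₀²` has positive imaginary part, so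
-- the problem is uniquely solvable (`bijective_cellOp`, `existsUnique_corrector`). The gradient
-- part of a test field in `X0` contributes nothing to the cell equation, and `X0div` is stable
-- under conjugation. Therefore `w = z + u` solves the cell equation exactly when `u` is the
-- corrector of `z` (`weakForm_iff_isCorrector`). By linearity `w = ∑ z_k H^k`, and `z` is the
-- circulation vector of `w`; this is the first part.
--
-- For the limits, write the system as `curl E = c₁ H`, `curl H = c₂ η⁻¹ J` with `c₁ c₂ = k₀²`.
-- Testing with `a(x) e_k(x/η)` and keeping the leading order in `η` shows that, in `y`, `E₀` is
-- curl-free, `H₀` is divergence-free and `curl H₀ = c₂ J₀`. Since `J = η ε_e E` in the matrix and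
-- `E = η ε_r⁻¹ J` in the scatterers, `J₀` vanishes outside the inclusions and `E₀` vanishes inside.
--
-- Testing the first equation with `a(x) v(x/η)`, `v` in `X0`, gives a singular term `η⁻¹ ∫ a E ·
-- curl v`. It equals `ε_r⁻¹ ∫ a J · curl v`, because `curl v` lives in the inclusions. The term
-- containing `∇a` tends to a mean of a vector product of `E₀` and `v`. This mean is zero: where
-- `E₀` does not vanish `v` is a periodic gradient, and `E₀` is curl-free (`cellPair_cross_eq`).
-- What remains is `∫ J₀ · curl v = ε_r c₁ ∫ H₀ · v` (`TwoScaleSystem.ae_weakForm`). Together with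
-- `curl H₀ = c₂ J₀` this is the cell equation for `H₀(x, ·)` for almost every `x`, and the first
-- part identifies `H₀` and `J₀`.

local instance unitAddCircleMeasureSpace : MeasureSpace UnitAddCircle := ⟨AddCircle.haarAddCircle⟩

local instance unitAddCircleIsAddHaarMeasure :
    Measure.IsAddHaarMeasure (volume : Measure UnitAddCircle) :=
  inferInstanceAs (Measure.IsAddHaarMeasure AddCircle.haarAddCircle)

local instance unitAddCircleIsProbabilityMeasure :
    IsProbabilityMeasure (volume : Measure UnitAddCircle) :=
  inferInstanceAs (IsProbabilityMeasure AddCircle.haarAddCircle)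

/-! ### The quotient map onto the torus and its effect on measures -/

/-- The flat torus `ℝ³ / ℤ³`. -/
abbrev Torus : Type := UnitAddTorus (Fin 3)

/-- The quotient map `ℝ³ → ℝ³ / ℤ³`. -/
def toTorus (y : E3) : Torus := fun i => (y i : UnitAddCircle)

/-- The section of `toTorus` with values in the half-closed unit cell. -/
def sec (t : Torus) : E3 := WithLp.toLp 2 fun i => (AddCircle.equivIoc 1 (-(1 / 2) : ℝ) (t i)).1

lemma continuous_toTorus : Continuous toTorus := by
  unfold toTorus
  refine continuous_pi fun i => (AddCircle.continuous_mk' 1).comp ?_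
  fun_prop

lemma measurable_toTorus : Measurable toTorus := continuous_toTorus.measurable

lemma toTorus_add (x y : E3) : toTorus (x + y) = toTorus x + toTorus y := by
  ext i; simp [toTorus]

lemma toTorus_latt (k : Fin 3 → ℤ) : toTorus (latt k) = 0 := by
  ext i
  simp only [toTorus, latt, Pi.zero_apply]
  rw [AddCircle.coe_eq_zero_iff]
  exact ⟨k i, by simp⟩

lemma toTorus_add_latt (y : E3) (k : Fin 3 → ℤ) : toTorus (y + latt k) = toTorus y := by
  rw [toTorus_add, toTorus_latt, add_zero]

lemma toTorus_sec (t : Torus) : toTorus (sec t) = t := by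
  ext i
  simp only [toTorus, sec]
  exact (AddCircle.equivIoc (1 : ℝ) (-(1 / 2))).symm_apply_apply (t i)

lemma exists_eq_add_latt_of_toTorus_eq {x y : E3} (h : toTorus x = toTorus y) :
    ∃ k, x = y + latt k := by
  have h' : ∀ i, ∃ n : ℤ, (n : ℝ) = x i - y i := fun i => by
    have := congrFun h i
    simp only [toTorus] at this
    rw [← sub_eq_zero, ← AddCircle.coe_sub, AddCircle.coe_eq_zero_iff] at this
    obtain ⟨n, hn⟩ := this
    exact ⟨n, by simpa using hn⟩
  choose k hk using h'
  refine ⟨k, ?_⟩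
  ext i
  simp [latt, hk]

lemma sec_toTorus {y : E3} (hy : y ∈ cell) : sec (toTorus y) = y := by
  ext i
  simp only [toTorus, sec]
  have h := hy i
  have : y i ∈ Ioc (-(1 / 2) : ℝ) (-(1 / 2) + 1) := ⟨h.1, by have := h.2; linarith⟩
  exact AddCircle.equivIoc_coe_of_mem this

lemma isOpen_cell : IsOpen cell := by
  have : cell = ⋂ i : Fin 3, (fun y : E3 => y i) ⁻¹' Ioo (-(1 / 2) : ℝ) (1 / 2) := by
    ext y; simp [cell]
  rw [this]
  exact isOpen_iInter_of_finite fun i => isOpen_Ioo.preimage (by fun_prop)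

lemma measurableSet_cell : MeasurableSet cell := isOpen_cell.measurableSet

/-- Haar measure on the circle is Lebesgue measure on a half-closed interval of length one; the
faces that the open cell leaves out are null. -/
lemma measurePreserving_toTorus : MeasurePreserving toTorus (volume.restrict cell) volume := by
  refine ⟨measurable_toTorus, ?_⟩
  refine Measure.ext_of_lintegral _ fun f hf => ?_
  rw [lintegral_map hf measurable_toTorus, UnitAddTorus.lintegral_preimage f (fun _ => -(1 / 2))]
  have hmp := PiLp.volume_preserving_ofLp (Fin 3)
  have hc : cell = (WithLp.ofLp : E3 → Fin 3 → ℝ) ⁻¹'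
      (univ.pi fun _ : Fin 3 => Ioo (-(1 / 2) : ℝ) (1 / 2)) := by
    ext y; simp [cell]
  have hf' : Measurable fun x : Fin 3 → ℝ => f fun i => (x i : UnitAddCircle) :=
    hf.comp (measurable_pi_lambda _ fun i =>
      (AddCircle.measurable_mk' (a := 1)).comp (measurable_pi_apply i))
  rw [hc]
  refine (hmp.setLIntegral_comp_preimage
    (MeasurableSet.univ_pi fun _ => measurableSet_Ioo) hf').trans ?_
  have hI : {x : Fin 3 → ℝ | ∀ i, x i ∈ Ioc (-(1 / 2) : ℝ) (-(1 / 2) + 1)} =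
      univ.pi fun _ : Fin 3 => Ioc (-(1 / 2) : ℝ) (-(1 / 2) + 1) := by
    ext; simp
  rw [hI]
  refine setLIntegral_congr ?_
  have : (-(1 / 2) + 1 : ℝ) = 1 / 2 := by norm_num
  rw [this]
  exact Measure.pi_Ioo_ae_eq_pi_Ioc

lemma measurable_sec : Measurable sec := by
  unfold sec
  refine (PiLp.volume_preserving_toLp (Fin 3)).measurable.comp
    (measurable_pi_lambda _ fun i => ?_)
  exact measurable_subtype_coe.comp
    ((AddCircle.measurableEquivIoc 1 (-(1 / 2))).measurable.comp (measurable_pi_apply i))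

lemma measurePreserving_sec : MeasurePreserving sec volume (volume.restrict cell) := by
  refine ⟨measurable_sec, ?_⟩
  rw [← measurePreserving_toTorus.map_eq, Measure.map_map measurable_sec measurable_toTorus]
  conv_rhs => rw [← Measure.map_id (μ := volume.restrict cell)]
  refine Measure.map_congr ?_
  filter_upwards [ae_restrict_mem measurableSet_cell] with y hy
  exact sec_toTorus hy
-- Haar measure is translation invariant, so the position of the cell does not matter.
lemma lintegral_cell_toTorus {w : Torus → ENNReal} (hw : Measurable w) (h : E3) :
    ∫⁻ y in cell, w (toTorus (h + y)) = ∫⁻ t, w t := by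
  simp_rw [toTorus_add]
  rw [measurePreserving_toTorus.lintegral_comp
    (f := fun t => w (toTorus h + t)) (hw.comp (measurable_const_add _))]
  exact lintegral_add_left_eq_self w _

lemma norm_le_of_mem_cell {y : E3} (hy : y ∈ cell) : ‖y‖ ≤ 1 := by
  rw [EuclideanSpace.norm_eq, Real.sqrt_le_iff, Fin.sum_univ_three]
  have h : ∀ i, ‖y i‖ ^ 2 ≤ 1 / 4 := fun i => by
    have := hy i
    rw [Real.norm_eq_abs, sq_abs]
    nlinarith [this.1, this.2]
  exact ⟨by norm_num, by linarith [h 0, h 1, h 2]⟩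

lemma volume_cell : volume cell = 1 := by
  have := measurePreserving_toTorus.measure_preimage MeasurableSet.univ.nullMeasurableSet
  simpa using this

/-- The integral over a ball of a nonnegative periodic function. -/
lemma lintegral_ball_toTorus_le {w : Torus → ENNReal} (hw : Measurable w) (M : ℝ) :
    ∫⁻ x in Metric.ball (0 : E3) M, w (toTorus x)
      ≤ volume (Metric.ball (0 : E3) (M + 2)) * ∫⁻ t, w t := by
  have hwt : Measurable fun x : E3 => w (toTorus x) := hw.comp measurable_toTorus
  set B := Metric.ball (0 : E3) (M + 2)
  calc ∫⁻ x in Metric.ball (0 : E3) M, w (toTorus x)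
      = ∫⁻ y in cell, ∫⁻ x in Metric.ball (0 : E3) M, w (toTorus x) := by
        simp [volume_cell]
    -- For each `y` in the cell the variable is shifted by `y`. Since `‖y‖ ≤ 1`, a ball enlarged by
    -- 2 contains the shifted ball.
    _ ≤ ∫⁻ y in cell, ∫⁻ h in B, w (toTorus (h + y)) := by
        refine setLIntegral_mono' measurableSet_cell fun y hy => ?_
        rw [← lintegral_indicator Metric.isOpen_ball.measurableSet,
          ← lintegral_indicator Metric.isOpen_ball.measurableSet,
          ← lintegral_add_right_eq_self _ y]
        refine lintegral_mono fun x => ?_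
        simp only [indicator]
        split_ifs with h1 h2
        · exact le_rfl
        · exfalso
          apply h2
          have h3 := norm_le_of_mem_cell hy
          simp only [Metric.mem_ball, dist_zero_right] at h1 ⊢
          calc ‖x‖ = ‖x + y - y‖ := by simp
            _ ≤ ‖x + y‖ + ‖y‖ := norm_sub_le _ _
            _ < M + 2 := by linarith
        · exact zero_le
        · exact le_rfl
    _ = ∫⁻ h in B, ∫⁻ y in cell, w (toTorus (h + y)) := by
        refine lintegral_lintegral_swap ?_
        exact (hwt.comp (by fun_prop : Measurable fun p : E3 × E3 => p.2 + p.1)).aemeasurable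
    _ = volume B * ∫⁻ t, w t := by
        simp_rw [lintegral_cell_toTorus hw]
        simp [mul_comm]

/-- Scaling `x` by `η⁻¹` turns the ball of radius `R` into one of radius `η⁻¹ R`, whose enlargement
by 2 scales back to `R + 2η`. The bound is therefore uniform for bounded `η`, which is what limits
with oscillating functions require. -/
lemma lintegral_ball_toTorus_smul_le {w : Torus → ENNReal} (hw : Measurable w) (R : ℝ) {η : ℝ}
    (hη : 0 < η) :
    ∫⁻ x in Metric.ball (0 : E3) R, w (toTorus (η⁻¹ • x))
      ≤ volume (Metric.ball (0 : E3) (R + 2 * η)) * ∫⁻ t, w t := by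
  have hwt : Measurable fun x : E3 => w (toTorus x) := hw.comp measurable_toTorus
  have h1 : ∀ r, Metric.ball (0 : E3) r = (fun x => η⁻¹ • x) ⁻¹' Metric.ball 0 (η⁻¹ * r) := by
    intro r
    ext x
    simp only [Metric.mem_ball, dist_zero_right, mem_preimage, norm_smul, norm_inv,
      Real.norm_of_nonneg hη.le]
    constructor <;> intro h
    · gcongr
    · exact lt_of_mul_lt_mul_left h (by positivity)
  have key : ∀ (g : E3 → ENNReal), Measurable g → ∀ r,
      ∫⁻ x in Metric.ball (0 : E3) r, g (η⁻¹ • x)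
        = ENNReal.ofReal (η ^ 3) * ∫⁻ x in Metric.ball (0 : E3) (η⁻¹ * r), g x := by
    intro g hg r
    have hm := Measure.map_addHaar_smul (volume : Measure E3) (inv_ne_zero hη.ne')
    have : ∫⁻ x in Metric.ball (0 : E3) r, g (η⁻¹ • x)
        = ∫⁻ x in Metric.ball (0 : E3) (η⁻¹ * r), g x
            ∂(Measure.map (η⁻¹ • ·) (volume : Measure E3)) := by
      rw [setLIntegral_map Metric.isOpen_ball.measurableSet hg (measurable_const_smul _), ← h1]
    rw [this, hm]
    simp [abs_of_pos hη]
  rw [key _ hwt, ← setLIntegral_one, key (fun _ => 1) measurable_const, setLIntegral_one]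
  have := lintegral_ball_toTorus_le hw (η⁻¹ * R)
  have h2 : η⁻¹ * (R + 2 * η) = η⁻¹ * R + 2 := by field_simp
  rw [h2, mul_assoc]
  gcongr

/-- The previous bound applied to the indicator of a null set. It makes `F (toTorus (η⁻¹ • x))`
meaningful for classes `F` modulo null sets. -/
lemma quasiMeasurePreserving_toTorus_smul {η : ℝ} (hη : 0 < η) :
    Measure.QuasiMeasurePreserving (fun x : E3 => toTorus (η⁻¹ • x)) volume volume := by
  have hm : Measurable fun x : E3 => toTorus (η⁻¹ • x) :=
    measurable_toTorus.comp (measurable_const_smul _)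
  refine ⟨hm, Measure.AbsolutelyContinuous.mk fun s hs h0 => ?_⟩
  rw [Measure.map_apply hm hs]
  refine measure_null_of_locally_null _ fun x _ => ?_
  have hB : MeasurableSet (Metric.ball (0 : E3) (‖x‖ + 1)) := Metric.isOpen_ball.measurableSet
  refine ⟨_, inter_mem_nhdsWithin _
    (Metric.isOpen_ball.mem_nhds (x := x) (s := Metric.ball 0 (‖x‖ + 1)) (by simp)), ?_⟩
  have h := lintegral_ball_toTorus_smul_le (measurable_one.indicator hs) (‖x‖ + 1) hη
  rw [lintegral_indicator_one hs, h0, mul_zero] at h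
  have h' : ∫⁻ x in Metric.ball (0 : E3) (‖x‖ + 1),
      ((fun x : E3 => toTorus (η⁻¹ • x)) ⁻¹' s).indicator 1 x ≤ 0 := h
  rw [lintegral_indicator_one (hm hs), Measure.restrict_apply (hm hs)] at h'
  exact le_antisymm h' zero_le

lemma quasiMeasurePreserving_toTorus :
    Measure.QuasiMeasurePreserving toTorus volume volume := by
  simpa using quasiMeasurePreserving_toTorus_smul one_pos

/-! ### Periodic functions and functions on the torus -/

/-- The square integrable functions on the torus. -/
abbrev L2T : Type := Lp ℂ 2 (volume : Measure Torus)

/-- The lattice is countable, so almost every `y` satisfies all the periodicity relations at once,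
in particular the one that brings `y` back to the representative `sec (toTorus y)`. -/
lemma ae_eq_sec_toTorus {F : Type*} {f : E3 → F}
    (hf : ∀ k : Fin 3 → ℤ, ∀ᵐ y, f (y + latt k) = f y) :
    f =ᵐ[volume] fun y => f (sec (toTorus y)) := by
  filter_upwards [ae_all_iff.2 hf] with y hy
  obtain ⟨k, hk⟩ := exists_eq_add_latt_of_toTorus_eq (toTorus_sec (toTorus y))
  rw [hk, hy]

lemma L2per.memLp_sec {F : Type*} [NormedAddCommGroup F] {f : E3 → F} (hf : L2per f) :
    MemLp (fun t => f (sec t)) 2 volume :=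
  hf.2.comp_measurePreserving measurePreserving_sec

lemma l2per_comp_toTorus {F : Type*} [NormedAddCommGroup F] {f : Torus → F}
    (hf : MemLp f 2 volume) : L2per fun y => f (toTorus y) :=
  ⟨fun k => Eventually.of_forall fun y => by simp only [toTorus_add_latt],
    hf.comp_measurePreserving measurePreserving_toTorus⟩

/-- The element of `L²` of the torus represented by a periodic function. -/
def toL2T (f : E3 → ℂ) (hf : L2per f) : L2T := hf.memLp_sec.toLp _

lemma L2per.ae_eq_toL2T {f : E3 → ℂ} (hf : L2per f) :
    f =ᵐ[volume] fun y => toL2T f hf (toTorus y) := by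
  refine (ae_eq_sec_toTorus hf.1).trans ?_
  exact (quasiMeasurePreserving_toTorus.ae_eq_comp hf.memLp_sec.coeFn_toLp).symm

lemma L2per.exists_torus {f : E3 → ℂ} (hf : L2per f) :
    ∃ F : L2T, f =ᵐ[volume] fun y => F (toTorus y) := ⟨_, hf.ae_eq_toL2T⟩

lemma l2per_torus (F : L2T) : L2per fun y => F (toTorus y) := l2per_comp_toTorus (Lp.memLp F)

lemma L2per.congr {F : Type*} [NormedAddCommGroup F] {f g : E3 → F} (hf : L2per f)
    (h : f =ᵐ[volume] g) : L2per g := by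
  refine ⟨fun k => ?_, hf.2.ae_eq (ae_restrict_of_ae h)⟩
  have h' := (measurePreserving_add_right (volume : Measure E3) (latt k)).quasiMeasurePreserving.ae_eq_comp h
  filter_upwards [hf.1 k, h, h'] with y h1 h2 h3
  simp only [Function.comp] at h3
  rw [← h3, h1, h2]

lemma integral_cell_toTorus {F : Type*} [NormedAddCommGroup F] [NormedSpace ℝ F] {f : Torus → F}
    (hf : AEStronglyMeasurable f volume) :
    ∫ y in cell, f (toTorus y) = ∫ t, f t := by
  rw [← measurePreserving_toTorus.map_eq, integral_map measurable_toTorus.aemeasurable]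
  rwa [measurePreserving_toTorus.map_eq]

/-- A periodic function is determined by its restriction to the cell. -/
lemma ae_eq_of_ae_eq_cell {F : Type*} {f g : E3 → F}
    (hf : ∀ k : Fin 3 → ℤ, ∀ᵐ y, f (y + latt k) = f y)
    (hg : ∀ k : Fin 3 → ℤ, ∀ᵐ y, g (y + latt k) = g y)
    (h : f =ᵐ[volume.restrict cell] g) : f =ᵐ[volume] g := by
  refine (ae_eq_sec_toTorus hf).trans (EventuallyEq.trans ?_ (ae_eq_sec_toTorus hg).symm)
  have := measurePreserving_sec.quasiMeasurePreserving.ae_eq_comp h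
  exact quasiMeasurePreserving_toTorus.ae_eq_comp this

/-! ### Fourier series -/

/-- The exponential `y ↦ exp (2πi k · y)`. -/
def em (k : Fin 3 → ℤ) (y : E3) : ℂ := UnitAddTorus.mFourier k (toTorus y)

/-- The Fourier coefficients of a periodic function. -/
def fc (f : E3 → ℂ) (k : Fin 3 → ℤ) : ℂ := ∫ y in cell, em (-k) y * f y

lemma em_eq_exp (k : Fin 3 → ℤ) (y : E3) :
    em k y = Complex.exp (2 * Real.pi * Complex.I * ∑ i, (k i : ℂ) * (y i : ℂ)) := by
  simp only [em, UnitAddTorus.mFourier, ContinuousMap.coe_mk, toTorus]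
  rw [Finset.mul_sum, Complex.exp_sum]
  refine Finset.prod_congr rfl fun i _ => ?_
  rw [fourier_coe_apply]
  congr 1
  push_cast
  ring

lemma continuous_em (k : Fin 3 → ℤ) : Continuous (em k) :=
  (UnitAddTorus.mFourier k).continuous.comp continuous_toTorus

lemma em_add_latt (k : Fin 3 → ℤ) (y : E3) (m : Fin 3 → ℤ) : em k (y + latt m) = em k y := by
  simp only [em, toTorus_add_latt]

lemma em_neg (k : Fin 3 → ℤ) (y : E3) : em (-k) y = conj (em k y) := by
  simp only [em, UnitAddTorus.mFourier_neg]

lemma l2per_em (k : Fin 3 → ℤ) : L2per (em k) :=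
  l2per_comp_toTorus ((UnitAddTorus.mFourier k).continuous.memLp_of_hasCompactSupport
    (HasCompactSupport.of_compactSpace _))

lemma fc_congr {f g : E3 → ℂ} (h : f =ᵐ[volume.restrict cell] g) (k : Fin 3 → ℤ) :
    fc f k = fc g k :=
  integral_congr_ae (h.mono fun y hy => by simp only [hy])

lemma fc_torus (F : L2T) (k : Fin 3 → ℤ) :
    fc (fun y => F (toTorus y)) k = UnitAddTorus.mFourierCoeff F k := by
  unfold fc em UnitAddTorus.mFourierCoeff
  exact integral_cell_toTorus (f := fun t => UnitAddTorus.mFourier (-k) t * F t)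
    ((UnitAddTorus.mFourier (-k)).continuous.aestronglyMeasurable.mul
      (Lp.aestronglyMeasurable F))

lemma fc_eq_mFourierCoeff {f : E3 → ℂ} {F : L2T} (h : f =ᵐ[volume] fun y => F (toTorus y))
    (k : Fin 3 → ℤ) : fc f k = UnitAddTorus.mFourierCoeff F k := by
  rw [fc_congr (ae_restrict_of_ae h), fc_torus]

/-- Completeness of the exponentials in `L²` of the torus. -/
lemma fc_injective {f g : E3 → ℂ} (hf : L2per f) (hg : L2per g) (h : ∀ k, fc f k = fc g k) :
    f =ᵐ[volume] g := by
  obtain ⟨F, hF⟩ := hf.exists_torus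
  obtain ⟨G, hG⟩ := hg.exists_torus
  have : F = G := by
    apply UnitAddTorus.mFourierBasis.repr.injective
    ext k
    rw [UnitAddTorus.mFourierBasis_repr, UnitAddTorus.mFourierBasis_repr,
      ← fc_eq_mFourierCoeff hF, ← fc_eq_mFourierCoeff hG, h]
  rw [← this] at hG
  exact hF.trans hG.symm

/-- Riesz–Fischer; all periodic potentials below are constructed by prescribing their coefficients.
-/
lemma exists_fc_eq (c : (Fin 3 → ℤ) → ℂ) (hc : Summable fun k => ‖c k‖ ^ 2) :
    ∃ f, L2per f ∧ ∀ k, fc f k = c k := by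
  have hm : Memℓp c 2 := by
    refine memℓp_gen ?_
    simpa using hc
  refine ⟨fun y => (UnitAddTorus.mFourierBasis.repr.symm ⟨c, hm⟩ : L2T) (toTorus y),
    l2per_torus _, fun k => ?_⟩
  rw [fc_torus, ← UnitAddTorus.mFourierBasis_repr, LinearIsometryEquiv.apply_symm_apply]

lemma summable_fc {f : E3 → ℂ} (hf : L2per f) : Summable fun k => ‖fc f k‖ ^ 2 := by
  obtain ⟨F, hF⟩ := hf.exists_torus
  simp_rw [fc_eq_mFourierCoeff hF]
  exact (UnitAddTorus.hasSum_sq_mFourierCoeff F).summable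

lemma fc_conj {f : E3 → ℂ} (k : Fin 3 → ℤ) :
    fc (fun y => conj (f y)) k = conj (fc f (-k)) := by
  unfold fc
  rw [← integral_conj]
  refine integral_congr_ae (Eventually.of_forall fun y => ?_)
  simp only [map_mul, em_neg, Complex.conj_conj]

lemma L2per.conj {f : E3 → ℂ} (hf : L2per f) : L2per fun y => conj (f y) :=
  ⟨fun k => (hf.1 k).mono fun y hy => by simp only [hy], hf.2.star⟩

lemma L2per.add {F : Type*} [NormedAddCommGroup F] {f g : E3 → F} (hf : L2per f) (hg : L2per g) :
    L2per fun y => f y + g y :=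
  ⟨fun k => by filter_upwards [hf.1 k, hg.1 k] with y h1 h2; rw [h1, h2], hf.2.add hg.2⟩

lemma L2per.sub {F : Type*} [NormedAddCommGroup F] {f g : E3 → F} (hf : L2per f) (hg : L2per g) :
    L2per fun y => f y - g y :=
  ⟨fun k => by filter_upwards [hf.1 k, hg.1 k] with y h1 h2; rw [h1, h2], hf.2.sub hg.2⟩

lemma L2per.const_mul {f : E3 → ℂ} (hf : L2per f) (c : ℂ) : L2per fun y => c * f y :=
  ⟨fun k => by filter_upwards [hf.1 k] with y h1; rw [h1], hf.2.const_mul c⟩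

instance isProbabilityMeasure_cell : IsProbabilityMeasure (volume.restrict cell : Measure E3) :=
  ⟨by simp [volume_cell]⟩

lemma l2per_const {F : Type*} [NormedAddCommGroup F] (c : F) : L2per fun _ : E3 => c :=
  ⟨fun _ => Eventually.of_forall fun _ => rfl, memLp_const c⟩

lemma L2per.integrable_mul {f g : E3 → ℂ} (hf : L2per f) (hg : L2per g) :
    Integrable (fun y => f y * g y) (volume.restrict cell) :=
  MemLp.integrable_mul hf.2 hg.2

lemma integrable_em_mul {f : E3 → ℂ} (hf : L2per f) (k : Fin 3 → ℤ) :
    Integrable (fun y => em k y * f y) (volume.restrict cell) :=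
  (l2per_em k).integrable_mul hf

lemma fc_add {f g : E3 → ℂ} (hf : L2per f) (hg : L2per g) (k : Fin 3 → ℤ) :
    fc (fun y => f y + g y) k = fc f k + fc g k := by
  simp only [fc, mul_add]
  exact integral_add (integrable_em_mul hf _) (integrable_em_mul hg _)

lemma fc_sub {f g : E3 → ℂ} (hf : L2per f) (hg : L2per g) (k : Fin 3 → ℤ) :
    fc (fun y => f y - g y) k = fc f k - fc g k := by
  simp only [fc, mul_sub]
  exact integral_sub (integrable_em_mul hf _) (integrable_em_mul hg _)

lemma fc_const_mul (c : ℂ) (f : E3 → ℂ) (k : Fin 3 → ℤ) :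
    fc (fun y => c * f y) k = c * fc f k := by
  simp only [fc, mul_left_comm _ c]
  exact integral_const_mul _ _

/-- Parseval's identity for the bilinear product. -/
lemma hasSum_fc_mul_fc {f g : E3 → ℂ} (hf : L2per f) (hg : L2per g) :
    HasSum (fun k => fc f (-k) * fc g k) (∫ y in cell, f y * g y) := by
  -- The bilinear product of `f` and `g` is the Hermitian product of `conj f` and `g`, to which the
  -- usual Parseval identity applies.
  obtain ⟨F, hF⟩ := hf.conj.exists_torus
  obtain ⟨G, hG⟩ := hg.exists_torus
  have h := UnitAddTorus.hasSum_prod_mFourierCoeff F G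
  have e : ∫ y in cell, f y * g y = ∫ t, conj (F t) * G t := by
    rw [← integral_cell_toTorus (f := fun t => conj (F t) * G t)]
    · refine integral_congr_ae ?_
      filter_upwards [ae_restrict_of_ae hF, ae_restrict_of_ae hG] with y h1 h2
      rw [← h1, ← h2, Complex.conj_conj]
    · exact (Lp.aestronglyMeasurable F).star.mul (Lp.aestronglyMeasurable G)
  rw [e]
  refine h.congr_fun fun k => ?_
  rw [← fc_eq_mFourierCoeff hF, ← fc_eq_mFourierCoeff hG, fc_conj, Complex.conj_conj]

/-! ### Rescaled periodic functions -/

/-- The constant bounding the `L²` norm of a rescaled periodic function on a ball. -/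
def scaleConst (R η : ℝ) : ENNReal := volume (Metric.ball (0 : E3) (R + 2 * η)) ^ (1 / 2 : ℝ)

lemma scaleConst_ne_top (R η : ℝ) : scaleConst R η ≠ ⊤ :=
  ENNReal.rpow_ne_top_of_nonneg (by norm_num) measure_ball_lt_top.ne

lemma scaleConst_mono (R : ℝ) {η η' : ℝ} (h : η ≤ η') : scaleConst R η ≤ scaleConst R η' := by
  unfold scaleConst
  gcongr

lemma L2per.ae_eq_scaled {f : E3 → ℂ} (hf : L2per f) {η : ℝ} (hη : 0 < η) :
    (fun x => f (η⁻¹ • x)) =ᵐ[volume] fun x => toL2T f hf (toTorus (η⁻¹ • x)) := by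
  have hq : Measure.QuasiMeasurePreserving (fun x : E3 => η⁻¹ • x) volume volume := by
    refine ⟨measurable_const_smul _, ?_⟩
    rw [Measure.map_addHaar_smul _ (inv_ne_zero hη.ne')]
    exact Measure.smul_absolutelyContinuous
  exact hq.ae_eq_comp hf.ae_eq_toL2T

lemma L2per.aestronglyMeasurable_scaled {f : E3 → ℂ} (hf : L2per f) {η : ℝ} (hη : 0 < η) :
    AEStronglyMeasurable (fun x => f (η⁻¹ • x)) volume :=
  ((Lp.aestronglyMeasurable (toL2T f hf)).comp_quasiMeasurePreserving
    (quasiMeasurePreserving_toTorus_smul hη)).congr (hf.ae_eq_scaled hη).symm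

lemma L2per.aestronglyMeasurable {f : E3 → ℂ} (hf : L2per f) : AEStronglyMeasurable f volume := by
  simpa using hf.aestronglyMeasurable_scaled one_pos

lemma L2per.eLpNorm_cell {f : E3 → ℂ} (hf : L2per f) :
    eLpNorm f 2 (volume.restrict cell) = eLpNorm (toL2T f hf) 2 volume := by
  rw [eLpNorm_congr_ae (ae_restrict_of_ae hf.ae_eq_toL2T)]
  exact eLpNorm_comp_measurePreserving (Lp.aestronglyMeasurable _) measurePreserving_toTorus

/-- The oscillation bound applied to `‖F‖²`: rescaling is bounded from `L²` of the cell to `L²` of a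
ball, with a constant that increases with `η`. -/
lemma L2per.eLpNorm_scaled_le {f : E3 → ℂ} (hf : L2per f) (R : ℝ) {η : ℝ} (hη : 0 < η) :
    eLpNorm (fun x => f (η⁻¹ • x)) 2 (volume.restrict (Metric.ball 0 R))
      ≤ scaleConst R η * eLpNorm f 2 (volume.restrict cell) := by
  rw [hf.eLpNorm_cell, eLpNorm_congr_ae (ae_restrict_of_ae (hf.ae_eq_scaled hη))]
  set F := toL2T f hf
  have hm : Measurable fun t => ‖F t‖ₑ ^ (2 : ℝ) :=
    ((Lp.stronglyMeasurable F).measurable.enorm).pow_const _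
  have h := lintegral_ball_toTorus_smul_le hm R hη
  rw [eLpNorm_eq_lintegral_rpow_enorm_toReal (by norm_num) (by norm_num),
    eLpNorm_eq_lintegral_rpow_enorm_toReal (by norm_num) (by norm_num), scaleConst]
  simp only [ENNReal.toReal_ofNat]
  rw [← ENNReal.mul_rpow_of_nonneg _ _ (by norm_num)]
  gcongr

lemma L2per.memLp_scaled {f : E3 → ℂ} (hf : L2per f) (R : ℝ) {η : ℝ} (hη : 0 < η) :
    MemLp (fun x => f (η⁻¹ • x)) 2 (volume.restrict (Metric.ball 0 R)) :=
  ⟨(hf.aestronglyMeasurable_scaled hη).restrict,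
    (hf.eLpNorm_scaled_le R hη).trans_lt
      (ENNReal.mul_lt_top (scaleConst_ne_top R η).lt_top hf.2.2)⟩

lemma L2per.memLp_ball {f : E3 → ℂ} (hf : L2per f) (R : ℝ) :
    MemLp f 2 (volume.restrict (Metric.ball 0 R)) := by
  simpa using hf.memLp_scaled R one_pos

lemma L2per.locallyIntegrable {f : E3 → ℂ} (hf : L2per f) : LocallyIntegrable f volume := by
  intro x
  refine ⟨Metric.ball 0 (‖x‖ + 1), Metric.isOpen_ball.mem_nhds (by simp), ?_⟩
  have : IsFiniteMeasure (volume.restrict (Metric.ball (0 : E3) (‖x‖ + 1))) :=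
    ⟨by rw [Measure.restrict_apply_univ]; exact measure_ball_lt_top⟩
  exact (hf.memLp_ball _).integrable (by norm_num)

lemma norm_integral_mul_le {α : Type*} [MeasurableSpace α] {μ : Measure α} {f g : α → ℂ}
    (hf : MemLp f 2 μ) (hg : MemLp g 2 μ) :
    ‖∫ x, f x * g x ∂μ‖ ≤ (eLpNorm f 2 μ).toReal * (eLpNorm g 2 μ).toReal := by
  rw [← ENNReal.toReal_mul]
  refine (norm_integral_le_lintegral_norm _).trans ?_
  refine ENNReal.toReal_mono (ENNReal.mul_ne_top hf.2.ne hg.2.ne) ?_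
  have := eLpNorm_smul_le_mul_eLpNorm (p := 2) (q := 2) (r := 1) hg.1 hf.1
  rw [eLpNorm_one_eq_lintegral_enorm] at this
  simpa using this

/-- The pairing of `G ∈ L²(B_R)` with a rescaled periodic function, expanded in Fourier series. -/
lemma hasSum_fc_mul_integral {G : E3 → ℂ} {R : ℝ}
    (hG : MemLp G 2 (volume.restrict (Metric.ball 0 R))) {f : E3 → ℂ} (hf : L2per f)
    {η : ℝ} (hη : 0 < η) :
    HasSum (fun k => fc f k * ∫ x in Metric.ball 0 R, G x * em k (η⁻¹ • x))
      (∫ x in Metric.ball 0 R, G x * f (η⁻¹ • x)) := by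
  have hq := quasiMeasurePreserving_toTorus_smul hη
  have hint : ∀ F : L2T, Integrable (fun x => G x * F (toTorus (η⁻¹ • x)))
      (volume.restrict (Metric.ball 0 R)) := fun F =>
    MemLp.integrable_mul hG ((l2per_torus F).memLp_scaled R hη)
  -- The pairing with `G` is a bounded linear functional on `L²` of the torus, by the bound on
  -- rescaled functions, and so can be applied term by term to a Fourier series.
  let Λ₀ : L2T →ₗ[ℂ] ℂ :=
    { toFun := fun F => ∫ x in Metric.ball 0 R, G x * F (toTorus (η⁻¹ • x))
      map_add' := fun F F' => by
        rw [← integral_add (hint F) (hint F')]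
        refine integral_congr_ae (ae_restrict_of_ae ?_)
        filter_upwards [hq.ae_eq_comp (Lp.coeFn_add F F')] with x hx
        simp only [Function.comp_apply, Pi.add_apply] at hx
        rw [hx, mul_add]
      map_smul' := fun c F => by
        rw [RingHom.id_apply, smul_eq_mul, ← integral_const_mul]
        refine integral_congr_ae (ae_restrict_of_ae ?_)
        filter_upwards [hq.ae_eq_comp (Lp.coeFn_smul c F)] with x hx
        simp only [Function.comp_apply, Pi.smul_apply, smul_eq_mul] at hx
        rw [hx]
        ring }
  let Λ : L2T →L[ℂ] ℂ := Λ₀.mkContinuous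
    ((eLpNorm G 2 (volume.restrict (Metric.ball 0 R))).toReal * (scaleConst R η).toReal) fun F => by
      refine (norm_integral_mul_le hG ((l2per_torus F).memLp_scaled R hη)).trans ?_
      rw [mul_assoc, Lp.norm_def, ← ENNReal.toReal_mul (a := scaleConst R η)]
      refine mul_le_mul_of_nonneg_left (ENNReal.toReal_mono ?_ ?_) ENNReal.toReal_nonneg
      · exact ENNReal.mul_ne_top (scaleConst_ne_top R η) (Lp.eLpNorm_ne_top F)
      · refine ((l2per_torus F).eLpNorm_scaled_le R hη).trans_eq ?_
        congr 1
        exact eLpNorm_comp_measurePreserving (Lp.aestronglyMeasurable F) measurePreserving_toTorus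
  have h := (UnitAddTorus.hasSum_mFourier_series_L2 (toL2T f hf)).mapL Λ
  have e1 : Λ (toL2T f hf) = ∫ x in Metric.ball 0 R, G x * f (η⁻¹ • x) := by
    refine integral_congr_ae (ae_restrict_of_ae ?_)
    filter_upwards [hf.ae_eq_scaled hη] with x hx
    rw [hx]
  rw [e1] at h
  refine h.congr_fun fun k => ?_
  rw [map_smul, smul_eq_mul, fc_eq_mFourierCoeff hf.ae_eq_toL2T]
  congr 1
  refine integral_congr_ae (ae_restrict_of_ae ?_)
  filter_upwards [hq.ae_eq_comp (UnitAddTorus.coeFn_mFourierLp 2 k)] with x hx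
  simp only [Function.comp_apply] at hx
  rw [em, hx]

lemma ae_finset_sum_Lp {α ι : Type*} [MeasurableSpace α] {μ : Measure α} (s : Finset ι)
    (F : ι → Lp ℂ 2 μ) : ∀ᵐ t ∂μ, (∑ k ∈ s, F k : Lp ℂ 2 μ) t = ∑ k ∈ s, F k t := by
  classical
  induction s using Finset.induction_on with
  | empty =>
    filter_upwards [Lp.coeFn_zero ℂ 2 μ] with t ht
    simpa using ht
  | insert a s ha ih =>
    rw [Finset.sum_insert ha]
    filter_upwards [ih, Lp.coeFn_add (F a) (∑ k ∈ s, F k)] with t h1 h2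
    rw [h2, Pi.add_apply, h1, Finset.sum_insert ha]

/-- Trigonometric polynomials are dense in the periodic square integrable functions. -/
lemma L2per.exists_trig_approx {f : E3 → ℂ} (hf : L2per f) {ε : ENNReal} (hε : 0 < ε) :
    ∃ s : Finset (Fin 3 → ℤ),
      eLpNorm (fun y => f y - ∑ k ∈ s, fc f k * em k y) 2 (volume.restrict cell) < ε := by
  have h := UnitAddTorus.hasSum_mFourier_series_L2 (toL2T f hf)
  rw [HasSum, SummationFilter.unconditional_filter, EMetric.tendsto_atTop] at h
  obtain ⟨s, hs⟩ := h ε hε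
  refine ⟨s, ?_⟩
  have hs := hs s le_rfl
  rw [edist_comm, Lp.edist_def] at hs
  refine lt_of_eq_of_lt ?_ hs
  rw [← eLpNorm_comp_measurePreserving
    ((Lp.aestronglyMeasurable _).sub (Lp.aestronglyMeasurable _)) measurePreserving_toTorus]
  refine eLpNorm_congr_ae ?_
  have h1 : ∀ᵐ t, (∑ k ∈ s, UnitAddTorus.mFourierCoeff (toL2T f hf) k •
      UnitAddTorus.mFourierLp 2 k : L2T) t =
      ∑ k ∈ s, UnitAddTorus.mFourierCoeff (toL2T f hf) k * UnitAddTorus.mFourier k t := by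
    have h2 : ∀ᵐ t, ∀ k ∈ s, (UnitAddTorus.mFourierCoeff (toL2T f hf) k •
        UnitAddTorus.mFourierLp 2 k : L2T) t = UnitAddTorus.mFourierCoeff (toL2T f hf) k *
          UnitAddTorus.mFourier k t := by
      rw [eventually_all_finset]
      intro k _
      filter_upwards [Lp.coeFn_smul (UnitAddTorus.mFourierCoeff (toL2T f hf) k)
        (UnitAddTorus.mFourierLp 2 k : L2T), UnitAddTorus.coeFn_mFourierLp 2 k] with t h3 h4
      rw [h3, Pi.smul_apply, h4, smul_eq_mul]
    filter_upwards [h2, ae_finset_sum_Lp s fun k => (UnitAddTorus.mFourierCoeff (toL2T f hf) k •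
        UnitAddTorus.mFourierLp 2 k : L2T)] with t h3 h4
    rw [h4]
    exact Finset.sum_congr rfl h3
  filter_upwards [ae_restrict_of_ae hf.ae_eq_toL2T,
    ae_restrict_of_ae (quasiMeasurePreserving_toTorus.ae h1)] with y h2 h3
  simp only [Function.comp_apply, Pi.sub_apply]
  rw [h3, h2]
  congr 1
  exact Finset.sum_congr rfl fun k _ => by rw [fc_eq_mFourierCoeff hf.ae_eq_toL2T, em]

/-- The integral of a periodic function over a translate of the cell. -/
lemma integral_cell_add {F : Type*} [NormedAddCommGroup F] [NormedSpace ℝ F] {f : E3 → F}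
    (hf : ∀ k : Fin 3 → ℤ, ∀ᵐ y, f (y + latt k) = f y)
    (hm : AEStronglyMeasurable f (volume.restrict cell)) (x : E3) :
    ∫ h in cell, f (x + h) = ∫ y in cell, f y := by
  have hs : AEStronglyMeasurable (fun t => f (sec t)) volume :=
    hm.comp_measurePreserving measurePreserving_sec
  have h1 := ae_eq_sec_toTorus hf
  have h2 : (fun h => f (x + h)) =ᵐ[volume] fun h => f (sec (toTorus x + toTorus h)) := by
    have := (measurePreserving_add_left (volume : Measure E3) x).quasiMeasurePreserving.ae_eq_comp h1
    filter_upwards [this] with h hh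
    simpa only [Function.comp, toTorus_add] using hh
  rw [integral_congr_ae (ae_restrict_of_ae h2), integral_congr_ae (ae_restrict_of_ae h1),
    integral_cell_toTorus hs,
    integral_cell_toTorus (f := fun t => f (sec (toTorus x + t)))
      (hs.comp_measurePreserving (measurePreserving_add_left volume (toTorus x)))]
  exact integral_add_left_eq_self (fun t => f (sec t)) _

lemma integrable_cell_add {F : Type*} [NormedAddCommGroup F] {f : E3 → F}
    (hf : L2per f) (x : E3) : Integrable (fun h => f (x + h)) (volume.restrict cell) := by
  have h1 := ae_eq_sec_toTorus hf.1
  have hs : Integrable (fun t => f (sec t)) volume := hf.memLp_sec.integrable (by norm_num)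
  have h2 : (fun h => f (x + h)) =ᵐ[volume] fun h => f (sec (toTorus x + toTorus h)) := by
    have := (measurePreserving_add_left (volume : Measure E3) x).quasiMeasurePreserving.ae_eq_comp h1
    filter_upwards [this] with h hh
    simpa only [Function.comp, toTorus_add] using hh
  refine Integrable.congr ?_ (EventuallyEq.symm (ae_restrict_of_ae h2))
  exact ((measurePreserving_add_left volume (toTorus x)).comp
    measurePreserving_toTorus).integrable_comp_of_integrable hs

/-- The integral of `|f (h + x)|` over `h` in the cell does not depend on `x`, so integrability of
`ρ` is all that is left to use. This justifies Fubini in the averaging over translates. -/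
lemma integrable_translate_prod {f : E3 → ℂ} (hf : L2per f) {ρ : E3 → ℂ}
    (hρ : Continuous ρ) (hρc : HasCompactSupport ρ) :
    Integrable (fun p : E3 × E3 => f (p.1 + p.2) * ρ p.2)
      ((volume.restrict cell).prod volume) := by
  have hm : AEStronglyMeasurable (fun p : E3 × E3 => f (p.1 + p.2) * ρ p.2)
      ((volume.restrict cell).prod volume) := by
    refine AEStronglyMeasurable.mul ?_ (by fun_prop)
    exact hf.aestronglyMeasurable.comp_quasiMeasurePreserving
      (Measure.quasiMeasurePreserving_snd.comp
        (measurePreserving_prod_add (volume.restrict cell) volume).quasiMeasurePreserving)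
  have hn : ∀ x, ∫ h in cell, ‖f (h + x) * ρ x‖ = ‖ρ x‖ * ∫ y in cell, ‖f y‖ := fun x => by
    simp_rw [norm_mul]
    rw [integral_mul_const, mul_comm]
    congr 1
    simp_rw [add_comm _ x]
    exact integral_cell_add (f := fun y => ‖f y‖)
      (fun k => (hf.1 k).mono fun y hy => by simp only [hy]) hf.2.1.norm x
  rw [integrable_prod_iff' hm]
  refine ⟨Eventually.of_forall fun x => ?_, ?_⟩
  · simp_rw [add_comm _ x]
    exact (integrable_cell_add hf x).mul_const _
  · simp_rw [hn]
    exact ((hρ.integrable_of_hasCompactSupport hρc).norm).mul_const _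

lemma integral_translate_eq (f ρ : E3 → ℂ) (h : E3) :
    ∫ x, f x * ρ (x - h) = ∫ x, f (h + x) * ρ x := by
  rw [← integral_add_right_eq_self _ h]
  simp [add_comm]

lemma integrable_integral_translate {f : E3 → ℂ} (hf : L2per f) {ρ : E3 → ℂ}
    (hρ : Continuous ρ) (hρc : HasCompactSupport ρ) :
    Integrable (fun h => ∫ x, f x * ρ (x - h)) (volume.restrict cell) := by
  simp_rw [integral_translate_eq]
  exact (integrable_translate_prod hf hρ hρc).integral_prod_left

/-- Averaging over the cell of the translates of a test function. -/
lemma integral_cell_integral_translate {f : E3 → ℂ} (hf : L2per f) {ρ : E3 → ℂ}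
    (hρ : Continuous ρ) (hρc : HasCompactSupport ρ) :
    ∫ h in cell, ∫ x, f x * ρ (x - h) = (∫ x, ρ x) * ∫ y in cell, f y := by
  simp_rw [integral_translate_eq]
  rw [integral_integral_swap (integrable_translate_prod hf hρ hρc)]
  simp_rw [integral_mul_const, add_comm _ (_ : E3)]
  have e2 : ∀ x, ∫ h in cell, f (x + h) = ∫ y in cell, f y := fun x =>
    integral_cell_add hf.1 hf.2.1 x
  simp_rw [e2]
  rw [integral_const_mul, mul_comm]

section

/-! ### Weak derivatives -/

/-- The partial derivative of a complex-valued function. -/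
def cpderiv (i : Fin 3) (φ : E3 → ℂ) (x : E3) : ℂ := fderiv ℝ φ x (EuclideanSpace.single i 1)

lemma cpderiv_ofReal {φ : E3 → ℝ} (hφ : Differentiable ℝ φ) (i : Fin 3) (x : E3) :
    cpderiv i (fun y => (φ y : ℂ)) x = (pderiv i φ x : ℂ) := by
  have h := (Complex.ofRealCLM.hasFDerivAt (x := φ x)).comp x (hφ x).hasFDerivAt
  have h' : HasFDerivAt (fun y => (φ y : ℂ)) (Complex.ofRealCLM ∘L fderiv ℝ φ x) x := h
  rw [cpderiv, h'.fderiv]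
  rfl

lemma cpderiv_mul {φ ψ : E3 → ℂ} {x : E3} (hφ : DifferentiableAt ℝ φ x)
    (hψ : DifferentiableAt ℝ ψ x) (i : Fin 3) :
    cpderiv i (fun y => φ y * ψ y) x = cpderiv i φ x * ψ x + φ x * cpderiv i ψ x := by
  rw [cpderiv, fderiv_fun_mul hφ hψ]
  simp [cpderiv]
  ring

lemma cpderiv_comp_sub {φ : E3 → ℂ} (i : Fin 3) (h x : E3) :
    cpderiv i (fun y => φ (y - h)) x = cpderiv i φ (x - h) := by
  simp only [cpderiv, sub_eq_add_neg]
  rw [fderiv_comp_add_right]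

lemma continuous_cpderiv {φ : E3 → ℂ} (hφ : ContDiff ℝ (⊤ : ℕ∞) φ) (i : Fin 3) :
    Continuous (cpderiv i φ) :=
  (hφ.continuous_fderiv (by simp)).clm_apply continuous_const

lemma contDiff_cpderiv {φ : E3 → ℂ} (hφ : ContDiff ℝ (⊤ : ℕ∞) φ) (i : Fin 3) :
    ContDiff ℝ (⊤ : ℕ∞) (cpderiv i φ) :=
  (hφ.fderiv_right (m := (⊤ : ℕ∞)) (by simp)).clm_apply contDiff_const

lemma continuous_pderiv {φ : E3 → ℝ} (hφ : ContDiff ℝ (⊤ : ℕ∞) φ) (i : Fin 3) :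
    Continuous (pderiv i φ) :=
  (hφ.continuous_fderiv (by simp)).clm_apply continuous_const

lemma contDiff_pderiv {φ : E3 → ℝ} (hφ : ContDiff ℝ (⊤ : ℕ∞) φ) (i : Fin 3) :
    ContDiff ℝ (⊤ : ℕ∞) (pderiv i φ) :=
  (hφ.fderiv_right (m := (⊤ : ℕ∞)) (by simp)).clm_apply contDiff_const

lemma tsupport_pderiv_subset (φ : E3 → ℝ) (i : Fin 3) : tsupport (pderiv i φ) ⊆ tsupport φ :=
  closure_minimal (fun x hx => by
    by_contra hx'
    apply hx
    simp only [pderiv]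
    rw [fderiv_of_notMem_tsupport ℝ hx']
    rfl) (isClosed_tsupport φ)

lemma IsTestFun.pderiv {φ : E3 → ℝ} (hφ : IsTestFun φ) (i : Fin 3) : IsTestFun (pderiv i φ) :=
  ⟨contDiff_pderiv hφ.1 i, hφ.2.of_isClosed_subset (isClosed_tsupport _)
    (tsupport_pderiv_subset φ i)⟩

lemma hasCompactSupport_cpderiv {φ : E3 → ℂ} (hφ : HasCompactSupport φ) (i : Fin 3) :
    HasCompactSupport (cpderiv i φ) :=
  hφ.fderiv_apply ℝ _

lemma integrable_mul_of_hasCompactSupport {φ f : E3 → ℂ} (hφ : Continuous φ)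
    (hφc : HasCompactSupport φ) (hf : LocallyIntegrable f volume) :
    Integrable (fun x => φ x * f x) volume := by
  simpa using hf.integrable_smul_left_of_hasCompactSupport hφ hφc

lemma cpderiv_eq_re_add_im {φ : E3 → ℂ} (hφ : Differentiable ℝ φ) (i : Fin 3) (x : E3) :
    cpderiv i φ x = (pderiv i (fun y => (φ y).re) x : ℂ)
      + Complex.I * (pderiv i (fun y => (φ y).im) x : ℂ) := by
  have h1 : HasFDerivAt (fun y => (φ y).re) (Complex.reCLM ∘L fderiv ℝ φ x) x :=
    (Complex.reCLM.hasFDerivAt (x := φ x)).comp x (hφ x).hasFDerivAt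
  have h2 : HasFDerivAt (fun y => (φ y).im) (Complex.imCLM ∘L fderiv ℝ φ x) x :=
    (Complex.imCLM.hasFDerivAt (x := φ x)).comp x (hφ x).hasFDerivAt
  rw [cpderiv, pderiv, pderiv, h1.fderiv, h2.fderiv]
  simp only [ContinuousLinearMap.comp_apply, Complex.reCLM_apply, Complex.imCLM_apply]
  rw [mul_comm, Complex.re_add_im]

/-- Weak derivatives can be tested with complex-valued functions. -/
lemma IsWeakPartial.complex {i : Fin 3} {f g : E3 → ℂ} (h : IsWeakPartial i f g)
    (hf : LocallyIntegrable f volume) (hg : LocallyIntegrable g volume) {φ : E3 → ℂ}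
    (hφ : ContDiff ℝ (⊤ : ℕ∞) φ) (hφc : HasCompactSupport φ) :
    ∫ x, cpderiv i φ x * f x = -∫ x, φ x * g x := by
  have hre : IsTestFun fun x => (φ x).re :=
    ⟨Complex.reCLM.contDiff.comp hφ, hφc.comp_left (g := Complex.re) rfl⟩
  have him : IsTestFun fun x => (φ x).im :=
    ⟨Complex.imCLM.contDiff.comp hφ, hφc.comp_left (g := Complex.im) rfl⟩
  have e1 := cpderiv_eq_re_add_im (hφ.differentiable (by simp)) i
  have i1 := integrable_mul_of_hasCompactSupport (φ := fun x => (pderiv i (fun y => (φ y).re) x : ℂ))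
    (Complex.continuous_ofReal.comp (continuous_pderiv hre.1 i))
    ((hre.pderiv i).2.comp_left (g := Complex.ofReal) rfl) hf
  have i2 := integrable_mul_of_hasCompactSupport (φ := fun x => (pderiv i (fun y => (φ y).im) x : ℂ))
    (Complex.continuous_ofReal.comp (continuous_pderiv him.1 i))
    ((him.pderiv i).2.comp_left (g := Complex.ofReal) rfl) hf
  have i3 := integrable_mul_of_hasCompactSupport (φ := fun x => ((φ x).re : ℂ))
    (Complex.continuous_ofReal.comp hre.1.continuous)
    (hre.2.comp_left (g := Complex.ofReal) rfl) hg
  have i4 := integrable_mul_of_hasCompactSupport (φ := fun x => ((φ x).im : ℂ))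
    (Complex.continuous_ofReal.comp him.1.continuous)
    (him.2.comp_left (g := Complex.ofReal) rfl) hg
  calc ∫ x, cpderiv i φ x * f x
      = ∫ x, ((pderiv i (fun y => (φ y).re) x : ℂ) * f x
          + Complex.I * ((pderiv i (fun y => (φ y).im) x : ℂ) * f x)) := by
        congr 1; ext x; rw [e1]; ring
    _ = -∫ x, (((φ x).re : ℂ) * g x + Complex.I * (((φ x).im : ℂ) * g x)) := by
        rw [integral_add i1 (i2.const_mul _), integral_add i3 (i4.const_mul _),
          integral_const_mul, integral_const_mul, h _ hre, h _ him]
        ring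
    _ = -∫ x, φ x * g x := by
        congr 2; ext x
        conv_rhs => rw [← Complex.re_add_im (φ x)]
        ring

lemma exists_bound_of_periodic {b : E3 → ℂ} (hb : Continuous b) : ∃ C, ∀ y ∈ cell, ‖b y‖ ≤ C := by
  obtain ⟨C, hC⟩ := (isCompact_closedBall (0 : E3) 1).exists_bound_of_continuousOn hb.continuousOn
  exact ⟨C, fun y hy => hC y (by simpa using norm_le_of_mem_cell hy)⟩

lemma L2per.mul_continuous {f b : E3 → ℂ} (hf : L2per f) (hb : Continuous b)
    (hp : ∀ y k, b (y + latt k) = b y) : L2per fun y => b y * f y := by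
  refine ⟨fun k => (hf.1 k).mono fun y hy => by simp only [hy, hp], ?_⟩
  obtain ⟨C, hC⟩ := exists_bound_of_periodic hb
  refine MemLp.of_le_mul (c := C) hf.2 (hb.aestronglyMeasurable.mul hf.2.1) ?_
  filter_upwards [ae_restrict_mem measurableSet_cell] with y hy
  rw [norm_mul]
  exact mul_le_mul_of_nonneg_right (hC y hy) (norm_nonneg _)

lemma cpderiv_add_latt {b : E3 → ℂ} (hp : ∀ y k, b (y + latt k) = b y) (i : Fin 3) (y : E3)
    (k : Fin 3 → ℤ) : cpderiv i b (y + latt k) = cpderiv i b y := by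
  have := fderiv_comp_add_right (𝕜 := ℝ) (f := b) (x := y) (latt k)
  rw [cpderiv, cpderiv, ← this]
  simp_rw [hp]

lemma exists_testFun_integral_one : ∃ ρ : E3 → ℝ, IsTestFun ρ ∧ ∫ x, ρ x = 1 := by
  let B : ContDiffBump (0 : E3) := ⟨1, 2, one_pos, one_lt_two⟩
  exact ⟨B.normed volume, ⟨B.contDiff_normed, B.hasCompactSupport_normed⟩, B.integral_normed⟩

lemma integral_pderiv_eq_zero {ρ : E3 → ℝ} (hρ : IsTestFun ρ) (i : Fin 3) :
    ∫ x, pderiv i ρ x = 0 := by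
  have h := integral_mul_fderiv_eq_neg_fderiv_mul_of_integrable (μ := (volume : Measure E3))
    (f := fun _ => (1 : ℝ)) (g := ρ) (v := EuclideanSpace.single i 1) (by simp)
    (by
      simp only [one_mul]
      exact ((continuous_pderiv hρ.1 i).integrable_of_hasCompactSupport (hρ.pderiv i).2))
    (by simpa using hρ.1.continuous.integrable_of_hasCompactSupport hρ.2)
    (fun _ _ => differentiableAt_const _) fun x _ => hρ.1.differentiable (by simp) x
  simpa [pderiv] using h

/-- Weak derivatives of periodic functions can be tested with smooth periodic functions. -/
lemma IsWeakPartial.periodic {i : Fin 3} {f g : E3 → ℂ} (h : IsWeakPartial i f g)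
    (hf : L2per f) (hg : L2per g) {b : E3 → ℂ} (hb : ContDiff ℝ (⊤ : ℕ∞) b)
    (hp : ∀ y k, b (y + latt k) = b y) :
    ∫ y in cell, cpderiv i b y * f y = -∫ y in cell, b y * g y := by
  obtain ⟨ρ, hρ, hρ1⟩ := exists_testFun_integral_one
  have hρC : ContDiff ℝ (⊤ : ℕ∞) fun x => (ρ x : ℂ) := Complex.ofRealCLM.contDiff.comp hρ.1
  have hρCc : HasCompactSupport fun x => (ρ x : ℂ) := hρ.2.comp_left (g := Complex.ofReal) rfl
  have hdρc : HasCompactSupport fun x => (pderiv i ρ x : ℂ) :=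
    (hρ.pderiv i).2.comp_left (g := Complex.ofReal) rfl
  have hdρ : Continuous fun x => (pderiv i ρ x : ℂ) :=
    Complex.continuous_ofReal.comp (continuous_pderiv hρ.1 i)
  have h1 : L2per fun y => cpderiv i b y * f y :=
    hf.mul_continuous (continuous_cpderiv hb i) (cpderiv_add_latt hp i)
  have h2 : L2per fun y => b y * f y := hf.mul_continuous hb.continuous hp
  have h3 : L2per fun y => b y * g y := hg.mul_continuous hb.continuous hp
  -- The weak derivative is tested with the compactly supported function `b(x) ρ(x - t)`. Averaging
  -- over `t` in the cell recovers integrals over the cell from `∫ ρ = 1` and removes the derivative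
  -- of the cutoff, because `∫ ∂_i ρ = 0`.
  have key : ∀ t : E3, (∫ x, (cpderiv i b x * f x) * (ρ (x - t) : ℂ))
      + (∫ x, (b x * f x) * (pderiv i ρ (x - t) : ℂ)) = -∫ x, (b x * g x) * (ρ (x - t) : ℂ) := by
    intro t
    have hst : HasCompactSupport fun x => (ρ (x - t) : ℂ) :=
      hρCc.comp_homeomorph (Homeomorph.subRight t)
    have hsd : HasCompactSupport fun x => (pderiv i ρ (x - t) : ℂ) :=
      hdρc.comp_homeomorph (Homeomorph.subRight t)
    have hΦ : ContDiff ℝ (⊤ : ℕ∞) fun x => (ρ (x - t) : ℂ) :=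
      hρC.comp (contDiff_id.sub contDiff_const)
    have := h.complex hf.locallyIntegrable hg.locallyIntegrable (hb.mul hΦ) hst.mul_left
    rw [← integral_add]
    · refine Eq.trans ?_ (this.trans ?_)
      · congr 1; ext x
        rw [cpderiv_mul (hb.differentiable (by simp) x) (hΦ.differentiable (by simp) x),
          cpderiv_comp_sub (φ := fun x => (ρ x : ℂ)), cpderiv_ofReal (hρ.1.differentiable (by simp))]
        ring
      · congr 2; ext x; ring
    · simp_rw [mul_comm _ (ρ _ : ℂ)]
      exact integrable_mul_of_hasCompactSupport hΦ.continuous hst h1.locallyIntegrable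
    · simp_rw [mul_comm _ (pderiv i ρ _ : ℂ)]
      exact integrable_mul_of_hasCompactSupport
        (hdρ.comp (continuous_id.sub continuous_const)) hsd h2.locallyIntegrable
  have k1 := integral_cell_integral_translate h1 hρC.continuous hρCc
  have k2 := integral_cell_integral_translate h2 hdρ hdρc
  have k3 := integral_cell_integral_translate h3 hρC.continuous hρCc
  have h4 := integral_congr_ae (μ := volume.restrict cell) (Eventually.of_forall key)
  rw [integral_add (integrable_integral_translate h1 hρC.continuous hρCc)
    (integrable_integral_translate h2 hdρ hdρc), integral_neg, k1, k2, k3,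
    integral_complex_ofReal, integral_complex_ofReal, integral_pderiv_eq_zero hρ, hρ1] at h4
  simpa using h4

/-- The Fourier multiplier of `∂_i`. -/
def ik (k : Fin 3 → ℤ) (i : Fin 3) : ℂ := 2 * Real.pi * Complex.I * k i

lemma ik_neg (k : Fin 3 → ℤ) (i : Fin 3) : ik (-k) i = -ik k i := by simp [ik]

lemma em_contDiff (k : Fin 3 → ℤ) : ContDiff ℝ (⊤ : ℕ∞) (em k) := by
  have : em k = fun y => Complex.exp (2 * Real.pi * Complex.I * ∑ i, (k i : ℂ) * (y i : ℂ)) :=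
    funext (em_eq_exp k)
  rw [this]
  refine Complex.contDiff_exp.comp ?_ 
  refine contDiff_const.mul (ContDiff.sum fun i _ => contDiff_const.mul ?_)
  exact Complex.ofRealCLM.contDiff.comp (EuclideanSpace.proj (𝕜 := ℝ) i).contDiff

lemma cpderiv_em (i : Fin 3) (k : Fin 3 → ℤ) (x : E3) :
    cpderiv i (em k) x = ik k i * em k x := by
  have hem : em k = fun y => Complex.exp (2 * Real.pi * Complex.I * ∑ i, (k i : ℂ) * (y i : ℂ)) :=
    funext (em_eq_exp k)
  let l : E3 →L[ℝ] ℂ := ∑ j, (2 * Real.pi * Complex.I * (k j : ℂ)) •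
    (Complex.ofRealCLM ∘L (EuclideanSpace.proj (𝕜 := ℝ) j))
  have hl : ∀ y : E3, 2 * Real.pi * Complex.I * ∑ i, (k i : ℂ) * (y i : ℂ) = l y := fun y => by
    simp [l, Finset.mul_sum, mul_assoc]
  have hd : HasFDerivAt (em k) (Complex.exp (l x) • l) x := by
    rw [hem]
    simp_rw [hl]
    exact l.hasFDerivAt.cexp
  have hs : l (EuclideanSpace.single i 1) = ik k i := by
    rw [← hl, ik, Finset.sum_eq_single i (fun j _ hj => by simp [hj]) (by simp)]
    simp
  rw [cpderiv, hd.fderiv, em_eq_exp, hl, smul_apply, hs, smul_eq_mul, mul_comm]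

lemma IsWeakPartial.fc {i : Fin 3} {f g : E3 → ℂ} (h : IsWeakPartial i f g)
    (hf : L2per f) (hg : L2per g) (k : Fin 3 → ℤ) :
    fc g k = ik k i * fc f k := by
  have := h.periodic hf hg (em_contDiff (-k)) fun y m => em_add_latt _ y m
  simp only [cpderiv_em, mul_assoc] at this
  rw [integral_const_mul, ik_neg] at this
  rw [CellProblem.fc, CellProblem.fc, ← neg_eq_iff_eq_neg.2 this]
  ring

lemma integral_ball_eq_integral {F : Type*} [NormedAddCommGroup F] [NormedSpace ℝ F] {f : E3 → F}
    {R : ℝ} (h : ∀ x, x ∉ Metric.ball (0 : E3) R → f x = 0) :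
    ∫ x in Metric.ball (0 : E3) R, f x = ∫ x, f x :=
  setIntegral_eq_integral_of_forall_compl_eq_zero h

lemma exists_ball_of_hasCompactSupport {φ : E3 → ℝ} (hφ : HasCompactSupport φ) :
    ∃ R, tsupport φ ⊆ Metric.ball (0 : E3) R :=
  hφ.isCompact.isBounded.subset_ball 0

/-- Both sides of the definition expand in the Fourier series of `f` and `g`, and for a single
exponential the identity is classical integration by parts. With `IsWeakPartial.fc`, weak
differentiation of periodic functions is exactly multiplication by `ik`. -/
lemma isWeakPartial_of_fc {i : Fin 3} {f g : E3 → ℂ} (hf : L2per f) (hg : L2per g)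
    (h : ∀ k, fc g k = ik k i * fc f k) : IsWeakPartial i f g := by
  intro φ hφ
  obtain ⟨R, hR⟩ := exists_ball_of_hasCompactSupport hφ.2
  have hz : ∀ x, x ∉ Metric.ball (0 : E3) R → φ x = 0 := fun x hx =>
    image_eq_zero_of_notMem_tsupport fun h => hx (hR h)
  have hz' : ∀ x, x ∉ Metric.ball (0 : E3) R → pderiv i φ x = 0 := fun x hx =>
    image_eq_zero_of_notMem_tsupport fun h => hx (hR (tsupport_pderiv_subset φ i h))
  have hc : Continuous fun x => (φ x : ℂ) := Complex.continuous_ofReal.comp hφ.1.continuous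
  have hcs : HasCompactSupport fun x => (φ x : ℂ) := hφ.2.comp_left (g := Complex.ofReal) rfl
  have hdc : Continuous fun x => (pderiv i φ x : ℂ) :=
    Complex.continuous_ofReal.comp (continuous_pderiv hφ.1 i)
  have hdcs : HasCompactSupport fun x => (pderiv i φ x : ℂ) :=
    (hφ.pderiv i).2.comp_left (g := Complex.ofReal) rfl
  have s1 := hasSum_fc_mul_integral (R := R) ((hdc.memLp_of_hasCompactSupport hdcs).restrict _)
    hf one_pos
  have s2 := hasSum_fc_mul_integral (R := R) ((hc.memLp_of_hasCompactSupport hcs).restrict _)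
    hg one_pos
  simp only [inv_one, one_smul] at s1 s2
  rw [integral_ball_eq_integral fun x hx => by rw [hz' x hx, Complex.ofReal_zero, zero_mul]] at s1
  rw [integral_ball_eq_integral fun x hx => by rw [hz x hx, Complex.ofReal_zero, zero_mul]] at s2
  refine s1.unique ?_
  refine s2.neg.congr_fun fun k => ?_
  rw [integral_ball_eq_integral fun x hx => by rw [hz' x hx, Complex.ofReal_zero, zero_mul],
    integral_ball_eq_integral fun x hx => by rw [hz x hx, Complex.ofReal_zero, zero_mul], h]
  have hd : ∀ x, (pderiv i φ x : ℂ) = fderiv ℝ (fun y => (φ y : ℂ)) x (EuclideanSpace.single i 1) :=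
    fun x => (cpderiv_ofReal (hφ.1.differentiable (by simp)) i x).symm
  have hde : ∀ x, fderiv ℝ (em k) x (EuclideanSpace.single i 1)
      = ik k i * em k x := cpderiv_em i k
  have hp := integral_mul_fderiv_eq_neg_fderiv_mul_of_integrable (μ := (volume : Measure E3))
    (f := fun x => (φ x : ℂ)) (g := em k) (v := EuclideanSpace.single i 1)
    (by
      simp_rw [← hd]
      exact integrable_mul_of_hasCompactSupport hdc hdcs (continuous_em k).locallyIntegrable)
    (by
      simp_rw [hde]
      exact integrable_mul_of_hasCompactSupport hc hcs
        (continuous_const.mul (continuous_em k)).locallyIntegrable)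
    (integrable_mul_of_hasCompactSupport hc hcs (continuous_em k).locallyIntegrable)
    (fun x _ => (Complex.ofRealCLM.contDiff.comp hφ.1).differentiable (by simp) x)
    fun x _ => (em_contDiff k).differentiable (by simp) x
  simp_rw [hde, ← hd] at hp
  have e : ∫ x, (φ x : ℂ) * (ik k i * em k x)
      = ik k i * ∫ x, (φ x : ℂ) * em k x := by
    rw [← integral_const_mul]
    congr 1; ext x; ring
  rw [e] at hp
  linear_combination (CellProblem.fc f k) * hp

/-! ### Periodic Sobolev functions -/

/-- The choice of derivative depends on `f` only through the predicate `IsWeakPartial i f`, which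
does not see null sets. Hence the two derivatives are the same function, not merely equal almost
everywhere. -/
lemma weakPartial_congr {f g : E3 → ℂ} (h : f =ᵐ[volume] g) (i : Fin 3) :
    weakPartial i f = weakPartial i g := by
  have : IsWeakPartial i f = IsWeakPartial i g := by
    ext a
    refine forall_congr' fun φ => forall_congr' fun _ => ?_
    have e : ∫ x, (CellProblem.pderiv i φ x : ℂ) * f x = ∫ x, (CellProblem.pderiv i φ x : ℂ) * g x :=
      integral_congr_ae (h.mono fun x hx => by simp only [hx])
    rw [e]
  unfold weakPartial
  rw [this]

lemma W12per.l2per_weakPartial {f : E3 → ℂ} (hf : W12per f) (i : Fin 3) :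
    L2per (weakPartial i f) := (Classical.epsilon_spec (hf.2 i)).1

lemma W12per.isWeakPartial {f : E3 → ℂ} (hf : W12per f) (i : Fin 3) :
    IsWeakPartial i f (weakPartial i f) := (Classical.epsilon_spec (hf.2 i)).2

lemma W12per.fc_weakPartial {f : E3 → ℂ} (hf : W12per f) (i : Fin 3) (k : Fin 3 → ℤ) :
    fc (weakPartial i f) k = ik k i * fc f k :=
  (hf.isWeakPartial i).fc hf.1 (hf.l2per_weakPartial i) k

lemma W12per.weakPartial_ae_eq {f g : E3 → ℂ} (hf : W12per f) {i : Fin 3} (hg : L2per g)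
    (h : ∀ k, fc g k = ik k i * fc f k) : weakPartial i f =ᵐ[volume] g :=
  fc_injective (hf.l2per_weakPartial i) hg fun k => by rw [hf.fc_weakPartial, h]

/-- Riesz–Fischer provides a square integrable function with the coefficients of the derivative. -/
lemma w12per_of_summable {f : E3 → ℂ} (hf : L2per f)
    (h : ∀ i, Summable fun k => ‖ik k i * fc f k‖ ^ 2) : W12per f := by
  refine ⟨hf, fun i => ?_⟩
  obtain ⟨g, hg, hgc⟩ := exists_fc_eq _ (h i)
  exact ⟨g, hg, isWeakPartial_of_fc hf hg hgc⟩

lemma W12per.summable {f : E3 → ℂ} (hf : W12per f) (i : Fin 3) :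
    Summable fun k => ‖ik k i * fc f k‖ ^ 2 := by
  simp_rw [← hf.fc_weakPartial]
  exact summable_fc (hf.l2per_weakPartial i)

lemma W12per.congr {f g : E3 → ℂ} (hf : W12per f) (h : f =ᵐ[volume] g) : W12per g := by
  refine w12per_of_summable (hf.1.congr h) fun i => ?_
  simp_rw [← fc_congr (ae_restrict_of_ae h)]
  exact hf.summable i

lemma W12per.add {f g : E3 → ℂ} (hf : W12per f) (hg : W12per g) : W12per fun y => f y + g y :=
  ⟨hf.1.add hg.1, fun i => ⟨_, (hf.l2per_weakPartial i).add (hg.l2per_weakPartial i),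
    isWeakPartial_of_fc (hf.1.add hg.1) ((hf.l2per_weakPartial i).add (hg.l2per_weakPartial i))
      fun k => by
        rw [fc_add (hf.l2per_weakPartial i) (hg.l2per_weakPartial i), fc_add hf.1 hg.1,
          hf.fc_weakPartial, hg.fc_weakPartial, mul_add]⟩⟩

lemma W12per.const_mul {f : E3 → ℂ} (hf : W12per f) (c : ℂ) : W12per fun y => c * f y :=
  ⟨hf.1.const_mul c, fun i => ⟨_, (hf.l2per_weakPartial i).const_mul c,
    isWeakPartial_of_fc (hf.1.const_mul c) ((hf.l2per_weakPartial i).const_mul c)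
      fun k => by rw [fc_const_mul, fc_const_mul, hf.fc_weakPartial, mul_left_comm]⟩⟩

lemma conj_ik (k : Fin 3 → ℤ) (i : Fin 3) : conj (ik k i) = -ik k i := by
  rw [ik, map_mul, map_mul, map_mul, Complex.conj_ofReal, Complex.conj_I, Complex.conj_ofNat,
    map_intCast]
  ring

lemma W12per.conj {f : E3 → ℂ} (hf : W12per f) : W12per fun y => conj (f y) :=
  ⟨hf.1.conj, fun i => ⟨_, (hf.l2per_weakPartial i).conj,
    isWeakPartial_of_fc hf.1.conj (hf.l2per_weakPartial i).conj
      fun k => by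
        rw [fc_conj, fc_conj, hf.fc_weakPartial, map_mul, conj_ik, ik_neg, neg_neg]⟩⟩

lemma isWeakPartial_const (c : ℂ) (i : Fin 3) : IsWeakPartial i (fun _ => c) fun _ => 0 := by
  intro φ hφ
  rw [integral_mul_const, integral_complex_ofReal, integral_pderiv_eq_zero hφ]
  simp

lemma fc_zero (k : Fin 3 → ℤ) : fc (fun _ => 0) k = 0 := by simp [fc]

lemma fc_const (c : ℂ) {k : Fin 3 → ℤ} (hk : k ≠ 0) : fc (fun _ => c) k = 0 := by
  obtain ⟨i, hi⟩ := Function.ne_iff.1 hk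
  have h := (isWeakPartial_const c i).fc (l2per_const c) (l2per_const 0) k
  rw [fc_zero, eq_comm, mul_eq_zero] at h
  refine h.resolve_left ?_
  simp only [ik, mul_eq_zero, Complex.I_ne_zero, or_false, Int.cast_eq_zero]
  have : (Real.pi : ℂ) ≠ 0 := Complex.ofReal_ne_zero.2 Real.pi_ne_zero
  simp [this]
  exact hi

lemma w12per_const (c : ℂ) : W12per fun _ : E3 => c :=
  ⟨l2per_const c, fun i => ⟨fun _ => 0, l2per_const 0, isWeakPartial_const c i⟩⟩

lemma weakPartial_add {f g : E3 → ℂ} (hf : W12per f) (hg : W12per g) (i : Fin 3) :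
    weakPartial i (fun y => f y + g y) =ᵐ[volume]
      fun y => weakPartial i f y + weakPartial i g y :=
  (hf.add hg).weakPartial_ae_eq ((hf.l2per_weakPartial i).add (hg.l2per_weakPartial i)) fun k => by
    rw [fc_add (hf.l2per_weakPartial i) (hg.l2per_weakPartial i), fc_add hf.1 hg.1,
      hf.fc_weakPartial, hg.fc_weakPartial, mul_add]

lemma weakPartial_const_mul {f : E3 → ℂ} (hf : W12per f) (c : ℂ) (i : Fin 3) :
    weakPartial i (fun y => c * f y) =ᵐ[volume] fun y => c * weakPartial i f y :=
  (hf.const_mul c).weakPartial_ae_eq ((hf.l2per_weakPartial i).const_mul c) fun k => by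
    rw [fc_const_mul, fc_const_mul, hf.fc_weakPartial, mul_left_comm]

lemma weakPartial_conj {f : E3 → ℂ} (hf : W12per f) (i : Fin 3) :
    weakPartial i (fun y => conj (f y)) =ᵐ[volume] fun y => conj (weakPartial i f y) :=
  hf.conj.weakPartial_ae_eq (hf.l2per_weakPartial i).conj fun k => by
    rw [fc_conj, fc_conj, hf.fc_weakPartial, map_mul, conj_ik, ik_neg, neg_neg]

lemma weakPartial_const (c : ℂ) (i : Fin 3) :
    weakPartial i (fun _ => c) =ᵐ[volume] fun _ => 0 :=
  (w12per_const c).weakPartial_ae_eq (l2per_const 0)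
    ((isWeakPartial_const c i).fc (l2per_const c) (l2per_const 0))

/-! ### Fourier multipliers -/

/-- The symbol of the Laplacian. -/
def ikSq (k : Fin 3 → ℤ) : ℂ := ∑ i, ik k i ^ 2

lemma norm_ik (k : Fin 3 → ℤ) (i : Fin 3) : ‖ik k i‖ = 2 * Real.pi * |(k i : ℝ)| := by
  simp [ik, abs_of_pos Real.pi_pos]

/-- Each `ik k i ^ 2` is a nonpositive real number, so nothing cancels in the sum. -/
lemma norm_ikSq (k : Fin 3 → ℤ) : ‖ikSq k‖ = ∑ i, ‖ik k i‖ ^ 2 := by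
  have h : ikSq k = ((-∑ i, ‖ik k i‖ ^ 2 : ℝ) : ℂ) := by
    rw [ikSq]
    push_cast
    rw [← Finset.sum_neg_distrib]
    refine Finset.sum_congr rfl fun i _ => ?_
    rw [norm_ik]
    push_cast
    rw [mul_pow, mul_pow, ← Complex.ofReal_pow |(k i : ℝ)|, sq_abs, ik]
    push_cast
    ring_nf
    simp [Complex.I_sq]
  rw [h, Complex.norm_real, norm_neg, Real.norm_of_nonneg (Finset.sum_nonneg fun i _ => sq_nonneg _)]

lemma one_le_norm_ikSq {k : Fin 3 → ℤ} (hk : k ≠ 0) : 1 ≤ ‖ikSq k‖ := by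
  obtain ⟨i, hi⟩ := Function.ne_iff.1 hk
  rw [norm_ikSq]
  refine le_trans ?_ (Finset.single_le_sum (f := fun i => ‖ik k i‖ ^ 2)
    (fun i _ => sq_nonneg _) (Finset.mem_univ i))
  have h1 : (1 : ℝ) ≤ |(k i : ℝ)| := by
    rw [← Int.cast_abs]
    exact_mod_cast Int.one_le_abs hi
  have h2 : 1 ≤ ‖ik k i‖ := by
    rw [norm_ik]
    nlinarith [Real.pi_gt_three]
  nlinarith

lemma ikSq_ne_zero {k : Fin 3 → ℤ} (hk : k ≠ 0) : ikSq k ≠ 0 := fun h => by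
  have := one_le_norm_ikSq hk
  rw [h, norm_zero] at this
  linarith

/-- Symbol of a double Riesz transform. This bound controls second derivatives of `Δ⁻¹ g` by `g`,
and is the source of the `W^{1,2}` regularity used below. -/
lemma norm_ik_mul_ik_div_le (k : Fin 3 → ℤ) (i j : Fin 3) : ‖ik k i * ik k j / ikSq k‖ ≤ 1 := by
  rw [norm_div, norm_mul, norm_ikSq]
  refine div_le_one_of_le₀ ?_ (Finset.sum_nonneg fun i _ => sq_nonneg _)
  have h1 := Finset.single_le_sum (f := fun i => ‖ik k i‖ ^ 2)
    (fun i _ => sq_nonneg _) (Finset.mem_univ i)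
  have h2 := Finset.single_le_sum (f := fun i => ‖ik k i‖ ^ 2)
    (fun i _ => sq_nonneg _) (Finset.mem_univ j)
  nlinarith [sq_nonneg (‖ik k i‖ - ‖ik k j‖)]

lemma norm_ik_div_le (k : Fin 3 → ℤ) (i : Fin 3) : ‖ik k i / ikSq k‖ ≤ 1 := by
  by_cases hk : k = 0
  -- At the zero frequency the quotient is 0 by the convention `x / 0 = 0`; potentials built from
  -- this symbol therefore have mean zero.
  · simp [hk, ik]
  · rw [norm_div]
    refine div_le_one_of_le₀ ?_ (norm_nonneg _)
    have h1 := Finset.single_le_sum (f := fun i => ‖ik k i‖ ^ 2)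
      (fun i _ => sq_nonneg _) (Finset.mem_univ i)
    rw [← norm_ikSq] at h1
    have h2 := one_le_norm_ikSq hk
    nlinarith [norm_nonneg (ik k i)]

lemma summable_of_norm_le {c d : (Fin 3 → ℤ) → ℂ} (hd : Summable fun k => ‖d k‖ ^ 2)
    (h : ∀ k, ‖c k‖ ≤ ‖d k‖) : Summable fun k => ‖c k‖ ^ 2 :=
  hd.of_nonneg_of_le (fun _ => sq_nonneg _) fun k => pow_le_pow_left₀ (norm_nonneg _) (h k) 2

lemma summable_add_sq {c d : (Fin 3 → ℤ) → ℂ} (hc : Summable fun k => ‖c k‖ ^ 2)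
    (hd : Summable fun k => ‖d k‖ ^ 2) : Summable fun k => ‖c k + d k‖ ^ 2 := by
  refine ((hc.add hd).mul_left 2).of_nonneg_of_le (fun _ => sq_nonneg _) fun k => ?_
  have := norm_add_le (c k) (d k)
  nlinarith [norm_nonneg (c k + d k), sq_nonneg (‖c k‖ - ‖d k‖)]

lemma summable_sum_sq {ι : Type*} {s : Finset ι} {c : ι → (Fin 3 → ℤ) → ℂ}
    (hc : ∀ i ∈ s, Summable fun k => ‖c i k‖ ^ 2) : Summable fun k => ‖∑ i ∈ s, c i k‖ ^ 2 := by
  classical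
  induction s using Finset.induction_on with
  | empty => simp
  | insert a s ha ih =>
    simp_rw [Finset.sum_insert ha]
    exact summable_add_sq (hc a (Finset.mem_insert_self _ _))
      (ih fun i hi => hc i (Finset.mem_insert_of_mem hi))

lemma summable_mul_sq {c m : (Fin 3 → ℤ) → ℂ} (hc : Summable fun k => ‖c k‖ ^ 2)
    (hm : ∀ k, ‖m k‖ ≤ 1) : Summable fun k => ‖m k * c k‖ ^ 2 :=
  summable_of_norm_le hc fun k => by
    rw [norm_mul]
    exact mul_le_of_le_one_left (norm_nonneg _) (hm k)

/-! ### Curl-free fields and the Helmholtz decomposition -/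

lemma W12per.l2per_grad {f : E3 → ℂ} (hf : W12per f) (i : Fin 3) :
    L2per fun y => grad f y i := hf.l2per_weakPartial i

lemma fc_grad {ψ : E3 → ℂ} (hψ : W12per ψ) (i : Fin 3) (k : Fin 3 → ℤ) :
    fc (fun y => grad ψ y i) k = ik k i * fc ψ k := hψ.fc_weakPartial i k

lemma ik_zero (i : Fin 3) : ik 0 i = 0 := by simp [ik]

/-- A field with `ik_i û_j = ik_j û_i` is the sum of a gradient and a constant. -/
lemma exists_potential_of_fc {u : E3 → C3} (hu : ∀ j, L2per fun y => u y j)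
    (hc : ∀ k i j, ik k i * fc (fun y => u y j) k = ik k j * fc (fun y => u y i) k) :
    ∃ (ψ : E3 → ℂ) (z : C3), W12per ψ ∧ u =ᵐ[volume] fun y => grad ψ y + z := by
  set w : Fin 3 → (Fin 3 → ℤ) → ℂ := fun j k => fc (fun y => u y j) k with hw
  have hws : ∀ j, Summable fun k => ‖w j k‖ ^ 2 := fun j => summable_fc (hu j)
  -- The potential solves `Δψ = div u`. The compatibility relation then gives `∇ψ = u` at every
  -- nonzero frequency, and the mean of `u` becomes the constant `z`.
  obtain ⟨ψ, hψ, hψc⟩ := exists_fc_eq (fun k => ∑ j, ik k j / ikSq k * w j k)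
    (summable_sum_sq fun j _ => summable_mul_sq (hws j) fun k => norm_ik_div_le k j)
  have hik : ∀ i k, k ≠ 0 → ik k i * fc ψ k = w i k := by
    intro i k hk
    have h0 := ikSq_ne_zero hk
    rw [hψc, Finset.mul_sum]
    have : ∀ j, ik k i * (ik k j / ikSq k * w j k) = ik k j ^ 2 * (w i k / ikSq k) := fun j => by
      field_simp
      have := hc k i j
      linear_combination ik k j * this
    simp_rw [this]
    rw [← Finset.sum_mul, ← ikSq]
    field_simp
  have hψW : W12per ψ := by
    refine w12per_of_summable hψ fun i => summable_of_norm_le (hws i) fun k => ?_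
    by_cases hk : k = 0
    · simp [hk, ik_zero]
    · rw [hik i k hk]
  refine ⟨ψ, WithLp.toLp 2 fun i => w i 0, hψW, ?_⟩
  have : ∀ i, (fun y => u y i) =ᵐ[volume] fun y => grad ψ y i + w i 0 := fun i => by
    refine fc_injective (hu i) ((hψW.l2per_grad i).add (l2per_const _)) fun k => ?_
    rw [fc_add (hψW.l2per_grad i) (l2per_const _), fc_grad hψW]
    by_cases hk : k = 0
    · subst hk
      simp [ik_zero, hw, fc, em, UnitAddTorus.mFourier_zero]
    · rw [hik i k hk, fc_const _ hk, add_zero]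
  filter_upwards [ae_all_iff.2 this] with y hy
  ext i
  simpa using hy i

lemma l2per_curl {u : E3 → C3} (hu : W12perVec u) (i : Fin 3) : L2per fun y => curl u y i :=
  ((hu (i + 2)).l2per_weakPartial (i + 1)).sub ((hu (i + 1)).l2per_weakPartial (i + 2))

lemma fc_curl {u : E3 → C3} (hu : W12perVec u) (i : Fin 3) (k : Fin 3 → ℤ) :
    fc (fun y => curl u y i) k = ik k (i + 1) * fc (fun y => u y (i + 2)) k
      - ik k (i + 2) * fc (fun y => u y (i + 1)) k := by
  rw [← (hu (i + 2)).fc_weakPartial, ← (hu (i + 1)).fc_weakPartial]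
  exact fc_sub ((hu (i + 2)).l2per_weakPartial (i + 1)) ((hu (i + 1)).l2per_weakPartial (i + 2)) k

lemma curl_ae_eq {u : E3 → C3} (hu : W12perVec u) {J : Fin 3 → E3 → ℂ} (hJ : ∀ i, L2per (J i))
    (h : ∀ i k, fc (J i) k = ik k (i + 1) * fc (fun y => u y (i + 2)) k
      - ik k (i + 2) * fc (fun y => u y (i + 1)) k) :
    ∀ᵐ y, ∀ i, curl u y i = J i y :=
  ae_all_iff.2 fun i => fc_injective (l2per_curl hu i) (hJ i) fun k => by rw [fc_curl hu, h]

lemma l2per_finset_sum {ι : Type*} {s : Finset ι} {f : ι → E3 → ℂ} (hf : ∀ i ∈ s, L2per (f i)) :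
    L2per fun y => ∑ i ∈ s, f i y := by
  classical
  induction s using Finset.induction_on with
  | empty => simpa using l2per_const (0 : ℂ)
  | insert a s ha ih =>
    simp_rw [Finset.sum_insert ha]
    exact (hf a (Finset.mem_insert_self _ _)).add
      (ih fun i hi => hf i (Finset.mem_insert_of_mem hi))

lemma fc_finset_sum {ι : Type*} {s : Finset ι} {f : ι → E3 → ℂ} (hf : ∀ i ∈ s, L2per (f i))
    (k : Fin 3 → ℤ) : fc (fun y => ∑ i ∈ s, f i y) k = ∑ i ∈ s, fc (f i) k := by
  classical
  induction s using Finset.induction_on with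
  | empty => simp [fc]
  | insert a s ha ih =>
    simp_rw [Finset.sum_insert ha]
    rw [fc_add (hf a (Finset.mem_insert_self _ _))
      (l2per_finset_sum fun i hi => hf i (Finset.mem_insert_of_mem hi)),
      ih fun i hi => hf i (Finset.mem_insert_of_mem hi)]

lemma l2per_divergence {u : E3 → C3} (hu : W12perVec u) : L2per (divergence u) :=
  l2per_finset_sum fun i _ => (hu i).l2per_weakPartial i

lemma fc_divergence {u : E3 → C3} (hu : W12perVec u) (k : Fin 3 → ℤ) :
    fc (divergence u) k = ∑ i, ik k i * fc (fun y => u y i) k := by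
  unfold divergence
  rw [fc_finset_sum fun i _ => (hu i).l2per_weakPartial i]
  exact Finset.sum_congr rfl fun i _ => (hu i).fc_weakPartial i k

lemma divergence_ae_eq_zero_iff {u : E3 → C3} (hu : W12perVec u) :
    (∀ᵐ y ∂volume.restrict cell, divergence u y = 0) ↔
      ∀ k, ∑ i, ik k i * fc (fun y => u y i) k = 0 := by
  refine ⟨fun h k => ?_, fun h => ?_⟩
  · rw [← fc_divergence hu, fc_congr h, fc_zero]
  · refine ae_restrict_of_ae (fc_injective (l2per_divergence hu) (l2per_const 0) fun k => ?_)
    rw [fc_divergence hu, h, fc_zero]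

/-- The identity `Δu = ∇ div u - curl curl u` on the Fourier side, for a field without divergence.
-/
lemma sum_ik_mul_eq (k : Fin 3 → ℤ) (u : Fin 3 → ℂ) (i : Fin 3)
    (hd : ∑ j, ik k j * u j = 0) :
    ikSq k * u i = ik k (i + 2) * (ik k (i + 2) * u i - ik k i * u (i + 2))
      - ik k (i + 1) * (ik k i * u (i + 1) - ik k (i + 1) * u i) := by
  rw [Fin.sum_univ_three] at hd
  rw [ikSq, Fin.sum_univ_three]
  have e : ∀ a : Fin 3 → ℂ, a 0 + a 1 + a 2 = a i + a (i + 1) + a (i + 2) := fun a => by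
    fin_cases i
    · rfl
    · change a 0 + a 1 + a 2 = a 1 + a 2 + a 0
      ring
    · change a 0 + a 1 + a 2 = a 2 + a 0 + a 1
      ring
  rw [e fun j => ik k j * u j] at hd
  rw [e fun j => ik k j ^ 2]
  linear_combination ik k i * hd

/-- A divergence-free periodic field with square integrable curl belongs to `W^{1,2}`. -/
lemma w12perVec_of_curl {u : E3 → C3} (hu : ∀ j, L2per fun y => u y j)
    {J : Fin 3 → E3 → ℂ} (hJ : ∀ i, L2per (J i))
    (h : ∀ i k, fc (J i) k = ik k (i + 1) * fc (fun y => u y (i + 2)) k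
      - ik k (i + 2) * fc (fun y => u y (i + 1)) k)
    (hd : ∀ k, ∑ i, ik k i * fc (fun y => u y i) k = 0) : W12perVec u := by
  intro i
  refine w12per_of_summable (hu i) fun j => ?_
  -- Inverting the Laplacian in `Δu = -curl J` expresses every first derivative of `u` through
  -- double Riesz transforms of the components of `J`.
  have e : ∀ k, ik k j * fc (fun y => u y i) k =
      ik k j * ik k (i + 2) / ikSq k * fc (J (i + 1)) k
        + -(ik k j * ik k (i + 1) / ikSq k) * fc (J (i + 2)) k := by
    intro k
    by_cases hk : k = 0
    · simp [hk, ik_zero]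
    have h0 := ikSq_ne_zero hk
    have := sum_ik_mul_eq k (fun i => fc (fun y => u y i) k) i (hd k)
    rw [h, h]
    have e1 : i + 1 + 1 = i + 2 := by fin_cases i <;> rfl
    have e2 : i + 1 + 2 = i := by fin_cases i <;> rfl
    have e3 : i + 2 + 1 = i := by fin_cases i <;> rfl
    have e4 : i + 2 + 2 = i + 1 := by fin_cases i <;> rfl
    rw [e1, e2, e3, e4]
    field_simp
    linear_combination ik k j * this
  simp_rw [e]
  refine summable_add_sq (summable_mul_sq (summable_fc (hJ _)) fun k => norm_ik_mul_ik_div_le _ _ _)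
    (summable_mul_sq (summable_fc (hJ _)) fun k => ?_)
  rw [norm_neg]
  exact norm_ik_mul_ik_div_le _ _ _

/-- Helmholtz decomposition of a periodic `W^{1,2}` field. -/
lemma exists_helmholtz {v : E3 → C3} (hv : W12perVec v) :
    ∃ φ, W12per φ ∧ W12perVec (grad φ) ∧
      ∀ k, ∑ i, ik k i * fc (fun y => v y i - grad φ y i) k = 0 := by
  -- Here `φ` is the mean-zero solution of `Δφ = div v`; one derivative of `v` gives two derivatives
  -- of `φ`.
  obtain ⟨φ, hφ, hφc⟩ := exists_fc_eq (fun k => ∑ j, ik k j / ikSq k * fc (fun y => v y j) k)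
    (summable_sum_sq fun j _ => summable_mul_sq (summable_fc (hv j).1) fun k => norm_ik_div_le k j)
  have hφW : W12per φ := by
    refine w12per_of_summable hφ fun i => ?_
    have e : ∀ k, ik k i * fc φ k = ∑ j, ik k i * ik k j / ikSq k * fc (fun y => v y j) k :=
      fun k => by
        rw [hφc, Finset.mul_sum]
        exact Finset.sum_congr rfl fun j _ => by ring
    simp_rw [e]
    exact summable_sum_sq fun j _ => summable_mul_sq (summable_fc (hv j).1)
      fun k => norm_ik_mul_ik_div_le k i j
  refine ⟨φ, hφW, fun i => w12per_of_summable (hφW.l2per_weakPartial i) fun l => ?_, fun k => ?_⟩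
  · have e : ∀ k, ik k l * fc (fun y => grad φ y i) k =
        ∑ j, ik k l * ik k i / ikSq k * (ik k j * fc (fun y => v y j) k) := fun k => by
      rw [fc_grad hφW, hφc, Finset.mul_sum, Finset.mul_sum]
      exact Finset.sum_congr rfl fun j _ => by ring
    simp_rw [e]
    exact summable_sum_sq fun j _ => summable_mul_sq ((hv j).summable j)
      fun k => norm_ik_mul_ik_div_le k l i
  · by_cases hk : k = 0
    · simp [hk, ik_zero]
    have h0 := ikSq_ne_zero hk
    have e : ∀ i, ik k i * fc (fun y => v y i - grad φ y i) k =
        ik k i * fc (fun y => v y i) k - ik k i ^ 2 * fc φ k := fun i => by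
      rw [fc_sub (hv i).1 (hφW.l2per_grad i), fc_grad hφW i k]
      ring
    simp_rw [e]
    rw [Finset.sum_sub_distrib, ← Finset.sum_mul, ← ikSq, hφc, Finset.mul_sum, sub_eq_zero]
    refine Finset.sum_congr rfl fun j _ => ?_
    field_simp

end

section

/-! ### Averages of translates -/

section Average

variable {Ω : Type*} [MeasurableSpace Ω] {μ : Measure Ω} [IsFiniteMeasure μ]

/-- The shift `(ω, x) ↦ (ω, x + Y ω)` preserves the product measure fibre by fibre. Hence `f (x + Y
ω)` is jointly measurable when `f` is known only up to a null set. -/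
lemma quasiMeasurePreserving_shift {Y : Ω → E3} (hY : Measurable Y) :
    Measure.QuasiMeasurePreserving (fun p : Ω × E3 => p.2 + Y p.1) (μ.prod volume) volume := by
  have h : MeasurePreserving (fun p : Ω × E3 => (p.1, p.2 + Y p.1)) (μ.prod volume)
      (μ.prod volume) := by
    refine MeasurePreserving.skew_product (μa := μ) (μc := (volume : Measure E3))
      (g := fun ω x => x + Y ω) (MeasurePreserving.id μ) ?_ ?_
    · exact measurable_snd.add (hY.comp measurable_fst)
    · exact Eventually.of_forall fun ω => (measurePreserving_add_right volume (Y ω)).map_eq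
  exact (Measure.quasiMeasurePreserving_snd (μ := μ) (ν := volume)).comp h.quasiMeasurePreserving

lemma lintegral_sq_le {Ω : Type*} [MeasurableSpace Ω] {μ : Measure Ω} (g : Ω → ENNReal) (hg : AEMeasurable g μ) :
    (∫⁻ ω, g ω ∂μ) ^ 2 ≤ μ univ * ∫⁻ ω, g ω ^ 2 ∂μ := by
  have h := ENNReal.lintegral_mul_le_Lp_mul_Lq μ Real.HolderConjugate.two_two hg
    (aemeasurable_const (b := (1 : ENNReal)))
  simp only [Pi.mul_apply, mul_one, ENNReal.one_rpow, lintegral_const, one_mul] at h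
  have h2 := pow_le_pow_left' h 2
  refine h2.trans_eq ?_
  rw [mul_pow, ← ENNReal.rpow_natCast, ← ENNReal.rpow_natCast, ← ENNReal.rpow_mul,
    ← ENNReal.rpow_mul]
  norm_num
  rw [mul_comm]

/-- The average of the translates `f (x + Y ω)` with weight `c ω`. -/
def shiftAvg (μ : Measure Ω) (c : Ω → ℂ) (Y : Ω → E3) (f : E3 → ℂ) (x : E3) : ℂ :=
  ∫ ω, c ω * f (x + Y ω) ∂μ

variable {c : Ω → ℂ} {Y : Ω → E3} {f : E3 → ℂ} {C : ℝ}

lemma aestronglyMeasurable_shift (hc : Measurable c) (hY : Measurable Y)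
    (hf : AEStronglyMeasurable f volume) :
    AEStronglyMeasurable (fun p : Ω × E3 => c p.1 * f (p.2 + Y p.1)) (μ.prod volume) :=
  (hc.comp measurable_fst).aestronglyMeasurable.mul
    (hf.comp_quasiMeasurePreserving (quasiMeasurePreserving_shift hY))

/-- Cauchy–Schwarz in `ω`, then Tonelli and translation invariance in `x`. The same averages serve
for mollification, for integration along a segment, and for the two combined. -/
lemma memLp_shiftAvg (hc : Measurable c) (hcC : ∀ ω, ‖c ω‖ ≤ C) (hY : Measurable Y)
    (hf : MemLp f 2 volume) : MemLp (shiftAvg μ c Y f) 2 volume := by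
  have hm := aestronglyMeasurable_shift (μ := μ) hc hY hf.1
  refine ⟨hm.prod_swap.integral_prod_right', ?_⟩
  have hm' : AEMeasurable (fun p : Ω × E3 => ‖f (p.2 + Y p.1)‖ₑ ^ 2) (μ.prod volume) :=
    ((hf.1.comp_quasiMeasurePreserving (quasiMeasurePreserving_shift hY)).enorm).pow_const 2
  have hsq : ∀ g : E3 → ℂ, ∫⁻ x, ‖g x‖ₑ ^ (2 : ENNReal).toReal = ∫⁻ x, ‖g x‖ₑ ^ 2 := fun g => by
    simp
  rw [eLpNorm_lt_top_iff_lintegral_rpow_enorm_lt_top (by norm_num) (by norm_num), hsq]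
  have hfin : ∫⁻ x, ‖f x‖ₑ ^ 2 < ⊤ := by
    rw [← hsq]
    exact (eLpNorm_lt_top_iff_lintegral_rpow_enorm_lt_top (by norm_num) (by norm_num)).1 hf.2
  have hsec : ∀ᵐ x, AEMeasurable (fun ω => ‖f (x + Y ω)‖ₑ) μ := by
    have := (hf.1.comp_quasiMeasurePreserving
      (quasiMeasurePreserving_shift (μ := μ) hY)).prod_swap.prodMk_left
    filter_upwards [this] with x hx
    exact hx.enorm
  calc ∫⁻ x, ‖shiftAvg μ c Y f x‖ₑ ^ 2
      ≤ ∫⁻ x, (ENNReal.ofReal C ^ 2 * μ univ) * ∫⁻ ω, ‖f (x + Y ω)‖ₑ ^ 2 ∂μ := by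
        refine lintegral_mono_ae ?_
        filter_upwards [hsec] with x hx
        have h1 : ‖shiftAvg μ c Y f x‖ₑ ≤ ENNReal.ofReal C * ∫⁻ ω, ‖f (x + Y ω)‖ₑ ∂μ := by
          refine (enorm_integral_le_lintegral_enorm _).trans ?_
          rw [← lintegral_const_mul' _ _ ENNReal.ofReal_ne_top]
          refine lintegral_mono fun ω => ?_
          rw [enorm_mul]
          gcongr
          rw [← ofReal_norm]
          exact ENNReal.ofReal_le_ofReal (hcC ω)
        refine (pow_le_pow_left' h1 2).trans ?_
        rw [mul_pow, mul_assoc]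
        gcongr
        exact lintegral_sq_le _ hx
    _ = (ENNReal.ofReal C ^ 2 * μ univ) * ∫⁻ ω, ∫⁻ x, ‖f (x + Y ω)‖ₑ ^ 2 ∂volume ∂μ := by
        rw [lintegral_const_mul' _ _ (ENNReal.mul_ne_top (by simp) (measure_ne_top _ _))]
        congr 1
        exact (lintegral_lintegral_swap hm').symm
    _ = (ENNReal.ofReal C ^ 2 * μ univ) * ((∫⁻ x, ‖f x‖ₑ ^ 2) * μ univ) := by
        congr 1
        rw [← lintegral_const]
        refine lintegral_congr fun ω => ?_
        exact lintegral_add_right_eq_self (fun x => ‖f x‖ₑ ^ 2) (Y ω)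
    _ < ⊤ := by
        refine ENNReal.mul_lt_top (ENNReal.mul_lt_top (by simp) (measure_lt_top _ _))
          (ENNReal.mul_lt_top hfin (measure_lt_top _ _))

/-- Averages of translates, tested against a function. -/
lemma integral_mul_shiftAvg (hc : Measurable c) (hcC : ∀ ω, ‖c ω‖ ≤ C) (hY : Measurable Y)
    (hf : MemLp f 2 volume) {φ : E3 → ℂ} (hφ : MemLp φ 2 volume) :
    ∫ x, φ x * shiftAvg μ c Y f x = ∫ ω, c ω * (∫ x, φ (x - Y ω) * f x) ∂μ := by
  have hm : AEStronglyMeasurable (fun p : Ω × E3 => φ p.2 * (c p.1 * f (p.2 + Y p.1)))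
      (μ.prod volume) :=
    (hφ.1.comp_quasiMeasurePreserving Measure.quasiMeasurePreserving_snd).mul
      (aestronglyMeasurable_shift hc hY hf.1)
  have hsh : ∀ ω, MemLp (fun x => f (x + Y ω)) 2 volume := fun ω =>
    hf.comp_measurePreserving (measurePreserving_add_right volume (Y ω))
  have hi : Integrable (fun p : Ω × E3 => φ p.2 * (c p.1 * f (p.2 + Y p.1))) (μ.prod volume) := by
    rw [integrable_prod_iff hm]
    refine ⟨Eventually.of_forall fun ω => MemLp.integrable_mul (q := 2) hφ ((hsh ω).const_mul (c ω)), ?_⟩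
    refine Integrable.of_bound (C := C * ((eLpNorm φ 2 volume).toReal * (eLpNorm f 2 volume).toReal))
      hm.norm.integral_prod_right' (Eventually.of_forall fun ω => ?_)
    have h1 : ∀ x, ‖φ x * (c ω * f (x + Y ω))‖ = ‖c ω‖ * (‖φ x‖ * ‖f (x + Y ω)‖) := fun x => by
      rw [norm_mul, norm_mul]; ring
    simp_rw [h1]
    rw [integral_const_mul, norm_mul, norm_norm]
    have h2 := norm_integral_mul_le (μ := (volume : Measure E3)) (f := fun x => ((‖φ x‖ : ℝ) : ℂ))
      (g := fun x => ((‖f (x + Y ω)‖ : ℝ) : ℂ)) hφ.norm.ofReal (hsh ω).norm.ofReal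
    have h3 : ∫ x, ((‖φ x‖ : ℝ) : ℂ) * ((‖f (x + Y ω)‖ : ℝ) : ℂ)
        = ((∫ x, ‖φ x‖ * ‖f (x + Y ω)‖ : ℝ) : ℂ) := by
      rw [← integral_complex_ofReal]
      simp
    rw [h3, Complex.norm_real] at h2
    have h4 : eLpNorm (fun x => ((‖φ x‖ : ℝ) : ℂ)) 2 volume = eLpNorm φ 2 volume :=
      eLpNorm_congr_norm_ae (Eventually.of_forall fun x => by simp)
    have h5 : eLpNorm (fun x => ((‖f (x + Y ω)‖ : ℝ) : ℂ)) 2 volume = eLpNorm f 2 volume := by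
      rw [← eLpNorm_comp_measurePreserving hf.1 (measurePreserving_add_right volume (Y ω))]
      exact eLpNorm_congr_norm_ae (Eventually.of_forall fun x => by simp)
    rw [h4, h5] at h2
    have hC : 0 ≤ C := (norm_nonneg _).trans (hcC ω)
    gcongr
    exact hcC ω
  calc ∫ x, φ x * shiftAvg μ c Y f x = ∫ x, ∫ ω, φ x * (c ω * f (x + Y ω)) ∂μ := by
        congr 1; ext x; rw [shiftAvg, integral_const_mul]
    _ = ∫ ω, (∫ x, φ x * (c ω * f (x + Y ω))) ∂μ := (integral_integral_swap hi).symm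
    _ = ∫ ω, c ω * (∫ x, φ (x - Y ω) * f x) ∂μ := by
        congr 1; ext ω
        rw [← integral_const_mul, ← integral_sub_right_eq_self _ (Y ω)]
        congr 1; ext x
        rw [sub_add_cancel]
        ring

end Average

/-! ### Local weak derivatives -/

/-- `∂_i f = g` in the sense of distributions on the set `U`. -/
def WeakPartialOn (U : Set E3) (i : Fin 3) (f g : E3 → ℂ) : Prop :=
  ∀ φ : E3 → ℝ, IsTestFun φ → tsupport φ ⊆ U →
    ∫ x, (pderiv i φ x : ℂ) * f x = -∫ x, (φ x : ℂ) * g x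

/-- The field `w` is curl-free in the sense of distributions on the set `U`. -/
def CurlFreeOn (U : Set E3) (w : Fin 3 → E3 → ℂ) : Prop :=
  ∀ φ : E3 → ℝ, IsTestFun φ → tsupport φ ⊆ U → ∀ i j,
    ∫ x, (pderiv i φ x : ℂ) * w j x = ∫ x, (pderiv j φ x : ℂ) * w i x

lemma WeakPartialOn.mono {U V : Set E3} {i : Fin 3} {f g : E3 → ℂ} (h : WeakPartialOn U i f g)
    (hV : V ⊆ U) : WeakPartialOn V i f g := fun φ hφ hs => h φ hφ (hs.trans hV)

lemma integral_mul_congr {φ : E3 → ℝ} {U : Set E3} (hU : tsupport φ ⊆ U) {f g : E3 → ℂ}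
    (h : ∀ᵐ x, x ∈ U → f x = g x) : ∫ x, (φ x : ℂ) * f x = ∫ x, (φ x : ℂ) * g x := by
  refine integral_congr_ae (h.mono fun x hx => ?_)
  by_cases hxU : x ∈ U
  · simp only [hx hxU]
  · simp only [image_eq_zero_of_notMem_tsupport fun h => hxU (hU h), Complex.ofReal_zero, zero_mul]

lemma WeakPartialOn.congr {U : Set E3} {i : Fin 3} {f g f' g' : E3 → ℂ}
    (h : WeakPartialOn U i f g) (hf : ∀ᵐ x, x ∈ U → f x = f' x) (hg : ∀ᵐ x, x ∈ U → g x = g' x) :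
    WeakPartialOn U i f' g' := fun φ hφ hs => by
  rw [← integral_mul_congr ((tsupport_pderiv_subset φ i).trans hs) hf,
    ← integral_mul_congr hs hg, h φ hφ hs]

lemma fderiv_eq_sum (φ : E3 → ℝ) (x h : E3) : fderiv ℝ φ x h = ∑ j, h j * pderiv j φ x := by
  have e : h = ∑ j, h j • EuclideanSpace.single j (1 : ℝ) := by
    ext i
    simp [Finset.sum_apply, Pi.single_apply]
  conv_lhs => rw [e]
  simp [pderiv]

lemma IsTestFun.comp_sub {φ : E3 → ℝ} (hφ : IsTestFun φ) (h : E3) :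
    IsTestFun fun x => φ (x - h) :=
  ⟨hφ.1.comp (contDiff_id.sub contDiff_const), hφ.2.comp_homeomorph (Homeomorph.subRight h)⟩

lemma pderiv_comp_sub (φ : E3 → ℝ) (i : Fin 3) (h x : E3) :
    pderiv i (fun y => φ (y - h)) x = pderiv i φ (x - h) := by
  simp only [pderiv, sub_eq_add_neg]
  rw [fderiv_comp_add_right]

lemma tsupport_comp_sub (φ : E3 → ℝ) (h : E3) :
    tsupport (fun x => φ (x - h)) = (fun x => x + h) '' tsupport φ := by
  have : (fun x => φ (x - h)) = φ ∘ Homeomorph.subRight h := rfl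
  rw [this, tsupport_comp_eq_preimage]
  ext x
  simp only [mem_preimage, mem_image]
  constructor
  · intro hx
    exact ⟨x - h, hx, sub_add_cancel x h⟩
  · rintro ⟨y, hy, rfl⟩
    simpa using hy

lemma IsTestFun.continuous_ofReal {φ : E3 → ℝ} (hφ : IsTestFun φ) :
    Continuous fun x => (φ x : ℂ) := Complex.continuous_ofReal.comp hφ.1.continuous

lemma IsTestFun.hasCompactSupport_ofReal {φ : E3 → ℝ} (hφ : IsTestFun φ) :
    HasCompactSupport fun x => (φ x : ℂ) := hφ.2.comp_left (g := Complex.ofReal) rfl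

lemma IsTestFun.memLp {φ : E3 → ℝ} (hφ : IsTestFun φ) : MemLp (fun x => (φ x : ℂ)) 2 volume :=
  hφ.continuous_ofReal.memLp_of_hasCompactSupport hφ.hasCompactSupport_ofReal

lemma IsTestFun.integrable_mul {φ : E3 → ℝ} (hφ : IsTestFun φ) {f : E3 → ℂ}
    (hf : LocallyIntegrable f volume) : Integrable (fun x => (φ x : ℂ) * f x) volume :=
  integrable_mul_of_hasCompactSupport hφ.continuous_ofReal hφ.hasCompactSupport_ofReal hf

lemma memLp_locallyIntegrable {f : E3 → ℂ} (hf : MemLp f 2 volume) : LocallyIntegrable f volume :=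
  hf.locallyIntegrable (by norm_num)

/-- Lebesgue measure on the unit interval. -/
abbrev unitMeasure : Measure ℝ := volume.restrict (Ioc (0 : ℝ) 1)

lemma testFun_sub_sub {φ : E3 → ℝ} (hφ : IsTestFun φ) (x h : E3) :
    φ (x - h) - φ x = -∫ τ, (∑ j, h j * pderiv j φ (x - τ • h)) ∂unitMeasure := by
  have hd : ∀ τ ∈ uIcc (0 : ℝ) 1, HasDerivAt (fun τ : ℝ => φ (x - τ • h))
      (-∑ j, h j * pderiv j φ (x - τ • h)) τ := fun τ _ => by
    have h1 : HasDerivAt (fun τ : ℝ => x - τ • h) (-h) τ := by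
      simpa using ((hasDerivAt_id τ).smul_const h).const_sub x
    have h2 := ((hφ.1.differentiable (by simp)) (x - τ • h)).hasFDerivAt.comp_hasDerivAt τ h1
    rw [map_neg, fderiv_eq_sum] at h2
    exact h2
  have hc : Continuous fun τ : ℝ => -∑ j, h j * pderiv j φ (x - τ • h) := by
    refine (continuous_finsetSum _ fun j _ => continuous_const.mul ?_).neg
    exact (continuous_pderiv hφ.1 j).comp (by fun_prop)
  have := intervalIntegral.integral_eq_sub_of_hasDerivAt hd (hc.intervalIntegrable 0 1)
  rw [intervalIntegral.integral_of_le zero_le_one, integral_neg] at this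
  rw [this]
  simp

/-- The increment of `∫ φ f` when `φ` is translated along a segment. -/
lemma integral_translate_sub {φ : E3 → ℝ} (hφ : IsTestFun φ) (h : E3) {f : E3 → ℂ}
    (hf : Integrable f volume) :
    (∫ x, (φ (x - h) : ℂ) * f x) - ∫ x, (φ x : ℂ) * f x
      = -∫ τ, (∑ j, (h j : ℂ) * ∫ x, (pderiv j φ (x - τ • h) : ℂ) * f x) ∂unitMeasure := by
  obtain ⟨C, hC⟩ : ∃ C, ∀ j x, ‖pderiv j φ x‖ ≤ C := by
    have : ∀ j, ∃ C, ∀ x, ‖pderiv j φ x‖ ≤ C := fun j =>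
      (hφ.pderiv j).2.exists_bound_of_continuous (hφ.pderiv j).1.continuous
    choose C hC using this
    exact ⟨∑ j, |C j|, fun j x => (hC j x).trans ((le_abs_self _).trans
      (Finset.single_le_sum (f := fun j => |C j|) (fun _ _ => abs_nonneg _) (Finset.mem_univ j)))⟩
  have hi : ∀ j, Integrable (fun p : E3 × ℝ => (pderiv j φ (p.1 - p.2 • h) : ℂ) * f p.1)
      (volume.prod unitMeasure) := fun j => by
    refine (hf.comp_fst unitMeasure).bdd_mul (c := C) ?_ (Eventually.of_forall fun p => ?_)
    · refine Continuous.aestronglyMeasurable ?_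
      exact Complex.continuous_ofReal.comp ((continuous_pderiv hφ.1 j).comp (by fun_prop))
    · rw [Complex.norm_real]
      exact hC _ _
  have hfi : ∀ ψ : E3 → ℝ, IsTestFun ψ → Integrable (fun x => (ψ x : ℂ) * f x) volume := fun ψ hψ =>
    hψ.integrable_mul hf.locallyIntegrable
  rw [← integral_sub (hfi _ (hφ.comp_sub h)) (hfi _ hφ)]
  have e1 : ∀ x, (φ (x - h) : ℂ) * f x - (φ x : ℂ) * f x
      = -∫ τ, (∑ j, (h j : ℂ) * ((pderiv j φ (x - τ • h) : ℂ) * f x)) ∂unitMeasure := fun x => by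
    rw [← sub_mul, ← Complex.ofReal_sub, testFun_sub_sub hφ, Complex.ofReal_neg,
      ← integral_complex_ofReal, neg_mul, ← integral_mul_const]
    congr 2; ext τ
    push_cast
    rw [Finset.sum_mul]
    exact Finset.sum_congr rfl fun j _ => by ring
  simp_rw [e1]
  rw [integral_neg, integral_integral_swap]
  · congr 2; ext τ
    rw [integral_finsetSum]
    · exact Finset.sum_congr rfl fun j _ => integral_const_mul _ _
    · intro j _
      refine Integrable.const_mul ?_ _
      have := (hφ.pderiv j).comp_sub (τ • h)
      exact hfi _ this
  · exact integrable_finsetSum _ fun j _ => (hi j).const_mul _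

end

section

/-! ### Locally constant cocycles on simply connected spaces -/

/-- The cocycle glues the products `U i × A`, with `A` discrete, into a covering space of `X`. As
`X` is simply connected and locally path connected, the covering has a global section; `a i` is its
coordinate in the chart over `U i`. This is the triviality of the first cohomology with locally
constant coefficients. -/
theorem exists_primitive_of_cocycle {X ι A : Type*} [TopologicalSpace X] [SimplyConnectedSpace X]
    [LocallyPathConnectedSpace X] [AddCommGroup A] (U : ι → Set X) (hU : ∀ i, IsOpen (U i))
    (hcov : ∀ x, ∃ i, x ∈ U i) (c : ι → ι → X → A)
    (hself : ∀ i, ∀ x ∈ U i, c i i x = 0)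
    (hcoc : ∀ i j k, ∀ x ∈ U i ∩ U j ∩ U k, c i j x + c j k x = c i k x)
    (hloc : ∀ i j, ∀ x ∈ U i ∩ U j, ∀ᶠ y in 𝓝 x, c i j y = c i j x) :
    ∃ a : ι → X → A, (∀ i j, ∀ x ∈ U i ∩ U j, a j x = a i x + c i j x) ∧
      ∀ i, ∀ x ∈ U i, ∀ᶠ y in 𝓝 x, a i y = a i x := by
  -- With the discrete topology on the fibre, a locally constant coordinate change is continuous and
  -- the bundle is a covering.
  let _ : TopologicalSpace A := ⊥
  have : DiscreteTopology A := ⟨rfl⟩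
  choose idx hidx using hcov
  let Z : FiberBundleCore ι X A :=
    { baseSet := U
      isOpen_baseSet := hU
      indexAt := idx
      mem_baseSet_at := hidx
      coordChange := fun i j x v => v + c i j x
      coordChange_self := fun i x hx v => by rw [hself i x hx, add_zero]
      continuousOn_coordChange := fun i j p hp => by
        refine ContinuousAt.continuousWithinAt (tendsto_nhds_of_eventually_eq ?_)
        have h1 : ∀ᶠ q in 𝓝 p, c i j q.1 = c i j p.1 :=
          (continuous_fst.tendsto p).eventually (hloc i j p.1 hp.1)
        have h2 : ∀ᶠ q in 𝓝 p, q.2 = p.2 :=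
          (continuous_snd.tendsto p).eventually ((isOpen_discrete {p.2}).mem_nhds rfl)
        filter_upwards [h1, h2] with q hq1 hq2
        rw [hq1, hq2]
      coordChange_comp := fun i j k x hx v => by
        rw [← hcoc i j k x hx, add_assoc] }
  obtain ⟨x₀⟩ : Nonempty X := inferInstance
  have hc : IsCoveringMap (Bundle.TotalSpace.proj : Bundle.TotalSpace A Z.Fiber → X) :=
    FiberBundle.isCoveringMap
  -- A lift of the identity of `X` is a global section.
  obtain ⟨s, ⟨-, hs⟩, -⟩ := hc.existsUnique_continuousMap_lifts (ContinuousMap.id X) x₀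
    (⟨x₀, (0 : A)⟩ : Bundle.TotalSpace A Z.Fiber) rfl
  have hs' : ∀ x, (s x).proj = x := fun x => congrFun hs x
  refine ⟨fun i x => (Z.localTriv i (s x)).2, fun i j x hx => ?_, fun i x hx => ?_⟩
  · have e := Z.coordChange_comp (Z.indexAt (s x).proj) i j x
      ⟨⟨by rw [hs' x]; exact hidx x, hx.1⟩, hx.2⟩ (s x).2
    simp only [FiberBundleCore.localTriv_apply]
    rw [hs' x] at e ⊢
    exact e.symm
  · have hcont : ContinuousAt (fun x => Z.localTriv i (s x)) x := by
      refine ContinuousAt.comp (g := Z.localTriv i) ?_ s.continuous.continuousAt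
      refine (Z.localTriv i).continuousAt ?_
      rw [FiberBundleCore.mem_localTriv_source, ← FiberBundleCore.baseSet_at, hs' x]
      exact hx
    exact (continuous_snd.continuousAt.comp hcont).eventually
      ((isOpen_discrete {(Z.localTriv i (s x)).2}).mem_nhds rfl)

/-! ### Mollification and the local potential -/

/-- `ρ` is an even smooth mollifier supported in the ball of radius `ε`. -/
structure IsMollifier (ε : ℝ) (ρ : E3 → ℝ) : Prop where
  testFun : IsTestFun ρ
  even : ∀ x, ρ (-x) = ρ x
  integral_one : ∫ x, ρ x = 1
  support : ∀ x, x ∉ Metric.ball (0 : E3) ε → ρ x = 0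

lemma exists_isMollifier {ε : ℝ} (hε : 0 < ε) : ∃ ρ, IsMollifier ε ρ := by
  let b : ContDiffBump (0 : E3) := ⟨ε / 2, ε, by positivity, by linarith⟩
  refine ⟨b.normed volume, ⟨b.contDiff_normed, b.hasCompactSupport_normed⟩, b.normed_neg,
    b.integral_normed, fun x hx => ?_⟩
  have := b.support_normed_eq (μ := volume)
  by_contra h
  exact hx (this ▸ (Function.mem_support.2 h))

instance isFiniteMeasure_ball (ε : ℝ) :
    IsFiniteMeasure ((volume : Measure E3).restrict (Metric.ball 0 ε)) :=
  ⟨by rw [Measure.restrict_apply_univ]; exact measure_ball_lt_top⟩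

lemma IsTestFun.exists_norm_le {φ : E3 → ℝ} (hφ : IsTestFun φ) : ∃ C, ∀ x, ‖(φ x : ℂ)‖ ≤ C := by
  obtain ⟨C, hC⟩ := hφ.2.exists_bound_of_continuous hφ.1.continuous
  exact ⟨C, fun x => by rw [Complex.norm_real]; exact hC x⟩

/-- The mollification of `f`. -/
def mollify (ε : ℝ) (ρ : E3 → ℝ) (f : E3 → ℂ) : E3 → ℂ :=
  shiftAvg (volume.restrict (Metric.ball 0 ε)) (fun h => (ρ h : ℂ)) id f

variable {ε : ℝ} {ρ : E3 → ℝ}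

lemma IsMollifier.integral_one' (hρ : IsMollifier ε ρ) :
    ∫ h in Metric.ball (0 : E3) ε, (ρ h : ℂ) = 1 := by
  rw [integral_ball_eq_integral fun x hx => by rw [hρ.support x hx, Complex.ofReal_zero],
    integral_complex_ofReal, hρ.integral_one, Complex.ofReal_one]

/-- The average of `f (x + h)` with weight `ρ h` is a convolution because `ρ` is even. -/
lemma contDiff_mollify (hρ : IsMollifier ε ρ) {f : E3 → ℂ} (hf : MemLp f 2 volume) :
    ContDiff ℝ (⊤ : ℕ∞) (mollify ε ρ f) := by
  have h := hρ.testFun.2.contDiff_convolution_left (ContinuousLinearMap.lsmul ℝ ℝ)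
    (μ := (volume : Measure E3)) hρ.testFun.1 (memLp_locallyIntegrable hf)
  convert h using 1
  ext x
  rw [convolution_def, ← integral_neg_eq_self, mollify, shiftAvg, integral_ball_eq_integral]
  · refine integral_congr_ae (Eventually.of_forall fun t => ?_)
    simp [hρ.even]
  · intro t ht
    rw [hρ.support t ht, Complex.ofReal_zero, zero_mul]

lemma memLp_mollify (hρ : IsMollifier ε ρ) {f : E3 → ℂ} (hf : MemLp f 2 volume) :
    MemLp (mollify ε ρ f) 2 volume := by
  obtain ⟨C, hC⟩ := hρ.testFun.exists_norm_le
  exact memLp_shiftAvg hρ.testFun.continuous_ofReal.measurable hC measurable_id hf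

lemma integral_mul_mollify (hρ : IsMollifier ε ρ) {f : E3 → ℂ} (hf : MemLp f 2 volume)
    {φ : E3 → ℝ} (hφ : IsTestFun φ) :
    ∫ x, (φ x : ℂ) * mollify ε ρ f x
      = ∫ h in Metric.ball (0 : E3) ε, (ρ h : ℂ) * ∫ x, (φ (x - h) : ℂ) * f x := by
  obtain ⟨C, hC⟩ := hρ.testFun.exists_norm_le
  exact integral_mul_shiftAvg hρ.testFun.continuous_ofReal.measurable hC measurable_id hf hφ.memLp

/-- Regularity of `m` is required only on the support of `φ`, so that `m` may be a potential known
only on a ball. -/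
lemma integral_pderiv_mul_of_differentiable {m : E3 → ℂ} {φ : E3 → ℝ} (hφ : IsTestFun φ)
    (hm : ∀ x ∈ tsupport φ, DifferentiableAt ℝ m x) (i : Fin 3)
    (hc : ∀ x ∈ tsupport φ, ContinuousAt (cpderiv i m) x) :
    ∫ x, (pderiv i φ x : ℂ) * m x = -∫ x, (φ x : ℂ) * cpderiv i m x := by
  have hφd : Differentiable ℝ fun x => (φ x : ℂ) :=
    Complex.ofRealCLM.differentiable.comp (hφ.1.differentiable (by simp))
  have ht : tsupport (fun x => (φ x : ℂ)) ⊆ tsupport φ :=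
    closure_mono fun x hx => by
      simpa using hx
  have hint : ∀ ψ : E3 → ℝ, IsTestFun ψ → tsupport ψ ⊆ tsupport φ → ∀ g : E3 → ℂ,
      (∀ x ∈ tsupport φ, ContinuousAt g x) → Integrable (fun x => (ψ x : ℂ) * g x) volume := by
    intro ψ hψ hs g hg
    refine Continuous.integrable_of_hasCompactSupport ?_ (hψ.hasCompactSupport_ofReal.mul_right)
    refine continuous_iff_continuousAt.2 fun x => ?_
    by_cases hx : x ∈ tsupport φ
    · exact hψ.continuous_ofReal.continuousAt.mul (hg x hx)
    · have : (fun x => (ψ x : ℂ) * g x) =ᶠ[𝓝 x] fun _ => 0 := by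
        filter_upwards [(isClosed_tsupport φ).isOpen_compl.mem_nhds hx] with y hy
        rw [image_eq_zero_of_notMem_tsupport fun h => hy (hs h), Complex.ofReal_zero, zero_mul]
      exact this.continuousAt
  have h := integral_mul_fderiv_eq_neg_fderiv_mul_of_integrable (μ := (volume : Measure E3))
    (f := fun x => (φ x : ℂ)) (g := m) (v := EuclideanSpace.single i (1 : ℝ)) ?_ ?_ ?_
    (fun x _ => hφd x) (fun x hx => hm x (ht hx))
  · rw [← neg_eq_iff_eq_neg] at h
    refine Eq.trans (integral_congr_ae (Eventually.of_forall fun x => ?_)) h.symm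
    simp only
    rw [← cpderiv_ofReal (hφ.1.differentiable (by simp))]
    rfl
  · have := hint _ (hφ.pderiv i) (tsupport_pderiv_subset φ i) m fun x hx => (hm x hx).continuousAt
    refine this.congr (Eventually.of_forall fun x => ?_)
    simp only
    rw [← cpderiv_ofReal (hφ.1.differentiable (by simp))]
    rfl
  · exact hint _ hφ subset_rfl _ hc
  · exact hint _ hφ subset_rfl m fun x hx => (hm x hx).continuousAt

lemma eqOn_zero_of_integral_mul {U : Set E3} (hU : IsOpen U) {m : E3 → ℂ} (hm : Continuous m)
    (h : ∀ φ : E3 → ℝ, IsTestFun φ → tsupport φ ⊆ U → ∫ x, (φ x : ℂ) * m x = 0) :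
    ∀ x ∈ U, m x = 0 := by
  have := hU.ae_eq_zero_of_integral_contDiff_smul_eq_zero (μ := volume)
    (hm.locallyIntegrable.locallyIntegrableOn U) fun φ hφ hc hs => by
      simpa using h φ ⟨hφ, hc⟩ hs
  have h2 := Measure.eqOn_open_of_ae_eq (μ := volume) (f := m) (g := fun _ => 0)
    ((ae_restrict_iff' hU.measurableSet).2 this) hU hm.continuousOn continuousOn_const
  exact fun x hx => h2 hx

lemma ae_eq_of_integral_mul_eq {U : Set E3} (hU : IsOpen U) {f g : E3 → ℂ}
    (hf : MemLp f 2 volume) (hg : MemLp g 2 volume)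
    (h : ∀ φ : E3 → ℝ, IsTestFun φ → tsupport φ ⊆ U →
      ∫ x, (φ x : ℂ) * f x = ∫ x, (φ x : ℂ) * g x) :
    ∀ᵐ x, x ∈ U → f x = g x := by
  have := hU.ae_eq_zero_of_integral_contDiff_smul_eq_zero (μ := volume) (f := fun x => f x - g x)
    ((memLp_locallyIntegrable (hf.sub hg)).locallyIntegrableOn U) fun φ hφ hc hs => by
      have hφ' : IsTestFun φ := ⟨hφ, hc⟩
      simp only [Complex.real_smul, mul_sub]
      rw [integral_sub (hφ'.integrable_mul (memLp_locallyIntegrable hf))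
        (hφ'.integrable_mul (memLp_locallyIntegrable hg)), h φ hφ' hs, sub_self]
  exact this.mono fun x hx hxU => sub_eq_zero.1 (hx hxU)

lemma tsupport_comp_sub_subset {φ : E3 → ℝ} {p h : E3} {r : ℝ} (hs : tsupport φ ⊆ Metric.ball p r)
    (hh : h ∈ Metric.ball (0 : E3) ε) {s : ℝ} (hrs : r + ε ≤ s) :
    tsupport (fun x => φ (x - h)) ⊆ Metric.ball p s := by
  rw [tsupport_comp_sub]
  rintro _ ⟨x, hx, rfl⟩
  have h1 := hs hx
  rw [Metric.mem_ball, dist_eq_norm] at h1 ⊢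
  rw [mem_ball_zero_iff] at hh
  have := norm_add_le (x - p) h
  rw [show x + h - p = x - p + h by abel]
  linarith

/-- A function with vanishing weak gradient on a ball is constant on a smaller one. -/
lemma exists_const_of_weakPartialOn_zero {p : E3} {r : ℝ} (hr : 0 < r) {f : E3 → ℂ}
    (hf : MemLp f 2 volume) (hfi : Integrable f volume)
    (h : ∀ i, WeakPartialOn (Metric.ball p r) i f fun _ => 0) :
    ∃ c, ∀ᵐ x, x ∈ Metric.ball p (r / 2) → f x = c := by
  obtain ⟨ρ, hρ⟩ := exists_isMollifier (ε := r / 2) (by positivity)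
  -- A zero weak gradient makes `∫ φ(x - k) f` independent of small `k`, so `f` coincides with its
  -- mollification on the half ball: the other half of the radius is the room for the shifts. The
  -- mollification is smooth with zero gradient there, hence constant.
  have htr : ∀ φ : E3 → ℝ, IsTestFun φ → tsupport φ ⊆ Metric.ball p (r / 2) →
      ∀ k ∈ Metric.ball (0 : E3) (r / 2), ∫ x, (φ (x - k) : ℂ) * f x = ∫ x, (φ x : ℂ) * f x := by
    intro φ hφ hs k hk
    rw [← sub_eq_zero, integral_translate_sub hφ k hfi]
    have : ∀ τ ∈ Ioc (0 : ℝ) 1,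
        ∑ j, (k j : ℂ) * ∫ x, (pderiv j φ (x - τ • k) : ℂ) * f x = 0 := fun τ hτ => by
      refine Finset.sum_eq_zero fun j _ => ?_
      have hk' : τ • k ∈ Metric.ball (0 : E3) (r / 2) := by
        rw [mem_ball_zero_iff] at hk ⊢
        rw [norm_smul, Real.norm_of_nonneg hτ.1.le]
        nlinarith [norm_nonneg k, hτ.1, hτ.2]
      have := h j _ (hφ.comp_sub (τ • k)) (tsupport_comp_sub_subset hs hk' (by linarith))
      simp only [pderiv_comp_sub, mul_zero, integral_zero, neg_zero] at this
      rw [this, mul_zero]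
    rw [setIntegral_congr_fun measurableSet_Ioc this]
    simp
  have hfm : ∀ᵐ x, x ∈ Metric.ball p (r / 2) → f x = mollify (r / 2) ρ f x := by
    refine ae_eq_of_integral_mul_eq Metric.isOpen_ball hf (memLp_mollify hρ hf) fun φ hφ hs => ?_
    rw [integral_mul_mollify hρ hf hφ, setIntegral_congr_fun measurableSet_ball
      (g := fun k => (ρ k : ℂ) * ∫ x, (φ x : ℂ) * f x)
      fun k hk => by simp only; rw [htr φ hφ hs k hk]]
    rw [integral_mul_const, hρ.integral_one', one_mul]
  have hsm := contDiff_mollify hρ hf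
  have hz : ∀ i, ∀ x ∈ Metric.ball p (r / 2), cpderiv i (mollify (r / 2) ρ f) x = 0 := fun i => by
    refine eqOn_zero_of_integral_mul Metric.isOpen_ball (continuous_cpderiv hsm i)
      fun φ hφ hs => ?_
    have := integral_pderiv_mul_of_differentiable hφ
      (fun x _ => (hsm.differentiable (by simp)) x) i fun x _ =>
        (continuous_cpderiv hsm i).continuousAt
    rw [← neg_eq_iff_eq_neg] at this
    rw [← this, ← integral_mul_congr ((tsupport_pderiv_subset φ i).trans hs) hfm,
      h i φ hφ (hs.trans (Metric.ball_subset_ball (by linarith)))]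
    simp
  obtain ⟨c, hc⟩ := Metric.isOpen_ball.exists_is_const_of_fderiv_eq_zero
    (convex_ball p (r / 2)).isPreconnected (hsm.differentiable (by simp)).differentiableOn
    (𝕜 := ℝ) fun x hx => by
      ext v
      have e : v = ∑ j, v j • EuclideanSpace.single j (1 : ℝ) := by
        ext i
        simp [Finset.sum_apply, Pi.single_apply]
      rw [e, map_sum]
      refine Finset.sum_eq_zero fun j _ => ?_
      rw [map_smul]
      have := hz j x hx
      rw [cpderiv] at this
      rw [this, smul_zero]
  exact ⟨c, hfm.mono fun x hx hxB => by rw [hx hxB, hc x hxB]⟩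


lemma continuous_integral_translate {φ : E3 → ℝ} (hφ : IsTestFun φ) {f : E3 → ℂ}
    (hf : Integrable f volume) : Continuous fun k : E3 => ∫ x, (φ (x - k) : ℂ) * f x := by
  obtain ⟨C, hC⟩ := hφ.exists_norm_le
  refine continuous_of_dominated (bound := fun x => C * ‖f x‖) (fun k => ?_) (fun k => ?_)
    (hf.norm.const_mul C) (Eventually.of_forall fun x => ?_)
  · exact ((hφ.comp_sub k).integrable_mul hf.locallyIntegrable).1
  · refine Eventually.of_forall fun x => ?_
    rw [norm_mul]
    exact mul_le_mul_of_nonneg_right (hC _) (norm_nonneg _)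
  · exact (hφ.continuous_ofReal.comp (continuous_const.sub continuous_id)).mul continuous_const

lemma norm_integral_translate_le {φ : E3 → ℝ} {C : ℝ} (hC : ∀ x, ‖(φ x : ℂ)‖ ≤ C) {f : E3 → ℂ}
    (hf : Integrable f volume) (k : E3) :
    ‖∫ x, (φ (x - k) : ℂ) * f x‖ ≤ C * ∫ x, ‖f x‖ := by
  rw [← integral_const_mul]
  refine norm_integral_le_of_norm_le (hf.norm.const_mul C) (Eventually.of_forall fun x => ?_)
  rw [norm_mul]
  exact mul_le_mul_of_nonneg_right (hC _) (norm_nonneg _)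

/-- The difference between a curl-free field and its mollification is a gradient. -/
lemma exists_mollify_potential (hρ : IsMollifier ε ρ) {w : Fin 3 → E3 → ℂ}
    (hw : ∀ j, MemLp (w j) 2 volume) (hwi : ∀ j, Integrable (w j) volume) :
    ∃ Θ : E3 → ℂ, MemLp Θ 2 volume ∧ ∀ φ : E3 → ℝ, IsTestFun φ → ∀ i,
      (∀ h ∈ Metric.ball (0 : E3) ε, ∀ j, ∫ x, (pderiv i φ (x - h) : ℂ) * w j x
        = ∫ x, (pderiv j φ (x - h) : ℂ) * w i x) →
      ∫ x, (pderiv i φ x : ℂ) * Θ x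
        = (∫ x, (φ x : ℂ) * w i x) - ∫ x, (φ x : ℂ) * mollify ε ρ (w i) x := by
  -- For a curl-free field, `w_i(x + h) - w_i(x) = ∫₀¹ ∑ h_j ∂_j w_i(x + τh) dτ = ∂_i ∫₀¹ ∑ h_j
  -- w_j(x + τh) dτ`. Averaging in `h` with weight `ρ` gives `Θ = ∑_j ∫∫ ρ(h) h_j w_j(x + τh)`,
  -- whose gradient is the mollified field minus `w`. The measure `μ` carries the pair `(h, τ)`.
  let μ : Measure (E3 × ℝ) := ((volume : Measure E3).restrict (Metric.ball 0 ε)).prod unitMeasure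
  let c : Fin 3 → E3 × ℝ → ℂ := fun j p => (ρ p.1 : ℂ) * (p.1 j : ℂ)
  let Y : E3 × ℝ → E3 := fun p => p.2 • p.1
  have hY : Continuous Y := by fun_prop
  have hcc : ∀ j, Continuous (c j) := fun j =>
    (hρ.testFun.continuous_ofReal.comp continuous_fst).mul (by fun_prop)
  have hcb : ∀ j, ∃ C, ∀ p, ‖c j p‖ ≤ C := fun j => by
    obtain ⟨C, hC⟩ := HasCompactSupport.exists_bound_of_continuous
      (f := fun h : E3 => (ρ h : ℂ) * (h j : ℂ))
      hρ.testFun.hasCompactSupport_ofReal.mul_right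
      (hρ.testFun.continuous_ofReal.mul (by fun_prop))
    exact ⟨C, fun p => hC p.1⟩
  choose C hC using hcb
  have hm : ∀ j, MemLp (shiftAvg μ (c j) Y (w j)) 2 volume := fun j =>
    memLp_shiftAvg (hcc j).measurable (hC j) hY.measurable (hw j)
  refine ⟨fun x => ∑ j, shiftAvg μ (c j) Y (w j) x, memLp_finsetSum _ fun j _ => hm j,
    fun φ hφ i hc => ?_⟩
  simp only [Finset.mul_sum]
  rw [integral_finsetSum _ fun j _ =>
    (hφ.pderiv i).integrable_mul (memLp_locallyIntegrable (hm j))]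
  simp_rw [fun j => integral_mul_shiftAvg (μ := μ) (hcc j).measurable (hC j) hY.measurable (hw j)
    (hφ.pderiv i).memLp]
  have e1 : ∀ j, ∫ p, c j p * (∫ x, (pderiv i φ (x - Y p) : ℂ) * w j x) ∂μ
      = ∫ p, c j p * (∫ x, (pderiv j φ (x - Y p) : ℂ) * w i x) ∂μ := fun j => by
    refine integral_congr_ae ?_
    have hae : ∀ᵐ p ∂μ, p ∈ Metric.ball (0 : E3) ε ×ˢ Ioc (0 : ℝ) 1 := by
      simp only [μ, Measure.prod_restrict]
      exact ae_restrict_mem (measurableSet_ball.prod measurableSet_Ioc)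
    filter_upwards [hae] with p hp
    rw [hc (Y p) ?_ j]
    have h1 := mem_ball_zero_iff.1 hp.1
    rw [mem_ball_zero_iff, norm_smul, Real.norm_of_nonneg hp.2.1.le]
    nlinarith [norm_nonneg p.1, hp.2.1, hp.2.2]
  simp_rw [e1]
  have hint : ∀ j, Integrable (fun p => c j p * (∫ x, (pderiv j φ (x - Y p) : ℂ) * w i x)) μ := by
    intro j
    obtain ⟨B, hB⟩ := (hφ.pderiv j).exists_norm_le
    refine Integrable.of_bound (C := C j * (B * ∫ x, ‖w i x‖)) ?_ (Eventually.of_forall fun p => ?_)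
    · exact ((hcc j).mul ((continuous_integral_translate (hφ.pderiv j) (hwi i)).comp
        hY)).aestronglyMeasurable
    · rw [norm_mul]
      exact mul_le_mul (hC j p) (norm_integral_translate_le hB (hwi i) _) (norm_nonneg _)
        ((norm_nonneg _).trans (hC j p))
  rw [← integral_finsetSum _ fun j _ => hint j, integral_prod _ (integrable_finsetSum _ fun j _ => hint j)]
  have e2 : ∀ h : E3, ∫ τ, ∑ j, c j (h, τ) * (∫ x, (pderiv j φ (x - Y (h, τ)) : ℂ) * w i x)
      ∂unitMeasure = (ρ h : ℂ) * (∫ x, (φ x : ℂ) * w i x)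
        - (ρ h : ℂ) * ∫ x, (φ (x - h) : ℂ) * w i x := fun h => by
    have := integral_translate_sub hφ h (hwi i)
    rw [← neg_eq_iff_eq_neg, neg_sub] at this
    rw [← mul_sub, this, ← integral_const_mul]
    congr 1; ext τ
    rw [Finset.mul_sum]
    exact Finset.sum_congr rfl fun j _ => by simp only [c, Y]; ring
  simp_rw [e2]
  have hρi : ∀ K : E3 → ℂ, Continuous K →
      Integrable (fun h => (ρ h : ℂ) * K h) (volume.restrict (Metric.ball (0 : E3) ε)) := fun K hK =>
    ((hρ.testFun.continuous_ofReal.mul hK).integrable_of_hasCompactSupport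
      hρ.testFun.hasCompactSupport_ofReal.mul_right).integrableOn
  rw [integral_sub (hρi _ continuous_const)
    (hρi _ (continuous_integral_translate hφ (hwi i))), integral_mul_const, hρ.integral_one',
    one_mul, integral_mul_mollify hρ (hw i) hφ]

lemma cpderiv_eq_of_hasFDerivAt {P : E3 → ℂ} {L : E3 →L[ℝ] ℂ} {x : E3} (h : HasFDerivAt P L x)
    (i : Fin 3) : cpderiv i P x = L (EuclideanSpace.single i 1) := by
  rw [cpderiv, h.fderiv]

/-- A smooth curl-free field on a ball is a gradient. -/
lemma exists_potential_of_contDiff {p : E3} {r : ℝ} {m : Fin 3 → E3 → ℂ}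
    (hm : ∀ i, ContDiff ℝ (⊤ : ℕ∞) (m i))
    (hc : ∀ x ∈ Metric.ball p r, ∀ i j, cpderiv i (m j) x = cpderiv j (m i) x) :
    ∃ P : E3 → ℂ, ∀ x ∈ Metric.ball p r, DifferentiableAt ℝ P x ∧ ∀ i, cpderiv i P x = m i x := by
  let dx : Fin 3 → E3 →L[ℝ] ℂ := fun i =>
    Complex.ofRealCLM.comp (EuclideanSpace.proj i : E3 →L[ℝ] ℝ)
  let w : E3 → E3 →L[ℝ] ℂ := fun x => ∑ i, m i x • dx i
  have hdm : ∀ i, Differentiable ℝ (m i) := fun i => (hm i).differentiable (by simp)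
  have hdw : ∀ x, HasFDerivAt w (∑ i, (fderiv ℝ (m i) x).smulRight (dx i)) x := fun x => by
    refine HasFDerivAt.fun_sum fun i _ => ?_
    exact (hdm i x).hasFDerivAt.smul_const (dx i)
  have hsum : ∀ (L : E3 →L[ℝ] ℂ) (v : E3), L v = ∑ j, (v j : ℂ) * L (EuclideanSpace.single j 1) := by
    intro L v
    have e : v = ∑ j, v j • EuclideanSpace.single j (1 : ℝ) := by
      ext i
      simp [Finset.sum_apply, Pi.single_apply]
    conv_lhs => rw [e]
    simp
  obtain ⟨P, hP⟩ := (convex_ball p r).exists_forall_hasFDerivAt_of_fderiv_symmetric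
    Metric.isOpen_ball (ω := w) (fun x _ => (hdw x).differentiableAt.differentiableWithinAt)
    (fun a ha x y => by
      rw [(hdw a).fderiv]
      simp only [FunLike.coe_sum, Finset.sum_apply, ContinuousLinearMap.smulRight_apply,
        ContinuousLinearMap.coe_comp, Function.comp_apply, Complex.ofRealCLM_apply, dx,
        smul_apply, smul_eq_mul, EuclideanSpace.coe_proj]
      simp_rw [fun i => hsum (fderiv ℝ (m i) a) x, fun i => hsum (fderiv ℝ (m i) a) y,
        Finset.sum_mul]
      rw [Finset.sum_comm]
      refine Finset.sum_congr rfl fun j _ => Finset.sum_congr rfl fun i _ => ?_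
      have := hc a ha i j
      rw [cpderiv, cpderiv] at this
      rw [this]
      ring)
  refine ⟨P, fun x hx => ⟨(hP x hx).differentiableAt, fun i => ?_⟩⟩
  rw [cpderiv_eq_of_hasFDerivAt (hP x hx)]
  simp [w, dx, apply_ite Complex.ofReal]

/-- A curl-free square integrable field is locally a gradient. -/
theorem exists_local_potential {U : Set E3} (hU : IsOpen U) {w : Fin 3 → E3 → ℂ}
    (hw : ∀ j, MemLp (w j) 2 volume) (hwi : ∀ j, Integrable (w j) volume) (hc : CurlFreeOn U w)
    {p : E3} (hp : p ∈ U) :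
    ∃ r > 0, ∃ θ : E3 → ℂ, Metric.ball p r ⊆ U ∧ MemLp θ 2 volume ∧ Integrable θ volume ∧
      ∀ i, WeakPartialOn (Metric.ball p r) i θ (w i) := by
  obtain ⟨s, hs, hsU⟩ := Metric.isOpen_iff.1 hU p hp
  -- A third of the radius is kept for the shifts of the mollifier; the potential of the mollified
  -- field exists on radius `2r` and is bounded on the closed ball of radius `r`.
  obtain ⟨r, hr, rfl⟩ : ∃ r > 0, s = 3 * r := ⟨s / 3, by positivity, by ring⟩
  obtain ⟨ρ, hρ⟩ := exists_isMollifier hr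
  have hcφ : ∀ φ : E3 → ℝ, IsTestFun φ → tsupport φ ⊆ Metric.ball p (2 * r) →
      ∀ h ∈ Metric.ball (0 : E3) r, ∀ i j, ∫ x, (pderiv i φ (x - h) : ℂ) * w j x
        = ∫ x, (pderiv j φ (x - h) : ℂ) * w i x := by
    intro φ hφ hφs h hh i j
    have := hc _ (hφ.comp_sub h) ((tsupport_comp_sub_subset hφs hh (by linarith)).trans hsU) i j
    simpa only [pderiv_comp_sub] using this
  have hsm := fun i => contDiff_mollify hρ (hw i)
  have hibp : ∀ φ : E3 → ℝ, IsTestFun φ → ∀ i j, ∫ x, (pderiv i φ x : ℂ) * mollify r ρ (w j) x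
      = -∫ x, (φ x : ℂ) * cpderiv i (mollify r ρ (w j)) x := fun φ hφ i j =>
    integral_pderiv_mul_of_differentiable hφ (fun x _ => (hsm j).differentiable (by simp) x) i
      fun x _ => (continuous_cpderiv (hsm j) i).continuousAt
  have hclosed : ∀ x ∈ Metric.ball p (2 * r), ∀ i j,
      cpderiv i (mollify r ρ (w j)) x = cpderiv j (mollify r ρ (w i)) x := by
    intro x hx i j
    rw [← sub_eq_zero]
    refine eqOn_zero_of_integral_mul Metric.isOpen_ball (U := Metric.ball p (2 * r))
      (m := fun x => cpderiv i (mollify r ρ (w j)) x - cpderiv j (mollify r ρ (w i)) x)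
      ((continuous_cpderiv (hsm j) i).sub (continuous_cpderiv (hsm i) j)) (fun φ hφ hφs => ?_) x hx
    simp only [mul_sub]
    rw [integral_sub (hφ.integrable_mul (continuous_cpderiv (hsm j) i).locallyIntegrable)
      (hφ.integrable_mul (continuous_cpderiv (hsm i) j).locallyIntegrable)]
    have e : ∀ i j, ∫ x, (pderiv i φ x : ℂ) * mollify r ρ (w j) x
        = ∫ h in Metric.ball (0 : E3) r, (ρ h : ℂ) * ∫ x, (pderiv i φ (x - h) : ℂ) * w j x :=
      fun i j => integral_mul_mollify hρ (hw j) (hφ.pderiv i)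
    have e2 : ∫ h in Metric.ball (0 : E3) r, (ρ h : ℂ) * ∫ x, (pderiv i φ (x - h) : ℂ) * w j x
        = ∫ h in Metric.ball (0 : E3) r, (ρ h : ℂ) * ∫ x, (pderiv j φ (x - h) : ℂ) * w i x :=
      setIntegral_congr_fun measurableSet_ball fun h hh => by
        rw [hcφ φ hφ hφs h hh i j]
    rw [← e, ← e, hibp φ hφ, hibp φ hφ, neg_inj] at e2
    rw [e2, sub_self]
  -- The classical Poincaré lemma gives `∇P` equal to the mollified field, while `∇Θ` is the
  -- mollified field minus `w`. Thus `P - Θ` is a potential of `w`.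
  obtain ⟨P, hP⟩ := exists_potential_of_contDiff hsm hclosed
  obtain ⟨Θ, hΘ, hΘ'⟩ := exists_mollify_potential hρ hw hwi
  have hPc : ContinuousOn P (Metric.closedBall p r) := fun x hx =>
    (hP x (Metric.closedBall_subset_ball (by linarith) hx)).1.continuousAt.continuousWithinAt
  obtain ⟨M, hM⟩ := (isCompact_closedBall p r).exists_bound_of_continuousOn hPc
  have hfin : volume (Metric.ball p r) < ⊤ := measure_ball_lt_top
  have hPm : MemLp ((Metric.ball p r).indicator P) 2 volume := by
    rw [memLp_indicator_iff_restrict measurableSet_ball]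
    have : IsFiniteMeasure ((volume : Measure E3).restrict (Metric.ball p r)) :=
      ⟨by rwa [Measure.restrict_apply_univ]⟩
    refine MemLp.of_bound ((hPc.mono Metric.ball_subset_closedBall).aestronglyMeasurable
      measurableSet_ball) M ?_
    exact (ae_restrict_iff' measurableSet_ball).2 (Eventually.of_forall fun x hx =>
      hM x (Metric.ball_subset_closedBall hx))
  have hθm : MemLp ((Metric.ball p r).indicator fun x => P x - Θ x) 2 volume := by
    have := hPm.sub (hΘ.indicator (s := Metric.ball p r) measurableSet_ball)
    rwa [← Set.indicator_sub'] at this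
  refine ⟨r, hr, (Metric.ball p r).indicator fun x => P x - Θ x,
    (Metric.ball_subset_ball (by linarith)).trans hsU, hθm, ?_, fun i φ hφ hφs => ?_⟩
  · rw [integrable_indicator_iff measurableSet_ball]
    rw [memLp_indicator_iff_restrict measurableSet_ball] at hθm
    have : IsFiniteMeasure ((volume : Measure E3).restrict (Metric.ball p r)) :=
      ⟨by rwa [Measure.restrict_apply_univ]⟩
    exact hθm.integrable (by norm_num)
  · have hsub : tsupport φ ⊆ Metric.ball p (2 * r) :=
      hφs.trans (Metric.ball_subset_ball (by linarith))
    have hPi : ∫ x, (pderiv i φ x : ℂ) * (Metric.ball p r).indicator P x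
        = -∫ x, (φ x : ℂ) * mollify r ρ (w i) x := by
      have h1 := integral_pderiv_mul_of_differentiable hφ (fun x hx => (hP x (hsub hx)).1) i
        fun x hx => by
          have : cpderiv i P =ᶠ[𝓝 x] mollify r ρ (w i) := by
            filter_upwards [Metric.isOpen_ball.mem_nhds (hsub hx)] with y hy
            exact (hP y hy).2 i
          exact ((hsm i).continuous.continuousAt).congr this.symm
      rw [integral_mul_congr (φ := φ) hsub (Eventually.of_forall fun x hx => (hP x hx).2 i)] at h1
      rw [← h1]
      exact integral_mul_congr ((tsupport_pderiv_subset φ i).trans hφs)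
        (Eventually.of_forall fun x hx => by rw [indicator_of_mem hx])
    have e : ∫ x, (pderiv i φ x : ℂ) * (Metric.ball p r).indicator (fun x => P x - Θ x) x
        = ∫ x, (pderiv i φ x : ℂ) * ((Metric.ball p r).indicator P x - Θ x) :=
      integral_mul_congr ((tsupport_pderiv_subset φ i).trans hφs)
        (Eventually.of_forall fun x hx => by rw [indicator_of_mem hx, indicator_of_mem hx])
    rw [e]
    simp only [mul_sub]
    rw [integral_sub ((hφ.pderiv i).integrable_mul (memLp_locallyIntegrable hPm))
      ((hφ.pderiv i).integrable_mul (memLp_locallyIntegrable hΘ)), hPi,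
      hΘ' φ hφ i fun h hh j => hcφ φ hφ hsub h hh i j]
    ring

end

section

/-! ### Global potentials on simply connected open sets -/

/-- The filter `𝓝 x ⊓ ae` expresses "almost everywhere near `x`". It is nontrivial because
neighbourhoods have positive measure, and so a function can be almost everywhere equal to only one
constant near `x`. -/
instance neBot_nhds_inf_ae (x : E3) : (𝓝 x ⊓ ae (volume : Measure E3)).NeBot := by
  refine inf_neBot_iff.2 fun {s} hs {t} ht => ?_
  by_contra h
  have hst : s ⊆ tᶜ := fun y hy hyt => h ⟨y, hy, hyt⟩
  exact (Measure.measure_pos_of_mem_nhds volume hs).ne' (measure_mono_null hst ht)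

lemma eventually_nhds_inf_ae {x : E3} {P : E3 → Prop} :
    (∀ᶠ y in 𝓝 x ⊓ ae (volume : Measure E3), P y) ↔
      ∃ δ > 0, ∀ᵐ y, y ∈ Metric.ball x δ → P y := by
  constructor
  · intro h
    obtain ⟨s, hs, t, ht, hst⟩ := eventually_inf.1 h
    obtain ⟨δ, hδ, hδs⟩ := Metric.mem_nhds_iff.1 hs
    exact ⟨δ, hδ, mem_of_superset ht fun y hy hyB => hst y ⟨hδs hyB, hy⟩⟩
  · rintro ⟨δ, hδ, h⟩
    exact eventually_inf.2 ⟨_, Metric.ball_mem_nhds x hδ, _, h, fun y hy => hy.2 hy.1⟩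

lemma eventually_eventually_nhds_inf_ae {x : E3} {P : E3 → Prop}
    (h : ∀ᶠ y in 𝓝 x ⊓ ae (volume : Measure E3), P y) :
    ∀ᶠ y in 𝓝 x, ∀ᶠ z in 𝓝 y ⊓ ae (volume : Measure E3), P z := by
  obtain ⟨s, hs, t, ht, hst⟩ := eventually_inf.1 h
  filter_upwards [eventually_mem_nhds_iff.2 hs] with y hy
  exact eventually_inf.2 ⟨s, hy, t, ht, hst⟩

lemma ae_of_forall_eventually {W : Set E3} {P : E3 → Prop}
    (h : ∀ x ∈ W, ∀ᶠ y in 𝓝 x ⊓ ae (volume : Measure E3), P y) : ∀ᵐ x, x ∈ W → P x := by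
  rw [ae_iff]
  refine measure_null_of_locally_null _ fun x hx => ?_
  simp only [mem_ofPred_eq, Classical.not_imp] at hx
  obtain ⟨δ, hδ, hP⟩ := eventually_nhds_inf_ae.1 (h x hx.1)
  refine ⟨{y | y ∈ Metric.ball x δ ∧ ¬P y}, ?_, ?_⟩
  · filter_upwards [self_mem_nhdsWithin, mem_nhdsWithin_of_mem_nhds (Metric.ball_mem_nhds x hδ)]
      with y hy hyB
    exact ⟨hyB, fun hPy => hy fun _ => hPy⟩
  · rw [ae_iff] at hP
    simpa only [Classical.not_imp] using hP

/-- The function `Θ` is, near every point of `U`, a square integrable potential of `w`. -/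
def IsLocalPotential (U : Set E3) (w : Fin 3 → E3 → ℂ) (Θ : E3 → ℂ) : Prop :=
  ∀ p ∈ U, ∃ r > 0, ∃ θ : E3 → ℂ, Metric.ball p r ⊆ U ∧ MemLp θ 2 volume ∧
    Integrable θ volume ∧ (∀ᵐ x, x ∈ Metric.ball p r → Θ x = θ x) ∧
    ∀ i, WeakPartialOn (Metric.ball p r) i θ (w i)

lemma WeakPartialOn.sub {U : Set E3} {i : Fin 3} {f g f' g' : E3 → ℂ}
    (h : WeakPartialOn U i f g) (h' : WeakPartialOn U i f' g')
    (hf : LocallyIntegrable f volume) (hg : LocallyIntegrable g volume)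
    (hf' : LocallyIntegrable f' volume) (hg' : LocallyIntegrable g' volume) :
    WeakPartialOn U i (fun x => f x - f' x) fun x => g x - g' x := fun φ hφ hs => by
  simp only [mul_sub]
  rw [integral_sub ((hφ.pderiv i).integrable_mul hf) ((hφ.pderiv i).integrable_mul hf'),
    integral_sub (hφ.integrable_mul hg) (hφ.integrable_mul hg'), h φ hφ hs, h' φ hφ hs]
  ring

lemma weakPartialOn_const (U : Set E3) (i : Fin 3) (c : ℂ) :
    WeakPartialOn U i (fun _ => c) fun _ => 0 := fun φ hφ _ => by
  rw [integral_mul_const, integral_complex_ofReal, integral_pderiv_eq_zero hφ]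
  simp

/-- Near each point of an overlap two local potentials differ by a constant `c p q`. These constants
form a locally constant cocycle, which splits on a simply connected set as `c p q = a q - a p`. The
functions `θ p - a p` then agree almost everywhere on overlaps and can be glued over a countable
subcover. -/
theorem exists_global_potential {U : Set E3} (hU : IsOpen U) [SimplyConnectedSpace U]
    {w : Fin 3 → E3 → ℂ} (hw : ∀ j, MemLp (w j) 2 volume) (hwi : ∀ j, Integrable (w j) volume)
    (hc : CurlFreeOn U w) : ∃ Θ, IsLocalPotential U w Θ := by
  have : LocallyPathConnectedSpace U := hU.locallyPathConnectedSpace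
  choose r hr θ hrU hθ hθi hθw using fun p : U => exists_local_potential hU hw hwi hc p.2
  have hdiff : ∀ p q : U, ∀ x : E3, x ∈ Metric.ball p.1 (r p) → x ∈ Metric.ball q.1 (r q) →
      ∃ c, ∀ᶠ y in 𝓝 x ⊓ ae (volume : Measure E3), θ q y - θ p y = c := by
    intro p q x hp hq
    obtain ⟨δ, hδ, hδs⟩ := Metric.isOpen_iff.1
      (Metric.isOpen_ball.inter Metric.isOpen_ball (s := Metric.ball p.1 (r p))
        (t := Metric.ball q.1 (r q))) x ⟨hp, hq⟩
    obtain ⟨c, hc⟩ := exists_const_of_weakPartialOn_zero (p := x) hδ ((hθ q).sub (hθ p))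
      ((hθi q).sub (hθi p)) fun i => by
        have := ((hθw q i).mono fun y hy => (hδs hy).2).sub
          ((hθw p i).mono fun y hy => (hδs hy).1) (hθi q).locallyIntegrable
          (hwi i).locallyIntegrable (hθi p).locallyIntegrable (hwi i).locallyIntegrable
        simp only [sub_self] at this
        exact this
    exact ⟨c, eventually_nhds_inf_ae.2 ⟨δ / 2, by positivity, hc⟩⟩
  choose! c hcs using hdiff
  have huniq : ∀ {x : E3} {f : E3 → ℂ} {a b : ℂ},
      (∀ᶠ y in 𝓝 x ⊓ ae (volume : Measure E3), f y = a) →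
      (∀ᶠ y in 𝓝 x ⊓ ae (volume : Measure E3), f y = b) → a = b := fun ha hb => by
    obtain ⟨y, h1, h2⟩ := (ha.and hb).exists
    rw [← h1, h2]
  obtain ⟨a, ha, haloc⟩ := exists_primitive_of_cocycle (X := U)
    (fun p : U => Subtype.val ⁻¹' Metric.ball p.1 (r p))
    (fun p => Metric.isOpen_ball.preimage continuous_subtype_val)
    (fun x => ⟨x, Metric.mem_ball_self (hr x)⟩) (fun p q x => c p q x)
    (fun p x hx => huniq (hcs p p x hx hx) (Eventually.of_forall fun y => sub_self _))
    (fun p q s x hx => by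
      refine huniq (f := fun y => θ s y - θ p y) ?_ (hcs p s x hx.1.1 hx.2)
      filter_upwards [hcs p q x hx.1.1 hx.1.2, hcs q s x hx.1.2 hx.2] with y h1 h2
      rw [← h1, ← h2]
      ring)
    (fun p q x hx => by
      have h1 := eventually_eventually_nhds_inf_ae (hcs p q x hx.1 hx.2)
      have h2 : ∀ᶠ y in 𝓝 x.1, y ∈ Metric.ball p.1 (r p) ∩ Metric.ball q.1 (r q) :=
        (Metric.isOpen_ball.inter Metric.isOpen_ball).mem_nhds hx
      refine (continuous_subtype_val.tendsto x).eventually (p := fun y => c p q y = c p q x) ?_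
      filter_upwards [h1, h2] with y hy hy2
      exact huniq (hcs p q y hy2.1 hy2.2) hy)
  -- The correction lives on the subtype `U`; it is extended by zero so that it can be subtracted
  -- from functions on the whole space.
  let a' : U → E3 → ℂ := fun q x => Function.extend Subtype.val (a q) 0 x
  have ha' : ∀ q (x : U), a' q x = a q x := fun q x => Subtype.val_injective.extend_apply _ _ _
  have haloc' : ∀ q : U, ∀ x ∈ Metric.ball q.1 (r q), ∀ᶠ y in 𝓝 x, a' q y = a' q x := by
    intro q x hx
    have h := haloc q ⟨x, hrU q hx⟩ hx
    rw [nhds_subtype_eq_comap, eventually_comap] at h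
    filter_upwards [h, hU.mem_nhds (hrU q hx)] with y hy hyU
    have := hy ⟨y, hyU⟩ rfl
    rwa [← ha', ← ha'] at this
  have hpq : ∀ p q : U, ∀ᵐ x, x ∈ Metric.ball p.1 (r p) ∩ Metric.ball q.1 (r q) →
      θ q x - a' q x = θ p x - a' p x := by
    intro p q
    refine ae_of_forall_eventually fun x hx => ?_
    filter_upwards [hcs p q x hx.1 hx.2, mem_inf_of_left (haloc' p x hx.1),
      mem_inf_of_left (haloc' q x hx.2)] with y h1 h2 h3
    have h4 := ha p q ⟨x, hrU p hx.1⟩ hx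
    rw [← ha', ← ha'] at h4
    rw [h2, h3, h4, ← h1]
    ring
  -- Only countably many charts may be compared, since each comparison holds outside a null set.
  obtain ⟨s, hsc, hs⟩ := TopologicalSpace.countable_cover_nhds
    (f := fun p : U => Subtype.val ⁻¹' Metric.ball p.1 (r p))
    fun p => (Metric.isOpen_ball.preimage continuous_subtype_val).mem_nhds
      (Metric.mem_ball_self (hr p))
  have hsne : s.Nonempty := by
    obtain ⟨x₀⟩ : Nonempty U := inferInstance
    have := hs ▸ mem_univ x₀
    simp only [mem_iUnion] at this
    exact ⟨_, this.choose_spec.choose⟩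
  obtain ⟨e, rfl⟩ := hsc.exists_eq_range hsne
  have hex : ∀ x ∈ U, ∃ n, x ∈ Metric.ball (e n).1 (r (e n)) := fun x hx => by
    have := hs ▸ mem_univ (⟨x, hx⟩ : U)
    simp only [mem_iUnion, mem_range] at this
    obtain ⟨_, ⟨n, rfl⟩, hn⟩ := this
    exact ⟨n, hn⟩
  classical
  -- Each point uses the first ball of the enumeration that contains it; another choice would change
  -- the value only on a null set.
  let Θ : E3 → ℂ := fun x => if hx : ∃ n, x ∈ Metric.ball (e n).1 (r (e n)) then
    θ (e (Nat.find hx)) x - a' (e (Nat.find hx)) x else 0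
  have hΘ : ∀ p : U, ∀ᵐ x, x ∈ Metric.ball p.1 (r p) → Θ x = θ p x - a' p x := by
    intro p
    filter_upwards [ae_all_iff.2 fun n => hpq p (e n)] with x hx hxp
    have h := hex x (hrU p hxp)
    simp only [Θ, dif_pos h]
    exact hx _ ⟨hxp, Nat.find_spec h⟩
  refine ⟨Θ, fun p hp => ?_⟩
  -- On a small ball the correction is the constant `a' p p`. Subtracting it only on that ball keeps
  -- the local representative square integrable and leaves the weak gradient on the ball unchanged.
  obtain ⟨δ, hδ, hδs⟩ := Metric.mem_nhds_iff.1
    (haloc' ⟨p, hp⟩ p (Metric.mem_ball_self (hr ⟨p, hp⟩)))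
  have hsub := Metric.ball_subset_ball (x := p) (min_le_right δ (r ⟨p, hp⟩))
  have hcm : ∀ q : ENNReal, MemLp ((Metric.ball p (min δ (r ⟨p, hp⟩))).indicator
      fun _ => a' ⟨p, hp⟩ p) q volume := fun q =>
    memLp_indicator_const q measurableSet_ball _ (Or.inr measure_ball_lt_top.ne)
  refine ⟨min δ (r ⟨p, hp⟩), lt_min hδ (hr _), fun x => θ ⟨p, hp⟩ x -
    (Metric.ball p (min δ (r ⟨p, hp⟩))).indicator (fun _ => a' ⟨p, hp⟩ p) x,
    hsub.trans (hrU ⟨p, hp⟩), (hθ _).sub (hcm 2),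
    (hθi _).sub (memLp_one_iff_integrable.1 (hcm 1)), ?_, fun i => ?_⟩
  · filter_upwards [hΘ ⟨p, hp⟩] with x hx hxB
    rw [hx (hsub hxB), indicator_of_mem hxB]
    rw [show a' ⟨p, hp⟩ x = a' ⟨p, hp⟩ p from
      hδs (Metric.ball_subset_ball (min_le_left _ _) hxB)]
  · have h1 := ((hθw ⟨p, hp⟩ i).mono hsub).sub
      (weakPartialOn_const _ i (a' ⟨p, hp⟩ p)) (hθi _).locallyIntegrable
      (hwi i).locallyIntegrable (locallyIntegrable_const _) (locallyIntegrable_const _)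
    refine h1.congr (Eventually.of_forall fun x hx => ?_) (Eventually.of_forall fun x hx => ?_)
    · rw [indicator_of_mem hx]
    · rw [sub_zero]

end

section

/-! ### Partitions of unity and globalization of weak derivatives -/

lemma exists_smooth_partition {ι : Type*} [Fintype ι] {K : Set E3} (hK : IsClosed K)
    (U : ι → Set E3) (hU : ∀ i, IsOpen (U i)) (hc : K ⊆ ⋃ i, U i) :
    ∃ χ : ι → E3 → ℝ, (∀ i, ContDiff ℝ (⊤ : ℕ∞) (χ i)) ∧ (∀ i, tsupport (χ i) ⊆ U i) ∧
      ∀ x ∈ K, ∑ i, χ i x = 1 := by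
  obtain ⟨f, hf⟩ := SmoothPartitionOfUnity.exists_isSubordinate (modelWithCornersSelf ℝ E3) hK U hU hc
  refine ⟨fun i => f i, fun i => (f i).contMDiff.contDiff, hf, fun x hx => ?_⟩
  rw [← finsum_eq_sum_of_fintype, f.sum_eq_one hx]

lemma exists_finite_ball_cover {K : Set E3} (hK : IsCompact K) (r : E3 → ℝ)
    (hr : ∀ x ∈ K, 0 < r x) :
    ∃ t : Finset E3, (∀ x ∈ t, x ∈ K) ∧ K ⊆ ⋃ x : t, Metric.ball x.1 (r x) := by
  obtain ⟨t, ht, hc⟩ := hK.elim_nhds_subcover (fun x => Metric.ball x (r x))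
    fun x hx => Metric.ball_mem_nhds x (hr x hx)
  refine ⟨t, ht, fun x hx => ?_⟩
  have := hc hx
  simp only [mem_iUnion] at this ⊢
  obtain ⟨y, hy, h⟩ := this
  exact ⟨⟨y, hy⟩, h⟩

lemma IsTestFun.mul_contDiff {φ χ : E3 → ℝ} (hφ : IsTestFun φ) (hχ : ContDiff ℝ (⊤ : ℕ∞) χ) :
    IsTestFun fun x => χ x * φ x := ⟨hχ.mul hφ.1, hφ.2.mul_left⟩

lemma tsupport_mul_subset {φ χ : E3 → ℝ} :
    tsupport (fun x => χ x * φ x) ⊆ tsupport χ ∩ tsupport φ :=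
  subset_inter (tsupport_mul_subset_left) (tsupport_mul_subset_right)

lemma pderiv_mul {φ χ : E3 → ℝ} (hφ : Differentiable ℝ φ) (hχ : Differentiable ℝ χ) (i : Fin 3)
    (x : E3) : pderiv i (fun y => χ y * φ y) x = pderiv i χ x * φ x + χ x * pderiv i φ x := by
  have := ((hχ x).hasFDerivAt.mul (hφ x).hasFDerivAt).fderiv
  simp only [pderiv]
  rw [show (fun y => χ y * φ y) = χ * φ from rfl, this]
  simp
  ring

/-- Finitely many of the balls carrying square integrable representatives cover a compact set. No
bound up to the boundary of `U` is claimed. -/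
lemma IsLocalPotential.memLp {U : Set E3} {w : Fin 3 → E3 → ℂ} {Θ : E3 → ℂ}
    (h : IsLocalPotential U w Θ) {K : Set E3} (hK : IsCompact K) (hKU : K ⊆ U) :
    MemLp (K.indicator Θ) 2 volume := by
  choose! r hr θ hrU hθ hθi hΘ hw using h
  obtain ⟨t, htK, htc⟩ := exists_finite_ball_cover hK r fun x hx => hr x (hKU hx)
  have key : ∀ s : Finset E3, (∀ x ∈ s, x ∈ K) →
      MemLp ((⋃ x ∈ s, Metric.ball x (r x)).indicator Θ) 2 volume := by
    intro s
    induction s using Finset.induction_on with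
    | empty => intro _; simp
    | insert a s ha ih =>
      intro hs
      rw [Finset.set_biUnion_insert]
      have haU := hKU (hs a (Finset.mem_insert_self a s))
      have h1 : MemLp ((Metric.ball a (r a)).indicator Θ) 2 volume := by
        refine MemLp.ae_eq ?_ ((hθ a haU).indicator (s := Metric.ball a (r a)) measurableSet_ball)
        filter_upwards [hΘ a haU] with x hx
        by_cases hxB : x ∈ Metric.ball a (r a)
        · rw [indicator_of_mem hxB, indicator_of_mem hxB, hx hxB]
        · rw [indicator_of_notMem hxB, indicator_of_notMem hxB]
      have h2 := (ih fun x hx => hs x (Finset.mem_insert_of_mem hx)).indicator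
        (measurableSet_ball (x := a) (ε := r a)).compl
      refine (h1.add h2).ae_eq (Eventually.of_forall fun x => ?_)
      by_cases hxB : x ∈ Metric.ball a (r a) <;>
        by_cases hxs : x ∈ ⋃ x ∈ s, Metric.ball x (r x) <;>
        simp only [Pi.add_apply, indicator, mem_compl_iff, mem_union, hxB, hxs, if_true, if_false,
          not_true, not_false_eq_true, add_zero, zero_add, or_true, or_false]
  refine ((key t htK).indicator hK.measurableSet).ae_eq (Eventually.of_forall fun x => ?_)
  by_cases hx : x ∈ K
  · have h1 : x ∈ ⋃ x ∈ t, Metric.ball x (r x) := by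
      have := htc hx
      simp only [mem_iUnion] at this ⊢
      obtain ⟨y, hy⟩ := this
      exact ⟨y.1, y.2, hy⟩
    rw [indicator_of_mem hx, indicator_of_mem hx, indicator_of_mem h1]
  · rw [indicator_of_notMem hx, indicator_of_notMem hx]

lemma integrable_of_memLp_indicator {K : Set E3} (hK : IsCompact K) {f : E3 → ℂ}
    (hf : MemLp (K.indicator f) 2 volume) : Integrable (K.indicator f) volume := by
  rw [integrable_indicator_iff hK.measurableSet]
  rw [memLp_indicator_iff_restrict hK.measurableSet] at hf
  have : IsFiniteMeasure ((volume : Measure E3).restrict K) :=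
    ⟨by rw [Measure.restrict_apply_univ]; exact hK.measure_lt_top⟩
  exact hf.integrable (by norm_num)

/-- A partition of unity on the support of `φ` reduces the identity to the balls on which `Θ` has a
square integrable representative. -/
lemma IsLocalPotential.weakPartialOn {U : Set E3} {w : Fin 3 → E3 → ℂ} {Θ : E3 → ℂ}
    (h : IsLocalPotential U w Θ) (hw : ∀ j, MemLp (w j) 2 volume) (i : Fin 3) :
    WeakPartialOn U i Θ (w i) := by
  intro φ hφ hφU
  have hΘm := h.memLp hφ.2 hφU
  choose! r hr θ hrU hθ hθi hΘ hθw using h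
  obtain ⟨t, htK, htc⟩ := exists_finite_ball_cover hφ.2 r fun x hx => hr x (hφU hx)
  obtain ⟨χ, hχ, hχs, hχ1⟩ := exists_smooth_partition (ι := t) (isClosed_tsupport φ)
    (fun x => Metric.ball x.1 (r x)) (fun x => Metric.isOpen_ball) htc
  have hsum : ∀ x, φ x = ∑ k, χ k x * φ x := fun x => by
    by_cases hx : x ∈ tsupport φ
    · rw [← Finset.sum_mul, hχ1 x hx, one_mul]
    · simp [image_eq_zero_of_notMem_tsupport hx]
  have htest : ∀ k, IsTestFun fun x => χ k x * φ x := fun k => hφ.mul_contDiff (hχ k)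
  have hpd : ∀ x, pderiv i φ x = ∑ k, pderiv i (fun x => χ k x * φ x) x := fun x => by
    have e : φ = fun x => ∑ k, χ k x * φ x := funext hsum
    conv_lhs => rw [pderiv, e]
    rw [fderiv_fun_sum fun k _ => ((htest k).1.differentiable (by simp)) x]
    simp [pderiv]
  have hsub : ∀ k, tsupport (fun x => χ k x * φ x) ⊆ Metric.ball k.1 (r k) := fun k =>
    tsupport_mul_subset.trans (inter_subset_left.trans (hχs k))
  have h1 : ∀ k, ∫ x, (pderiv i (fun x => χ k x * φ x) x : ℂ) * (tsupport φ).indicator Θ x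
      = -∫ x, ((χ k x * φ x : ℝ) : ℂ) * w i x := fun k => by
    rw [← hθw k.1 (hφU (htK k.1 k.2)) i _ (htest k) (hsub k)]
    refine integral_congr_ae ?_
    filter_upwards [hΘ k.1 (hφU (htK k.1 k.2))] with x hx
    by_cases hxs : x ∈ tsupport (fun x => χ k x * φ x)
    · rw [indicator_of_mem (tsupport_mul_subset hxs).2, hx (hsub k hxs)]
    · rw [image_eq_zero_of_notMem_tsupport fun h => hxs (tsupport_pderiv_subset _ i h)]
      simp
  have e1 : ∫ x, (pderiv i φ x : ℂ) * Θ x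
      = ∫ x, (pderiv i φ x : ℂ) * (tsupport φ).indicator Θ x :=
    integral_mul_congr (tsupport_pderiv_subset φ i)
      (Eventually.of_forall fun x hx => by rw [indicator_of_mem hx])
  rw [e1]
  simp_rw [hpd, Complex.ofReal_sum, Finset.sum_mul]
  rw [integral_finsetSum _ fun k _ =>
    ((htest k).pderiv i).integrable_mul (memLp_locallyIntegrable hΘm)]
  simp_rw [h1]
  rw [Finset.sum_neg_distrib, ← integral_finsetSum _ fun k _ =>
    (htest k).integrable_mul (memLp_locallyIntegrable (hw i))]
  simp_rw [← Finset.sum_mul, ← Complex.ofReal_sum, ← hsum]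

lemma IsLocalPotential.locallyIntegrableOn {U : Set E3} {w : Fin 3 → E3 → ℂ} {Θ : E3 → ℂ}
    (h : IsLocalPotential U w Θ) : LocallyIntegrableOn Θ U volume := fun p hp => by
  obtain ⟨r, hr, θ, hrU, -, hθi, hΘ, -⟩ := h p hp
  refine ⟨Metric.ball p r, mem_nhdsWithin_of_mem_nhds (Metric.ball_mem_nhds p hr), ?_⟩
  exact hθi.integrableOn.congr ((ae_restrict_iff' measurableSet_ball).2
    (hΘ.mono fun x hx hxB => (hx hxB).symm))

/-! ### Extension of the potential across the boundary -/

/-- The shift is a small multiple of the vertical direction in the coordinates where `S` lies below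
a Lipschitz graph. Moving upwards leaves the point of the graph underneath unchanged, so a point
above the graph remains above it; and `p`, being on the boundary, is moved strictly above. -/
lemma exists_inward_shift {V S : Set E3} (hV : IsOpen V) (hS : IsClosed S) (hSV : S ⊆ V)
    (hL : HasLipschitzBoundary S) {p : E3} (hp : p ∈ frontier S) :
    ∃ (h : E3) (δ : ℝ), 0 < δ ∧ Metric.closedBall (p + h) δ ⊆ V \ S ∧
      (∀ x ∈ Metric.ball p δ, ∀ τ ∈ Icc (0 : ℝ) 1, x + τ • h ∈ V) ∧
      ∀ x ∈ Metric.ball p δ, x ∉ S → ∀ τ ∈ Icc (0 : ℝ) 1, x + τ • h ∉ S := by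
  obtain ⟨A, r, C, g, hr, hg, hA⟩ := hL p hp
  have hpS : p ∈ S := hS.frontier_subset hp
  obtain ⟨r₁, hr₁, hr₁V⟩ := Metric.isOpen_iff.1 hV p (hSV hpS)
  set s := min r r₁ with hs
  have hs0 : 0 < s := lt_min hr hr₁
  let n : E3 := A.linearIsometryEquiv.symm (EuclideanSpace.single 2 1)
  have hn : ‖n‖ = 1 := by
    rw [LinearIsometryEquiv.norm_map]
    simp
  have hAn : ∀ (x : E3) (t : ℝ), A (x + t • n) = A x + t • EuclideanSpace.single (2 : Fin 3) (1 : ℝ) := by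
    intro x t
    have := A.map_vadd x (t • n)
    rw [vadd_eq_add, vadd_eq_add, map_smul, LinearIsometryEquiv.apply_symm_apply] at this
    rw [add_comm x, this, add_comm]
  have h0 : ∀ (x : E3) (t : ℝ), A (x + t • n) 0 = A x 0 := fun x t => by
    rw [hAn]
    simp
  have h1 : ∀ (x : E3) (t : ℝ), A (x + t • n) 1 = A x 1 := fun x t => by
    rw [hAn]
    simp
  have h2 : ∀ (x : E3) (t : ℝ), A (x + t • n) 2 = A x 2 + t := fun x t => by
    rw [hAn]
    simp
  -- If `p` were strictly below the graph, continuity would put a neighbourhood of `p` inside `S`.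
  have hgp : g !₂[A p 0, A p 1] ≤ A p 2 := by
    by_contra hlt
    rw [not_le] at hlt
    refine hp.2 ?_
    have hco : Continuous fun x => g !₂[A x 0, A x 1] := by
      refine hg.continuous.comp ((PiLp.continuous_toLp 2 _).comp ?_)
      refine continuous_pi fun i => ?_
      have hAc := A.continuous
      fin_cases i <;> simp <;> fun_prop
    have hA2 : Continuous fun x => A x 2 := by
      have hAc := A.continuous
      fun_prop
    rw [mem_interior_iff_mem_nhds]
    filter_upwards [(isOpen_lt hA2 hco).mem_nhds hlt, Metric.ball_mem_nhds p hr] with x hx hxB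
    exact (hA x hxB).2 (le_of_lt hx)
  have hball : ∀ x ∈ Metric.ball p (s / 2), ∀ t ∈ Icc (0 : ℝ) (s / 2), x + t • n ∈ Metric.ball p s := by
    intro x hx t ht
    rw [Metric.mem_ball, dist_eq_norm] at hx ⊢
    have := norm_add_le (x - p) (t • n)
    rw [norm_smul, hn, Real.norm_of_nonneg ht.1] at this
    rw [show x + t • n - p = x - p + t • n by abel]
    linarith [ht.2]
  have hmem : p + (s / 2) • n ∈ V \ S := by
    have hb := hball p (Metric.mem_ball_self (by positivity)) (s / 2) ⟨by positivity, le_rfl⟩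
    refine ⟨hr₁V (Metric.ball_subset_ball (min_le_right _ _) hb), fun hin => ?_⟩
    have := (hA _ (Metric.ball_subset_ball (min_le_left _ _) hb)).1 hin
    rw [h0, h1, h2] at this
    linarith
  obtain ⟨δ, hδ, hδs⟩ := Metric.nhds_basis_closedBall.mem_iff.1
    ((hV.sdiff hS).mem_nhds hmem)
  have hτ : ∀ τ ∈ Icc (0 : ℝ) 1, τ * (s / 2) ∈ Icc (0 : ℝ) (s / 2) := fun τ hτ =>
    ⟨mul_nonneg hτ.1 (by positivity), mul_le_of_le_one_left (by positivity) hτ.2⟩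
  refine ⟨(s / 2) • n, min δ (s / 2), lt_min hδ (by positivity),
    (Metric.closedBall_subset_closedBall (min_le_left _ _)).trans hδs, fun x hx τ ht => ?_,
    fun x hx hxS τ ht hin => ?_⟩
  · rw [smul_smul]
    exact hr₁V (Metric.ball_subset_ball (min_le_right _ _)
      (hball x (Metric.ball_subset_ball (min_le_right _ _) hx) _ (hτ τ ht)))
  · rw [smul_smul] at hin
    have hb := hball x (Metric.ball_subset_ball (min_le_right _ _) hx) _ (hτ τ ht)
    have h3 := (hA _ (Metric.ball_subset_ball (min_le_left _ _) hb)).1 hin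
    rw [h0, h1, h2] at h3
    have hxb : x ∈ Metric.ball p r := by
      have := hball x (Metric.ball_subset_ball (min_le_right _ _) hx) 0 ⟨le_rfl, by positivity⟩
      rw [zero_smul, add_zero] at this
      exact Metric.ball_subset_ball (min_le_left _ _) this
    exact hxS ((hA x hxb).2 (by linarith [(hτ τ ht).1]))

/-- Near every point of `S` the potential `Θ` of `w` on `V \ S` extends to a Sobolev function. -/
theorem exists_boundary_extension {V S : Set E3} (hV : IsOpen V) (hS : IsClosed S) (hSV : S ⊆ V)
    (hL : HasLipschitzBoundary S) {w : Fin 3 → E3 → ℂ} (hw : ∀ j, MemLp (w j) 2 volume)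
    (hwi : ∀ j, Integrable (w j) volume) {v : Fin 3 → Fin 3 → E3 → ℂ}
    (hv : ∀ i j, MemLp (v i j) 2 volume) (hvw : ∀ i j, WeakPartialOn V i (w j) (v i j))
    {Θ : E3 → ℂ} (hΘ : IsLocalPotential (V \ S) w Θ) {p : E3} (hp : p ∈ S) :
    ∃ δ > 0, ∃ (θ : E3 → ℂ) (θ' : Fin 3 → E3 → ℂ), MemLp θ 2 volume ∧
      (∀ i, MemLp (θ' i) 2 volume) ∧ Metric.ball p δ ⊆ V ∧
      (∀ i, WeakPartialOn (Metric.ball p δ) i θ (θ' i)) ∧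
      (∀ᵐ x, x ∈ Metric.ball p δ \ S → θ x = Θ x) ∧
      ∀ i, ∀ᵐ x, x ∈ Metric.ball p δ \ S → θ' i x = w i x := by
  -- Near an interior point the potential imposes no condition, and zero serves as the extension.
  by_cases hpi : p ∈ interior S
  · obtain ⟨δ, hδ, hδS⟩ := Metric.isOpen_iff.1 isOpen_interior p hpi
    have hE : Metric.ball p δ ⊆ S := hδS.trans interior_subset
    refine ⟨δ, hδ, fun _ => 0, fun _ _ => 0, MemLp.zero', fun _ => MemLp.zero', hE.trans hSV,
      fun i φ _ _ => by simp, Eventually.of_forall fun x hx => absurd (hE hx.1) hx.2,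
      fun i => Eventually.of_forall fun x hx => absurd (hE hx.1) hx.2⟩
  obtain ⟨h, δ, hδ, hK, hVτ, hSτ⟩ := exists_inward_shift hV hS hSV hL ⟨subset_closure hp, hpi⟩
  have hD : IsOpen (V \ S) := hV.sdiff hS
  set K := Metric.closedBall (p + h) δ with hKdef
  have hKc : IsCompact K := isCompact_closedBall _ _
  have hΘK : MemLp (K.indicator Θ) 2 volume := hΘ.memLp hKc hK
  let avg : (E3 → ℂ) → E3 → ℂ := shiftAvg unitMeasure (fun _ => 1) fun τ => τ • h
  have hYm : Measurable fun τ : ℝ => τ • h := by fun_prop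
  have hone : ∀ τ : ℝ, ‖(1 : ℂ)‖ ≤ 1 := fun _ => by simp
  have havg : ∀ {f : E3 → ℂ}, MemLp f 2 volume → MemLp (avg f) 2 volume := fun hf =>
    memLp_shiftAvg measurable_const hone hYm hf
  have havgi : ∀ {f : E3 → ℂ}, MemLp f 2 volume → ∀ {φ : E3 → ℝ}, IsTestFun φ →
      ∫ x, (φ x : ℂ) * avg f x = ∫ τ, (∫ x, (φ (x - τ • h) : ℂ) * f x) ∂unitMeasure := by
    intro f hf φ hφ
    have := integral_mul_shiftAvg (μ := unitMeasure) (c := fun _ => 1) measurable_const hone hYm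
      hf hφ.memLp
    simpa only [one_mul] using this
  have hsh : ∀ {f : E3 → ℂ}, MemLp f 2 volume → MemLp (fun x => f (x + h)) 2 volume := fun hf =>
    hf.comp_measurePreserving (measurePreserving_add_right volume h)
  have hshi : ∀ (f : E3 → ℂ) (φ : E3 → ℝ),
      ∫ x, (φ x : ℂ) * f (x + h) = ∫ x, (φ (x - h) : ℂ) * f x := fun f φ => by
    rw [← integral_add_right_eq_self (fun x => (φ (x - h) : ℂ) * f x) h]
    simp
  have hcont : ∀ {φ : E3 → ℝ}, IsTestFun φ → ∀ {f : E3 → ℂ}, Integrable f volume →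
      Integrable (fun τ : ℝ => ∫ x, (φ (x - τ • h) : ℂ) * f x) unitMeasure := by
    intro φ hφ f hf
    obtain ⟨B, hB⟩ := hφ.exists_norm_le
    refine Integrable.of_bound (C := B * ∫ x, ‖f x‖) ?_
      (Eventually.of_forall fun τ => norm_integral_translate_le hB hf _)
    exact ((continuous_integral_translate hφ hf).comp (by fun_prop)).aestronglyMeasurable
  -- The extension at `x` is the value of `Θ` at the shifted point `x + h`, which is outside `S`,
  -- corrected by the line integral of `w` back to `x`. Because `w` is a Sobolev field on all of
  -- `V`, the formula has the square integrable weak gradient `θ'` also inside `S`; outside `S` it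
  -- reproduces `Θ`.
  set θ : E3 → ℂ := fun x => K.indicator Θ (x + h) - ∑ j, (h j : ℂ) * avg (w j) x with hθ
  set θ' : Fin 3 → E3 → ℂ := fun i x => w i (x + h) - ∑ j, (h j : ℂ) * avg (v i j) x with hθ'
  have hsumw : MemLp (fun x => ∑ j, (h j : ℂ) * avg (w j) x) 2 volume :=
    memLp_finsetSum _ fun j _ => (havg (hw j)).const_mul _
  have hsumv : ∀ i, MemLp (fun x => ∑ j, (h j : ℂ) * avg (v i j) x) 2 volume := fun i =>
    memLp_finsetSum _ fun j _ => (havg (hv i j)).const_mul _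
  have hθm : MemLp θ 2 volume := (hsh hΘK).sub hsumw
  have hθm' : ∀ i, MemLp (θ' i) 2 volume := fun i => (hsh (hw i)).sub (hsumv i)
  have htr : ∀ {φ : E3 → ℝ}, tsupport φ ⊆ Metric.ball p δ → ∀ τ ∈ Icc (0 : ℝ) 1,
      tsupport (fun x => φ (x - τ • h)) ⊆ V := by
    intro φ hφs τ hτ
    rw [tsupport_comp_sub]
    rintro _ ⟨x, hx, rfl⟩
    exact hVτ x (hφs hx) τ hτ
  have hexp : ∀ {f : E3 → ℂ} {s : Fin 3 → E3 → ℂ} {φ : E3 → ℝ}, IsTestFun φ → MemLp f 2 volume →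
      (∀ j, MemLp (s j) 2 volume) →
      ∫ x, (φ x : ℂ) * (f (x + h) - ∑ j, (h j : ℂ) * avg (s j) x)
        = (∫ x, (φ (x - h) : ℂ) * f x)
          - ∑ j, (h j : ℂ) * ∫ τ, (∫ x, (φ (x - τ • h) : ℂ) * s j x) ∂unitMeasure := by
    intro f s φ hφ hf hs
    simp only [mul_sub]
    rw [integral_sub (hφ.integrable_mul (memLp_locallyIntegrable (hsh hf)))
      (hφ.integrable_mul (memLp_locallyIntegrable
        (memLp_finsetSum _ fun j _ => (havg (hs j)).const_mul _))), hshi]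
    congr 1
    simp_rw [Finset.mul_sum]
    rw [integral_finsetSum]
    · refine Finset.sum_congr rfl fun j _ => ?_
      rw [← havgi (hs j) hφ, ← integral_const_mul]
      congr 1; ext x; ring
    · intro j _
      exact hφ.integrable_mul (memLp_locallyIntegrable ((havg (hs j)).const_mul _))
  have hwp : ∀ i, WeakPartialOn (Metric.ball p δ) i θ (θ' i) := by
    intro i φ hφ hφs
    have hsupp : tsupport (fun x => φ (x - h)) ⊆ Metric.ball (p + h) δ := by
      rw [tsupport_comp_sub]
      rintro _ ⟨x, hx, rfl⟩
      have := hφs hx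
      rw [Metric.mem_ball] at this ⊢
      rwa [dist_add_right]
    rw [hθ, hθ']
    rw [hexp (hφ.pderiv i) hΘK hw, hexp hφ (hw i) (hv i), neg_sub']
    congr 1
    · have := hΘ.weakPartialOn hw i _ (hφ.comp_sub h)
        ((hsupp.trans Metric.ball_subset_closedBall).trans hK)
      rw [← this]
      simp only [pderiv_comp_sub]
      refine integral_congr_ae (Eventually.of_forall fun x => ?_)
      by_cases hx : x ∈ K
      · simp only [indicator_of_mem hx]
      · have hx' : x ∉ tsupport (pderiv i fun x => φ (x - h)) := fun hin =>
          hx (Metric.ball_subset_closedBall (hsupp (tsupport_pderiv_subset _ _ hin)))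
        have := image_eq_zero_of_notMem_tsupport hx'
        rw [pderiv_comp_sub] at this
        simp [this]
    · rw [← Finset.sum_neg_distrib]
      refine Finset.sum_congr rfl fun j _ => ?_
      rw [← mul_neg, ← integral_neg]
      congr 1
      refine setIntegral_congr_fun measurableSet_Ioc fun τ hτ => ?_
      have := hvw i j _ (hφ.comp_sub (τ • h)) (htr hφs τ ⟨hτ.1.le, hτ.2⟩)
      simp only [pderiv_comp_sub] at this
      exact this
  have hopen : IsOpen (Metric.ball p δ \ S) := Metric.isOpen_ball.sdiff hS
  have hbV : Metric.ball p δ ⊆ V := fun x hx => by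
    simpa using hVτ x hx 0 ⟨le_rfl, zero_le_one⟩
  have hbD : Metric.ball p δ \ S ⊆ V \ S := fun x hx => ⟨hbV hx.1, hx.2⟩
  have heq : ∀ᵐ x, x ∈ Metric.ball p δ \ S → θ x = Θ x := by
    have hloc : LocallyIntegrableOn (fun x => θ x - Θ x) (Metric.ball p δ \ S) volume :=
      ((memLp_locallyIntegrable hθm).locallyIntegrableOn _).sub
        (hΘ.locallyIntegrableOn.mono_set hbD)
    refine (hopen.ae_eq_zero_of_integral_contDiff_smul_eq_zero hloc fun φ hφ1 hφ2 hφs => ?_).mono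
      fun x hx hxB => sub_eq_zero.1 (hx hxB)
    have hφ : IsTestFun φ := ⟨hφ1, hφ2⟩
    -- The region swept by the support of `φ` along the shift is compact and still avoids `S`. There
    -- `Θ` is integrable with gradient `w`, so the increment formula applies to it.
    let K' : Set E3 := (fun q : E3 × ℝ => q.1 + q.2 • h) '' (tsupport φ ×ˢ Icc (0 : ℝ) 1)
    have hK'c : IsCompact K' := (hφ2.isCompact.prod isCompact_Icc).image (by fun_prop)
    have hK'D : K' ⊆ V \ S := by
      rintro _ ⟨⟨x, τ⟩, ⟨hx, hτ⟩, rfl⟩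
      exact ⟨hVτ x (hφs hx).1 τ hτ, hSτ x (hφs hx).1 (hφs hx).2 τ hτ⟩
    have hΘm := hΘ.memLp hK'c hK'D
    have hΘi := integrable_of_memLp_indicator hK'c hΘm
    have hts : ∀ τ ∈ Icc (0 : ℝ) 1, tsupport (fun x => φ (x - τ • h)) ⊆ K' := by
      intro τ hτ
      rw [tsupport_comp_sub]
      rintro _ ⟨x, hx, rfl⟩
      exact ⟨(x, τ), ⟨hx, hτ⟩, rfl⟩
    have hind : ∀ {ψ : E3 → ℝ} {A : Set E3}, tsupport ψ ⊆ A → ∀ f : E3 → ℂ,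
        ∫ x, (ψ x : ℂ) * A.indicator f x = ∫ x, (ψ x : ℂ) * f x := fun hψ f =>
      integral_mul_congr hψ (Eventually.of_forall fun x hx => by rw [indicator_of_mem hx])
    have hT := integral_translate_sub hφ h hΘi
    have hts1 := hts 1 ⟨zero_le_one, le_rfl⟩
    have hts0 := hts 0 ⟨le_rfl, zero_le_one⟩
    simp only [one_smul, zero_smul, sub_zero] at hts1 hts0
    rw [hind hts1, hind hts0] at hT
    have hR : ∫ τ, (∑ j, (h j : ℂ) * ∫ x, (pderiv j φ (x - τ • h) : ℂ) * K'.indicator Θ x)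
          ∂unitMeasure
        = ∫ τ, (∑ j, (h j : ℂ) * -∫ x, (φ (x - τ • h) : ℂ) * w j x) ∂unitMeasure := by
      refine setIntegral_congr_fun measurableSet_Ioc fun τ hτ => ?_
      have hτ' : τ ∈ Icc (0 : ℝ) 1 := ⟨hτ.1.le, hτ.2⟩
      refine Finset.sum_congr rfl fun j _ => ?_
      have h1 := hΘ.weakPartialOn hw j _ (hφ.comp_sub (τ • h)) ((hts τ hτ').trans hK'D)
      have h2 := hind ((tsupport_pderiv_subset _ j).trans (hts τ hτ')) Θ
      rw [← h2] at h1
      simp only [pderiv_comp_sub] at h1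
      rw [h1]
    have hRi : ∀ j ∈ Finset.univ, Integrable (fun τ : ℝ =>
        (h j : ℂ) * -∫ x, (φ (x - τ • h) : ℂ) * w j x) unitMeasure := fun j _ =>
      (hcont hφ (hwi j)).neg.const_mul _
    rw [hR, integral_finsetSum _ hRi] at hT
    simp_rw [integral_const_mul, integral_neg] at hT
    have hKball : tsupport (fun x => φ (x - h)) ⊆ K := by
      rw [tsupport_comp_sub]
      rintro _ ⟨x, hx, rfl⟩
      have := Metric.ball_subset_closedBall (hφs hx).1
      rw [Metric.mem_closedBall] at this ⊢
      rwa [dist_add_right]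
    have hmain : ∫ x, (φ x : ℂ) * θ x = ∫ x, (φ x : ℂ) * Θ x := by
      rw [hθ, hexp hφ hΘK hw, hind hKball]
      simp only [mul_neg, Finset.sum_neg_distrib, neg_neg] at hT
      rw [← hT]
      ring
    simp only [Complex.real_smul, mul_sub]
    have hΘφ : ∫ x, (φ x : ℂ) * Θ x = ∫ x, (φ x : ℂ) * K'.indicator Θ x := (hind hts0 Θ).symm
    have hΘφ' : (fun x => (φ x : ℂ) * Θ x) = fun x => (φ x : ℂ) * K'.indicator Θ x := by
      ext x
      by_cases hx : x ∈ K'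
      · rw [indicator_of_mem hx]
      · rw [image_eq_zero_of_notMem_tsupport fun hin => hx (hts0 hin)]
        simp
    rw [integral_sub (hφ.integrable_mul (memLp_locallyIntegrable hθm)), hmain, sub_self]
    rw [hΘφ']
    exact hφ.integrable_mul hΘi.locallyIntegrable
  refine ⟨δ, hδ, θ, θ', hθm, hθm', hbV, hwp, heq, fun i => ?_⟩
  -- Outside `S` both fields are the weak gradient of the same function.
  refine ae_eq_of_integral_mul_eq hopen (hθm' i) (hw i) fun φ hφ hφs => ?_
  have h1 := hwp i φ hφ (hφs.trans sdiff_subset)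
  have h2 := hΘ.weakPartialOn hw i φ hφ (hφs.trans hbD)
  rw [integral_mul_congr ((tsupport_pderiv_subset φ i).trans hφs) heq, h2] at h1
  exact (neg_injective h1).symm

end

section

/-! ### Existence of the circulation vector -/

/-- The potential of `w` on `V \ S`, multiplied by a cutoff, extends to a Sobolev function on the
whole space. -/
theorem exists_global_extension {V S : Set E3} (hV : IsOpen V) (hS : IsCompact S) (hSV : S ⊆ V)
    (hL : HasLipschitzBoundary S) {w : Fin 3 → E3 → ℂ} (hw : ∀ j, MemLp (w j) 2 volume)
    (hwi : ∀ j, Integrable (w j) volume) {v : Fin 3 → Fin 3 → E3 → ℂ}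
    (hv : ∀ i j, MemLp (v i j) 2 volume) (hvw : ∀ i j, WeakPartialOn V i (w j) (v i j))
    {Θ : E3 → ℂ} (hΘ : IsLocalPotential (V \ S) w Θ) :
    ∃ (F : E3 → ℂ) (G : Fin 3 → E3 → ℂ) (N : Set E3), IsOpen N ∧ S ⊆ N ∧ N ⊆ V ∧
      MemLp F 2 volume ∧ (∀ j, MemLp (G j) 2 volume) ∧ (∀ j, IsWeakPartial j F (G j)) ∧
      ∀ j, ∀ᵐ x, x ∈ N \ S → G j x = w j x := by
  choose! δ hδ θ θ' hθ hθ' hδV hθw hθΘ hθ'w using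
    fun p hp => exists_boundary_extension hV hS.isClosed hSV hL hw hwi hv hvw hΘ (p := p) hp
  obtain ⟨t, htS, htc⟩ := exists_finite_ball_cover hS δ hδ
  have hUo : IsOpen (⋃ x : t, Metric.ball x.1 (δ x)) := isOpen_iUnion fun _ => Metric.isOpen_ball
  -- The partition of unity must sum to one on a neighbourhood of `S`, not only on `S`, for the
  -- derivatives of its members to cancel near the boundary.
  obtain ⟨ε, hε, hεU⟩ := hS.exists_cthickening_subset_open hUo htc
  obtain ⟨χ, hχ, hχs, hχ1⟩ := exists_smooth_partition (ι := t)
    (Metric.isClosed_cthickening (δ := ε) (E := S)) (fun x => Metric.ball x.1 (δ x))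
    (fun x => Metric.isOpen_ball) hεU
  have hχc : ∀ m, HasCompactSupport (χ m) := fun m => by
    refine Metric.isCompact_of_isClosed_isBounded (isClosed_tsupport _) ?_
    exact Metric.isBounded_ball.subset (hχs m)
  have hχt : ∀ m, IsTestFun (χ m) := fun m => ⟨hχ m, hχc m⟩
  have hmul : ∀ {φ : E3 → ℝ} {f : E3 → ℂ}, IsTestFun φ → MemLp f 2 volume →
      MemLp (fun x => (φ x : ℂ) * f x) 2 volume := fun {φ f} hφ hf => by
    obtain ⟨C, hC⟩ := hφ.exists_norm_le
    exact MemLp.of_le_mul (c := C) hf (hφ.continuous_ofReal.aestronglyMeasurable.mul hf.1)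
      (Eventually.of_forall fun x => by
        rw [norm_mul]
        exact mul_le_mul_of_nonneg_right (hC x) (norm_nonneg _))
  let F : E3 → ℂ := fun x => ∑ m, (χ m x : ℂ) * θ m.1 x
  let G : Fin 3 → E3 → ℂ := fun j x =>
    ∑ m, ((pderiv j (χ m) x : ℂ) * θ m.1 x + (χ m x : ℂ) * θ' m.1 j x)
  have hF1 : ∀ m : t, MemLp (fun x => (χ m x : ℂ) * θ m.1 x) 2 volume := fun m =>
    hmul (hχt m) (hθ _ (htS _ m.2))
  have hG1 : ∀ j, ∀ m : t, MemLp (fun x => (pderiv j (χ m) x : ℂ) * θ m.1 x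
      + (χ m x : ℂ) * θ' m.1 j x) 2 volume := fun j m =>
    (hmul ((hχt m).pderiv j) (hθ _ (htS _ m.2))).add (hmul (hχt m) (hθ' _ (htS _ m.2) j))
  refine ⟨F, G, Metric.thickening ε S, Metric.isOpen_thickening, Metric.self_subset_thickening hε S,
    ?_, memLp_finsetSum _ fun m _ => hF1 m, fun j => memLp_finsetSum _ fun m _ => hG1 j m,
    fun j φ hφ => ?_, fun j => ?_⟩
  · refine (Metric.thickening_subset_cthickening _ _).trans (hεU.trans ?_)
    exact iUnion_subset fun x => hδV _ (htS _ x.2)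
  · simp only [F, G, Finset.mul_sum]
    rw [integral_finsetSum _ fun m _ => (hφ.pderiv j).integrable_mul (memLp_locallyIntegrable (hF1 m)),
      integral_finsetSum _ fun m _ => hφ.integrable_mul (memLp_locallyIntegrable (hG1 j m)),
      ← Finset.sum_neg_distrib]
    refine Finset.sum_congr rfl fun m _ => ?_
    have hψ : IsTestFun fun x => χ m x * φ x := hφ.mul_contDiff (hχ m)
    have h1 := hθw m.1 (htS _ m.2) j _ hψ (tsupport_mul_subset.trans
      (inter_subset_left.trans (hχs m)))
    have hdd : ∀ x, pderiv j (fun y => χ m y * φ y) x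
        = pderiv j (χ m) x * φ x + χ m x * pderiv j φ x :=
      pderiv_mul (hφ.1.differentiable (by simp)) ((hχ m).differentiable (by simp)) j
    have hi1 : Integrable (fun x => (φ x : ℂ) * ((pderiv j (χ m) x : ℂ) * θ m.1 x)) volume :=
      hφ.integrable_mul (memLp_locallyIntegrable (hmul ((hχt m).pderiv j) (hθ _ (htS _ m.2))))
    have hi2 : Integrable (fun x => (pderiv j φ x : ℂ) * ((χ m x : ℂ) * θ m.1 x)) volume :=
      (hφ.pderiv j).integrable_mul (memLp_locallyIntegrable (hF1 m))
    have hi3 : Integrable (fun x => (φ x : ℂ) * ((χ m x : ℂ) * θ' m.1 j x)) volume :=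
      hφ.integrable_mul (memLp_locallyIntegrable (hmul (hχt m) (hθ' _ (htS _ m.2) j)))
    have e1 : ∫ x, ((pderiv j (fun y => χ m y * φ y) x : ℝ) : ℂ) * θ m.1 x
        = (∫ x, (φ x : ℂ) * ((pderiv j (χ m) x : ℂ) * θ m.1 x))
          + ∫ x, (pderiv j φ x : ℂ) * ((χ m x : ℂ) * θ m.1 x) := by
      rw [← integral_add hi1 hi2]
      congr 1; ext x
      rw [hdd]
      push_cast
      ring
    have e2 : ∫ x, ((χ m x * φ x : ℝ) : ℂ) * θ' m.1 j x
        = ∫ x, (φ x : ℂ) * ((χ m x : ℂ) * θ' m.1 j x) := by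
      congr 1; ext x
      push_cast
      ring
    rw [e1, e2] at h1
    simp only [mul_add]
    rw [integral_add hi1 hi3, neg_add, ← h1]
    ring
  · have h1 : ∀ᵐ x, ∀ m : t, x ∈ Metric.ball m.1 (δ m) \ S → θ m.1 x = Θ x :=
      ae_all_iff.2 fun m => hθΘ m.1 (htS _ m.2)
    have h2 : ∀ᵐ x, ∀ m : t, x ∈ Metric.ball m.1 (δ m) \ S → θ' m.1 j x = w j x :=
      ae_all_iff.2 fun m => hθ'w m.1 (htS _ m.2) j
    filter_upwards [h1, h2] with x hx1 hx2 hx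
    have e : ∀ m, (pderiv j (χ m) x : ℂ) * θ m.1 x + (χ m x : ℂ) * θ' m.1 j x
        = (pderiv j (χ m) x : ℂ) * Θ x + (χ m x : ℂ) * w j x := fun m => by
      by_cases hxm : x ∈ tsupport (χ m)
      · rw [hx1 m ⟨hχs m hxm, hx.2⟩, hx2 m ⟨hχs m hxm, hx.2⟩]
      · rw [image_eq_zero_of_notMem_tsupport hxm,
          image_eq_zero_of_notMem_tsupport fun h => hxm (tsupport_pderiv_subset _ j h)]
        simp
    simp only [G]
    simp_rw [e]
    rw [Finset.sum_add_distrib, ← Finset.sum_mul, ← Finset.sum_mul, ← Complex.ofReal_sum,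
      ← Complex.ofReal_sum, hχ1 x (Metric.thickening_subset_cthickening _ _ hx.1)]
    -- Near `x` the sum of the cutoffs is constant, so their derivatives cancel and only `w` remains
    -- in `G`.
    have hd : ∑ m, pderiv j (χ m) x = 0 := by
      have h3 : (fun y => ∑ m, χ m y) =ᶠ[𝓝 x] fun _ => (1 : ℝ) := by
        filter_upwards [Metric.isOpen_thickening.mem_nhds hx.1] with y hy
        exact hχ1 y (Metric.thickening_subset_cthickening _ _ hy)
      have h4 := h3.fderiv_eq (𝕜 := ℝ)
      rw [fderiv_fun_sum fun m _ => ((hχ m).differentiable (by simp)) x, fderiv_fun_const] at h4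
      have h5 := congrArg (fun L : E3 →L[ℝ] ℝ => L (EuclideanSpace.single j 1)) h4
      simpa [pderiv] using h5
    rw [hd]
    simp

lemma curl_eq_zero_iff (u : E3 → C3) (y : E3) : curl u y = 0 ↔
    ∀ i j, weakPartial i (fun x => u x j) y = weakPartial j (fun x => u x i) y := by
  constructor
  · intro h
    have h' : ∀ i : Fin 3, weakPartial (i + 1) (fun x => u x (i + 2)) y
        = weakPartial (i + 2) (fun x => u x (i + 1)) y := fun i => by
      have := congrArg (fun a : C3 => a i) h
      exact sub_eq_zero.1 this
    have h0 := h' 0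
    have h1 := h' 1
    have h2 := h' 2
    simp only [zero_add, show (1 : Fin 3) + 1 = 2 from rfl, show (1 : Fin 3) + 2 = 0 from rfl,
      show (2 : Fin 3) + 1 = 0 from rfl, show (2 : Fin 3) + 2 = 1 from rfl] at h0 h1 h2
    intro i j
    fin_cases i <;> fin_cases j <;> first | rfl | assumption | (symm; assumption)
  · intro h
    ext i
    simp only [curl, PiLp.zero_apply]
    rw [h, sub_self]

/-- The periodic extension of the restriction of `f` to the cell. -/
def perExt (f : E3 → ℂ) (y : E3) : ℂ := f (sec (toTorus y))

lemma l2per_perExt {f : E3 → ℂ} (hf : MemLp f 2 volume) : L2per (perExt f) :=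
  l2per_comp_toTorus (f := fun t => f (sec t))
    ((hf.restrict cell).comp_measurePreserving measurePreserving_sec)

lemma perExt_eq {f : E3 → ℂ} {y : E3} (hy : y ∈ cell) : perExt f y = f y := by
  rw [perExt, sec_toTorus hy]

lemma cpderiv_cpderiv_comm {ψ : E3 → ℂ} (hψ : ContDiff ℝ (⊤ : ℕ∞) ψ) (i j : Fin 3) (x : E3) :
    cpderiv i (cpderiv j ψ) x = cpderiv j (cpderiv i ψ) x := by
  have hs : IsSymmSndFDerivAt ℝ ψ x := hψ.contDiffAt.isSymmSndFDerivAt (by simp; norm_cast)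
  have hd : DifferentiableAt ℝ (fderiv ℝ ψ) x :=
    ((hψ.fderiv_right (m := (⊤ : ℕ∞)) (by simp)).differentiable (by simp)) x
  have e : ∀ i j : Fin 3, cpderiv i (cpderiv j ψ) x
      = fderiv ℝ (fderiv ℝ ψ) x (EuclideanSpace.single i 1) (EuclideanSpace.single j 1) := by
    intro i j
    have := (hd.hasFDerivAt.clm_apply (hasFDerivAt_const (EuclideanSpace.single j (1 : ℝ)) x)).fderiv
    have h2 : cpderiv j ψ = fun y => fderiv ℝ ψ y (EuclideanSpace.single j 1) := rfl
    rw [cpderiv, h2, this]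
    simp
  rw [e, e]
  exact hs.eq _ _

end

/-! ### Correction of the field inside the inclusion -/

section

lemma IsInclusion.isOpen_compl {S : Set E3} (hS : IsInclusion S) : IsOpen (cell \ S) :=
  isOpen_cell.sdiff hS.isCompact.isClosed

/-- A field that is curl-free outside `S` has the Fourier coefficients of a curl-free field, up to
a field supported in `S`. -/
theorem exists_supported_correction {S : Set E3} (hS : IsInclusion S) {u : E3 → C3}
    (hu : W12perVec u) (hc : CurlFreeOutside S u) :
    ∃ s : Fin 3 → E3 → ℂ, (∀ j, MemLp (s j) 2 volume) ∧ (∀ j, ∀ y ∉ S, s j y = 0) ∧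
      ∀ k i j, ik k i * fc (fun y => u y j - perExt (s j) y) k
        = ik k j * fc (fun y => u y i - perExt (s i) y) k := by
  have := hS.simplyConnected
  set B := Metric.ball (0 : E3) 2
  have hcB : cell ⊆ B := fun y hy => mem_ball_zero_iff.2 ((norm_le_of_mem_cell hy).trans_lt one_lt_two)
  have hmem : ∀ {f : E3 → ℂ}, L2per f → MemLp (B.indicator f) 2 volume := fun hf =>
    (memLp_indicator_iff_restrict measurableSet_ball).2 (hf.memLp_ball 2)
  have hint : ∀ {f : E3 → ℂ}, L2per f → Integrable (B.indicator f) volume := fun hf =>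
    (integrable_indicator_iff measurableSet_ball).2 (by
      exact (hf.memLp_ball 2).integrable (by norm_num))
  set w : Fin 3 → E3 → ℂ := fun j => B.indicator fun y => u y j with hw
  set v : Fin 3 → Fin 3 → E3 → ℂ := fun i j => B.indicator (weakPartial i fun y => u y j)
  have hw2 : ∀ j, MemLp (w j) 2 volume := fun j => hmem (hu j).1
  have hwi : ∀ j, Integrable (w j) volume := fun j => hint (hu j).1
  have hv : ∀ i j, MemLp (v i j) 2 volume := fun i j => hmem ((hu j).l2per_weakPartial i)
  have hvw : ∀ i j, WeakPartialOn cell i (w j) (v i j) := fun i j => by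
    have h : WeakPartialOn cell i (fun y => u y j) (weakPartial i fun y => u y j) :=
      fun φ hφ _ => (hu j).isWeakPartial i φ hφ
    exact h.congr (Eventually.of_forall fun x hx => by simp only [w, indicator_of_mem (hcB hx)])
      (Eventually.of_forall fun x hx => by simp only [v, indicator_of_mem (hcB hx)])
  have hcurl : ∀ i j, ∀ᵐ y, y ∈ cell \ S →
      weakPartial i (fun x => u x j) y = weakPartial j (fun x => u x i) y := fun i j => by
    have hm : MeasurableSet (cell \ S) := hS.isOpen_compl.measurableSet
    exact ((ae_restrict_iff' hm).1 hc).mono fun y hy hyS => (curl_eq_zero_iff u y).1 (hy hyS) i j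
  have hcf : CurlFreeOn (cell \ S) w := fun φ hφ hφs i j => by
    rw [hvw i j φ hφ (hφs.trans sdiff_subset), hvw j i φ hφ (hφs.trans sdiff_subset), neg_inj]
    refine integral_mul_congr hφs ((hcurl i j).mono fun x hx hxS => ?_)
    simp only [v, indicator_of_mem (hcB hxS.1), hx hxS]
  obtain ⟨Θ, hΘ⟩ := exists_global_potential hS.isOpen_compl hw2 hwi hcf
  obtain ⟨F, G, N, hN, hSN, hNc, hF, hG, hFG, hGw⟩ := exists_global_extension isOpen_cell
    hS.isCompact hS.subset_cell hS.lipschitz hw2 hwi hv hvw hΘ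
  have hSm : MeasurableSet S := hS.isCompact.measurableSet
  -- Subtracting `s` replaces `u` inside `S` by `G = ∇F`. Since `G = w` on `N \ S`, the corrected
  -- field is the gradient of `F` throughout `N`, and it is unchanged outside `S`, where `u` was
  -- curl-free already.
  set s : Fin 3 → E3 → ℂ := fun j => S.indicator fun y => w j y - G j y with hs
  have hsm : ∀ j, MemLp (s j) 2 volume := fun j => ((hw2 j).sub (hG j)).indicator hSm
  refine ⟨s, hsm, fun j y hy => indicator_of_notMem hy _, fun k i j => ?_⟩
  obtain ⟨ε, hε, hεN⟩ := hS.isCompact.exists_cthickening_subset_open hN hSN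
  obtain ⟨χ, hχ, hχs, hχ1⟩ := exists_smooth_partition (ι := Unit)
    (Metric.isClosed_cthickening (δ := ε) (E := S)) (fun _ => N) (fun _ => hN)
    (hεN.trans (subset_iUnion (fun _ : Unit => N) ()))
  set κ := χ () with hκ
  have hκ1 : ∀ x ∈ Metric.thickening ε S, κ x = 1 := fun x hx => by
    simpa using hχ1 x (Metric.thickening_subset_cthickening _ _ hx)
  have hκc : HasCompactSupport κ := Metric.isCompact_of_isClosed_isBounded (isClosed_tsupport _)
    ((Metric.isBounded_ball.subset hcB).subset ((hχs ()).trans hNc))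
  set e : E3 → ℂ := em (-k) with he
  have hes : ContDiff ℝ (⊤ : ℕ∞) e := em_contDiff (-k)
  -- Localized exponential, equal to `e` near `S` and supported in `N`. It connects coefficients on
  -- the cell with test functions on the whole space: the supported correction sees only `S`, where
  -- the two coincide.
  set ψ : E3 → ℂ := fun x => (κ x : ℂ) * e x with hψ
  have hψs : ContDiff ℝ (⊤ : ℕ∞) ψ := (Complex.ofRealCLM.contDiff.comp (hχ ())).mul hes
  have hψsub : tsupport ψ ⊆ N := by
    refine (tsupport_mul_subset_left).trans ((closure_mono fun x hx => ?_).trans (hχs ()))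
    simpa using hx
  have hψc : HasCompactSupport ψ := (hκc.comp_left (g := Complex.ofReal) rfl).mul_right
  have hdψS : ∀ i, ∀ x ∈ S, cpderiv i ψ x = cpderiv i e x := fun i x hx => by
    have : ψ =ᶠ[𝓝 x] e := by
      filter_upwards [Metric.isOpen_thickening.mem_nhds (Metric.self_subset_thickening hε S hx)]
        with y hy
      simp only [hψ, hκ1 y hy, Complex.ofReal_one, one_mul]
    simp only [cpderiv, this.fderiv_eq]
  have hdψN : ∀ i, ∀ x ∉ N, cpderiv i ψ x = 0 := fun i x hx => by
    have h1 : x ∉ tsupport (fderiv ℝ ψ) := fun h => hx (hψsub (tsupport_fderiv_subset ℝ h))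
    simp only [cpderiv, image_eq_zero_of_notMem_tsupport h1]
    rfl
  have hli : ∀ {f : E3 → ℂ}, MemLp f 2 volume → ∀ i, Integrable (fun x => cpderiv i ψ x * f x) volume :=
    fun hf i => integrable_mul_of_hasCompactSupport (continuous_cpderiv hψs i)
      (hasCompactSupport_cpderiv hψc i) (memLp_locallyIntegrable hf)
  -- the pairing of the supported field with the derivatives of the exponential
  have e1 : ∀ i j, ∫ y in cell, cpderiv i e y * perExt (s j) y
      = (∫ x, cpderiv i ψ x * w j x) - ∫ x, cpderiv i ψ x * G j x := fun i j => by
    rw [← integral_sub (hli (hw2 j) i) (hli (hG j) i), ← integral_indicator measurableSet_cell]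
    refine integral_congr_ae ((hGw j).mono fun x hx => ?_)
    simp only
    by_cases hxS : x ∈ S
    · rw [indicator_of_mem (hS.subset_cell hxS), perExt_eq (hS.subset_cell hxS)]
      simp only [hs, indicator_of_mem hxS]
      rw [hdψS i x hxS, mul_sub]
    · have h0 : cell.indicator (fun y => cpderiv i e y * perExt (s j) y) x = 0 := by
        by_cases hxc : x ∈ cell
        · rw [indicator_of_mem hxc, perExt_eq hxc]
          simp only [hs, indicator_of_notMem hxS, mul_zero]
        · rw [indicator_of_notMem hxc]
      rw [h0]
      by_cases hxN : x ∈ N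
      · rw [hx ⟨hxN, hxS⟩, sub_self]
      · rw [hdψN i x hxN]
        simp
  have e2 : ∀ i j, ∫ x, cpderiv i ψ x * w j x = -∫ x, ψ x * weakPartial i (fun y => u y j) x := by
    intro i j
    rw [← ((hu j).isWeakPartial i).complex (hu j).1.locallyIntegrable
      ((hu j).l2per_weakPartial i).locallyIntegrable hψs hψc]
    refine integral_congr_ae (Eventually.of_forall fun x => ?_)
    by_cases hxN : x ∈ N
    · simp only [hw, indicator_of_mem (hcB (hNc hxN))]
    · simp only [hdψN i x hxN, zero_mul]
  -- Since `G` is a gradient, both pairings are second derivatives of `ψ` against `F`.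
  have e3 : ∫ x, cpderiv i ψ x * G j x = ∫ x, cpderiv j ψ x * G i x := by
    have h1 : ∀ i j, ∫ x, cpderiv i ψ x * G j x = -∫ x, cpderiv j (cpderiv i ψ) x * F x :=
      fun i j => by
      rw [(hFG j).complex (memLp_locallyIntegrable hF) (memLp_locallyIntegrable (hG j))
        (contDiff_cpderiv hψs i) (hasCompactSupport_cpderiv hψc i), neg_neg]
    rw [h1, h1]
    simp_rw [cpderiv_cpderiv_comm hψs j i]
  have e4 : ∀ i j, ∫ y in cell, cpderiv i e y * u y j
      = -∫ y in cell, e y * weakPartial i (fun y => u y j) y := fun i j =>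
    ((hu j).isWeakPartial i).periodic (hu j).1 ((hu j).l2per_weakPartial i) hes
      (fun y m => em_add_latt _ _ _)
  have hψi : ∀ i j, Integrable (fun x => ψ x * weakPartial i (fun y => u y j) x) volume := fun i j =>
    integrable_mul_of_hasCompactSupport hψs.continuous hψc
      ((hu j).l2per_weakPartial i).locallyIntegrable
  have hei : ∀ i j, IntegrableOn (fun x => e x * weakPartial i (fun y => u y j) x) cell volume :=
    fun i j => integrable_em_mul ((hu j).l2per_weakPartial i) _
  -- In the cell the difference of the two cross derivatives is supported in `S`, where `ψ = e`.
  have e5 : (∫ x, ψ x * weakPartial i (fun y => u y j) x)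
        - ∫ x, ψ x * weakPartial j (fun y => u y i) x
      = (∫ y in cell, e y * weakPartial i (fun y => u y j) y)
        - ∫ y in cell, e y * weakPartial j (fun y => u y i) y := by
    rw [← integral_sub (hψi i j) (hψi j i), ← integral_sub (hei i j) (hei j i),
      ← integral_indicator measurableSet_cell]
    refine integral_congr_ae ((hcurl i j).mono fun x hx => ?_)
    simp only
    by_cases hxc : x ∈ cell
    · rw [indicator_of_mem hxc]
      by_cases hxS : x ∈ S
      · simp only [hψ, hκ1 x (Metric.self_subset_thickening hε S hxS), Complex.ofReal_one, one_mul]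
      · rw [hx ⟨hxc, hxS⟩, sub_self, sub_self]
    · rw [indicator_of_notMem hxc,
        image_eq_zero_of_notMem_tsupport fun h => hxc (hNc (hψsub h))]
      simp
  have hfc : ∀ i j, ∫ y in cell, cpderiv i e y * (u y j - perExt (s j) y)
      = -(ik k i * fc (fun y => u y j - perExt (s j) y) k) := fun i j => by
    rw [fc, ← integral_const_mul, ← integral_neg]
    congr 1; ext y
    rw [he, cpderiv_em, ik_neg]
    ring
  have hfc2 : ∀ i j, ∫ y in cell, cpderiv i e y * (u y j - perExt (s j) y)
      = (∫ y in cell, cpderiv i e y * u y j) - ∫ y in cell, cpderiv i e y * perExt (s j) y := by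
    intro i j
    simp only [mul_sub]
    have h : ∀ {f : E3 → ℂ}, L2per f → IntegrableOn (fun y => cpderiv i e y * f y) cell volume := by
      intro f hf
      refine ((integrable_em_mul hf (-k)).const_mul (ik (-k) i)).congr
        (Eventually.of_forall fun y => ?_)
      simp only [he, cpderiv_em]
      ring
    exact integral_sub (h (hu j).1) (h (l2per_perExt (hsm j)))
  rw [← neg_inj, ← hfc, ← hfc, hfc2, hfc2, e4, e4, e1, e1, e2, e2, e3]
  linear_combination e5

/-- Existence of the circulation vector. -/
theorem exists_isCirculation {S : Set E3} (hS : IsInclusion S) {u : E3 → C3}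
    (hu : W12perVec u) (hc : CurlFreeOutside S u) : ∃ z, IsCirculation S u z := by
  obtain ⟨s, hsm, hs0, hs⟩ := exists_supported_correction hS hu hc
  obtain ⟨ψ, z, hψ, h⟩ := exists_potential_of_fc
    (u := fun y => WithLp.toLp 2 fun j => u y j - perExt (s j) y)
    (fun j => (hu j).1.sub (l2per_perExt (hsm j))) hs
  refine ⟨z, ψ, hψ, ?_⟩
  have hm : MeasurableSet (cell \ S) := hS.isOpen_compl.measurableSet
  refine (ae_restrict_iff' hm).2 (h.mono fun y hy hyS => ?_)
  refine Eq.trans ?_ hy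
  ext j
  simp only
  rw [perExt_eq hyS.1, hs0 j y hyS.2, sub_zero]

end

section

/-! ### Uniqueness of the circulation vector -/

lemma exists_lt_half_bound {S : Set E3} (hS : IsInclusion S) :
    ∃ δ : ℝ, 0 ≤ δ ∧ δ < 1 / 2 ∧ ∀ y ∈ S, ∀ i, |y i| ≤ δ := by
  have h : ∀ i : Fin 3, ∃ δ : ℝ, 0 ≤ δ ∧ δ < 1 / 2 ∧ ∀ y ∈ S, |y i| ≤ δ := fun i => by
    obtain ⟨y₀, hy₀, hmax⟩ := hS.isCompact.exists_isMaxOn hS.isConnected.nonempty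
      (f := fun y : E3 => |y i|) (by fun_prop)
    refine ⟨|y₀ i|, abs_nonneg _, ?_, fun y hy => hmax hy⟩
    have := hS.subset_cell hy₀ i
    rw [abs_lt]
    exact this
  choose δ h0 h1 h2 using h
  refine ⟨Finset.univ.sup' Finset.univ_nonempty δ, ?_, ?_, fun y hy i => ?_⟩
  · exact (h0 0).trans (Finset.le_sup' δ (Finset.mem_univ 0))
  · rw [Finset.sup'_lt_iff]
    exact fun i _ => h1 i
  · exact (h2 i y hy).trans (Finset.le_sup' δ (Finset.mem_univ i))

/-- Smooth periodic weights that vanish on the inclusion and detect the circulation vector. -/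
structure IsCircWeight (S : Set E3) (χ : Fin 3 → E3 → ℂ) : Prop where
  contDiff : ∀ i, ContDiff ℝ (⊤ : ℕ∞) (χ i)
  periodic : ∀ i y k, χ i (y + latt k) = χ i y
  cpderiv_eq_zero : ∀ i y, cpderiv i (χ i) y = 0
  eq_zero : ∀ i, ∀ y ∈ S, χ i y = 0
  integral_one : ∀ i, ∫ y in cell, χ i y = 1

/-- The function `cos (2πδ) - cos (2πt)` is 1-periodic and, for `|t| ≤ 1/2`, positive exactly when
`|t| > δ`. Composition with `expNegInvGlue` flattens its nonpositive part to zero while keeping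
smoothness. -/
lemma exists_circWeight_aux {δ : ℝ} (h0 : 0 ≤ δ) (h1 : δ < 1 / 2) :
    ∃ b : ℝ → ℝ, ContDiff ℝ (⊤ : ℕ∞) b ∧ (∀ t, ∀ m : ℤ, b (t + m) = b t) ∧
      (∀ t, |t| ≤ δ → b t = 0) ∧ (∀ t, 0 ≤ b t) ∧ ∀ t, δ < |t| → |t| ≤ 1 / 2 → 0 < b t := by
  refine ⟨fun t => expNegInvGlue (Real.cos (2 * Real.pi * δ) - Real.cos (2 * Real.pi * t)),
    ?_, fun t m => ?_, fun t ht => ?_, fun t => expNegInvGlue.nonneg _, fun t ht ht' => ?_⟩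
  · have h : ContDiff ℝ (⊤ : ℕ∞) fun t : ℝ =>
        Real.cos (2 * Real.pi * δ) - Real.cos (2 * Real.pi * t) := by fun_prop
    exact expNegInvGlue.contDiff.comp h
  · have : Real.cos (2 * Real.pi * (t + m)) = Real.cos (2 * Real.pi * t) := by
      rw [mul_add, mul_comm (2 * Real.pi) (m : ℝ), Real.cos_add_int_mul_two_pi]
    simp only [this]
  · refine expNegInvGlue.zero_of_nonpos ?_
    rw [sub_nonpos, ← Real.cos_abs (2 * Real.pi * t), abs_mul, abs_of_pos Real.two_pi_pos]
    refine Real.cos_le_cos_of_nonneg_of_le_pi ?_ ?_ ?_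
    · positivity
    · nlinarith [Real.pi_pos]
    · exact mul_le_mul_of_nonneg_left ht Real.two_pi_pos.le
  · refine expNegInvGlue.pos_of_pos ?_
    rw [sub_pos, ← Real.cos_abs (2 * Real.pi * t), abs_mul, abs_of_pos Real.two_pi_pos]
    refine Real.cos_lt_cos_of_nonneg_of_le_pi ?_ ?_ ?_
    · positivity
    · nlinarith [Real.pi_pos]
    · exact mul_lt_mul_of_pos_left ht Real.two_pi_pos

/-- The weight for the component `i` is a function of the coordinate `i + 1` only, so its derivative
in direction `i` is zero. It vanishes on a slab in that coordinate containing `S`; the gap between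
`S` and the faces of the cell leaves it a positive integral, which is normalized to one. -/
lemma exists_isCircWeight {S : Set E3} (hS : IsInclusion S) : ∃ χ, IsCircWeight S χ := by
  obtain ⟨δ, h0, h1, hδ⟩ := exists_lt_half_bound hS
  obtain ⟨b, hb, hbp, hb0, hbn, hbpos⟩ := exists_circWeight_aux h0 h1
  have hproj : ∀ i : Fin 3, ContDiff ℝ (⊤ : ℕ∞) fun y : E3 => b (y i) := fun i => by
    have h : ContDiff ℝ (⊤ : ℕ∞) fun y : E3 => y i := by fun_prop
    exact hb.comp h
  have hint : ∀ i : Fin 3, Integrable (fun y : E3 => b (y i)) (volume.restrict cell) := fun i => by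
    obtain ⟨C, hC⟩ := exists_bound_of_periodic (b := fun y : E3 => (b (y i) : ℂ))
      (Complex.continuous_ofReal.comp (hproj i).continuous)
    refine Integrable.of_bound (C := C) (hproj i).continuous.aestronglyMeasurable ?_
    exact (ae_restrict_iff' measurableSet_cell).2 (Eventually.of_forall fun y hy => by
      simpa using hC y hy)
  have hIpos : ∀ i : Fin 3, 0 < ∫ y in cell, b (y i) := fun i => by
    rw [integral_pos_iff_support_of_nonneg (fun y => hbn _) (hint i)]
    have hopen : IsOpen (cell ∩ {y : E3 | δ < y i}) :=
      isOpen_cell.inter (isOpen_lt continuous_const (by fun_prop))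
    have hne : (cell ∩ {y : E3 | δ < y i}).Nonempty := by
      refine ⟨EuclideanSpace.single i ((δ + 1 / 2) / 2), fun j => ?_, ?_⟩
      · by_cases hj : j = i
        · subst hj
          simp only [PiLp.single_apply, if_true, mem_Ioo]
          constructor <;> linarith
        · simp only [PiLp.single_apply, hj, if_false, mem_Ioo]
          norm_num
      · simp only [mem_ofPred_eq, PiLp.single_apply, if_true]
        linarith
    refine (hopen.measure_pos volume hne).trans_le ?_
    rw [Measure.restrict_apply' measurableSet_cell]
    refine measure_mono fun y hy => ⟨?_, hy.1⟩
    have h3 : δ < |y i| := lt_of_lt_of_le hy.2 (le_abs_self _)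
    have h4 : |y i| ≤ 1 / 2 := abs_le.2 ⟨(hy.1 i).1.le, (hy.1 i).2.le⟩
    exact (hbpos _ h3 h4).ne'
  set I : Fin 3 → ℝ := fun i => ∫ y in cell, b (y i) with hI
  refine ⟨fun i y => ((I (i + 1))⁻¹ * b (y (i + 1)) : ℝ), fun i => ?_, fun i y k => ?_,
    fun i y => ?_, fun i y hy => ?_, fun i => ?_⟩
  · exact Complex.ofRealCLM.contDiff.comp (contDiff_const.mul (hproj (i + 1)))
  · have : (y + latt k) (i + 1) = y (i + 1) + (k (i + 1) : ℤ) := by simp [latt]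
    simp only [this, hbp]
  · have hd : Differentiable ℝ fun y : E3 => (I (i + 1))⁻¹ * b (y (i + 1)) :=
      (contDiff_const.mul (hproj (i + 1))).differentiable (by simp)
    rw [cpderiv_ofReal hd, pderiv, Complex.ofReal_eq_zero]
    have hl : HasLineDerivAt ℝ (fun y : E3 => (I (i + 1))⁻¹ * b (y (i + 1))) 0 y
        (EuclideanSpace.single i (1 : ℝ)) := by
      have hne : i + 1 ≠ i := by simp
      have : ∀ t : ℝ, (y + t • EuclideanSpace.single i (1 : ℝ)) (i + 1) = y (i + 1) := fun t => by
        simp [hne]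
      simp only [HasLineDerivAt, this]
      exact hasDerivAt_const _ _
    rw [← (hd y).lineDeriv_eq_fderiv]
    exact hl.lineDeriv
  · have := hb0 (y (i + 1)) (hδ y hy (i + 1))
    simp [this]
  · rw [integral_complex_ofReal, integral_const_mul, inv_mul_cancel₀ (hIpos (i + 1)).ne',
      Complex.ofReal_one]

variable {S : Set E3} {χ : Fin 3 → E3 → ℂ}

lemma IsCircWeight.l2per (hχ : IsCircWeight S χ) (i : Fin 3) : L2per (χ i) := by
  have := (l2per_const (1 : ℂ)).mul_continuous (hχ.contDiff i).continuous (hχ.periodic i)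
  simpa only [mul_one] using this

/-- As `χ i` vanishes on `S`, the field may be replaced by `∇ψ + z` on the whole cell. The gradient
then drops out after integration by parts, since `∂_i χ_i = 0`. The integral averages the mean of `u
i` over lines in direction `i` that avoid `S`. -/
lemma IsCirculation.eq_integral (hS : IsInclusion S) (hχ : IsCircWeight S χ) {u : E3 → C3} {z : C3}
    (h : IsCirculation S u z) (i : Fin 3) : ∫ y in cell, χ i y * u y i = z i := by
  obtain ⟨ψ, hψ, h⟩ := h
  have h' := (ae_restrict_iff' hS.isOpen_compl.measurableSet).1 h
  have e : ∫ y in cell, χ i y * u y i = ∫ y in cell, (χ i y * grad ψ y i + χ i y * z i) := by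
    refine setIntegral_congr_ae measurableSet_cell (h'.mono fun y hy hyc => ?_)
    by_cases hyS : y ∈ S
    · simp [hχ.eq_zero i y hyS]
    · rw [hy ⟨hyc, hyS⟩, PiLp.add_apply, mul_add]
  rw [e, integral_add ((hχ.l2per i).integrable_mul (hψ.l2per_grad i))
    ((hχ.l2per i).integrable_mul (l2per_const _)), integral_mul_const, hχ.integral_one, one_mul]
  have h2 := (hψ.isWeakPartial i).periodic hψ.1 (hψ.l2per_weakPartial i) (hχ.contDiff i)
    (hχ.periodic i)
  simp only [hχ.cpderiv_eq_zero, zero_mul, integral_zero] at h2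
  rw [show ∫ y in cell, χ i y * grad ψ y i = ∫ y in cell, χ i y * weakPartial i ψ y from rfl]
  rw [neg_eq_zero.1 h2.symm, zero_add]

theorem IsCirculation.unique (hS : IsInclusion S) {u : E3 → C3} {z z' : C3}
    (h : IsCirculation S u z) (h' : IsCirculation S u z') : z = z' := by
  obtain ⟨χ, hχ⟩ := exists_isCircWeight hS
  ext i
  rw [← h.eq_integral hS hχ i, h'.eq_integral hS hχ i]

lemma IsCirculation.congr {u v : E3 → C3} {z : C3} (h : IsCirculation S u z)
    (huv : u =ᵐ[volume] v) : IsCirculation S v z := by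
  obtain ⟨ψ, hψ, h⟩ := h
  exact ⟨ψ, hψ, by filter_upwards [h, ae_restrict_of_ae huv] with y h1 h2; rw [← h2, h1]⟩

lemma grad_add_ae {ψ φ : E3 → ℂ} (hψ : W12per ψ) (hφ : W12per φ) :
    ∀ᵐ y, grad (fun y => ψ y + φ y) y = grad ψ y + grad φ y := by
  filter_upwards [ae_all_iff.2 fun i => weakPartial_add hψ hφ i] with y hy
  ext i
  exact hy i

lemma grad_const_mul_ae {ψ : E3 → ℂ} (hψ : W12per ψ) (c : ℂ) :
    ∀ᵐ y, grad (fun y => c * ψ y) y = c • grad ψ y := by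
  filter_upwards [ae_all_iff.2 fun i => weakPartial_const_mul hψ c i] with y hy
  ext i
  exact hy i

lemma IsCirculation.add {u v : E3 → C3} {z z' : C3} (h : IsCirculation S u z)
    (h' : IsCirculation S v z') : IsCirculation S (fun y => u y + v y) (z + z') := by
  obtain ⟨ψ, hψ, h⟩ := h
  obtain ⟨φ, hφ, h'⟩ := h'
  refine ⟨_, hψ.add hφ, ?_⟩
  filter_upwards [h, h', ae_restrict_of_ae (grad_add_ae hψ hφ)] with y h1 h2 h3
  rw [h1, h2, h3]
  abel

lemma IsCirculation.const_smul {u : E3 → C3} {z : C3} (h : IsCirculation S u z) (c : ℂ) :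
    IsCirculation S (fun y => c • u y) (c • z) := by
  obtain ⟨ψ, hψ, h⟩ := h
  refine ⟨_, hψ.const_mul c, ?_⟩
  filter_upwards [h, ae_restrict_of_ae (grad_const_mul_ae hψ c)] with y h1 h3
  rw [h1, h3, smul_add]

lemma isCirculation_const (z : C3) : IsCirculation S (fun _ => z) z := by
  refine ⟨fun _ => 0, w12per_const 0, ?_⟩
  filter_upwards [ae_restrict_of_ae (ae_all_iff.2 fun i => weakPartial_const 0 i)] with y hy
  have : grad (fun _ => 0) y = 0 := by
    ext i
    exact hy i
  rw [this, zero_add]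

/-- A curl-free field outside `S` has zero circulation vector as soon as its weighted means
vanish. -/
lemma isCirculation_zero_iff (hS : IsInclusion S) (hχ : IsCircWeight S χ) {u : E3 → C3}
    (hu : W12perVec u) (hc : CurlFreeOutside S u) :
    IsCirculation S u 0 ↔ ∀ i, ∫ y in cell, χ i y * u y i = 0 := by
  constructor
  · intro h i
    rw [h.eq_integral hS hχ i, PiLp.zero_apply]
  · intro h
    -- Vanishing means can only say that the circulation vector is zero once some circulation vector
    -- is known to exist.
    obtain ⟨z, hz⟩ := exists_isCirculation hS hu hc
    have : z = 0 := by
      ext i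
      rw [← hz.eq_integral hS hχ i, h i, PiLp.zero_apply]
    rwa [this] at hz

end

section

/-! ### The Hilbert space of divergence-free fields and their curls -/

/-- `J` is the curl of the divergence-free periodic field `u`, it is supported in `S`, and the
circulation vector of `u` is zero. -/
structure CurlPair (S : Set E3) (χ : Fin 3 → E3 → ℂ) (u : E3 → C3) (J : Fin 3 → E3 → ℂ) : Prop where
  l2u : ∀ j, L2per fun y => u y j
  l2J : ∀ i, L2per (J i)
  curl_eq : ∀ i k, fc (J i) k = ik k (i + 1) * fc (fun y => u y (i + 2)) k
    - ik k (i + 2) * fc (fun y => u y (i + 1)) k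
  div_eq : ∀ k, ∑ i, ik k i * fc (fun y => u y i) k = 0
  supp : ∀ i, ∀ᵐ y ∂volume.restrict cell, y ∉ S → J i y = 0
  mean : ∀ i, ∫ y in cell, χ i y * u y i = 0

variable {S : Set E3} {χ : Fin 3 → E3 → ℂ}

lemma curl_congr {u v : E3 → C3} (h : u =ᵐ[volume] v) : curl u = curl v := by
  have h' : ∀ i j, weakPartial i (fun x => u x j) = weakPartial i fun x => v x j := fun i j =>
    weakPartial_congr (h.mono fun x hx => by rw [hx]) i
  ext y i
  simp only [curl, h']

lemma divergence_congr {u v : E3 → C3} (h : u =ᵐ[volume] v) : divergence u = divergence v := by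
  have h' : ∀ i j, weakPartial i (fun x => u x j) = weakPartial i fun x => v x j := fun i j =>
    weakPartial_congr (h.mono fun x hx => by rw [hx]) i
  ext y
  simp only [divergence, h']

lemma X0.congr {u v : E3 → C3} (hu : X0 S u) (h : u =ᵐ[volume] v) : X0 S v :=
  ⟨fun j => (hu.sobolev j).congr (h.mono fun y hy => by simp only [hy]),
    by rw [CurlFreeOutside, ← curl_congr h]; exact hu.curlFree, hu.circulation_zero.congr h⟩

lemma X0div.congr {u v : E3 → C3} (hu : X0div S u) (h : u =ᵐ[volume] v) : X0div S v :=
  ⟨hu.toX0.congr h, by rw [← divergence_congr h]; exact hu.divFree⟩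

lemma X0div.curlPair (hS : IsInclusion S) (hχ : IsCircWeight S χ) {u : E3 → C3} (hu : X0div S u) :
    CurlPair S χ u fun i y => curl u y i where
  l2u j := (hu.sobolev j).1
  l2J := l2per_curl hu.sobolev
  curl_eq := fc_curl hu.sobolev
  div_eq := (divergence_ae_eq_zero_iff hu.sobolev).1 hu.divFree
  supp i := by
    refine (ae_restrict_iff' measurableSet_cell).2 ?_
    filter_upwards [(ae_restrict_iff' hS.isOpen_compl.measurableSet).1 hu.curlFree] with y hy hc hyS
    rw [hy ⟨hc, hyS⟩, PiLp.zero_apply]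
  mean := (isCirculation_zero_iff hS hχ hu.sobolev hu.curlFree).1 hu.circulation_zero

/-- `CurlPair` asks only for conditions that are closed in `L²`; the missing first derivatives come
from the regularity of divergence-free fields with square integrable curl. -/
lemma CurlPair.sobolev {u : E3 → C3} {J : Fin 3 → E3 → ℂ} (h : CurlPair S χ u J) : W12perVec u :=
  w12perVec_of_curl h.l2u h.l2J h.curl_eq h.div_eq

lemma CurlPair.curl_ae {u : E3 → C3} {J : Fin 3 → E3 → ℂ} (h : CurlPair S χ u J) :
    ∀ᵐ y, ∀ i, curl u y i = J i y := curl_ae_eq h.sobolev h.l2J h.curl_eq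

lemma CurlPair.x0div (hS : IsInclusion S) (hχ : IsCircWeight S χ) {u : E3 → C3}
    {J : Fin 3 → E3 → ℂ} (h : CurlPair S χ u J) : X0div S u := by
  have hc : CurlFreeOutside S u := by
    refine (ae_restrict_iff' hS.isOpen_compl.measurableSet).2 ?_
    have h1 := (ae_restrict_iff' measurableSet_cell).1 (ae_all_iff.2 h.supp)
    filter_upwards [h.curl_ae, h1] with y h2 h3 hy
    ext i
    rw [h2 i, h3 hy.1 i hy.2, PiLp.zero_apply]
  exact ⟨⟨h.sobolev, hc, (isCirculation_zero_iff hS hχ h.sobolev hc).2 h.mean⟩,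
    (divergence_ae_eq_zero_iff h.sobolev).2 h.div_eq⟩

lemma CurlPair.congr {u u' : E3 → C3} {J J' : Fin 3 → E3 → ℂ} (h : CurlPair S χ u J)
    (hu : u =ᵐ[volume] u') (hJ : ∀ i, J i =ᵐ[volume] J' i) : CurlPair S χ u' J' := by
  have hu' : ∀ j, (fun y => u y j) =ᵐ[volume] fun y => u' y j := fun j =>
    hu.mono fun y hy => by simp only [hy]
  have hfu : ∀ j k, fc (fun y => u y j) k = fc (fun y => u' y j) k := fun j k =>
    fc_congr (ae_restrict_of_ae (hu' j)) k
  refine ⟨fun j => (h.l2u j).congr (hu' j), fun i => (h.l2J i).congr (hJ i), fun i k => ?_,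
    fun k => ?_, fun i => ?_, fun i => ?_⟩
  · rw [← fc_congr (ae_restrict_of_ae (hJ i)) k, h.curl_eq, hfu, hfu]
  · rw [← h.div_eq k]
    simp only [hfu]
  · filter_upwards [h.supp i, ae_restrict_of_ae (hJ i)] with y h1 h2 hy
    rw [← h2, h1 hy]
  · rw [← h.mean i]
    exact integral_congr_ae ((ae_restrict_of_ae (hu' i)).mono fun y hy => by simp only [hy])

/-- The ambient Hilbert space of pairs of periodic vector fields. -/
abbrev PairSpace : Type := PiLp 2 fun _ : Fin 3 ⊕ Fin 3 => L2T

/-- The first field of a pair. -/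
def pairField (p : PairSpace) (y : E3) : C3 := WithLp.toLp 2 fun j => p (Sum.inl j) (toTorus y)

/-- The second field of a pair. -/
def pairCurl (p : PairSpace) (i : Fin 3) (y : E3) : ℂ := p (Sum.inr i) (toTorus y)

/-- The coordinate projections of the space of pairs. -/
def pairProj (a : Fin 3 ⊕ Fin 3) : PairSpace →L[ℂ] L2T := PiLp.proj 2 _ a

/-- The Fourier coefficient as a bounded functional. -/
def coefL (k : Fin 3 → ℤ) : L2T →L[ℂ] ℂ := innerSL ℂ (UnitAddTorus.mFourierLp 2 k)

lemma coefL_apply (k : Fin 3 → ℤ) (F : L2T) : coefL k F = fc (fun y => F (toTorus y)) k := by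
  rw [fc_torus, coefL, innerSL_apply_apply, ← UnitAddTorus.mFourierBasis_repr,
    HilbertBasis.repr_apply_apply, UnitAddTorus.coe_mFourierBasis]

lemma inner_L2T (F G : L2T) :
    inner ℂ F G = ∫ y in cell, G (toTorus y) * conj (F (toTorus y)) := by
  rw [L2.inner_def]
  have hm : AEStronglyMeasurable (fun t => G t * conj (F t)) (volume : Measure Torus) :=
    (Lp.aestronglyMeasurable G).mul
      (Complex.continuous_conj.comp_aestronglyMeasurable (Lp.aestronglyMeasurable F))
  rw [integral_cell_toTorus hm]
  rfl

/-- The closed subspace of the pairs `(u, curl u)` with `u` in `X0div`. -/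
def curlSpace (S : Set E3) (χ : Fin 3 → L2T) : Submodule ℂ PairSpace :=
  (⨅ i : Fin 3, ⨅ k : Fin 3 → ℤ, (coefL k ∘L pairProj (Sum.inr i)
      - (ik k (i + 1) • (coefL k ∘L pairProj (Sum.inl (i + 2)))
        - ik k (i + 2) • (coefL k ∘L pairProj (Sum.inl (i + 1)))) : PairSpace →L[ℂ] ℂ).ker) ⊓
  (⨅ k : Fin 3 → ℤ, (∑ i, ik k i • (coefL k ∘L pairProj (Sum.inl i)) : PairSpace →L[ℂ] ℂ).ker) ⊓
  -- Vanishing outside `S` is expressed as orthogonality to every function that vanishes on `S`,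
  -- hence as an intersection of kernels of bounded functionals.
  (⨅ i : Fin 3, ⨅ G : {G : L2T // ∀ᵐ t, sec t ∈ S → G t = 0},
      (innerSL ℂ G.1 ∘L pairProj (Sum.inr i) : PairSpace →L[ℂ] ℂ).ker) ⊓
  ⨅ i : Fin 3, (innerSL ℂ (χ i) ∘L pairProj (Sum.inl i) : PairSpace →L[ℂ] ℂ).ker

lemma isClosed_curlSpace (S : Set E3) (χ : Fin 3 → L2T) :
    IsClosed (curlSpace S χ : Set PairSpace) := by
  have h : ∀ ℓ : PairSpace →L[ℂ] ℂ, IsClosed (ℓ.ker : Set PairSpace) := fun ℓ => ℓ.isClosed_ker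
  simp only [curlSpace, Submodule.coe_inf, Submodule.coe_iInf]
  exact ((((isClosed_iInter fun i => isClosed_iInter fun k => h _).inter
    (isClosed_iInter fun k => h _)).inter
    (isClosed_iInter fun i => isClosed_iInter fun G => h _)).inter (isClosed_iInter fun i => h _))

lemma IsCircWeight.l2per_conj (hχ : IsCircWeight S χ) (i : Fin 3) : L2per fun y => conj (χ i y) :=
  (hχ.l2per i).conj

/-- The weights as elements of `L²`. -/
def weightL2 (hχ : IsCircWeight S χ) (i : Fin 3) : L2T := toL2T _ (hχ.l2per_conj i)

lemma mem_curlSpace_iff (hS : IsInclusion S) (hχ : IsCircWeight S χ) (p : PairSpace) :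
    p ∈ curlSpace S (weightL2 hχ) ↔ CurlPair S χ (pairField p) (pairCurl p) := by
  have hSm : MeasurableSet S := hS.isCompact.measurableSet
  have hmean : ∀ i, inner ℂ (weightL2 hχ i) (p (Sum.inl i))
      = ∫ y in cell, χ i y * pairField p y i := fun i => by
    rw [inner_L2T]
    refine integral_congr_ae (ae_restrict_of_ae ((hχ.l2per_conj i).ae_eq_toL2T.mono fun y hy => ?_))
    have hy' : conj (χ i y) = weightL2 hχ i (toTorus y) := hy
    simp only [pairField]
    rw [← hy', Complex.conj_conj, mul_comm]
  have hsupp : ∀ i, (∀ G : {G : L2T // ∀ᵐ t, sec t ∈ S → G t = 0},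
      inner ℂ G.1 (p (Sum.inr i)) = 0) ↔ ∀ᵐ y ∂volume.restrict cell, y ∉ S → pairCurl p i y = 0 := by
    intro i
    constructor
    · intro h
      -- The orthogonality is tested with the part of the component outside `S`, whose squared norm
      -- it annihilates.
      have hm : MemLp ((sec ⁻¹' Sᶜ).indicator (p (Sum.inr i))) 2 (volume : Measure Torus) :=
        (Lp.memLp _).indicator (measurePreserving_sec.measurable hSm.compl)
      have h1 := h ⟨hm.toLp _, hm.coeFn_toLp.mono fun t ht hts => by
        rw [ht, indicator_of_notMem]
        exact fun h => h hts⟩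
      have h2 : inner ℂ (hm.toLp _) (hm.toLp _) = inner ℂ (hm.toLp _) (p (Sum.inr i)) := by
        rw [L2.inner_def, L2.inner_def]
        refine integral_congr_ae (hm.coeFn_toLp.mono fun t ht => ?_)
        simp only
        rw [ht]
        by_cases hts : t ∈ sec ⁻¹' Sᶜ
        · rw [indicator_of_mem hts]
        · rw [indicator_of_notMem hts, inner_zero_left, inner_zero_left]
      rw [h1, inner_self_eq_zero] at h2
      have h3 : ∀ᵐ t, (sec ⁻¹' Sᶜ).indicator (p (Sum.inr i)) t = 0 := by
        filter_upwards [hm.coeFn_toLp, (Lp.eq_zero_iff_ae_eq_zero.1 h2)] with t h4 h5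
        rw [← h4, h5, Pi.zero_apply]
      have h4 := measurePreserving_toTorus.quasiMeasurePreserving.ae h3
      filter_upwards [h4, ae_restrict_mem measurableSet_cell] with y h5 hy hyS
      rwa [indicator_of_mem] at h5
      simpa only [mem_preimage, mem_compl_iff, sec_toTorus hy] using hyS
    · intro h G
      rw [inner_L2T]
      have hG := measurePreserving_toTorus.quasiMeasurePreserving.ae G.2
      refine integral_eq_zero_of_ae ?_
      filter_upwards [hG, h, ae_restrict_mem measurableSet_cell] with y h1 h2 hy
      rw [sec_toTorus hy] at h1
      by_cases hyS : y ∈ S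
      · rw [h1 hyS, map_zero, mul_zero, Pi.zero_apply]
      · have := h2 hyS
        rw [pairCurl] at this
        rw [this, zero_mul, Pi.zero_apply]
  simp only [curlSpace, Submodule.mem_inf, Submodule.mem_iInf, LinearMap.mem_ker,
    ContinuousLinearMap.coe_coe, sub_apply, smul_apply, ContinuousLinearMap.comp_apply,
    FunLike.coe_sum, Finset.sum_apply, coefL_apply, smul_eq_mul, innerSL_apply_apply,
    pairProj, PiLp.proj_apply, hmean, sub_eq_zero]
  constructor
  · rintro ⟨⟨⟨h1, h2⟩, h3⟩, h4⟩
    exact ⟨fun j => l2per_torus _, fun i => l2per_torus _, h1, h2, fun i => (hsupp i).1 (h3 i), h4⟩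
  · intro h
    exact ⟨⟨⟨h.curl_eq, h.div_eq⟩, fun i => (hsupp i).2 (h.supp i)⟩, h.mean⟩

lemma CurlPair.exists_pair (hS : IsInclusion S) (hχ : IsCircWeight S χ) {u : E3 → C3}
    {J : Fin 3 → E3 → ℂ} (h : CurlPair S χ u J) :
    ∃ p ∈ curlSpace S (weightL2 hχ), u =ᵐ[volume] pairField p ∧
      ∀ i, J i =ᵐ[volume] pairCurl p i := by
  let p : PairSpace := WithLp.toLp 2 fun a => match a with
    | Sum.inl j => toL2T _ (h.l2u j)
    | Sum.inr i => toL2T _ (h.l2J i)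
  have h1 : u =ᵐ[volume] pairField p := by
    filter_upwards [ae_all_iff.2 fun j => (h.l2u j).ae_eq_toL2T] with y hy
    ext j
    exact hy j
  have h2 : ∀ i, J i =ᵐ[volume] pairCurl p i := fun i => (h.l2J i).ae_eq_toL2T
  exact ⟨p, (mem_curlSpace_iff hS hχ p).2 (h.congr h1 h2), h1, h2⟩

end

section

/-! ### Solvability of the cell problem -/

section CellOperator

variable (K : Submodule ℂ PairSpace)

/-- The projection of a pair onto a component of its field. -/
def fieldProj (j : Fin 3) : K →L[ℂ] L2T := pairProj (Sum.inl j) ∘L K.subtypeL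

lemma fieldProj_apply (j : Fin 3) (p : K) : fieldProj K j p = (p : PairSpace) (Sum.inl j) := rfl

variable [CompleteSpace K]

/-- The bounded operator representing the form `∫ J · conj J' - c ∫ u · conj u'`. -/
def cellOp (c : ℂ) : K →L[ℂ] K :=
  -- The inner product of `K` is already `∫ J · conj J' + ∫ u · conj u'`. Removing `1 + c` times the
  -- second term leaves the form.
  1 - (1 + c) • ∑ j, (fieldProj K j).adjoint ∘L fieldProj K j

/-- A constant as a periodic `L²` function. -/
def constL2 (a : ℂ) : L2T := toL2T _ (l2per_const a)

/-- The representative of the antilinear form `c ∫ z · conj u`. -/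
def cellRhs (c : ℂ) (z : C3) : K := c • ∑ j, (fieldProj K j).adjoint (constL2 (z j))

lemma inner_smul_sum_adjoint (d : ℂ) (f : Fin 3 → L2T) (p : K) :
    inner ℂ p (d • ∑ j, (fieldProj K j).adjoint (f j)) = d * ∑ j, inner ℂ (fieldProj K j p) (f j) := by
  have h1 : ∀ x : K, inner ℂ p (d • x) = d * inner ℂ p x := fun x => inner_smul_right p x d
  have h2 : inner ℂ p (∑ j, (fieldProj K j).adjoint (f j))
      = ∑ j, inner ℂ p ((fieldProj K j).adjoint (f j)) := inner_sum _ _ _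
  rw [h1, h2]
  congr 1
  exact Finset.sum_congr rfl fun j _ => ContinuousLinearMap.adjoint_inner_right _ _ _

lemma inner_cellOp (c : ℂ) (p q : K) : inner ℂ p (cellOp K c q)
    = ∑ i, inner ℂ ((p : PairSpace) (Sum.inr i)) ((q : PairSpace) (Sum.inr i))
      - c * ∑ j, inner ℂ ((p : PairSpace) (Sum.inl j)) ((q : PairSpace) (Sum.inl j)) := by
  have h : inner ℂ p q = ∑ j, inner ℂ ((p : PairSpace) (Sum.inl j)) ((q : PairSpace) (Sum.inl j))
      + ∑ i, inner ℂ ((p : PairSpace) (Sum.inr i)) ((q : PairSpace) (Sum.inr i)) := by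
    rw [Submodule.coe_inner, PiLp.inner_apply, Fintype.sum_sum_type]
  have hsub : ∀ x y : K, inner ℂ p (x - y) = inner ℂ p x - inner ℂ p y := inner_sub_right p
  simp only [cellOp, sub_apply, one_apply_eq_self, smul_apply, FunLike.coe_sum, Finset.sum_apply,
    ContinuousLinearMap.comp_apply, hsub, inner_smul_sum_adjoint, h]
  simp only [fieldProj_apply]
  ring

lemma inner_cellRhs (c : ℂ) (z : C3) (p : K) : inner ℂ p (cellRhs K c z)
    = c * ∑ j, inner ℂ ((p : PairSpace) (Sum.inl j)) (constL2 (z j)) := by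
  rw [cellRhs, inner_smul_sum_adjoint]
  simp only [fieldProj_apply]

/-- Coercivity: the imaginary part of `a - c b` controls `b`, and then the triangle inequality
controls `a`. Only the imaginary part of `c` needs a sign. -/
lemma add_le_mul_norm_sub {a b : ℝ} (hb : 0 ≤ b) {c : ℂ} (hc : 0 < c.im) :
    a + b ≤ (1 + (1 + ‖c‖) / c.im) * ‖(a : ℂ) - c * b‖ := by
  have h1 : c.im * b ≤ ‖(a : ℂ) - c * b‖ := by
    have := Complex.abs_im_le_norm ((a : ℂ) - c * b)
    simp only [Complex.sub_im, Complex.ofReal_im, Complex.mul_im, Complex.ofReal_re, mul_zero,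
      zero_add, zero_sub, abs_neg] at this
    rwa [abs_of_nonneg (by positivity)] at this
  have h2 : a ≤ ‖(a : ℂ) - c * b‖ + ‖c‖ * b := by
    have h3 := norm_add_le ((a : ℂ) - c * b) (c * b)
    rw [sub_add_cancel, norm_mul, Complex.norm_real, Complex.norm_real, Real.norm_of_nonneg hb] at h3
    exact (le_abs_self a).trans h3
  have h4 : b ≤ ‖(a : ℂ) - c * b‖ / c.im := by
    rw [le_div_iff₀ hc]
    linarith
  have h5 : (1 + ‖c‖) * b ≤ (1 + ‖c‖) * (‖(a : ℂ) - c * b‖ / c.im) :=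
    mul_le_mul_of_nonneg_left h4 (by positivity)
  have h6 : (1 + (1 + ‖c‖) / c.im) * ‖(a : ℂ) - c * b‖
      = ‖(a : ℂ) - c * b‖ + (1 + ‖c‖) * (‖(a : ℂ) - c * b‖ / c.im) := by ring
  rw [h6]
  linarith

/-- Lax–Milgram, with `a` and `b` the squared norms of the curl and of the field in the coercivity
estimate. -/
lemma bijective_cellOp {c : ℂ} (hc : 0 < c.im) : Function.Bijective (cellOp K c) := by
  rw [← ContinuousLinearMap.isUnit_iff_bijective]
  set D : ℝ := 1 + (1 + ‖c‖) / c.im with hD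
  have hD0 : 0 < D := by positivity
  refine ContinuousLinearMap.isUnit_of_forall_le_norm_inner_map _ (c := D⁻¹.toNNReal)
    (by simpa using hD0) fun p => ?_
  rw [norm_inner_symm, inner_cellOp, Real.coe_toNNReal _ (by positivity)]
  set a : ℝ := ∑ i, ‖(p : PairSpace) (Sum.inr i)‖ ^ 2 with ha
  set b : ℝ := ∑ i, ‖(p : PairSpace) (Sum.inl i)‖ ^ 2 with hb
  have hab : ‖p‖ ^ 2 = a + b := by
    rw [Submodule.coe_norm, PiLp.norm_sq_eq_of_L2, Fintype.sum_sum_type, add_comm]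
  have e1 : ∑ i, inner ℂ ((p : PairSpace) (Sum.inr i)) ((p : PairSpace) (Sum.inr i)) = (a : ℂ) := by
    simp [ha, inner_self_eq_norm_sq_to_K]
  have e2 : ∑ i, inner ℂ ((p : PairSpace) (Sum.inl i)) ((p : PairSpace) (Sum.inl i)) = (b : ℂ) := by
    simp [hb, inner_self_eq_norm_sq_to_K]
  rw [e1, e2, hab, ← div_eq_mul_inv, div_le_iff₀ hD0, mul_comm]
  exact add_le_mul_norm_sub (Finset.sum_nonneg fun i _ => by positivity) hc

end CellOperator

variable {S : Set E3} {χ : Fin 3 → E3 → ℂ}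

lemma conjVec_apply (a : C3) (i : Fin 3) : conjVec a i = conj (a i) := rfl

lemma integral_dot {u v : E3 → C3} (hu : ∀ j, L2per fun y => u y j) (hv : ∀ j, L2per fun y => v y j) :
    ∫ y in cell, dot (u y) (v y) = ∑ j, ∫ y in cell, u y j * v y j := by
  simp only [dot]
  exact integral_finsetSum _ fun j _ => (hu j).integrable_mul (hv j)

lemma integral_dot_conjVec {u v : E3 → C3} (hu : ∀ j, L2per fun y => u y j)
    (hv : ∀ j, L2per fun y => v y j) :
    ∫ y in cell, dot (u y) (conjVec (v y)) = ∑ j, ∫ y in cell, u y j * conj (v y j) :=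
  integral_dot hu fun j => (hv j).conj

/-- Integrals over `S` of products of curls are integrals over the cell. -/
lemma setIntegral_dot_eq_cell (hS : IsInclusion S) {a b : E3 → C3}
    (ha : ∀ᵐ y ∂volume.restrict (cell \ S), a y = 0) :
    ∫ y in S, dot (a y) (b y) = ∫ y in cell, dot (a y) (b y) := by
  refine (setIntegral_eq_of_subset_of_ae_sdiff_eq_zero measurableSet_cell.nullMeasurableSet
    hS.subset_cell ?_).symm
  have h := (ae_restrict_iff' hS.isOpen_compl.measurableSet).1 ha
  filter_upwards [h] with y hy hyc
  simp [dot, hy hyc]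

lemma CurlPair.setIntegral_curl (hS : IsInclusion S) (hχ : IsCircWeight S χ) {u v : E3 → C3}
    {J J' : Fin 3 → E3 → ℂ} (h : CurlPair S χ u J) (h' : CurlPair S χ v J') :
    ∫ y in S, dot (curl u y) (conjVec (curl v y)) = ∑ i, ∫ y in cell, J i y * conj (J' i y) := by
  rw [setIntegral_dot_eq_cell hS (h.x0div hS hχ).curlFree,
    integral_dot_conjVec (l2per_curl h.sobolev) (l2per_curl h'.sobolev)]
  refine Finset.sum_congr rfl fun i _ => integral_congr_ae ?_
  filter_upwards [ae_restrict_of_ae h.curl_ae, ae_restrict_of_ae h'.curl_ae] with y h1 h2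
  rw [h1, h2]

lemma integral_dot_conjVec_congr {A : Set E3} {a a' b b' : E3 → C3} (ha : a =ᵐ[volume] a')
    (hb : b =ᵐ[volume] b') :
    ∫ y in A, dot (a y) (conjVec (b y)) = ∫ y in A, dot (a' y) (conjVec (b' y)) :=
  integral_congr_ae (by
    filter_upwards [ae_restrict_of_ae ha, ae_restrict_of_ae hb] with y h1 h2
    rw [h1, h2])

instance completeSpace_curlSpace (S : Set E3) (χ : Fin 3 → L2T) : CompleteSpace (curlSpace S χ) :=
  (isClosed_curlSpace S χ).completeSpace_coe

/-- The corrector equation in operator form. -/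
lemma isCorrector_pairField_iff (hS : IsInclusion S) (hχ : IsCircWeight S χ) (εr : ℂ) (k₀ : ℝ) (z : C3) (q : curlSpace S (weightL2 hχ)) :
    IsCorrector S εr k₀ z (pairField q) ↔
      cellOp _ (εr * (k₀ : ℂ) ^ 2) q = cellRhs _ (εr * (k₀ : ℂ) ^ 2) z := by
  have hcp : ∀ p : curlSpace S (weightL2 hχ), CurlPair S χ (pairField p) (pairCurl p) := fun p =>
    (mem_curlSpace_iff hS hχ p).1 p.2
  have hl : ∀ p : curlSpace S (weightL2 hχ),
      inner ℂ p (cellOp _ (εr * (k₀ : ℂ) ^ 2) q)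
        = (∫ y in S, dot (curl (pairField q) y) (conjVec (curl (pairField p) y)))
          - εr * (k₀ : ℂ) ^ 2 * ∫ y in cell, dot (pairField q y) (conjVec (pairField p y)) := by
    intro p
    rw [inner_cellOp, (hcp q).setIntegral_curl hS hχ (hcp p),
      integral_dot_conjVec (hcp q).l2u (hcp p).l2u]
    simp only [inner_L2T]
    rfl
  have hr : ∀ p : curlSpace S (weightL2 hχ),
      inner ℂ p (cellRhs _ (εr * (k₀ : ℂ) ^ 2) z)
        = εr * (k₀ : ℂ) ^ 2 * ∫ y in cell, dot z (conjVec (pairField p y)) := by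
    intro p
    rw [inner_cellRhs, integral_dot_conjVec (u := fun _ => z) (fun j => l2per_const (z j)) (hcp p).l2u]
    simp only [inner_L2T]
    congr 1
    refine Finset.sum_congr rfl fun j _ => integral_congr_ae (ae_restrict_of_ae ?_)
    filter_upwards [(l2per_const (z j)).ae_eq_toL2T] with y hy
    rw [constL2, ← hy]
    rfl
  constructor
  · intro h
    refine ext_inner_left ℂ fun p => ?_
    rw [hl, hr]
    exact h.2 _ ((hcp p).x0div hS hχ)
  · intro h
    refine ⟨(hcp q).x0div hS hχ, fun v hv => ?_⟩
    obtain ⟨p, hp, hvp, -⟩ := (hv.curlPair hS hχ).exists_pair hS hχ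
    have := (hl ⟨p, hp⟩).symm.trans ((congrArg (inner ℂ (⟨p, hp⟩ : curlSpace S (weightL2 hχ))) h).trans
      (hr ⟨p, hp⟩))
    rw [integral_dot_conjVec_congr (EventuallyEq.refl _ (pairField (q : PairSpace))) hvp,
      integral_dot_conjVec_congr (EventuallyEq.refl _ fun _ => z) hvp, curl_congr hvp]
    exact this

lemma IsCorrector.congr {εr : ℂ} {k₀ : ℝ} {z : C3} {u v : E3 → C3} (h : IsCorrector S εr k₀ z u)
    (huv : u =ᵐ[volume] v) : IsCorrector S εr k₀ z v :=
  ⟨h.1.congr huv, fun w hw => by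
    rw [← curl_congr huv, ← h.2 w hw,
      integral_dot_conjVec_congr huv.symm (EventuallyEq.refl _ w)]⟩

/-- The corrector problem is uniquely solvable. -/
theorem existsUnique_corrector (hS : IsInclusion S) {εr : ℂ} (hεr : 0 < εr.im) {k₀ : ℝ} (hk₀ : k₀ ≠ 0) (z : C3) :
    ∃ u, IsCorrector S εr k₀ z u ∧ ∀ v, IsCorrector S εr k₀ z v → v =ᵐ[volume] u := by
  obtain ⟨χ, hχ⟩ := exists_isCircWeight hS
  -- As `k₀` is real, the sign of the imaginary part is that of `ε_r`.
  have hc : 0 < (εr * (k₀ : ℂ) ^ 2).im := by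
    rw [← Complex.ofReal_pow, Complex.im_mul_ofReal]
    positivity
  have hb := bijective_cellOp (curlSpace S (weightL2 hχ)) hc
  obtain ⟨q, hq⟩ := hb.2 (cellRhs _ (εr * (k₀ : ℂ) ^ 2) z)
  refine ⟨pairField q, (isCorrector_pairField_iff hS hχ εr k₀ z q).2 hq, fun v hv => ?_⟩
  obtain ⟨p, hp, hvp, -⟩ := (hv.1.curlPair hS hχ).exists_pair hS hχ
  have h1 := (isCorrector_pairField_iff hS hχ εr k₀ z ⟨p, hp⟩).1 (hv.congr hvp)
  have h2 : (⟨p, hp⟩ : curlSpace S (weightL2 hχ)) = q := hb.1 (h1.trans hq.symm)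
  rw [← h2]
  exact hvp

end

section

/-! ### Linearity of the cell problem -/

variable {S : Set E3}

lemma curl_add_ae {u v : E3 → C3} (hu : W12perVec u) (hv : W12perVec v) :
    ∀ᵐ y, curl (fun y => u y + v y) y = curl u y + curl v y := by
  filter_upwards [ae_all_iff.2 fun i => ae_all_iff.2 fun j => weakPartial_add (hu j) (hv j) i]
    with y hy
  ext i
  simp only [curl, PiLp.add_apply, hy]
  ring

lemma curl_const_smul_ae {u : E3 → C3} (hu : W12perVec u) (c : ℂ) :
    ∀ᵐ y, curl (fun y => c • u y) y = c • curl u y := by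
  filter_upwards [ae_all_iff.2 fun i => ae_all_iff.2 fun j => weakPartial_const_mul (hu j) c i]
    with y hy
  ext i
  simp only [curl, PiLp.smul_apply, smul_eq_mul, hy]
  ring

lemma curl_conjVec_ae {u : E3 → C3} (hu : W12perVec u) :
    ∀ᵐ y, curl (fun y => conjVec (u y)) y = conjVec (curl u y) := by
  filter_upwards [ae_all_iff.2 fun i => ae_all_iff.2 fun j => weakPartial_conj (hu j) i]
    with y hy
  ext i
  simp only [curl, conjVec_apply, hy, map_sub]

lemma curl_const_ae (z : C3) : ∀ᵐ y, curl (fun _ => z) y = 0 := by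
  filter_upwards [ae_all_iff.2 fun i => ae_all_iff.2 fun j => weakPartial_const (z j) i] with y hy
  ext i
  simp only [curl, hy, sub_self, PiLp.zero_apply]

lemma w12perVec_const (z : C3) : W12perVec fun _ => z := fun j => w12per_const (z j)

lemma W12perVec.add {u v : E3 → C3} (hu : W12perVec u) (hv : W12perVec v) :
    W12perVec fun y => u y + v y := fun j => (hu j).add (hv j)

lemma W12perVec.const_smul {u : E3 → C3} (hu : W12perVec u) (c : ℂ) :
    W12perVec fun y => c • u y := fun j => (hu j).const_mul c

lemma W12perVec.conjVec {u : E3 → C3} (hu : W12perVec u) :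
    W12perVec fun y => conjVec (u y) := fun j => (hu j).conj

lemma divergence_add_ae {u v : E3 → C3} (hu : W12perVec u) (hv : W12perVec v) :
    ∀ᵐ y, divergence (fun y => u y + v y) y = divergence u y + divergence v y := by
  filter_upwards [ae_all_iff.2 fun i => ae_all_iff.2 fun j => weakPartial_add (hu j) (hv j) i]
    with y hy
  simp only [divergence, PiLp.add_apply, hy, Finset.sum_add_distrib]

lemma divergence_const_smul_ae {u : E3 → C3} (hu : W12perVec u) (c : ℂ) :
    ∀ᵐ y, divergence (fun y => c • u y) y = c * divergence u y := by
  filter_upwards [ae_all_iff.2 fun i => ae_all_iff.2 fun j => weakPartial_const_mul (hu j) c i]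
    with y hy
  simp only [divergence, PiLp.smul_apply, smul_eq_mul, hy, Finset.mul_sum]

lemma divergence_conjVec_ae {u : E3 → C3} (hu : W12perVec u) :
    ∀ᵐ y, divergence (fun y => conjVec (u y)) y = conj (divergence u y) := by
  filter_upwards [ae_all_iff.2 fun i => ae_all_iff.2 fun j => weakPartial_conj (hu j) i]
    with y hy
  simp only [divergence, conjVec_apply, hy, map_sum]

lemma conjVec_conjVec (a : C3) : conjVec (conjVec a) = a := by
  ext i
  simp [conjVec]

lemma conjVec_zero : conjVec 0 = 0 := by
  ext i
  simp [conjVec]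

lemma IsCirculation.conjVec {u : E3 → C3} {z : C3} (h : IsCirculation S u z) :
    IsCirculation S (fun y => conjVec (u y)) (conjVec z) := by
  obtain ⟨ψ, hψ, h⟩ := h
  refine ⟨_, hψ.conj, ?_⟩
  filter_upwards [h, ae_restrict_of_ae (ae_all_iff.2 fun i => weakPartial_conj hψ i)] with y h1 h2
  rw [h1]
  ext i
  have : grad (fun y => conj (ψ y)) y i = conj (grad ψ y i) := h2 i
  rw [PiLp.add_apply, this, conjVec_apply, conjVec_apply, PiLp.add_apply, map_add]

lemma X0.add {u v : E3 → C3} (hu : X0 S u) (hv : X0 S v) : X0 S fun y => u y + v y where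
  sobolev := hu.sobolev.add hv.sobolev
  curlFree := by
    filter_upwards [hu.curlFree, hv.curlFree, ae_restrict_of_ae (curl_add_ae hu.sobolev hv.sobolev)]
      with y h1 h2 h3
    rw [h3, h1, h2, add_zero]
  circulation_zero := by simpa using hu.circulation_zero.add hv.circulation_zero

lemma X0.const_smul {u : E3 → C3} (hu : X0 S u) (c : ℂ) : X0 S fun y => c • u y where
  sobolev := hu.sobolev.const_smul c
  curlFree := by
    filter_upwards [hu.curlFree, ae_restrict_of_ae (curl_const_smul_ae hu.sobolev c)] with y h1 h3
    rw [h3, h1, smul_zero]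
  circulation_zero := by simpa using hu.circulation_zero.const_smul c

/-- The cell equation is bilinear and the corrector equation sesquilinear; stability under
conjugation allows passage from one to the other. -/
lemma X0.conjVec {u : E3 → C3} (hu : X0 S u) : X0 S fun y => conjVec (u y) where
  sobolev := hu.sobolev.conjVec
  curlFree := by
    filter_upwards [hu.curlFree, ae_restrict_of_ae (curl_conjVec_ae hu.sobolev)] with y h1 h3
    rw [h3, h1, conjVec_zero]
  circulation_zero := by simpa only [conjVec_zero] using hu.circulation_zero.conjVec

lemma X0div.add {u v : E3 → C3} (hu : X0div S u) (hv : X0div S v) :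
    X0div S fun y => u y + v y := ⟨hu.toX0.add hv.toX0, by
  filter_upwards [hu.divFree, hv.divFree, ae_restrict_of_ae (divergence_add_ae hu.sobolev hv.sobolev)]
    with y h1 h2 h3
  rw [h3, h1, h2, add_zero]⟩

lemma X0div.const_smul {u : E3 → C3} (hu : X0div S u) (c : ℂ) : X0div S fun y => c • u y :=
  ⟨hu.toX0.const_smul c, by
    filter_upwards [hu.divFree, ae_restrict_of_ae (divergence_const_smul_ae hu.sobolev c)] with y h1 h3
    rw [h3, h1, mul_zero]⟩

lemma X0div.conjVec {u : E3 → C3} (hu : X0div S u) : X0div S fun y => conjVec (u y) :=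
  ⟨hu.toX0.conjVec, by
    filter_upwards [hu.divFree, ae_restrict_of_ae (divergence_conjVec_ae hu.sobolev)] with y h1 h3
    rw [h3, h1, map_zero]⟩

lemma dot_add_left (a b v : C3) : dot (a + b) v = dot a v + dot b v := by
  simp [dot, add_mul, Finset.sum_add_distrib]

lemma dot_add_right (v a b : C3) : dot v (a + b) = dot v a + dot v b := by
  simp [dot, mul_add, Finset.sum_add_distrib]

lemma dot_smul_left (c : ℂ) (a v : C3) : dot (c • a) v = c * dot a v := by
  simp [dot, mul_assoc, Finset.mul_sum]

lemma integrable_dot {u v : E3 → C3} (hu : ∀ j, L2per fun y => u y j) (hv : ∀ j, L2per fun y => v y j) :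
    IntegrableOn (fun y => dot (u y) (v y)) cell volume :=
  integrable_finsetSum _ fun j _ => (hu j).integrable_mul (hv j)

lemma W12perVec.l2per {u : E3 → C3} (hu : W12perVec u) (j : Fin 3) : L2per fun y => u y j := (hu j).1

lemma IsCorrector.add (hS : IsInclusion S) {εr : ℂ} {k₀ : ℝ} {z z' : C3} {u u' : E3 → C3}
    (h : IsCorrector S εr k₀ z u) (h' : IsCorrector S εr k₀ z' u') :
    IsCorrector S εr k₀ (z + z') fun y => u y + u' y := by
  refine ⟨h.1.add h'.1, fun v hv => ?_⟩
  have hvc : ∀ j, L2per fun y => conjVec (v y) j := hv.sobolev.conjVec.l2per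
  have hcvc : ∀ j, L2per fun y => conjVec (curl v y) j := fun j => (l2per_curl hv.sobolev j).conj
  have hi := integrable_dot h.1.sobolev.l2per hvc
  have hi' := integrable_dot h'.1.sobolev.l2per hvc
  have hc := (integrable_dot (l2per_curl h.1.sobolev) hcvc).mono_set hS.subset_cell
  have hc' := (integrable_dot (l2per_curl h'.1.sobolev) hcvc).mono_set hS.subset_cell
  have hz := integrable_dot (w12perVec_const z).l2per hvc
  have hz' := integrable_dot (w12perVec_const z').l2per hvc
  have e1 : ∫ y in S, dot (curl (fun y => u y + u' y) y) (conjVec (curl v y))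
      = (∫ y in S, dot (curl u y) (conjVec (curl v y)))
        + ∫ y in S, dot (curl u' y) (conjVec (curl v y)) := by
    rw [← integral_add hc hc']
    refine integral_congr_ae ?_
    filter_upwards [ae_restrict_of_ae (curl_add_ae h.1.sobolev h'.1.sobolev)] with y hy
    rw [hy, dot_add_left]
  simp only [e1, dot_add_left]
  rw [integral_add hi hi', integral_add hz hz']
  linear_combination h.2 v hv + h'.2 v hv

lemma IsCorrector.const_smul {εr : ℂ} {k₀ : ℝ} {z : C3} {u : E3 → C3}
    (h : IsCorrector S εr k₀ z u) (c : ℂ) : IsCorrector S εr k₀ (c • z) fun y => c • u y := by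
  refine ⟨h.1.const_smul c, fun v hv => ?_⟩
  have e1 : ∫ y in S, dot (curl (fun y => c • u y) y) (conjVec (curl v y))
      = c * ∫ y in S, dot (curl u y) (conjVec (curl v y)) := by
    rw [← integral_const_mul]
    refine integral_congr_ae ?_
    filter_upwards [ae_restrict_of_ae (curl_const_smul_ae h.1.sobolev c)] with y hy
    rw [hy, dot_smul_left]
  simp only [e1, dot_smul_left]
  rw [integral_const_mul, integral_const_mul]
  linear_combination c * h.2 v hv

/-! ### The weak cell equation -/

/-- By Parseval the integral is a sum of terms `(k · û(-k)) φ̂(k)`, up to constants, and each of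
them vanishes. It applies to constant fields `u` as well as to divergence-free correctors. -/
lemma integral_dot_grad_eq_zero {u : E3 → C3} (hu : ∀ j, L2per fun y => u y j)
    (hd : ∀ k, ∑ i, ik k i * fc (fun y => u y i) k = 0) {φ : E3 → ℂ} (hφ : W12per φ) :
    ∫ y in cell, dot (u y) (grad φ y) = 0 := by
  rw [integral_dot hu hφ.l2per_grad]
  have h : HasSum (fun k => ∑ j, fc (fun y => u y j) (-k) * fc (fun y => grad φ y j) k)
      (∑ j, ∫ y in cell, u y j * grad φ y j) :=
    hasSum_sum fun j _ => hasSum_fc_mul_fc (hu j) (hφ.l2per_grad j)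
  have h0 : ∀ k, ∑ j, fc (fun y => u y j) (-k) * fc (fun y => grad φ y j) k = 0 := fun k => by
    have := hd (-k)
    simp only [ik_neg, neg_mul, Finset.sum_neg_distrib, neg_eq_zero] at this
    simp only [fc_grad hφ]
    have e : ∑ j, fc (fun y => u y j) (-k) * (ik k j * fc φ k)
        = (∑ j, ik k j * fc (fun y => u y j) (-k)) * fc φ k := by
      rw [Finset.sum_mul]
      exact Finset.sum_congr rfl fun j _ => by ring
    rw [e, this, zero_mul]
  simp only [h0] at h
  exact h.unique hasSum_zero

lemma sum_ik_mul_fc_const (z : C3) (k : Fin 3 → ℤ) : ∑ i, ik k i * fc (fun _ => z i) k = 0 := by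
  refine Finset.sum_eq_zero fun i _ => ?_
  by_cases hk : k = 0
  · rw [hk, ik_zero, zero_mul]
  · rw [fc_const _ hk, mul_zero]

lemma curl_grad_ae {φ : E3 → ℂ} (hφ : W12per φ) (hg : W12perVec (grad φ)) :
    ∀ᵐ y, curl (grad φ) y = 0 := by
  have := curl_ae_eq hg (J := fun _ _ => 0) (fun _ => l2per_const 0) fun i k => by
    rw [fc_zero, fc_grad hφ, fc_grad hφ]
    ring
  filter_upwards [this] with y hy
  ext i
  exact hy i

/-- Admissible test fields are the sum of a divergence-free one and a gradient. -/
lemma X0.exists_helmholtz {v : E3 → C3} (hv : X0 S v) :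
    ∃ (v' : E3 → C3) (φ : E3 → ℂ), X0div S v' ∧ W12per φ ∧ W12perVec (grad φ) ∧
      ∀ y, v y = v' y + grad φ y := by
  obtain ⟨φ, hφ, hg, hd⟩ := CellProblem.exists_helmholtz hv.sobolev
  have hv' : W12perVec fun y => v y + (-1 : ℂ) • grad φ y := hv.sobolev.add (hg.const_smul (-1))
  -- A gradient has zero curl and zero circulation vector, so removing it does not leave `X0`.
  have hc : ∀ᵐ y, curl (fun y => v y + (-1 : ℂ) • grad φ y) y = curl v y := by
    filter_upwards [curl_add_ae hv.sobolev (hg.const_smul (-1)), curl_const_smul_ae hg (-1),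
      curl_grad_ae hφ hg] with y h1 h2 h3
    rw [h1, h2, h3, smul_zero, add_zero]
  refine ⟨_, φ, ⟨⟨hv', ?_, ?_⟩, (divergence_ae_eq_zero_iff hv').2 fun k => ?_⟩, hφ, hg,
    fun y => by simp⟩
  · filter_upwards [hv.curlFree, ae_restrict_of_ae hc] with y h1 h2
    rw [h2, h1]
  · have hgr : IsCirculation S (grad φ) 0 := ⟨φ, hφ, Eventually.of_forall fun y => by rw [add_zero]⟩
    simpa using hv.circulation_zero.add (hgr.const_smul (-1))
  · rw [← hd k]
    simp [sub_eq_add_neg]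

/-- The weak cell equation is the corrector equation. -/
lemma weakForm_iff_isCorrector {εr : ℂ} {k₀ : ℝ} {z : C3} {u w : E3 → C3}
    (hu : X0div S u) (hw : ∀ᵐ y, w y = z + u y) :
    WeakForm S εr k₀ w ↔ IsCorrector S εr k₀ z u := by
  have hcw : ∀ᵐ y, curl w y = curl u y := by
    rw [curl_congr (v := fun y => z + u y) hw]
    filter_upwards [curl_add_ae (w12perVec_const z) hu.sobolev, curl_const_ae z] with y h1 h2
    rw [h1, h2, zero_add]
  have hzd : ∀ {v : E3 → C3}, W12perVec v → ∫ y in cell, dot (w y) (v y)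
      = (∫ y in cell, dot z (v y)) + ∫ y in cell, dot (u y) (v y) := fun {v} hv => by
    rw [← integral_add (integrable_dot (w12perVec_const z).l2per hv.l2per)
      (integrable_dot hu.sobolev.l2per hv.l2per)]
    refine integral_congr_ae (ae_restrict_of_ae (hw.mono fun y hy => ?_))
    simp only [hy, dot_add_left]
  constructor
  · intro h
    refine ⟨hu, fun v hv => ?_⟩
    -- Testing the bilinear equation with `conj v` gives the sesquilinear one.
    have h1 := h _ hv.conjVec.toX0
    rw [hzd hv.conjVec.sobolev] at h1
    have e : ∫ y in S, dot (curl w y) (curl (fun y => conjVec (v y)) y)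
        = ∫ y in S, dot (curl u y) (conjVec (curl v y)) := by
      refine integral_congr_ae ?_
      filter_upwards [ae_restrict_of_ae hcw, ae_restrict_of_ae (curl_conjVec_ae hv.sobolev)]
        with y h2 h3
      rw [h2, h3]
    rw [e] at h1
    linear_combination h1
  · intro h v hv
    -- The cell equation has more test fields than the corrector equation, but only by gradients.
    -- These are invisible to the curl term and orthogonal to both `z` and `u`.
    obtain ⟨v', φ, hv', hφ, hg, hvv⟩ := hv.exists_helmholtz
    have h1 := h.2 _ hv'.conjVec
    simp only [conjVec_conjVec] at h1
    have hcv : ∀ᵐ y, curl v y = curl v' y := by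
      rw [curl_congr (v := fun y => v' y + grad φ y) (Eventually.of_forall hvv)]
      filter_upwards [curl_add_ae hv'.sobolev hg, curl_grad_ae hφ hg] with y h2 h3
      rw [h2, h3, add_zero]
    have e1 : ∫ y in S, dot (curl w y) (curl v y)
        = ∫ y in S, dot (curl u y) (conjVec (curl (fun y => conjVec (v' y)) y)) := by
      refine integral_congr_ae ?_
      filter_upwards [ae_restrict_of_ae hcw, ae_restrict_of_ae (curl_conjVec_ae hv'.sobolev),
        ae_restrict_of_ae hcv] with y h2 h3 h4
      rw [h2, h3, h4, conjVec_conjVec]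
    have hsplit : ∀ {a : E3 → C3}, (∀ j, L2per fun y => a y j) →
        (∀ k, ∑ i, ik k i * fc (fun y => a y i) k = 0) →
        ∫ y in cell, dot (a y) (v y) = ∫ y in cell, dot (a y) (v' y) := fun {a} ha had => by
      simp only [hvv, dot_add_right]
      rw [integral_add (integrable_dot ha hv'.sobolev.l2per) (integrable_dot ha hφ.l2per_grad),
        integral_dot_grad_eq_zero ha had hφ, add_zero]
    rw [e1, hzd hv.sobolev, hsplit (a := fun _ => z) (w12perVec_const z).l2per (sum_ik_mul_fc_const z),
      hsplit hu.sobolev.l2per ((divergence_ae_eq_zero_iff hu.sobolev).1 hu.divFree)]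
    linear_combination h1

end

section

/-! ### The space of solutions -/

section Solutions

variable {S : Set E3} {εr : ℂ} {k₀ : ℝ}

lemma corrector_spec (hS : IsInclusion S) (hεr : 0 < εr.im) (hk₀ : k₀ ≠ 0) (k : Fin 3) :
    IsCorrector S εr k₀ (stdVec k) (corrector S εr k₀ k) := by
  obtain ⟨u, hu, -⟩ := existsUnique_corrector hS hεr hk₀ (stdVec k)
  exact Classical.epsilon_spec ⟨u, hu⟩

lemma IsCorrector.unique (hS : IsInclusion S) (hεr : 0 < εr.im) (hk₀ : k₀ ≠ 0) {z : C3}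
    {u v : E3 → C3} (hu : IsCorrector S εr k₀ z u) (hv : IsCorrector S εr k₀ z v) :
    u =ᵐ[volume] v := by
  obtain ⟨w, -, hw⟩ := existsUnique_corrector hS hεr hk₀ z
  exact (hw u hu).trans (hw v hv).symm

lemma sum_smul_stdVec (z : C3) : ∑ k, z k • stdVec k = z := by
  ext i
  fin_cases i <;> simp [stdVec, Fin.sum_univ_three]

lemma isCorrector_sum (hS : IsInclusion S) (hεr : 0 < εr.im) (hk₀ : k₀ ≠ 0) (z : C3) :
    IsCorrector S εr k₀ z fun y => ∑ k, z k • corrector S εr k₀ k y := by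
  have h : ∀ k, IsCorrector S εr k₀ (z k • stdVec k) fun y => z k • corrector S εr k₀ k y :=
    fun k => (corrector_spec hS hεr hk₀ k).const_smul (z k)
  have h3 := ((h 0).add hS (h 1)).add hS (h 2)
  have e := sum_smul_stdVec z
  rw [Fin.sum_univ_three] at e
  rw [e] at h3
  simpa only [Fin.sum_univ_three] using h3

/-- The linear combination of the shape fields with coefficients `z`. -/
def shapeSum (S : Set E3) (εr : ℂ) (k₀ : ℝ) (z : C3) (y : E3) : C3 := ∑ k, z k • shapeH S εr k₀ k y

lemma shapeSum_eq (z : C3) (y : E3) :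
    shapeSum S εr k₀ z y = z + ∑ k, z k • corrector S εr k₀ k y := by
  simp only [shapeSum, shapeH, smul_add, Finset.sum_add_distrib, sum_smul_stdVec]

lemma isSolution_iff_exists_isCorrector {w : E3 → C3} :
    IsSolution S εr k₀ w ↔ ∃ z u, IsCorrector S εr k₀ z u ∧ ∀ᵐ y, w y = z + u y := by
  constructor
  · rintro ⟨⟨z, hz⟩, hw⟩
    have h : ∀ᵐ y, w y = z + (w y - z) := Eventually.of_forall fun y => by abel
    exact ⟨z, _, (weakForm_iff_isCorrector hz h).1 hw, h⟩
  · rintro ⟨z, u, hu, hw⟩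
    refine ⟨⟨z, hu.1.congr (hw.mono fun y hy => ?_)⟩, (weakForm_iff_isCorrector hu.1 hw).2 hu⟩
    simp only [hy, add_sub_cancel_left]

lemma ae_eq_shapeSum (hS : IsInclusion S) (hεr : 0 < εr.im) (hk₀ : k₀ ≠ 0) {z : C3}
    {u w : E3 → C3} (hu : IsCorrector S εr k₀ z u) (hw : ∀ᵐ y, w y = z + u y) :
    w =ᵐ[volume] shapeSum S εr k₀ z := by
  filter_upwards [hw, hu.unique hS hεr hk₀ (isCorrector_sum hS hεr hk₀ z)] with y h1 h2
  rw [h1, h2, shapeSum_eq]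

lemma isSolution_iff (hS : IsInclusion S) (hεr : 0 < εr.im) (hk₀ : k₀ ≠ 0) {w : E3 → C3} :
    IsSolution S εr k₀ w ↔ ∃ z, w =ᵐ[volume] shapeSum S εr k₀ z := by
  rw [isSolution_iff_exists_isCorrector]
  constructor
  · rintro ⟨z, u, hu, hw⟩
    exact ⟨z, ae_eq_shapeSum hS hεr hk₀ hu hw⟩
  · rintro ⟨z, hz⟩
    exact ⟨z, _, isCorrector_sum hS hεr hk₀ z, hz.mono fun y hy => by rw [hy, shapeSum_eq]⟩

lemma isCirculation_of_ae_eq {u w : E3 → C3} {z : C3} (hu : X0 S u) (hw : ∀ᵐ y, w y = z + u y) :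
    IsCirculation S w z := by
  have h := (isCirculation_const (S := S) z).add hu.circulation_zero
  rw [add_zero] at h
  exact h.congr (hw.mono fun y hy => hy.symm)

lemma isCirculation_shapeSum (hS : IsInclusion S) (hεr : 0 < εr.im) (hk₀ : k₀ ≠ 0) (z : C3) :
    IsCirculation S (shapeSum S εr k₀ z) z :=
  isCirculation_of_ae_eq (isCorrector_sum hS hεr hk₀ z).1.toX0
    (Eventually.of_forall fun y => shapeSum_eq z y)

lemma isCirculation_iff_of_ae_eq (hS : IsInclusion S) (hεr : 0 < εr.im) (hk₀ : k₀ ≠ 0) {w : E3 → C3}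
    {z : C3} (hw : w =ᵐ[volume] shapeSum S εr k₀ z) (z' : C3) : IsCirculation S w z' ↔ z' = z := by
  have h := (isCirculation_shapeSum hS hεr hk₀ z).congr hw.symm
  exact ⟨fun h' => h'.unique hS h, fun e => e ▸ h⟩

lemma W12perVec.aestronglyMeasurable {u : E3 → C3} (hu : W12perVec u) :
    AEStronglyMeasurable u volume := by
  have h : AEMeasurable (fun y => WithLp.toLp 2 fun j => u y j) volume :=
    (WithLp.measurable_toLp 2 _).comp_aemeasurable
      (aemeasurable_pi_lambda _ fun j => (hu j).1.aestronglyMeasurable.aemeasurable)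
  exact h.aestronglyMeasurable

lemma aestronglyMeasurable_shapeH (hS : IsInclusion S) (hεr : 0 < εr.im) (hk₀ : k₀ ≠ 0) (k : Fin 3) :
    AEStronglyMeasurable (shapeH S εr k₀ k) volume :=
  aestronglyMeasurable_const.add (corrector_spec hS hεr hk₀ k).1.sobolev.aestronglyMeasurable

/-- The shape fields as classes of measurable functions. -/
def shapeClass (hS : IsInclusion S) (hεr : 0 < εr.im) (hk₀ : k₀ ≠ 0) (k : Fin 3) :
    E3 →ₘ[volume] C3 := AEEqFun.mk _ (aestronglyMeasurable_shapeH hS hεr hk₀ k)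

lemma coeFn_sum_shapeClass (hS : IsInclusion S) (hεr : 0 < εr.im) (hk₀ : k₀ ≠ 0) (z : C3) :
    ((∑ k, z k • shapeClass hS hεr hk₀ k : E3 →ₘ[volume] C3) : E3 → C3)
      =ᵐ[volume] shapeSum S εr k₀ z := by
  have h1 : ∀ k, ((z k • shapeClass hS hεr hk₀ k : E3 →ₘ[volume] C3) : E3 → C3)
      =ᵐ[volume] fun y => z k • shapeH S εr k₀ k y := fun k => by
    filter_upwards [AEEqFun.coeFn_smul (z k) (shapeClass hS hεr hk₀ k),
      AEEqFun.coeFn_mk _ (aestronglyMeasurable_shapeH hS hεr hk₀ k)] with y h2 h3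
    rw [h2, Pi.smul_apply, shapeClass, h3]
  rw [Fin.sum_univ_three]
  filter_upwards [h1 0, h1 1, h1 2, AEEqFun.coeFn_add (z 0 • shapeClass hS hεr hk₀ 0
    + z 1 • shapeClass hS hεr hk₀ 1) (z 2 • shapeClass hS hεr hk₀ 2),
    AEEqFun.coeFn_add (z 0 • shapeClass hS hεr hk₀ 0) (z 1 • shapeClass hS hεr hk₀ 1)]
    with y h2 h3 h4 h5 h6
  rw [h5, Pi.add_apply, h6, Pi.add_apply, h2, h3, h4, shapeSum, Fin.sum_univ_three]

/-- A vanishing combination with coefficients `g` has circulation vector `g` as well as 0. -/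
lemma linearIndependent_shapeClass (hS : IsInclusion S) (hεr : 0 < εr.im) (hk₀ : k₀ ≠ 0) :
    LinearIndependent ℂ (shapeClass hS hεr hk₀) := by
  rw [Fintype.linearIndependent_iff]
  intro g hg k
  have h := coeFn_sum_shapeClass hS hεr hk₀ (WithLp.toLp 2 g)
  have h0 : ((0 : E3 →ₘ[volume] C3) : E3 → C3) =ᵐ[volume] shapeSum S εr k₀ (WithLp.toLp 2 g) := by
    rw [← hg]
    exact h
  have h1 := (isCirculation_shapeSum hS hεr hk₀ (WithLp.toLp 2 g)).congr
    (h0.symm.trans (AEEqFun.coeFn_zero (μ := (volume : Measure E3)) (β := C3)))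
  have h2 := h1.unique hS (isCirculation_const (S := S) 0)
  have := congrArg (fun a : C3 => a k) h2
  simpa using this

/-- Taking the span of the classes of the shape fields makes basis and dimension immediate; that no
solution is missed is `isSolution_iff`. -/
theorem exists_solution_space (hS : IsInclusion S) (hεr : 0 < εr.im) (hk₀ : k₀ ≠ 0) :
    ∃ (V : Submodule ℂ (E3 →ₘ[volume] C3)) (b : Module.Basis (Fin 3) ℂ V),
      (∀ f : E3 →ₘ[volume] C3, f ∈ V ↔ IsSolution S εr k₀ f) ∧ Module.finrank ℂ V = 3 ∧
      ∀ k, ((b k : E3 →ₘ[volume] C3) : E3 → C3) =ᵐ[volume] shapeH S εr k₀ k := by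
  refine ⟨Submodule.span ℂ (range (shapeClass hS hεr hk₀)),
    Module.Basis.span (linearIndependent_shapeClass hS hεr hk₀), fun f => ?_, ?_, fun k => ?_⟩
  · rw [Submodule.mem_span_range_iff_exists_fun, isSolution_iff hS hεr hk₀]
    constructor
    · rintro ⟨c, rfl⟩
      exact ⟨WithLp.toLp 2 c, coeFn_sum_shapeClass hS hεr hk₀ (WithLp.toLp 2 c)⟩
    · rintro ⟨z, hz⟩
      exact ⟨fun k => z k, AEEqFun.ext ((coeFn_sum_shapeClass hS hεr hk₀ z).trans hz.symm)⟩
  · rw [finrank_span_eq_card (linearIndependent_shapeClass hS hεr hk₀), Fintype.card_fin]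
  · rw [Module.Basis.span_apply]
    exact AEEqFun.coeFn_mk _ _

end Solutions

end

section

/-! ### Two-scale convergence against oscillating test functions -/

/-- The pairing of the `j`-th component of a cell field with a scalar function. -/
def cellPair (u : E3 → C3) (j : Fin 3) (v : E3 → ℂ) : ℂ := ∫ y in cell, u y j * v y

lemma memLp_component {α : Type*} [MeasurableSpace α] {μ : Measure α} {f : α → C3}
    (hf : MemLp f 2 μ) (j : Fin 3) : MemLp (fun x => f x j) 2 μ :=
  MemLp.of_le hf ((EuclideanSpace.proj (𝕜 := ℂ) j).continuous.comp_aestronglyMeasurable hf.1)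
    (Eventually.of_forall fun x => PiLp.norm_apply_le (f x) j)

lemma IsTestFun.mul_memLp {a : E3 → ℝ} (ha : IsTestFun a) {μ : Measure E3} {g : E3 → ℂ}
    (hg : MemLp g 2 μ) : MemLp (fun x => (a x : ℂ) * g x) 2 μ := by
  obtain ⟨C, hC⟩ := ha.exists_norm_le
  refine MemLp.of_le_mul (c := C) hg (ha.continuous_ofReal.aestronglyMeasurable.mul hg.1) ?_
  refine Eventually.of_forall fun x => ?_
  rw [norm_mul]
  exact mul_le_mul_of_nonneg_right (hC x) (norm_nonneg _)

variable {R : ℝ}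

lemma integrable_pair {f₀ : E3 → E3 → C3}
    (h : MemLp (fun p : E3 × E3 => f₀ p.1 p.2) 2 (volume.restrict (Metric.ball 0 R ×ˢ cell)))
    {v : E3 → ℂ} (hv : L2per v) (j : Fin 3) :
    Integrable (fun p : E3 × E3 => f₀ p.1 p.2 j * v p.2)
      ((volume.restrict (Metric.ball 0 R)).prod (volume.restrict cell)) := by
  rw [Measure.volume_eq_prod, ← Measure.prod_restrict] at h
  exact MemLp.integrable_mul (memLp_component h j) (hv.2.comp_snd _)

lemma integrable_testFun_mul_pair {f₀ : E3 → E3 → C3}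
    (h : MemLp (fun p : E3 × E3 => f₀ p.1 p.2) 2 (volume.restrict (Metric.ball 0 R ×ˢ cell)))
    {a : E3 → ℝ} (ha : IsTestFun a) {v : E3 → ℂ} (hv : L2per v) (j : Fin 3) :
    Integrable (fun p : E3 × E3 => (a p.1 : ℂ) * (f₀ p.1 p.2 j * v p.2))
      ((volume.restrict (Metric.ball 0 R)).prod (volume.restrict cell)) := by
  obtain ⟨C, hC⟩ := ha.exists_norm_le
  refine (integrable_pair h hv j).bdd_mul (c := C) ?_ (Eventually.of_forall fun p => hC p.1)
  exact (ha.continuous_ofReal.comp continuous_fst).aestronglyMeasurable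

lemma integrable_cellPair {f₀ : E3 → E3 → C3}
    (h : MemLp (fun p : E3 × E3 => f₀ p.1 p.2) 2 (volume.restrict (Metric.ball 0 R ×ˢ cell)))
    {v : E3 → ℂ} (hv : L2per v) (j : Fin 3) :
    Integrable (fun x => cellPair (f₀ x) j v) (volume.restrict (Metric.ball 0 R)) :=
  (integrable_pair h hv j).integral_prod_left

lemma integral_testFun_mul_cellPair {f₀ : E3 → E3 → C3}
    (h : MemLp (fun p : E3 × E3 => f₀ p.1 p.2) 2 (volume.restrict (Metric.ball 0 R ×ˢ cell)))
    {a : E3 → ℝ} (ha : IsTestFun a) {v : E3 → ℂ} (hv : L2per v) (j : Fin 3) :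
    ∫ p in Metric.ball 0 R ×ˢ cell, (a p.1 : ℂ) * (f₀ p.1 p.2 j * v p.2) =
      ∫ x in Metric.ball 0 R, (a x : ℂ) * cellPair (f₀ x) j v := by
  rw [Measure.volume_eq_prod, ← Measure.prod_restrict,
    integral_prod _ (integrable_testFun_mul_pair h ha hv j)]
  refine integral_congr_ae (Eventually.of_forall fun x => ?_)
  simp only [cellPair, integral_const_mul]

lemma l2per_of_continuous {b : E3 → ℂ} (hb : Continuous b)
    (hp : ∀ y k, b (y + latt k) = b y) : L2per b := by
  simpa using (l2per_const (1 : ℂ)).mul_continuous hb hp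

lemma l2per_ofReal {b : E3 → ℝ} (hb : ContDiff ℝ (⊤ : ℕ∞) b)
    (hp : ∀ y k, b (y + latt k) = b y) : L2per fun y => (b y : ℂ) :=
  l2per_of_continuous (Complex.continuous_ofReal.comp hb.continuous) fun y k => by simp only [hp]

variable {η : ℕ → ℝ} {f : ℕ → E3 → C3} {f₀ : E3 → E3 → C3}

lemma TwoScaleConv.tendsto_real (hη : ∀ n, 0 < η n)
    (h : TwoScaleConv (Metric.ball 0 R) η f f₀) {a : E3 → ℝ} (ha : IsTestFun a)
    (hs : tsupport a ⊆ Metric.ball 0 R) {b : E3 → ℝ} (hb : ContDiff ℝ (⊤ : ℕ∞) b)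
    (hp : ∀ y k, b (y + latt k) = b y) (j : Fin 3) :
    Tendsto (fun n => ∫ x in Metric.ball 0 R, ((a x : ℂ) * f n x j) * (b ((η n)⁻¹ • x) : ℂ)) atTop
      (𝓝 (∫ x in Metric.ball 0 R, (a x : ℂ) * cellPair (f₀ x) j fun y => (b y : ℂ))) := by
  have hL := l2per_ofReal hb hp
  have ht : IsTwoScaleTest (Metric.ball 0 R) fun x y => a x * b y := by
    refine ⟨(ha.1.comp contDiff_fst).mul (hb.comp contDiff_snd), fun x y k => by rw [hp], ?_⟩
    refine ⟨tsupport a, hs, ha.2, fun x hx y => ?_⟩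
    rw [image_eq_zero_of_notMem_tsupport hx, zero_mul]
  have h1 := ((EuclideanSpace.proj (𝕜 := ℂ) j).continuous.tendsto _).comp (h.tendsto _ ht)
  have e0 : ∀ (r s : ℝ) (c : C3) (i : Fin 3), ((r * s) • c) i = (r : ℂ) * (c i * (s : ℂ)) := by
    intro r s c i
    rw [PiLp.smul_apply, Complex.real_smul]
    push_cast
    ring
  have e2 : (EuclideanSpace.proj (𝕜 := ℂ) j)
      (∫ p in Metric.ball 0 R ×ˢ cell, (a p.1 * b p.2) • f₀ p.1 p.2) =
        ∫ x in Metric.ball 0 R, (a x : ℂ) * cellPair (f₀ x) j fun y => (b y : ℂ) := by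
    rw [← integral_testFun_mul_cellPair h.memLp_limit ha hL j, PiLp.proj_apply, eval_integral_piLp]
    · simp only [e0]
    · intro i
      simp only [e0]
      have := integrable_testFun_mul_pair h.memLp_limit ha hL i
      rwa [Measure.volume_eq_prod, ← Measure.prod_restrict]
  rw [e2] at h1
  refine h1.congr fun n => ?_
  simp only [Function.comp_apply]
  rw [PiLp.proj_apply, eval_integral_piLp]
  · simp only [e0, mul_assoc]
  · intro i
    simp only [e0, ← mul_assoc]
    exact MemLp.integrable_mul (ha.mul_memLp (memLp_component (h.memLp n) i))
      (hL.memLp_scaled R (hη n))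

/-- Two-scale test functions are real, so the exponential is split into its real and imaginary
parts. -/
lemma TwoScaleConv.tendsto_em (hη : ∀ n, 0 < η n)
    (h : TwoScaleConv (Metric.ball 0 R) η f f₀) {a : E3 → ℝ} (ha : IsTestFun a)
    (hs : tsupport a ⊆ Metric.ball 0 R) (k : Fin 3 → ℤ) (j : Fin 3) :
    Tendsto (fun n => ∫ x in Metric.ball 0 R, ((a x : ℂ) * f n x j) * em k ((η n)⁻¹ • x)) atTop
      (𝓝 (∫ x in Metric.ball 0 R, (a x : ℂ) * cellPair (f₀ x) j (em k))) := by
  have hre : ContDiff ℝ (⊤ : ℕ∞) fun y => (em k y).re := Complex.reCLM.contDiff.comp (em_contDiff k)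
  have him : ContDiff ℝ (⊤ : ℕ∞) fun y => (em k y).im := Complex.imCLM.contDiff.comp (em_contDiff k)
  have pre : ∀ y m, (em k (y + latt m)).re = (em k y).re := fun y m => by rw [em_add_latt]
  have pim : ∀ y m, (em k (y + latt m)).im = (em k y).im := fun y m => by rw [em_add_latt]
  have t := (h.tendsto_real hη ha hs hre pre j).add
    ((h.tendsto_real hη ha hs him pim j).const_mul Complex.I)
  have lre := l2per_ofReal hre pre
  have lim := l2per_ofReal him pim
  have e : ∀ z w : ℂ, w * (z.re : ℂ) + Complex.I * (w * (z.im : ℂ)) = w * z := fun z w => by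
    conv_rhs => rw [← Complex.re_add_im z]
    ring
  refine (t.congr fun n => ?_).trans (le_of_eq (congrArg _ ?_))
  · rw [← integral_const_mul, ← integral_add]
    · simp only [e]
    · exact MemLp.integrable_mul (ha.mul_memLp (memLp_component (h.memLp n) j))
        (lre.memLp_scaled R (hη n))
    · exact (MemLp.integrable_mul (ha.mul_memLp (memLp_component (h.memLp n) j))
        (lim.memLp_scaled R (hη n))).const_mul _
  · rw [← integral_testFun_mul_cellPair h.memLp_limit ha lre,
      ← integral_testFun_mul_cellPair h.memLp_limit ha lim,
      ← integral_testFun_mul_cellPair h.memLp_limit ha (l2per_em k), ← integral_const_mul,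
      ← integral_add]
    · simp only [← mul_assoc _ (f₀ _ _ j), e]
    · have := integrable_testFun_mul_pair h.memLp_limit ha lre j
      rwa [Measure.volume_eq_prod, ← Measure.prod_restrict]
    · have := integrable_testFun_mul_pair h.memLp_limit ha lim j
      rw [Measure.volume_eq_prod, ← Measure.prod_restrict]
      exact this.const_mul _

/-- The limit functional is continuous in `v` for the norm of `L²` of the cell, as needed when `v`
is approximated by trigonometric polynomials. -/
lemma cellPair_norm_le {a : E3 → ℝ} (ha : IsTestFun a)
    (h : MemLp (fun p : E3 × E3 => f₀ p.1 p.2) 2 (volume.restrict (Metric.ball 0 R ×ˢ cell)))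
    (j : Fin 3) : ∃ C, ∀ v, L2per v → ‖∫ x in Metric.ball 0 R, (a x : ℂ) * cellPair (f₀ x) j v‖ ≤
      C * (eLpNorm v 2 (volume.restrict cell)).toReal := by
  have hm := h
  rw [Measure.volume_eq_prod, ← Measure.prod_restrict] at hm
  obtain ⟨C, hC⟩ := ha.exists_norm_le
  have hA : MemLp (fun p : E3 × E3 => (a p.1 : ℂ) * f₀ p.1 p.2 j) 2
      ((volume.restrict (Metric.ball 0 R)).prod (volume.restrict cell)) := by
    have hj := memLp_component hm j
    refine MemLp.of_le_mul (c := C) hj ((ha.continuous_ofReal.comp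
      continuous_fst).aestronglyMeasurable.mul hj.1) (Eventually.of_forall fun p => ?_)
    rw [norm_mul]
    exact mul_le_mul_of_nonneg_right (hC p.1) (norm_nonneg _)
  set c := volume.restrict (Metric.ball (0 : E3) R) univ with hc
  have hct : c ≠ ⊤ := measure_ne_top _ _
  refine ⟨(eLpNorm (fun p : E3 × E3 => (a p.1 : ℂ) * f₀ p.1 p.2 j) 2
    ((volume.restrict (Metric.ball 0 R)).prod (volume.restrict cell))).toReal *
      (c ^ (1 / 2 : ℝ)).toReal, fun v hv => ?_⟩
  rw [← integral_testFun_mul_cellPair h ha hv, Measure.volume_eq_prod, ← Measure.prod_restrict]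
  simp only [← mul_assoc]
  refine (norm_integral_mul_le hA (hv.2.comp_snd _)).trans_eq ?_
  rw [mul_assoc, ← ENNReal.toReal_mul (a := c ^ (1 / 2 : ℝ))]
  congr 2
  have e : eLpNorm v 2 (Measure.map Prod.snd
      ((volume.restrict (Metric.ball (0 : E3) R)).prod (volume.restrict cell))) =
      eLpNorm (v ∘ Prod.snd) 2
        ((volume.restrict (Metric.ball (0 : E3) R)).prod (volume.restrict cell)) :=
    eLpNorm_map_measure (by
      rw [Measure.map_snd_prod]
      exact hv.2.1.smul_measure _) measurable_snd.aemeasurable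
  rw [Measure.map_snd_prod, eLpNorm_smul_measure_of_ne_top (by norm_num)] at e
  rw [show (fun p : E3 × E3 => v p.2) = v ∘ Prod.snd from rfl, ← e]
  simp [hc]

/-- Two-scale convergence against products of a test function and a rescaled periodic square
integrable function. -/
theorem TwoScaleConv.tendsto_periodic (hη : ∀ n, 0 < η n) (hη0 : Tendsto η atTop (𝓝 0))
    (h : TwoScaleConv (Metric.ball 0 R) η f f₀) (hb : BoundedL2 (Metric.ball 0 R) f)
    {a : E3 → ℝ} (ha : IsTestFun a) (hs : tsupport a ⊆ Metric.ball 0 R) {v : E3 → ℂ} (hv : L2per v)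
    (j : Fin 3) :
    Tendsto (fun n => ∫ x in Metric.ball 0 R, ((a x : ℂ) * f n x j) * v ((η n)⁻¹ • x)) atTop
      (𝓝 (∫ x in Metric.ball 0 R, (a x : ℂ) * cellPair (f₀ x) j v)) := by
  obtain ⟨C₁, hC₁⟩ := cellPair_norm_le ha h.memLp_limit j
  obtain ⟨C₂, hC₂⟩ := ha.exists_norm_le
  obtain ⟨M, hM⟩ := hb
  obtain ⟨B, hB⟩ := hη0.bddAbove_range
  have hB' : ∀ n, η n ≤ B := fun n => hB ⟨n, rfl⟩
  have hC₂0 : 0 ≤ C₂ := (norm_nonneg _).trans (hC₂ 0)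
  have hmem : ∀ n, MemLp (fun x => (a x : ℂ) * f n x j) 2 (volume.restrict (Metric.ball 0 R)) :=
    fun n => ha.mul_memLp (memLp_component (h.memLp n) j)
  have hnorm : ∀ n, (eLpNorm (fun x => (a x : ℂ) * f n x j) 2
      (volume.restrict (Metric.ball 0 R))).toReal ≤ C₂ * M := by
    intro n
    have h1 : eLpNorm (fun x => (a x : ℂ) * f n x j) 2 (volume.restrict (Metric.ball 0 R)) ≤
        ENNReal.ofReal C₂ * eLpNorm (f n) 2 (volume.restrict (Metric.ball 0 R)) := by
      refine eLpNorm_le_mul_eLpNorm_of_ae_le_mul (Eventually.of_forall fun x => ?_) 2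
      rw [norm_mul]
      exact mul_le_mul (hC₂ x) (PiLp.norm_apply_le (f n x) j) (norm_nonneg _) hC₂0
    refine (ENNReal.toReal_mono ?_ (h1.trans (mul_le_mul_right (hM n) _))).trans_eq ?_
    · exact ENNReal.mul_ne_top ENNReal.ofReal_ne_top ENNReal.coe_ne_top
    · rw [ENNReal.toReal_mul, ENNReal.toReal_ofReal hC₂0, ENNReal.coe_toReal]
  -- The scales are bounded by `B`, so this constant bounds the prelimit functionals for all `n` at
  -- once.
  set K : ℝ := C₂ * M * (scaleConst R B).toReal with hK
  have hK0 : 0 ≤ K := by positivity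
  have hbd : ∀ n, ∀ q, L2per q → ‖∫ x in Metric.ball 0 R, ((a x : ℂ) * f n x j) * q ((η n)⁻¹ • x)‖ ≤
      K * (eLpNorm q 2 (volume.restrict cell)).toReal := by
    intro n q hq
    refine (norm_integral_mul_le (hmem n) (hq.memLp_scaled R (hη n))).trans ?_
    rw [hK, mul_assoc, ← ENNReal.toReal_mul (a := scaleConst R B)]
    refine mul_le_mul (hnorm n) (ENNReal.toReal_mono ?_ ?_) ENNReal.toReal_nonneg (by positivity)
    · exact ENNReal.mul_ne_top (scaleConst_ne_top R B) hq.2.2.ne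
    · exact (hq.eLpNorm_scaled_le R (hη n)).trans
        (mul_le_mul_left (scaleConst_mono R (hB' n)) _)
  rw [Metric.tendsto_atTop]
  intro ε hε
  -- With `v` approximated within `ε / (2D)`, the errors in the prelimit and in the limit together
  -- stay below `ε / 2`. The summand 1 only makes `D` positive.
  set D : ℝ := K + |C₁| + 1 with hD
  have hD0 : 0 < D := by positivity
  obtain ⟨s, hsA⟩ := hv.exists_trig_approx (ε := ENNReal.ofReal (ε / (2 * D)))
    (by rw [ENNReal.ofReal_pos]; positivity)
  set p : E3 → ℂ := fun y => ∑ k ∈ s, fc v k * em k y with hp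
  have hpL : L2per p := l2per_finset_sum fun k _ => (l2per_em k).const_mul _
  have hqL : L2per fun y => v y - p y := hv.sub hpL
  set δ : ℝ := (eLpNorm (fun y => v y - p y) 2 (volume.restrict cell)).toReal with hδ
  have hδ0 : 0 ≤ δ := ENNReal.toReal_nonneg
  have hδ1 : δ < ε / (2 * D) := by
    rw [hδ, ← ENNReal.toReal_ofReal (show 0 ≤ ε / (2 * D) by positivity)]
    exact ENNReal.toReal_strict_mono ENNReal.ofReal_ne_top hsA
  have hconv : Tendsto (fun n => ∫ x in Metric.ball 0 R, ((a x : ℂ) * f n x j) * p ((η n)⁻¹ • x))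
      atTop (𝓝 (∫ x in Metric.ball 0 R, (a x : ℂ) * cellPair (f₀ x) j p)) := by
    have t := tendsto_finsetSum s fun k _ =>
      (h.tendsto_em hη ha hs k j).const_mul (fc v k)
    refine (t.congr fun n => ?_).trans (le_of_eq (congrArg _ ?_))
    · simp only [hp, Finset.mul_sum, ← integral_const_mul]
      rw [← integral_finsetSum]
      · refine integral_congr_ae (Eventually.of_forall fun x => ?_)
        exact Finset.sum_congr rfl fun k _ => by ring
      · exact fun k _ => (MemLp.integrable_mul (hmem n) ((l2per_em k).memLp_scaled R (hη n))).const_mul _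
    · rw [← integral_testFun_mul_cellPair h.memLp_limit ha hpL]
      simp_rw [← integral_testFun_mul_cellPair h.memLp_limit ha (l2per_em _), ← integral_const_mul]
      rw [← integral_finsetSum]
      · refine integral_congr_ae (Eventually.of_forall fun x => ?_)
        simp only [hp, Finset.mul_sum]
        exact Finset.sum_congr rfl fun k _ => by ring
      · intro k _
        have := integrable_testFun_mul_pair h.memLp_limit ha (l2per_em k) j
        rw [Measure.volume_eq_prod, ← Measure.prod_restrict]
        exact this.const_mul _
  obtain ⟨N, hN⟩ := Metric.tendsto_atTop.1 hconv (ε / 2) (by positivity)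
  refine ⟨N, fun n hn => ?_⟩
  have e1 : ∫ x in Metric.ball 0 R, ((a x : ℂ) * f n x j) * v ((η n)⁻¹ • x) =
      (∫ x in Metric.ball 0 R, ((a x : ℂ) * f n x j) * (fun y => v y - p y) ((η n)⁻¹ • x)) +
        ∫ x in Metric.ball 0 R, ((a x : ℂ) * f n x j) * p ((η n)⁻¹ • x) := by
    rw [← integral_add]
    rotate_left
    · exact MemLp.integrable_mul (hmem n) (hqL.memLp_scaled R (hη n))
    · exact MemLp.integrable_mul (hmem n) (hpL.memLp_scaled R (hη n))
    refine integral_congr_ae (Eventually.of_forall fun x => ?_)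
    simp only
    ring
  have e2 : ∫ x in Metric.ball 0 R, (a x : ℂ) * cellPair (f₀ x) j v =
      (∫ x in Metric.ball 0 R, (a x : ℂ) * cellPair (f₀ x) j fun y => v y - p y) +
        ∫ x in Metric.ball 0 R, (a x : ℂ) * cellPair (f₀ x) j p := by
    simp_rw [← integral_testFun_mul_cellPair h.memLp_limit ha hqL,
      ← integral_testFun_mul_cellPair h.memLp_limit ha hpL,
      ← integral_testFun_mul_cellPair h.memLp_limit ha hv]
    rw [← integral_add]
    · refine integral_congr_ae (Eventually.of_forall fun x => ?_)
      simp only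
      ring
    · have := integrable_testFun_mul_pair h.memLp_limit ha hqL j
      rwa [Measure.volume_eq_prod, ← Measure.prod_restrict]
    · have := integrable_testFun_mul_pair h.memLp_limit ha hpL j
      rwa [Measure.volume_eq_prod, ← Measure.prod_restrict]
  have b1 := hbd n _ hqL
  have b2 := hC₁ _ hqL
  have b3 := hN n hn
  rw [dist_eq_norm] at b3 ⊢
  rw [e1, e2]
  have b4 : C₁ * δ ≤ |C₁| * δ := mul_le_mul_of_nonneg_right (le_abs_self _) hδ0
  have b5 : D * δ < ε / 2 := by
    have := mul_lt_mul_of_pos_left hδ1 hD0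
    calc D * δ < D * (ε / (2 * D)) := this
      _ = ε / 2 := by field_simp
  rw [add_sub_add_comm]
  refine (norm_add_le _ _).trans_lt ?_
  have b6 := norm_sub_le (∫ x in Metric.ball 0 R, ((a x : ℂ) * f n x j) *
    (fun y => v y - p y) ((η n)⁻¹ • x)) (∫ x in Metric.ball 0 R,
      (a x : ℂ) * cellPair (f₀ x) j fun y => v y - p y)
  have b7 : K * δ + |C₁| * δ ≤ D * δ := by rw [hD]; nlinarith
  linarith

end

section

/-! ### Maxwell's equations tested with oscillating functions -/

variable {R η : ℝ} {U G : E3 → C3} {a : E3 → ℝ}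

/-- `curl U = G` in the sense of distributions on the ball of radius `R`. -/
def WeakCurlOn (R : ℝ) (U G : E3 → C3) : Prop :=
  ∀ φ : E3 → ℝ, IsTestFun φ → tsupport φ ⊆ Metric.ball 0 R → ∀ i : Fin 3,
    ∫ x in Metric.ball 0 R,
      ((pderiv (i + 1) φ x : ℂ) * U x (i + 2) - (pderiv (i + 2) φ x : ℂ) * U x (i + 1))
      = -∫ x in Metric.ball 0 R, (φ x : ℂ) * G x i

lemma integrable_mul_ball {φ g : E3 → ℂ} (hφ : Continuous φ) (hφc : HasCompactSupport φ)
    (hg : MemLp g 2 (volume.restrict (Metric.ball 0 R))) :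
    Integrable (fun x => φ x * g x) (volume.restrict (Metric.ball 0 R)) :=
  MemLp.integrable_mul (p := 2) (q := 2) ((hφ.memLp_of_hasCompactSupport hφc).restrict _) hg

lemma integrable_fun_sub {α : Type*} [MeasurableSpace α] {μ : Measure α} {f g : α → ℂ}
    (hf : Integrable f μ) (hg : Integrable g μ) : Integrable (fun x => f x - g x) μ := hf.sub hg

/-- Weak curls can be tested with complex-valued functions. -/
lemma WeakCurlOn.complex (h : WeakCurlOn R U G)
    (hU : MemLp U 2 (volume.restrict (Metric.ball 0 R)))
    (hG : MemLp G 2 (volume.restrict (Metric.ball 0 R))) {φ : E3 → ℂ}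
    (hφ : ContDiff ℝ (⊤ : ℕ∞) φ) (hφc : HasCompactSupport φ) (hs : tsupport φ ⊆ Metric.ball 0 R)
    (i : Fin 3) :
    ∫ x in Metric.ball 0 R, (cpderiv (i + 1) φ x * U x (i + 2) - cpderiv (i + 2) φ x * U x (i + 1))
      = -∫ x in Metric.ball 0 R, φ x * G x i := by
  have hre : IsTestFun fun x => (φ x).re :=
    ⟨Complex.reCLM.contDiff.comp hφ, hφc.comp_left (g := Complex.re) rfl⟩
  have him : IsTestFun fun x => (φ x).im :=
    ⟨Complex.imCLM.contDiff.comp hφ, hφc.comp_left (g := Complex.im) rfl⟩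
  have sre : tsupport (fun x => (φ x).re) ⊆ Metric.ball 0 R :=
    (closure_mono (Function.support_subset_iff'.2 fun x hx => by
      simp only [Function.notMem_support.1 hx, Complex.zero_re])).trans hs
  have sim : tsupport (fun x => (φ x).im) ⊆ Metric.ball 0 R :=
    (closure_mono (Function.support_subset_iff'.2 fun x hx => by
      simp only [Function.notMem_support.1 hx, Complex.zero_im])).trans hs
  have hd := hφ.differentiable (by simp)
  have i0 : ∀ {ψ : E3 → ℝ}, IsTestFun ψ → ∀ {V : E3 → C3},
      MemLp V 2 (volume.restrict (Metric.ball 0 R)) → ∀ j, Integrable (fun x => (ψ x : ℂ) * V x j)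
        (volume.restrict (Metric.ball 0 R)) := fun hψ V hV j =>
    integrable_mul_ball hψ.continuous_ofReal hψ.hasCompactSupport_ofReal (memLp_component hV j)
  calc ∫ x in Metric.ball 0 R,
        (cpderiv (i + 1) φ x * U x (i + 2) - cpderiv (i + 2) φ x * U x (i + 1))
      = ∫ x in Metric.ball 0 R,
          (((pderiv (i + 1) (fun y => (φ y).re) x : ℂ) * U x (i + 2)
              - (pderiv (i + 2) (fun y => (φ y).re) x : ℂ) * U x (i + 1))
            + Complex.I * ((pderiv (i + 1) (fun y => (φ y).im) x : ℂ) * U x (i + 2)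
              - (pderiv (i + 2) (fun y => (φ y).im) x : ℂ) * U x (i + 1))) := by
        refine integral_congr_ae (Eventually.of_forall fun x => ?_)
        simp only [cpderiv_eq_re_add_im hd]
        ring
    _ = -∫ x in Metric.ball 0 R, (((φ x).re : ℂ) * G x i + Complex.I * (((φ x).im : ℂ) * G x i)) := by
        rw [integral_add (integrable_fun_sub (i0 (hre.pderiv _) hU _) (i0 (hre.pderiv _) hU _))
            ((integrable_fun_sub (i0 (him.pderiv _) hU _) (i0 (him.pderiv _) hU _)).const_mul _),
          integral_add (i0 hre hG i) ((i0 him hG i).const_mul _),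
          integral_const_mul, integral_const_mul, h _ hre sre, h _ him sim]
        ring
    _ = -∫ x in Metric.ball 0 R, φ x * G x i := by
        congr 1
        refine integral_congr_ae (Eventually.of_forall fun x => ?_)
        simp only
        conv_rhs => rw [← Complex.re_add_im (φ x)]
        ring

/-- The pairing of the `j`-th component of `U` with an oscillating function of amplitude `a`. -/
def oscPair (R η : ℝ) (a : E3 → ℝ) (U : E3 → C3) (j : Fin 3) (v : E3 → ℂ) : ℂ :=
  ∫ x in Metric.ball 0 R, ((a x : ℂ) * U x j) * v (η⁻¹ • x)

/-- The oscillating test function `x ↦ a(x) e_k(x / η)`. -/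
def oscTest (η : ℝ) (a : E3 → ℝ) (k : Fin 3 → ℤ) (x : E3) : ℂ := (a x : ℂ) * em k (η⁻¹ • x)

lemma contDiff_oscTest (ha : IsTestFun a) (k : Fin 3 → ℤ) :
    ContDiff ℝ (⊤ : ℕ∞) (oscTest η a k) :=
  (Complex.ofRealCLM.contDiff.comp ha.1).mul ((em_contDiff k).comp (contDiff_const_smul _))

lemma hasCompactSupport_oscTest (ha : IsTestFun a) (k : Fin 3 → ℤ) :
    HasCompactSupport (oscTest η a k) :=
  ha.hasCompactSupport_ofReal.mul_right

lemma tsupport_oscTest_subset (k : Fin 3 → ℤ) : tsupport (oscTest η a k) ⊆ tsupport a :=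
  closure_mono fun x hx h0 => hx (by simp only [oscTest, h0, Complex.ofReal_zero, zero_mul])

/-- The slow derivative falls on the amplitude, while the fast one is multiplied by `η⁻¹`; this
separation of orders drives all the limits below. -/
lemma cpderiv_oscTest (ha : IsTestFun a) (k : Fin 3 → ℤ) (i : Fin 3) (x : E3) :
    cpderiv i (oscTest η a k) x =
      oscTest η (pderiv i a) k x + (η⁻¹ : ℝ) * ik k i * oscTest η a k x := by
  have h1 : DifferentiableAt ℝ (fun x => (a x : ℂ)) x :=
    (Complex.ofRealCLM.contDiff.comp ha.1).differentiable (by simp) x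
  have hem : DifferentiableAt ℝ (em k) (η⁻¹ • x) := (em_contDiff k).differentiable (by simp) _
  have h2 : DifferentiableAt ℝ (fun x => em k (η⁻¹ • x)) x :=
    ((em_contDiff k).comp (contDiff_const_smul _)).differentiable (by simp) x
  have e : cpderiv i (fun x => em k (η⁻¹ • x)) x = (η⁻¹ : ℝ) * (ik k i * em k (η⁻¹ • x)) := by
    rw [← cpderiv_em, cpderiv, cpderiv, fderiv_comp_smul]
    simp
  have := cpderiv_mul h1 h2 i
  rw [show oscTest η a k = fun x => (a x : ℂ) * em k (η⁻¹ • x) from rfl, this,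
    cpderiv_ofReal (ha.1.differentiable (by simp)), e]
  simp only [oscTest]
  ring

lemma integrable_oscTest_mul (ha : IsTestFun a) (k : Fin 3 → ℤ)
    (hU : MemLp U 2 (volume.restrict (Metric.ball 0 R))) (j : Fin 3) :
    Integrable (fun x => oscTest η a k x * U x j) (volume.restrict (Metric.ball 0 R)) :=
  integrable_mul_ball (contDiff_oscTest ha k).continuous (hasCompactSupport_oscTest ha k)
    (memLp_component hU j)

lemma oscPair_em (a : E3 → ℝ) (U : E3 → C3) (j : Fin 3) (k : Fin 3 → ℤ) :
    oscPair R η a U j (em k) = ∫ x in Metric.ball 0 R, oscTest η a k x * U x j := by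
  refine integral_congr_ae (Eventually.of_forall fun x => ?_)
  simp only [oscTest]
  ring

/-- The product rule separates the slow part from the `η⁻¹` part, where differentiating the
exponential gives the symbol of the curl in the cell variable. -/
lemma WeakCurlOn.oscPair_em (h : WeakCurlOn R U G)
    (hU : MemLp U 2 (volume.restrict (Metric.ball 0 R)))
    (hG : MemLp G 2 (volume.restrict (Metric.ball 0 R))) (ha : IsTestFun a)
    (hs : tsupport a ⊆ Metric.ball 0 R) (k : Fin 3 → ℤ) (i : Fin 3) :
    oscPair R η (pderiv (i + 1) a) U (i + 2) (em k) - oscPair R η (pderiv (i + 2) a) U (i + 1) (em k)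
      + (η⁻¹ : ℝ) * (ik k (i + 1) * oscPair R η a U (i + 2) (em k)
        - ik k (i + 2) * oscPair R η a U (i + 1) (em k)) = -oscPair R η a G i (em k) := by
  have key := h.complex hU hG (contDiff_oscTest (η := η) ha k) (hasCompactSupport_oscTest ha k)
    ((tsupport_oscTest_subset k).trans hs) i
  simp only [CellProblem.oscPair_em]
  rw [← key]
  have i1 := fun m j => integrable_oscTest_mul (η := η) (ha.pderiv m) k hU j
  have i2 := fun j => integrable_oscTest_mul (η := η) ha k hU j
  rw [← integral_sub (i1 _ _) (i1 _ _), ← integral_const_mul, ← integral_const_mul,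
    ← integral_sub ((i2 _).const_mul _) ((i2 _).const_mul _), ← integral_const_mul,
    ← integral_add (integrable_fun_sub (i1 _ _) (i1 _ _))
      ((integrable_fun_sub ((i2 _).const_mul _) ((i2 _).const_mul _)).const_mul _)]
  refine integral_congr_ae (Eventually.of_forall fun x => ?_)
  simp only [cpderiv_oscTest ha]
  ring

lemma hasSum_oscPair (hη : 0 < η) (hU : MemLp U 2 (volume.restrict (Metric.ball 0 R)))
    (ha : IsTestFun a) {v : E3 → ℂ} (hv : L2per v) (j : Fin 3) :
    HasSum (fun k => fc v k * oscPair R η a U j (em k)) (oscPair R η a U j v) :=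
  hasSum_fc_mul_integral (ha.mul_memLp (memLp_component hU j)) hv hη

/-- Weak curl equations tested with an oscillating Sobolev field. -/
lemma WeakCurlOn.oscPair_field (h : WeakCurlOn R U G)
    (hU : MemLp U 2 (volume.restrict (Metric.ball 0 R)))
    (hG : MemLp G 2 (volume.restrict (Metric.ball 0 R))) (ha : IsTestFun a)
    (hs : tsupport a ⊆ Metric.ball 0 R) (hη : 0 < η) {v : E3 → C3} (hv : W12perVec v) :
    (∑ i, (oscPair R η (pderiv (i + 1) a) U (i + 2) (fun y => v y i)
        - oscPair R η (pderiv (i + 2) a) U (i + 1) fun y => v y i))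
      - (η⁻¹ : ℝ) * ∑ j, oscPair R η a U j (fun y => curl v y j)
      = -∑ i, oscPair R η a G i fun y => v y i := by
  -- The field `v (x/η)` is only a Sobolev function and not an admissible test function. The
  -- identity is proved for exponentials and summed with the Fourier coefficients of `v`.
  have s1 := hasSum_sum fun i (_ : i ∈ Finset.univ) =>
    (hasSum_oscPair hη hU (ha.pderiv (i + 1)) (hv.l2per i) (i + 2)).sub
      (hasSum_oscPair hη hU (ha.pderiv (i + 2)) (hv.l2per i) (i + 1))
  have s2 := (hasSum_sum fun j (_ : j ∈ Finset.univ) =>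
    hasSum_oscPair hη hU ha (l2per_curl hv j) j).mul_left ((η⁻¹ : ℝ) : ℂ)
  have s3 := (hasSum_sum fun j (_ : j ∈ Finset.univ) =>
    hasSum_oscPair hη hG ha (hv.l2per j) j).neg
  refine (s1.sub s2).unique (s3.congr_fun fun k => ?_)
  have e := fun i => h.oscPair_em (η := η) hU hG ha hs k i
  simp only [fc_curl hv, Fin.sum_univ_three, Fin.isValue] at e ⊢
  have e0 := e 0
  have e1 := e 1
  have e2 := e 2
  simp only [Fin.isValue, show (0 : Fin 3) + 1 = 1 from rfl, show (0 : Fin 3) + 2 = 2 from rfl,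
    show (1 : Fin 3) + 1 = 2 from rfl, show (1 : Fin 3) + 2 = 0 from rfl,
    show (2 : Fin 3) + 1 = 0 from rfl, show (2 : Fin 3) + 2 = 1 from rfl] at e0 e1 e2 ⊢
  linear_combination (fc (fun y => v y 0) k) * e0 + (fc (fun y => v y 1) k) * e1
    + (fc (fun y => v y 2) k) * e2

/-- A weak curl is divergence-free. -/
lemma WeakCurlOn.oscPair_div (h : WeakCurlOn R U G)
    (hU : MemLp U 2 (volume.restrict (Metric.ball 0 R)))
    (hG : MemLp G 2 (volume.restrict (Metric.ball 0 R))) (ha : IsTestFun a)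
    (hs : tsupport a ⊆ Metric.ball 0 R) (k : Fin 3 → ℤ) :
    ∑ i, oscPair R η (pderiv i a) G i (em k) + (η⁻¹ : ℝ) * ∑ i, ik k i * oscPair R η a G i (em k)
      = 0 := by
  set φ := oscTest η a k
  have hφ : ContDiff ℝ (⊤ : ℕ∞) φ := contDiff_oscTest ha k
  have hφc : HasCompactSupport φ := hasCompactSupport_oscTest ha k
  have hts : ∀ i, tsupport (cpderiv i φ) ⊆ Metric.ball 0 R := fun i =>
    ((tsupport_fderiv_apply_subset ℝ _).trans (tsupport_oscTest_subset k)).trans hs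
  -- The component `i` of the equation is tested with `∂_i φ`; in the sum the second derivatives
  -- cancel by symmetry.
  have key := fun i => h.complex hU hG (contDiff_cpderiv hφ i) (hasCompactSupport_cpderiv hφc i)
    (hts i) i
  have i1 := fun i => integrable_oscTest_mul (η := η) (ha.pderiv i) k hG i
  have i2 := fun i => integrable_oscTest_mul (η := η) ha k hG i
  have i3 : ∀ m i j, Integrable (fun x => cpderiv m (cpderiv i φ) x * U x j)
      (volume.restrict (Metric.ball 0 R)) := fun m i j =>
    integrable_mul_ball (contDiff_cpderiv (contDiff_cpderiv hφ i) m).continuous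
      (hasCompactSupport_cpderiv (hasCompactSupport_cpderiv hφc i) m) (memLp_component hU j)
  have e : ∀ i, oscPair R η (pderiv i a) G i (em k) + (η⁻¹ : ℝ) * (ik k i * oscPair R η a G i (em k))
      = -∫ x in Metric.ball 0 R, (cpderiv (i + 1) (cpderiv i φ) x * U x (i + 2)
        - cpderiv (i + 2) (cpderiv i φ) x * U x (i + 1)) := by
    intro i
    rw [key, neg_neg, CellProblem.oscPair_em, CellProblem.oscPair_em, ← integral_const_mul,
      ← integral_const_mul, ← integral_add (i1 i) (((i2 i).const_mul _).const_mul _)]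
    refine integral_congr_ae (Eventually.of_forall fun x => ?_)
    simp only [φ, cpderiv_oscTest ha]
    ring
  rw [Finset.mul_sum, ← Finset.sum_add_distrib, Finset.sum_congr rfl fun i _ => e i,
    Finset.sum_neg_distrib, ← integral_finsetSum _ fun i _ =>
      integrable_fun_sub (i3 _ _ _) (i3 _ _ _), neg_eq_zero]
  refine integral_eq_zero_of_ae (Eventually.of_forall fun x => ?_)
  simp only [Fin.sum_univ_three, Fin.isValue, show (0 : Fin 3) + 1 = 1 from rfl,
    show (0 : Fin 3) + 2 = 2 from rfl,
    show (1 : Fin 3) + 1 = 2 from rfl, show (1 : Fin 3) + 2 = 0 from rfl,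
    show (2 : Fin 3) + 1 = 0 from rfl, show (2 : Fin 3) + 2 = 1 from rfl, Pi.zero_apply]
  rw [cpderiv_cpderiv_comm hφ 1 0, cpderiv_cpderiv_comm hφ 2 0, cpderiv_cpderiv_comm hφ 2 1]
  ring

end

section

/-! ### Densities of limit functionals -/

variable {R : ℝ} {f₀ g₀ : E3 → E3 → C3} {Ω S : Set E3}

/-- The limit of the pairings of a two-scale convergent sequence with oscillating functions. -/
def limPair (R : ℝ) (a : E3 → ℝ) (f₀ : E3 → E3 → C3) (j : Fin 3) (v : E3 → ℂ) : ℂ :=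
  ∫ x in Metric.ball 0 R, (a x : ℂ) * cellPair (f₀ x) j v

/-- `G` is integrable on the ball of radius `R` and is the density of the functional `L`. -/
structure IsDensity (R : ℝ) (G : E3 → ℂ) (L : (E3 → ℝ) → ℂ) : Prop where
  integrable : Integrable G (volume.restrict (Metric.ball 0 R))
  eq : ∀ a, IsTestFun a → ∫ x in Metric.ball 0 R, (a x : ℂ) * G x = L a

lemma IsTestFun.integrable_mul_of_integrable {a : E3 → ℝ} (ha : IsTestFun a) {μ : Measure E3}
    {G : E3 → ℂ} (hG : Integrable G μ) : Integrable (fun x => (a x : ℂ) * G x) μ := by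
  obtain ⟨C, hC⟩ := ha.exists_norm_le
  exact hG.bdd_mul (c := C) ha.continuous_ofReal.aestronglyMeasurable (Eventually.of_forall hC)

namespace IsDensity

variable {G G' : E3 → ℂ} {L L' : (E3 → ℝ) → ℂ}

lemma add (h : IsDensity R G L) (h' : IsDensity R G' L') :
    IsDensity R (fun x => G x + G' x) fun a => L a + L' a :=
  ⟨h.1.add h'.1, fun a ha => by
    simp only [mul_add]
    rw [integral_add (ha.integrable_mul_of_integrable h.1) (ha.integrable_mul_of_integrable h'.1),
      h.eq a ha, h'.eq a ha]⟩

lemma const_mul (h : IsDensity R G L) (c : ℂ) : IsDensity R (fun x => c * G x) fun a => c * L a :=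
  ⟨h.1.const_mul c, fun a ha => by
    rw [← h.eq a ha, ← integral_const_mul]
    refine integral_congr_ae (Eventually.of_forall fun x => ?_)
    simp only
    ring⟩

lemma sub (h : IsDensity R G L) (h' : IsDensity R G' L') :
    IsDensity R (fun x => G x - G' x) fun a => L a - L' a := by
  simpa [sub_eq_add_neg] using h.add (h'.const_mul (-1))

lemma sum {ι : Type*} {s : Finset ι} {G : ι → E3 → ℂ} {L : ι → (E3 → ℝ) → ℂ}
    (h : ∀ i, IsDensity R (G i) (L i)) :
    IsDensity R (fun x => ∑ i ∈ s, G i x) fun a => ∑ i ∈ s, L i a :=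
  ⟨integrable_finsetSum _ fun i _ => (h i).1, fun a ha => by
    simp only [Finset.mul_sum]
    rw [integral_finsetSum _ fun i _ => ha.integrable_mul_of_integrable (h i).1]
    exact Finset.sum_congr rfl fun i _ => (h i).eq a ha⟩

/-- Fundamental lemma of the calculus of variations: a limit identity valid for every amplitude
supported in `Ω` becomes an identity for almost every `x`. -/
lemma ae_eq_zero (h : IsDensity R G L) (hΩ : IsOpen Ω) (hΩR : Ω ⊆ Metric.ball 0 R)
    (hL : ∀ a, IsTestFun a → tsupport a ⊆ Ω → L a = 0) : ∀ᵐ x ∂volume.restrict Ω, G x = 0 := by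
  have h1 := hΩ.ae_eq_zero_of_integral_contDiff_smul_eq_zero
    (μ := volume.restrict (Metric.ball 0 R)) (f := G)
    (h.1.locallyIntegrable.locallyIntegrableOn Ω) fun φ hφ hc hs => by
      simp only [Complex.real_smul]
      rw [h.eq φ ⟨hφ, hc⟩, hL φ ⟨hφ, hc⟩ hs]
  rw [ae_restrict_iff' hΩ.measurableSet]
  filter_upwards [(ae_restrict_iff' Metric.isOpen_ball.measurableSet).1 h1] with x hx hxΩ
  exact hx (hΩR hxΩ) hxΩ

end IsDensity

lemma isDensity_cellPair
    (h : MemLp (fun p : E3 × E3 => f₀ p.1 p.2) 2 (volume.restrict (Metric.ball 0 R ×ˢ cell)))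
    {v : E3 → ℂ} (hv : L2per v) (j : Fin 3) :
    IsDensity R (fun x => cellPair (f₀ x) j v) fun a => limPair R a f₀ j v :=
  ⟨integrable_cellPair h hv j, fun _ _ => rfl⟩

/-! ### Slices of two-scale limits -/

/-- Fubini for the square of the norm. -/
lemma ae_l2per_slice (hΩR : Ω ⊆ Metric.ball 0 R)
    (h : MemLp (fun p : E3 × E3 => f₀ p.1 p.2) 2 (volume.restrict (Metric.ball 0 R ×ˢ cell)))
    (hp : ∀ x y (k : Fin 3 → ℤ), f₀ x (y + latt k) = f₀ x y) :
    ∀ᵐ x ∂volume.restrict Ω, ∀ j, L2per fun y => f₀ x y j := by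
  refine ae_restrict_of_ae_restrict_of_subset hΩR ?_
  rw [Measure.volume_eq_prod, ← Measure.prod_restrict] at h
  have h1 : Integrable (fun p : E3 × E3 => ‖f₀ p.1 p.2‖ ^ 2)
      ((volume.restrict (Metric.ball 0 R)).prod (volume.restrict cell)) := by
    simpa using h.integrable_norm_pow (p := 2) (by norm_num)
  filter_upwards [h1.prod_right_ae, h.1.prodMk_left] with x hx hm j
  refine ⟨fun k => Eventually.of_forall fun y => by simp only [hp], ?_⟩
  exact memLp_component ((memLp_two_iff_integrable_sq_norm hm).2 hx) j

/-- The union of the translates of `S` by the lattice. -/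
def perSet (S : Set E3) : Set E3 := toTorus ⁻¹' (toTorus '' S)

lemma mem_perSet_iff {y : E3} : y ∈ perSet S ↔ ∃ k, ∃ s ∈ S, y = s + latt k := by
  constructor
  · rintro ⟨s, hs, e⟩
    obtain ⟨k, hk⟩ := exists_eq_add_latt_of_toTorus_eq e.symm
    exact ⟨k, s, hs, hk⟩
  · rintro ⟨k, s, hs, rfl⟩
    exact ⟨s, hs, (toTorus_add_latt s k).symm⟩

lemma mem_perSet_iff_of_mem_cell (hS : S ⊆ cell) {y : E3} (hy : y ∈ cell) :
    y ∈ perSet S ↔ y ∈ S := by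
  constructor
  · rintro ⟨s, hs, e⟩
    rw [← sec_toTorus hy, ← e, sec_toTorus (hS hs)]
    exact hs
  · exact fun h => ⟨y, h, rfl⟩

lemma add_latt_mem_perSet_iff {y : E3} (k : Fin 3 → ℤ) : y + latt k ∈ perSet S ↔ y ∈ perSet S := by
  simp only [perSet, mem_preimage, toTorus_add_latt]

lemma measurableSet_perSet (hS : IsCompact S) : MeasurableSet (perSet S) :=
  measurable_toTorus (hS.image continuous_toTorus).isClosed.measurableSet

lemma L2per.indicator {v : E3 → ℂ} (hv : L2per v) {A : Set E3} (hA : MeasurableSet A)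
    (hp : ∀ y k, y + latt k ∈ A ↔ y ∈ A) : L2per (A.indicator v) := by
  classical
  refine ⟨fun k => (hv.1 k).mono fun y hy => ?_, hv.2.indicator hA⟩
  simp only [indicator_apply, hp, hy]

lemma ae_of_ae_cell_perSet (hS : S ⊆ cell) {v : E3 → ℂ} (hv : L2per v) (hSc : IsCompact S)
    (h : ∀ᵐ y ∂volume.restrict cell, y ∉ S → v y = 0) : ∀ᵐ y, y ∉ perSet S → v y = 0 := by
  have h1 : (perSet S)ᶜ.indicator v =ᵐ[volume] fun _ => 0 := by
    refine ae_eq_of_ae_eq_cell (hv.indicator (measurableSet_perSet hSc).compl fun y k => ?_).1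
      (fun k => Eventually.of_forall fun y => rfl) ?_
    · rw [mem_compl_iff, mem_compl_iff, add_latt_mem_perSet_iff]
    · filter_upwards [h, ae_restrict_mem measurableSet_cell] with y hy hc
      by_cases hyS : y ∈ (perSet S)ᶜ
      · rw [indicator_of_mem hyS]
        exact hy fun hs => hyS ((mem_perSet_iff_of_mem_cell hS hc).2 hs)
      · rw [indicator_of_notMem hyS]
  filter_upwards [h1] with y hy hyS
  rwa [indicator_of_mem (show y ∈ (perSet S)ᶜ from hyS)] at hy

/-- A periodic function whose pairings with the exponentials restricted to a periodic set vanish is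
zero on this set. -/
lemma ae_eq_zero_of_cellPair_indicator {u : E3 → C3} (hu : ∀ j, L2per fun y => u y j) {A : Set E3}
    (hA : MeasurableSet A) (hp : ∀ y k, y + latt k ∈ A ↔ y ∈ A) (j : Fin 3)
    (h : ∀ k, cellPair u j (A.indicator (em k)) = 0) : ∀ᵐ y, y ∈ A → u y j = 0 := by
  have h1 : A.indicator (fun y => u y j) =ᵐ[volume] fun _ => 0 := by
    refine fc_injective ((hu j).indicator hA hp) (l2per_const 0) fun k => ?_
    rw [fc_zero, ← h (-k)]
    refine integral_congr_ae (Eventually.of_forall fun y => ?_)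
    by_cases hy : y ∈ A
    · simp only [indicator_of_mem hy, mul_comm]
    · simp only [indicator_of_notMem hy, mul_zero]
  filter_upwards [h1] with y hy hyA
  rwa [indicator_of_mem hyA] at hy

/-! ### The scatterers -/

lemma mem_perSet_of_mem_scatterers {η : ℝ} (hη : 0 < η) {x : E3} (hx : x ∈ scatterers S Ω η) :
    η⁻¹ • x ∈ perSet S := by
  simp only [scatterers, mem_iUnion] at hx
  obtain ⟨k, -, s, hs, rfl⟩ := hx
  simp only [smul_smul, inv_mul_cancel₀ hη.ne', one_smul]
  exact mem_perSet_iff.2 ⟨k, s, hs, add_comm _ _⟩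

lemma scatterers_subset (hS : S ⊆ cell) (η : ℝ) : scatterers S Ω η ⊆ Ω := by
  intro x hx
  simp only [scatterers, mem_iUnion] at hx
  obtain ⟨k, hk, s, hs, rfl⟩ := hx
  exact hk ⟨s, hS hs, rfl⟩

/-- In a compact subset of `Ω`, the rescaled periodic inclusions are scatterers at small scales. -/
lemma exists_forall_mem_scatterers (hS : S ⊆ cell) {K : Set E3} (hK : IsCompact K) (hΩ : IsOpen Ω)
    (hKΩ : K ⊆ Ω) : ∃ δ > 0, ∀ η, 0 < η → η < δ → ∀ x ∈ K, η⁻¹ • x ∈ perSet S →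
      x ∈ scatterers S Ω η := by
  obtain ⟨δ, hδ, hδK⟩ := hK.exists_thickening_subset_open hΩ hKΩ
  -- Two points of the cell are at distance at most 2, so a scaled cell touching `K` stays in the
  -- `δ`-neighbourhood of `K` as soon as `2η < δ`.
  refine ⟨δ / 2, by positivity, fun η hη hηδ x hx hxS => ?_⟩
  obtain ⟨k, s, hs, e⟩ := mem_perSet_iff.1 hxS
  have ex : x = η • (latt k + s) := by
    rw [add_comm, ← e, smul_smul, mul_inv_cancel₀ hη.ne', one_smul]
  simp only [scatterers, mem_iUnion]
  refine ⟨k, ?_, s, hs, ex.symm⟩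
  rintro _ ⟨y, hy, rfl⟩
  refine hδK (Metric.mem_thickening_iff.2 ⟨x, hx, ?_⟩)
  rw [ex, dist_eq_norm]
  simp only
  rw [← smul_sub, add_sub_add_left_eq_sub, norm_smul, Real.norm_of_nonneg hη.le]
  have h1 : ‖y - s‖ ≤ 2 := (norm_sub_le _ _).trans (by
    have := norm_le_of_mem_cell hy
    have := norm_le_of_mem_cell (hS hs)
    linarith)
  nlinarith

end

section

/-! ### The two-scale limits of the Maxwell system -/

variable {S Ω : Set E3} {R : ℝ} {εr c₁ c₂ εe : ℂ} {η : ℕ → ℝ} {E H J : ℕ → E3 → C3}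
  {E₀ H₀ J₀ : E3 → E3 → C3}

/-- Bounded two-scale convergent sequences of fields and currents on the ball of radius `R` which
satisfy `curl E = c₁ H`, `curl H = c₂ η⁻¹ J` and the constitutive laws of the composite. -/
structure TwoScaleSystem (S Ω : Set E3) (R : ℝ) (εr c₁ c₂ εe : ℂ) (η : ℕ → ℝ)
    (E H J : ℕ → E3 → C3) (E₀ H₀ J₀ : E3 → E3 → C3) : Prop where
  isOpen : IsOpen Ω
  subset_ball : Ω ⊆ Metric.ball 0 R
  pos : ∀ n, 0 < η n
  tendsto_zero : Tendsto η atTop (𝓝 0)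
  boundedE : BoundedL2 (Metric.ball 0 R) E
  boundedH : BoundedL2 (Metric.ball 0 R) H
  boundedJ : BoundedL2 (Metric.ball 0 R) J
  convE : TwoScaleConv (Metric.ball 0 R) η E E₀
  convH : TwoScaleConv (Metric.ball 0 R) η H H₀
  convJ : TwoScaleConv (Metric.ball 0 R) η J J₀
  curlE : ∀ n, WeakCurlOn R (E n) fun x => c₁ • H n x
  curlH : ∀ n, WeakCurlOn R (H n) fun x => (((η n)⁻¹ : ℝ) * c₂) • J n x
  matrix : ∀ n x, x ∈ Ω → x ∉ scatterers S Ω (η n) → J n x = ((η n : ℂ) * εe) • E n x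
  inclusion : ∀ n x, x ∈ scatterers S Ω (η n) → E n x = ((η n : ℂ) * εr⁻¹) • J n x

lemma TwoScaleConv.tendsto_oscPair {f : ℕ → E3 → C3} {f₀ : E3 → E3 → C3} (hη : ∀ n, 0 < η n)
    (hη0 : Tendsto η atTop (𝓝 0)) (h : TwoScaleConv (Metric.ball 0 R) η f f₀)
    (hb : BoundedL2 (Metric.ball 0 R) f) {a : E3 → ℝ} (ha : IsTestFun a)
    (hs : tsupport a ⊆ Metric.ball 0 R) {v : E3 → ℂ} (hv : L2per v) (j : Fin 3) :
    Tendsto (fun n => oscPair R (η n) a (f n) j v) atTop (𝓝 (limPair R a f₀ j v)) :=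
  h.tendsto_periodic hη hη0 hb ha hs hv j

lemma oscPair_smul {θ : ℝ} (c : ℂ) (a : E3 → ℝ) (U : E3 → C3) (j : Fin 3) (v : E3 → ℂ) :
    oscPair R θ a (fun x => c • U x) j v = c * oscPair R θ a U j v := by
  rw [oscPair, oscPair, ← integral_const_mul]
  refine integral_congr_ae (Eventually.of_forall fun x => ?_)
  simp only [PiLp.smul_apply, smul_eq_mul]
  ring

lemma cellPair_em_neg (u : E3 → C3) (j : Fin 3) (k : Fin 3 → ℤ) :
    cellPair u j (em (-k)) = fc (fun y => u y j) k :=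
  integral_congr_ae (Eventually.of_forall fun _ => mul_comm _ _)

namespace TwoScaleSystem

lemma tendstoE (h : TwoScaleSystem S Ω R εr c₁ c₂ εe η E H J E₀ H₀ J₀) {a : E3 → ℝ}
    (ha : IsTestFun a) (hs : tsupport a ⊆ Metric.ball 0 R) {v : E3 → ℂ} (hv : L2per v) (j : Fin 3) :
    Tendsto (fun n => oscPair R (η n) a (E n) j v) atTop (𝓝 (limPair R a E₀ j v)) :=
  h.convE.tendsto_oscPair h.pos h.tendsto_zero h.boundedE ha hs hv j

lemma tendstoH (h : TwoScaleSystem S Ω R εr c₁ c₂ εe η E H J E₀ H₀ J₀) {a : E3 → ℝ}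
    (ha : IsTestFun a) (hs : tsupport a ⊆ Metric.ball 0 R) {v : E3 → ℂ} (hv : L2per v) (j : Fin 3) :
    Tendsto (fun n => oscPair R (η n) a (H n) j v) atTop (𝓝 (limPair R a H₀ j v)) :=
  h.convH.tendsto_oscPair h.pos h.tendsto_zero h.boundedH ha hs hv j

lemma tendstoJ (h : TwoScaleSystem S Ω R εr c₁ c₂ εe η E H J E₀ H₀ J₀) {a : E3 → ℝ}
    (ha : IsTestFun a) (hs : tsupport a ⊆ Metric.ball 0 R) {v : E3 → ℂ} (hv : L2per v) (j : Fin 3) :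
    Tendsto (fun n => oscPair R (η n) a (J n) j v) atTop (𝓝 (limPair R a J₀ j v)) :=
  h.convJ.tendsto_oscPair h.pos h.tendsto_zero h.boundedJ ha hs hv j

lemma tendsto_ofReal (h : TwoScaleSystem S Ω R εr c₁ c₂ εe η E H J E₀ H₀ J₀) :
    Tendsto (fun n => (η n : ℂ)) atTop (𝓝 0) := by
  have := (Complex.continuous_ofReal.tendsto 0).comp h.tendsto_zero
  rwa [Complex.ofReal_zero] at this

lemma ofReal_ne_zero (h : TwoScaleSystem S Ω R εr c₁ c₂ εe η E H J E₀ H₀ J₀) (n : ℕ) :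
    (η n : ℂ) ≠ 0 := Complex.ofReal_ne_zero.2 (h.pos n).ne'

/-- The cell field `E₀(x, ·)` is curl-free. -/
lemma ae_curl_E (h : TwoScaleSystem S Ω R εr c₁ c₂ εe η E H J E₀ H₀ J₀) (i : Fin 3)
    (k : Fin 3 → ℤ) : ∀ᵐ x ∂volume.restrict Ω,
      ik k (i + 1) * fc (fun y => E₀ x y (i + 2)) k - ik k (i + 2) * fc (fun y => E₀ x y (i + 1)) k
        = 0 := by
  have hd := fun j => isDensity_cellPair h.convE.memLp_limit (l2per_em (-k)) j
  have := (((hd (i + 2)).const_mul (ik k (i + 1))).sub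
    ((hd (i + 1)).const_mul (ik k (i + 2)))).ae_eq_zero h.isOpen h.subset_ball fun a ha hs => ?_
  · simpa only [cellPair_em_neg] using this
  have hsR := hs.trans h.subset_ball
  have hsp := fun m => (tsupport_pderiv_subset a m).trans hsR
  have t1 := ((h.tendstoE ha hsR (l2per_em (-k)) (i + 2)).const_mul (ik k (i + 1))).sub
    ((h.tendstoE ha hsR (l2per_em (-k)) (i + 1)).const_mul (ik k (i + 2)))
  -- After multiplication of the equation by `η`, the derivatives of the amplitude and the magnetic
  -- field carry a factor `η` and disappear. Only the derivative in the cell variable remains.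
  have t2 := h.tendsto_ofReal.mul
    (((h.tendstoE (ha.pderiv (i + 1)) (hsp _) (l2per_em (-k)) (i + 2)).sub
      (h.tendstoE (ha.pderiv (i + 2)) (hsp _) (l2per_em (-k)) (i + 1))).add
        ((h.tendstoH ha hsR (l2per_em (-k)) i).const_mul c₁))
  rw [zero_mul] at t2
  refine tendsto_nhds_unique t1 (t2.congr fun n => ?_)
  have e := (h.curlE n).oscPair_em (η := η n) (h.convE.memLp n) ((h.convH.memLp n).const_smul c₁)
    ha hsR (-k) i
  rw [oscPair_smul, ik_neg, ik_neg] at e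
  have hn := h.ofReal_ne_zero n
  have hinv : (((η n)⁻¹ : ℝ) : ℂ) * (η n : ℂ) = 1 := by
    rw [Complex.ofReal_inv, inv_mul_cancel₀ hn]
  linear_combination (η n : ℂ) * e + (ik k (i + 1) * oscPair R (η n) a (E n) (i + 2) (em (-k))
    - ik k (i + 2) * oscPair R (η n) a (E n) (i + 1) (em (-k))) * hinv

/-- The curl of the cell field `H₀(x, ·)` is `c₂ J₀(x, ·)`. -/
lemma ae_curl_H (h : TwoScaleSystem S Ω R εr c₁ c₂ εe η E H J E₀ H₀ J₀) (i : Fin 3)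
    (k : Fin 3 → ℤ) : ∀ᵐ x ∂volume.restrict Ω,
      c₂ * fc (fun y => J₀ x y i) k = ik k (i + 1) * fc (fun y => H₀ x y (i + 2)) k
        - ik k (i + 2) * fc (fun y => H₀ x y (i + 1)) k := by
  have hd := fun j => isDensity_cellPair h.convH.memLp_limit (l2per_em (-k)) j
  have hdJ := isDensity_cellPair h.convJ.memLp_limit (l2per_em (-k)) i
  have := ((hdJ.const_mul c₂).sub (((hd (i + 2)).const_mul (ik k (i + 1))).sub
    ((hd (i + 1)).const_mul (ik k (i + 2))))).ae_eq_zero h.isOpen h.subset_ball fun a ha hs => ?_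
  · simpa only [cellPair_em_neg, sub_eq_zero] using this
  have hsR := hs.trans h.subset_ball
  have hsp := fun m => (tsupport_pderiv_subset a m).trans hsR
  have t1 := ((h.tendstoJ ha hsR (l2per_em (-k)) i).const_mul c₂).sub
    (((h.tendstoH ha hsR (l2per_em (-k)) (i + 2)).const_mul (ik k (i + 1))).sub
    ((h.tendstoH ha hsR (l2per_em (-k)) (i + 1)).const_mul (ik k (i + 2))))
  -- Here the source is `η⁻¹ J`, of the same order as the fast derivative, and survives in the
  -- limit.
  have t2 := h.tendsto_ofReal.mul
    ((h.tendstoH (ha.pderiv (i + 2)) (hsp _) (l2per_em (-k)) (i + 1)).sub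
      (h.tendstoH (ha.pderiv (i + 1)) (hsp _) (l2per_em (-k)) (i + 2)))
  rw [zero_mul] at t2
  refine tendsto_nhds_unique t1 (t2.congr fun n => ?_)
  have e := (h.curlH n).oscPair_em (η := η n) (h.convH.memLp n) ((h.convJ.memLp n).const_smul ((((η n)⁻¹ : ℝ) : ℂ) * c₂))
    ha hsR (-k) i
  rw [oscPair_smul, ik_neg, ik_neg] at e
  have hn := h.ofReal_ne_zero n
  have hinv : (((η n)⁻¹ : ℝ) : ℂ) * (η n : ℂ) = 1 := by
    rw [Complex.ofReal_inv, inv_mul_cancel₀ hn]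
  linear_combination (-(η n : ℂ)) * e - (ik k (i + 1) * oscPair R (η n) a (H n) (i + 2) (em (-k))
    - ik k (i + 2) * oscPair R (η n) a (H n) (i + 1) (em (-k))
    - c₂ * oscPair R (η n) a (J n) i (em (-k))) * hinv

/-- The cell field `H₀(x, ·)` is divergence-free. -/
lemma ae_div_H (h : TwoScaleSystem S Ω R εr c₁ c₂ εe η E H J E₀ H₀ J₀) (hc₁ : c₁ ≠ 0)
    (k : Fin 3 → ℤ) : ∀ᵐ x ∂volume.restrict Ω, ∑ i, ik k i * fc (fun y => H₀ x y i) k = 0 := by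
  have hd := fun j => (isDensity_cellPair h.convH.memLp_limit (l2per_em (-k)) j).const_mul (ik k j)
  have := (IsDensity.sum (s := Finset.univ) hd).ae_eq_zero h.isOpen h.subset_ball
    fun a ha hs => ?_
  · simpa only [cellPair_em_neg] using this
  have hsR := hs.trans h.subset_ball
  have hsp := fun m => (tsupport_pderiv_subset a m).trans hsR
  have t1 := tendsto_finsetSum Finset.univ fun i (_ : i ∈ Finset.univ) =>
    (h.tendstoH ha hsR (l2per_em (-k)) i).const_mul (ik k i)
  have t2 := h.tendsto_ofReal.mul (tendsto_finsetSum Finset.univ fun i (_ : i ∈ Finset.univ) =>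
    h.tendstoH (ha.pderiv i) (hsp i) (l2per_em (-k)) i)
  rw [zero_mul] at t2
  refine tendsto_nhds_unique t1 (t2.congr fun n => ?_)
  -- `c₁ H` is a curl, hence divergence-free; the factor `c₁ ≠ 0` is cancelled at the end.
  have e := (h.curlE n).oscPair_div (η := η n) (h.convE.memLp n) ((h.convH.memLp n).const_smul c₁)
    ha hsR (-k)
  simp only [oscPair_smul, ik_neg] at e
  have hn := h.ofReal_ne_zero n
  have hinv : (((η n)⁻¹ : ℝ) : ℂ) * (η n : ℂ) = 1 := by
    rw [Complex.ofReal_inv, inv_mul_cancel₀ hn]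
  refine mul_left_cancel₀ hc₁ ?_
  simp only [Fin.sum_univ_three] at e ⊢
  linear_combination (η n : ℂ) * e + c₁ * (ik k 0 * oscPair R (η n) a (H n) 0 (em (-k))
    + ik k 1 * oscPair R (η n) a (H n) 1 (em (-k))
    + ik k 2 * oscPair R (η n) a (H n) 2 (em (-k))) * hinv

/-- Outside the scatterers the limit current vanishes. -/
lemma ae_cellPair_J (h : TwoScaleSystem S Ω R εr c₁ c₂ εe η E H J E₀ H₀ J₀) {v : E3 → ℂ}
    (hv : L2per v) (hv0 : ∀ y, y ∈ perSet S → v y = 0) (j : Fin 3) :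
    ∀ᵐ x ∂volume.restrict Ω, cellPair (J₀ x) j v = 0 := by
  refine (isDensity_cellPair h.convJ.memLp_limit hv j).ae_eq_zero h.isOpen h.subset_ball
    fun a ha hs => ?_
  have hsR := hs.trans h.subset_ball
  -- In the matrix `J = η ε_e E` with `E` bounded. Every scatterer lies over the periodic
  -- inclusions, where `v` vanishes, so no restriction on the scale is needed.
  have t := (h.tendsto_ofReal.mul_const εe).mul (h.tendstoE ha hsR hv j)
  rw [zero_mul, zero_mul] at t
  refine tendsto_nhds_unique (h.tendstoJ ha hsR hv j) (t.congr fun n => ?_)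
  rw [← oscPair_smul]
  refine integral_congr_ae (Eventually.of_forall fun x => ?_)
  simp only
  by_cases hx : x ∈ tsupport a
  · by_cases hxS : x ∈ scatterers S Ω (η n)
    · rw [hv0 _ (mem_perSet_of_mem_scatterers (h.pos n) hxS), mul_zero, mul_zero]
    · rw [h.matrix n x (hs hx) hxS]
  · rw [image_eq_zero_of_notMem_tsupport hx, Complex.ofReal_zero, zero_mul, zero_mul, zero_mul,
      zero_mul]

/-- At small scales the pairings of the electric field with functions supported in the inclusions
are those of the current. -/
lemma eventually_oscPair_eq (h : TwoScaleSystem S Ω R εr c₁ c₂ εe η E H J E₀ H₀ J₀)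
    (hS : S ⊆ cell) {a : E3 → ℝ} (ha : IsTestFun a) (hs : tsupport a ⊆ Ω) {v : E3 → ℂ}
    (hv0 : ∀ᵐ y, y ∉ perSet S → v y = 0) (j : Fin 3) :
    ∀ᶠ n in atTop, oscPair R (η n) a (E n) j v
      = (η n : ℂ) * εr⁻¹ * oscPair R (η n) a (J n) j v := by
  -- Cells meeting the boundary of `Ω` contain no scatterer. They stay away from the compact support
  -- of `a` once the scale is small.
  obtain ⟨δ, hδ, hδS⟩ := exists_forall_mem_scatterers hS ha.2 h.isOpen hs
  filter_upwards [h.tendsto_zero.eventually_lt_const hδ] with n hn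
  rw [← oscPair_smul]
  have hq : Measure.QuasiMeasurePreserving (fun x : E3 => (η n)⁻¹ • x) volume volume := by
    refine ⟨measurable_const_smul _, ?_⟩
    rw [Measure.map_addHaar_smul _ (inv_ne_zero (h.pos n).ne')]
    exact Measure.smul_absolutelyContinuous
  refine integral_congr_ae (ae_restrict_of_ae ?_)
  filter_upwards [hq.ae hv0] with x hx
  by_cases hxS : (η n)⁻¹ • x ∈ perSet S
  · by_cases hxa : x ∈ tsupport a
    · rw [h.inclusion n x (hδS _ (h.pos n) hn x hxa hxS)]
    · rw [image_eq_zero_of_notMem_tsupport hxa, Complex.ofReal_zero, zero_mul, zero_mul, zero_mul,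
        zero_mul]
  · rw [hx hxS, mul_zero, mul_zero]

/-- In the scatterers the limit electric field vanishes. -/
lemma ae_cellPair_E (h : TwoScaleSystem S Ω R εr c₁ c₂ εe η E H J E₀ H₀ J₀) (hS : S ⊆ cell)
    {v : E3 → ℂ} (hv : L2per v) (hv0 : ∀ᵐ y, y ∉ perSet S → v y = 0) (j : Fin 3) :
    ∀ᵐ x ∂volume.restrict Ω, cellPair (E₀ x) j v = 0 := by
  refine (isDensity_cellPair h.convE.memLp_limit hv j).ae_eq_zero h.isOpen h.subset_ball
    fun a ha hs => ?_
  have hsR := hs.trans h.subset_ball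
  -- In the scatterers `E = η ε_r⁻¹ J` with `J` bounded.
  have t := (h.tendsto_ofReal.mul_const εr⁻¹).mul (h.tendstoJ ha hsR hv j)
  rw [zero_mul, zero_mul] at t
  exact tendsto_nhds_unique (h.tendstoE ha hsR hv j)
    (t.congr' ((h.eventually_oscPair_eq hS ha hs hv0 j).mono fun n hn => hn.symm))

end TwoScaleSystem

end

section

/-! ### The cell problem satisfied by the two-scale limits -/

variable {S Ω : Set E3} {R : ℝ} {εr c₁ c₂ εe : ℂ} {η : ℕ → ℝ} {E H J : ℕ → E3 → C3}
  {E₀ H₀ J₀ : E3 → E3 → C3}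

/-- A curl-free periodic field vanishing in `S` has zero mean vector product with the fields of
`X0`. -/
lemma cellPair_cross_eq (hS : IsInclusion S) {u v : E3 → C3} (hu : ∀ j, L2per fun y => u y j)
    (hc : ∀ i k, ik k (i + 1) * fc (fun y => u y (i + 2)) k
      - ik k (i + 2) * fc (fun y => u y (i + 1)) k = 0)
    (hu0 : ∀ j, ∀ᵐ y, y ∈ perSet S → u y j = 0) (hv : X0 S v) (m : Fin 3) :
    cellPair u (m + 1) (fun y => v y (m + 2)) = cellPair u (m + 2) fun y => v y (m + 1) := by
  -- Where `u` may be nonzero, `v` is the periodic gradient `∇ψ`, with no constant because its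
  -- circulation vanishes. In Fourier series the vector product with a gradient brings out the curl
  -- of `u`.
  obtain ⟨ψ, hψ, hvψ⟩ := hv.circulation_zero
  have e : ∀ j i, cellPair u j (fun y => v y i) = ∫ y in cell, u y j * grad ψ y i := by
    intro j i
    refine integral_congr_ae ((ae_restrict_iff' measurableSet_cell).2 ?_)
    filter_upwards [(ae_restrict_iff' hS.isOpen_compl.measurableSet).1 hvψ, hu0 j] with y h1 h2 hy
    by_cases hyS : y ∈ S
    · simp only [h2 ⟨y, hyS, rfl⟩, zero_mul]
    · simp only [h1 ⟨hy, hyS⟩, add_zero]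
  rw [e, e]
  refine (hasSum_fc_mul_fc (hu _) (hψ.l2per_grad _)).unique
    ((hasSum_fc_mul_fc (hu _) (hψ.l2per_grad _)).congr_fun fun k => ?_)
  have h := hc m (-k)
  rw [ik_neg, ik_neg] at h
  rw [fc_grad hψ, fc_grad hψ]
  linear_combination fc ψ k * h

namespace TwoScaleSystem

/-- The exponentials restricted to the inclusions are countably many, so one null set of `x` serves
for all of them, and together they determine the slice there. -/
lemma ae_E_eq_zero (h : TwoScaleSystem S Ω R εr c₁ c₂ εe η E H J E₀ H₀ J₀) (hS : IsInclusion S) :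
    ∀ᵐ x ∂volume.restrict Ω, ∀ j, ∀ᵐ y, y ∈ perSet S → E₀ x y j = 0 := by
  have hm := measurableSet_perSet hS.isCompact
  have hp : ∀ y k, y + latt k ∈ perSet S ↔ y ∈ perSet S := fun y k => add_latt_mem_perSet_iff k
  have h1 := ae_all_iff.2 fun k => ae_all_iff.2 fun j =>
    h.ae_cellPair_E hS.subset_cell ((l2per_em k).indicator hm hp)
      (Eventually.of_forall fun y hy => indicator_of_notMem hy _) j
  filter_upwards [h1, ae_l2per_slice h.subset_ball h.convE.memLp_limit h.convE.periodic]
    with x hx hL j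
  exact ae_eq_zero_of_cellPair_indicator hL hm hp j fun k => hx k j

lemma ae_J_eq_zero (h : TwoScaleSystem S Ω R εr c₁ c₂ εe η E H J E₀ H₀ J₀) (hS : IsInclusion S) :
    ∀ᵐ x ∂volume.restrict Ω, ∀ j, ∀ᵐ y, y ∉ perSet S → J₀ x y j = 0 := by
  have hm := (measurableSet_perSet hS.isCompact).compl
  have hp : ∀ y k, y + latt k ∈ (perSet S)ᶜ ↔ y ∈ (perSet S)ᶜ := fun y k =>
    not_congr (add_latt_mem_perSet_iff k)
  have h1 := ae_all_iff.2 fun k => ae_all_iff.2 fun j =>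
    h.ae_cellPair_J ((l2per_em k).indicator hm hp)
      (fun y hy => indicator_of_notMem (not_not_intro hy) _) j
  filter_upwards [h1, ae_l2per_slice h.subset_ball h.convJ.memLp_limit h.convJ.periodic]
    with x hx hL j
  exact ae_eq_zero_of_cellPair_indicator hL hm hp j fun k => hx k j

/-- The limit form of the Maxwell system tested with an oscillating field of `X0`. -/
theorem ae_weakForm (h : TwoScaleSystem S Ω R εr c₁ c₂ εe η E H J E₀ H₀ J₀) (hS : IsInclusion S)
    (hεr : εr ≠ 0) {v : E3 → C3} (hv : X0 S v) :
    ∀ᵐ x ∂volume.restrict Ω, ∑ j, cellPair (J₀ x) j (fun y => curl v y j)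
      = εr * c₁ * ∑ i, cellPair (H₀ x) i fun y => v y i := by
  have hvs := hv.sobolev
  have hcS : ∀ j, ∀ᵐ y, y ∉ perSet S → curl v y j = 0 := fun j => by
    refine ae_of_ae_cell_perSet hS.subset_cell (l2per_curl hvs j) hS.isCompact ?_
    refine (ae_restrict_iff' measurableSet_cell).2 ?_
    filter_upwards [(ae_restrict_iff' hS.isOpen_compl.measurableSet).1 hv.curlFree] with y hy hc hyS
    rw [hy ⟨hc, hyS⟩, PiLp.zero_apply]
  have dJ := IsDensity.sum (s := Finset.univ) fun j =>
    isDensity_cellPair h.convJ.memLp_limit (l2per_curl hvs j) j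
  have dH := IsDensity.sum (s := Finset.univ) fun j =>
    isDensity_cellPair h.convH.memLp_limit (hvs.l2per j) j
  have := (dJ.sub (dH.const_mul (εr * c₁))).ae_eq_zero h.isOpen h.subset_ball fun a ha hs => ?_
  · simpa only [sub_eq_zero] using this
  have hsR := hs.trans h.subset_ball
  have hsp := fun m => (tsupport_pderiv_subset a m).trans hsR
  -- The limit of the term where the derivative falls on the amplitude is a vector product of `E₀`
  -- and `v`, whose cell mean is zero.
  have hcross : ∀ m : Fin 3, limPair R (pderiv m a) E₀ (m + 1) (fun y => v y (m + 2))
      = limPair R (pderiv m a) E₀ (m + 2) fun y => v y (m + 1) := by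
    intro m
    have hcE := ae_all_iff.2 fun i => ae_all_iff.2 fun k => h.ae_curl_E i k
    have h1 : ∀ᵐ x ∂volume.restrict Ω, cellPair (E₀ x) (m + 1) (fun y => v y (m + 2))
        = cellPair (E₀ x) (m + 2) fun y => v y (m + 1) := by
      filter_upwards [hcE, h.ae_E_eq_zero hS,
        ae_l2per_slice h.subset_ball h.convE.memLp_limit h.convE.periodic] with x hx1 hx2 hx3
      exact cellPair_cross_eq hS hx3 hx1 hx2 hv m
    refine integral_congr_ae (ae_restrict_of_ae ?_)
    filter_upwards [(ae_restrict_iff' h.isOpen.measurableSet).1 h1] with x hx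
    by_cases hxΩ : x ∈ Ω
    · rw [hx hxΩ]
    · rw [image_eq_zero_of_notMem_tsupport fun hxs => hxΩ (hs (tsupport_pderiv_subset a m hxs)),
        Complex.ofReal_zero, zero_mul, zero_mul]
  have t1 := (tendsto_finsetSum Finset.univ fun j (_ : j ∈ Finset.univ) =>
    h.tendstoJ ha hsR (l2per_curl hvs j) j).sub
    ((tendsto_finsetSum Finset.univ fun j (_ : j ∈ Finset.univ) =>
      h.tendstoH ha hsR (hvs.l2per j) j).const_mul (εr * c₁))
  have t2 := (tendsto_finsetSum Finset.univ fun i (_ : i ∈ Finset.univ) =>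
    (h.tendstoE (ha.pderiv (i + 1)) (hsp _) (hvs.l2per i) (i + 2)).sub
      (h.tendstoE (ha.pderiv (i + 2)) (hsp _) (hvs.l2per i) (i + 1))).const_mul εr
  have e0 : ∑ i : Fin 3, (limPair R (pderiv (i + 1) a) E₀ (i + 2) (fun y => v y i)
      - limPair R (pderiv (i + 2) a) E₀ (i + 1) fun y => v y i) = 0 := by
    have h0 := hcross 0
    have h1 := hcross 1
    have h2 := hcross 2
    simp only [Fin.sum_univ_three, Fin.isValue, show (0 : Fin 3) + 1 = 1 from rfl,
      show (0 : Fin 3) + 2 = 2 from rfl,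
      show (1 : Fin 3) + 1 = 2 from rfl, show (1 : Fin 3) + 2 = 0 from rfl,
      show (2 : Fin 3) + 1 = 0 from rfl, show (2 : Fin 3) + 2 = 1 from rfl] at h0 h1 h2 ⊢
    linear_combination h0 + h1 + h2
  rw [e0, mul_zero] at t2
  refine tendsto_nhds_unique t1 (t2.congr' ?_)
  filter_upwards [eventually_all.2 fun j => h.eventually_oscPair_eq hS.subset_cell ha hs (hcS j) j]
    with n hn
  -- The singular term `η⁻¹ ∫ a E · curl v` has a finite limit: `curl v` is supported in the
  -- inclusions, where `E = η ε_r⁻¹ J` absorbs the factor `η⁻¹`.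
  have e := (h.curlE n).oscPair_field (η := η n) (h.convE.memLp n)
    ((h.convH.memLp n).const_smul c₁) ha hsR (h.pos n) hvs
  simp only [oscPair_smul, hn, ← Finset.mul_sum] at e
  have hn0 := h.ofReal_ne_zero n
  have hinv : (((η n)⁻¹ : ℝ) : ℂ) * (η n : ℂ) = 1 := by
    rw [Complex.ofReal_inv, inv_mul_cancel₀ hn0]
  have hinv' : εr * εr⁻¹ = 1 := mul_inv_cancel₀ hεr
  set X := ∑ j, oscPair R (η n) a (J n) j (fun y => curl v y j)
  linear_combination εr * e + (εr * εr⁻¹ * X) * hinv + X * hinv'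

end TwoScaleSystem

/-- An identity between continuous functionals of the fields and their curls needs to be checked
on a dense sequence only. -/
lemma forall_curlPair_of_denseSeq (hS : IsInclusion S) {χ : Fin 3 → E3 → ℂ} (hχ : IsCircWeight S χ)
    {u w : E3 → C3} (hu : ∀ j, L2per fun y => u y j) (hw : ∀ j, L2per fun y => w y j) (c : ℂ)
    (p : ℕ → curlSpace S (weightL2 hχ)) (hp : DenseRange p)
    (h : ∀ m, ∑ j, cellPair w j (pairCurl (p m) j)
      = c * ∑ j, cellPair u j fun y => pairField (p m) y j) {v : E3 → C3} {K : Fin 3 → E3 → ℂ}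
    (hv : CurlPair S χ v K) :
    ∑ j, cellPair w j (K j) = c * ∑ j, cellPair u j fun y => v y j := by
  -- Pairings with a fixed field are inner products, so both sides of the identity are continuous on
  -- the space of pairs.
  have e : ∀ {g : E3 → C3} (hg : ∀ j, L2per fun y => g y j) (j : Fin 3) (F : L2T),
      cellPair g j (fun y => F (toTorus y)) = inner ℂ (toL2T _ (hg j).conj) F := by
    intro g hg j F
    rw [inner_L2T]
    refine integral_congr_ae (ae_restrict_of_ae ?_)
    filter_upwards [(hg j).conj.ae_eq_toL2T] with y hy
    rw [← hy, Complex.conj_conj, mul_comm]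
  have hc : ∀ q : curlSpace S (weightL2 hχ), ∑ j, cellPair w j (pairCurl q j)
      = c * ∑ j, cellPair u j fun y => pairField q y j := by
    have := hp.equalizer
      (g := fun q : curlSpace S (weightL2 hχ) => ∑ j, cellPair w j (pairCurl q j))
      (h := fun q : curlSpace S (weightL2 hχ) => c * ∑ j, cellPair u j fun y => pairField q y j)
      ?_ ?_ (funext h)
    · exact fun q => congrFun this q
    · have e' : ∀ (q : curlSpace S (weightL2 hχ)) j, cellPair w j (pairCurl q j)
          = inner ℂ (toL2T _ (hw j).conj) (pairProj (Sum.inr j) q) := fun q j => e hw j _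
      simp only [e']
      fun_prop
    · have e' : ∀ (q : curlSpace S (weightL2 hχ)) j, cellPair u j (fun y => pairField q y j)
          = inner ℂ (toL2T _ (hu j).conj) (pairProj (Sum.inl j) q) := fun q j => e hu j _
      simp only [e']
      fun_prop
  obtain ⟨q, hq, hvq, hKq⟩ := hv.exists_pair hS hχ
  have e1 : ∀ j, cellPair w j (K j) = cellPair w j (pairCurl q j) := fun j =>
    integral_congr_ae (ae_restrict_of_ae ((hKq j).mono fun y hy => by simp only [hy]))
  have e2 : ∀ j, cellPair u j (fun y => v y j) = cellPair u j fun y => pairField q y j := fun j =>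
    integral_congr_ae (ae_restrict_of_ae (hvq.mono fun y hy => by simp only [hy]))
  simp only [e1, e2]
  exact hc ⟨q, hq⟩

end

section

/-! ### Identification of the two-scale limits -/

variable {S Ω : Set E3} {R k₀ : ℝ} {εr c₁ c₂ εe : ℂ} {η : ℕ → ℝ} {E H J : ℕ → E3 → C3}
  {E₀ H₀ J₀ : E3 → E3 → C3} {χ : Fin 3 → E3 → ℂ}

instance separableSpace_curlSpace (S : Set E3) (χ : Fin 3 → L2T) :
    TopologicalSpace.SeparableSpace (curlSpace S χ) := by
  have : Fact ((2 : ENNReal) ≠ ⊤) := ⟨by norm_num⟩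
  have : TopologicalSpace.SeparableSpace L2T := inferInstance
  have : SecondCountableTopology L2T := UniformSpace.secondCountable_of_separable L2T
  have : SecondCountableTopology PairSpace := PiLp.secondCountableTopology ..
  have : SecondCountableTopology (curlSpace S χ) := TopologicalSpace.Subtype.secondCountableTopology _
  infer_instance

/-- The candidate for the circulation vector of a cell field. -/
def weightMean (χ : Fin 3 → E3 → ℂ) (u : E3 → C3) : C3 := WithLp.toLp 2 fun i => cellPair u i (χ i)

lemma weightMean_apply (u : E3 → C3) (i : Fin 3) : weightMean χ u i = cellPair u i (χ i) := rfl

lemma ik_mul_fc_sub_const {f : E3 → ℂ} (hf : L2per f) (c : ℂ) (k : Fin 3 → ℤ) (i : Fin 3) :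
    ik k i * fc (fun y => f y - c) k = ik k i * fc f k := by
  rw [fc_sub hf (l2per_const c)]
  by_cases hk : k = 0
  · rw [hk, ik_zero, zero_mul, zero_mul]
  · rw [fc_const _ hk, sub_zero]

/-- The cell problem in terms of the field `w` and its curl. -/
lemma isCorrector_of_weakForm (hS : IsInclusion S) (hχ : IsCircWeight S χ) {w : E3 → C3}
    {K : Fin 3 → E3 → ℂ} (hw : ∀ j, L2per fun y => w y j) (hK : ∀ i, L2per (K i))
    (hcurl : ∀ i k, fc (K i) k = ik k (i + 1) * fc (fun y => w y (i + 2)) k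
      - ik k (i + 2) * fc (fun y => w y (i + 1)) k)
    (hdiv : ∀ k, ∑ i, ik k i * fc (fun y => w y i) k = 0)
    (hsupp : ∀ i, ∀ᵐ y ∂volume.restrict cell, y ∉ S → K i y = 0)
    (hweak : ∀ v, X0div S v → ∑ j, ∫ y in cell, K j y * curl v y j
      = εr * (k₀ : ℂ) ^ 2 * ∑ j, ∫ y in cell, w y j * v y j) :
    IsCorrector S εr k₀ (weightMean χ w) fun y => w y - weightMean χ w := by
  -- With this `z` the weighted means of `w - z` vanish, which is the condition of zero circulation
  -- in `CurlPair`.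
  set z := weightMean χ w with hz
  have hp : CurlPair S χ (fun y => w y - z) K := by
    refine ⟨fun j => (hw j).sub (l2per_const (z j)), hK, fun i k => ?_, fun k => ?_, hsupp,
      fun i => ?_⟩
    · simp only [PiLp.sub_apply, ik_mul_fc_sub_const (hw _), hcurl]
    · simp only [PiLp.sub_apply, ik_mul_fc_sub_const (hw _), hdiv]
    · simp only [PiLp.sub_apply, mul_sub]
      rw [integral_sub ((hχ.l2per i).integrable_mul (hw i))
        ((hχ.l2per i).integrable_mul (l2per_const _)), integral_mul_const, hχ.integral_one, one_mul,
        hz, weightMean_apply, cellPair, sub_eq_zero]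
      exact integral_congr_ae (Eventually.of_forall fun y => mul_comm _ _)
  refine ⟨hp.x0div hS hχ, fun v hv => ?_⟩
  have hvs := hv.sobolev
  have h1 := hweak _ hv.conjVec
  have e1 : ∀ j, ∫ y in cell, K j y * curl (fun y => conjVec (v y)) y j
      = ∫ y in cell, K j y * conj (curl v y j) := fun j =>
    integral_congr_ae (ae_restrict_of_ae ((curl_conjVec_ae hvs).mono fun y hy => by
      simp only [hy, conjVec_apply]))
  simp only [e1, conjVec_apply] at h1
  rw [hp.setIntegral_curl hS hχ (hv.curlPair hS hχ), h1, integral_dot_conjVec hp.l2u hvs.l2per,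
    integral_dot_conjVec (fun j => l2per_const (z j)) hvs.l2per, sub_eq_iff_eq_add, ← mul_add,
    ← Finset.sum_add_distrib]
  congr 1
  refine Finset.sum_congr rfl fun j _ => ?_
  rw [← integral_add ((l2per_const (z j)).integrable_mul (hvs.l2per j).conj)
    ((hp.l2u j).integrable_mul (hvs.l2per j).conj)]
  refine integral_congr_ae (Eventually.of_forall fun y => ?_)
  simp only [PiLp.sub_apply]
  ring

/-- For almost every `x` the cell field `H₀(x, ·)` solves the cell problem and its curl is the cell
current. -/
theorem TwoScaleSystem.ae_isCorrector (h : TwoScaleSystem S Ω R εr c₁ c₂ εe η E H J E₀ H₀ J₀)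
    (hS : IsInclusion S) (hχ : IsCircWeight S χ) (hεr : εr ≠ 0) (hc₁ : c₁ ≠ 0)
    (hk₀ : c₁ * c₂ = (k₀ : ℂ) ^ 2) :
    ∀ᵐ x ∂volume.restrict Ω,
      IsCorrector S εr k₀ (weightMean χ (H₀ x)) (fun y => H₀ x y - weightMean χ (H₀ x)) ∧
      (∀ j, L2per fun y => J₀ x y j) ∧
      ∀ i k, fc (fun y => c₂ * J₀ x y i) k = ik k (i + 1) * fc (fun y => H₀ x y (i + 2)) k
        - ik k (i + 2) * fc (fun y => H₀ x y (i + 1)) k := by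
  -- The null set of `x` where the cell equation fails depends on the test field. It is discarded
  -- for a dense sequence of test fields, and continuity in the test field gives the others.
  set p := TopologicalSpace.denseSeq (curlSpace S (weightL2 hχ))
  have hp : ∀ m, CurlPair S χ (pairField (p m)) (pairCurl (p m)) := fun m =>
    (mem_curlSpace_iff hS hχ _).1 (p m).2
  filter_upwards [ae_l2per_slice h.subset_ball h.convH.memLp_limit h.convH.periodic,
    ae_l2per_slice h.subset_ball h.convJ.memLp_limit h.convJ.periodic,
    ae_all_iff.2 fun i => ae_all_iff.2 fun k => h.ae_curl_H i k,
    ae_all_iff.2 fun k => h.ae_div_H hc₁ k, h.ae_J_eq_zero hS,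
    ae_all_iff.2 fun m => h.ae_weakForm hS hεr ((hp m).x0div hS hχ).toX0]
    with x hH hJ hcurl hdiv hsupp hweak
  have hcurl' : ∀ i k, fc (fun y => c₂ * J₀ x y i) k = ik k (i + 1) * fc (fun y => H₀ x y (i + 2)) k
      - ik k (i + 2) * fc (fun y => H₀ x y (i + 1)) k := fun i k => by rw [fc_const_mul, hcurl]
  refine ⟨isCorrector_of_weakForm hS hχ hH (fun i => (hJ i).const_mul c₂) hcurl' hdiv
    (fun i => ?_) (fun v hv => ?_), hJ, hcurl'⟩
  · filter_upwards [ae_restrict_of_ae (hsupp i), ae_restrict_mem measurableSet_cell] with y h1 hy hyS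
    rw [h1 (mt (mem_perSet_iff_of_mem_cell hS.subset_cell hy).1 hyS), mul_zero]
  · have h1 := forall_curlPair_of_denseSeq hS hχ hH hJ (εr * c₁) p
      (TopologicalSpace.denseRange_denseSeq _) (fun m => by
        rw [← hweak m]
        refine Finset.sum_congr rfl fun j _ => integral_congr_ae (ae_restrict_of_ae ?_)
        filter_upwards [(hp m).curl_ae] with y hy
        rw [hy]) (hv.curlPair hS hχ)
    have e : ∀ j, ∫ y in cell, c₂ * J₀ x y j * curl v y j
        = c₂ * cellPair (J₀ x) j fun y => curl v y j := fun j => by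
      rw [cellPair, ← integral_const_mul]
      refine integral_congr_ae (Eventually.of_forall fun y => ?_)
      simp only
      ring
    simp only [e, ← Finset.mul_sum]
    rw [h1, ← hk₀]
    simp only [cellPair]
    ring

/-- The shape fields are Sobolev fields. -/
lemma w12perVec_shapeH (hS : IsInclusion S) (hεr : 0 < εr.im) (hk₀ : k₀ ≠ 0) (k : Fin 3) :
    W12perVec (shapeH S εr k₀ k) :=
  (w12perVec_const _).add (corrector_spec hS hεr hk₀ k).1.1.sobolev

lemma curl_shapeSum_ae (hS : IsInclusion S) (hεr : 0 < εr.im) (hk₀ : k₀ ≠ 0) (z : C3) :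
    ∀ᵐ y, curl (shapeSum S εr k₀ z) y = ∑ k, z k • shapeJ S εr k₀ k y := by
  have hW := fun k => w12perVec_shapeH hS hεr hk₀ k
  have e : shapeSum S εr k₀ z = fun y => z 0 • shapeH S εr k₀ 0 y + z 1 • shapeH S εr k₀ 1 y
      + z 2 • shapeH S εr k₀ 2 y := funext fun y => Fin.sum_univ_three _
  rw [e]
  filter_upwards [curl_add_ae (((hW 0).const_smul (z 0)).add ((hW 1).const_smul (z 1)))
      ((hW 2).const_smul (z 2)),
    curl_add_ae ((hW 0).const_smul (z 0)) ((hW 1).const_smul (z 1)),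
    curl_const_smul_ae (hW 0) (z 0), curl_const_smul_ae (hW 1) (z 1),
    curl_const_smul_ae (hW 2) (z 2)] with y h1 h2 h3 h4 h5
  rw [h1, h2, h3, h4, h5, Fin.sum_univ_three]
  rfl

lemma w12perVec_shapeSum (hS : IsInclusion S) (hεr : 0 < εr.im) (hk₀ : k₀ ≠ 0) (z : C3) :
    W12perVec (shapeSum S εr k₀ z) := by
  have e : shapeSum S εr k₀ z = fun y => z + ∑ k, z k • corrector S εr k₀ k y :=
    funext fun y => shapeSum_eq z y
  rw [e]
  exact (w12perVec_const z).add (isCorrector_sum hS hεr hk₀ z).1.sobolev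

/-- The slices of the two-scale limits in terms of the shape fields. -/
theorem TwoScaleSystem.ae_slice (h : TwoScaleSystem S Ω R εr c₁ c₂ εe η E H J E₀ H₀ J₀)
    (hS : IsInclusion S) (hχ : IsCircWeight S χ) (hεr : 0 < εr.im) (hc₁ : c₁ ≠ 0) (hc₂ : c₂ ≠ 0)
    (hk : c₁ * c₂ = (k₀ : ℂ) ^ 2) (hk₀ : k₀ ≠ 0) :
    ∀ᵐ x ∂volume.restrict Ω,
      (∀ z, IsCirculation S (H₀ x) z ↔ z = weightMean χ (H₀ x)) ∧
      H₀ x =ᵐ[volume] shapeSum S εr k₀ (weightMean χ (H₀ x)) ∧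
      J₀ x =ᵐ[volume] fun y => ∑ k, (c₂⁻¹ * weightMean χ (H₀ x) k) • shapeJ S εr k₀ k y := by
  have hεr0 : εr ≠ 0 := fun h0 => by simp [h0] at hεr
  filter_upwards [h.ae_isCorrector hS hχ hεr0 hc₁ hk] with x hx
  set z := weightMean χ (H₀ x)
  have e1 : H₀ x =ᵐ[volume] shapeSum S εr k₀ z := ae_eq_shapeSum hS hεr hk₀ hx.1
    (Eventually.of_forall fun y => (add_sub_cancel z (H₀ x y)).symm)
  refine ⟨fun z' => isCirculation_iff_of_ae_eq hS hεr hk₀ e1 z', e1, ?_⟩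
  have hW : W12perVec (H₀ x) := fun j =>
    (w12perVec_shapeSum hS hεr hk₀ z j).congr (e1.mono fun y hy => by simp only [hy])
  -- The curl of `H₀(x, ·)` is `c₂ J₀(x, ·)` on one side and `∑ z_k J^k` on the other.
  filter_upwards [curl_ae_eq hW (fun i => (hx.2.1 i).const_mul c₂) hx.2.2,
    curl_shapeSum_ae hS hεr hk₀ z] with y h1 h2
  rw [← curl_congr e1] at h2
  simp only [mul_smul, ← Finset.smul_sum]
  rw [← h2]
  ext i
  rw [PiLp.smul_apply, h1, smul_eq_mul, inv_mul_cancel_left₀ hc₂]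

end

section

/-! ### From slices to the product, and from Maxwell's equations to the limit system -/

variable {S Ω : Set E3} {R k₀ : ℝ} {εr c₁ c₂ : ℂ}

/-- Tonelli. Joint measurability cannot be dropped when passing from slices to the product. -/
lemma ae_prod_of_ae_ae {F : E3 × E3 → C3}
    (hF : AEStronglyMeasurable F ((volume.restrict Ω).prod (volume.restrict cell)))
    (h : ∀ᵐ x ∂volume.restrict Ω, ∀ᵐ y, F (x, y) = 0) :
    ∀ᵐ p ∂volume.restrict (Ω ×ˢ cell), F p = 0 := by
  rw [Measure.volume_eq_prod, ← Measure.prod_restrict]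
  have h1 : ∫⁻ p, ‖F p‖ₑ ∂((volume.restrict Ω).prod (volume.restrict cell)) = 0 := by
    rw [lintegral_prod _ hF.enorm]
    refine (lintegral_congr_ae (h.mono fun x hx => ?_)).trans lintegral_zero
    refine (lintegral_congr_ae (ae_restrict_of_ae (hx.mono fun y hy => ?_))).trans lintegral_zero
    simp only [hy, enorm_zero]
  filter_upwards [(lintegral_eq_zero_iff' hF.enorm).1 h1] with p hp
  simpa using hp

/-- The circulation vector is defined by a choice, which says nothing about measurability in `x`;
the weighted mean is a Fubini integral and so is measurable. -/
lemma aestronglyMeasurable_weightMean {χ : Fin 3 → E3 → ℂ} (hχ : IsCircWeight S χ)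
    {f₀ : E3 → E3 → C3} (hΩR : Ω ⊆ Metric.ball 0 R)
    (h : MemLp (fun p : E3 × E3 => f₀ p.1 p.2) 2 (volume.restrict (Metric.ball 0 R ×ˢ cell)))
    (k : Fin 3) : AEStronglyMeasurable (fun x => weightMean χ (f₀ x) k) (volume.restrict Ω) :=
  (integrable_cellPair h (hχ.l2per k) k).1.mono_measure (Measure.restrict_mono hΩR le_rfl)

lemma aestronglyMeasurable_shapeJ (hS : IsInclusion S) (hεr : 0 < εr.im) (hk₀ : k₀ ≠ 0)
    (k : Fin 3) : AEStronglyMeasurable (shapeJ S εr k₀ k) volume := by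
  have h : AEMeasurable (fun y => WithLp.toLp 2 fun j => curl (shapeH S εr k₀ k) y j) volume :=
    (WithLp.measurable_toLp 2 _).comp_aemeasurable (aemeasurable_pi_lambda _ fun j =>
      (l2per_curl (w12perVec_shapeH hS hεr hk₀ k) j).aestronglyMeasurable.aemeasurable)
  exact h.aestronglyMeasurable

/-- An expansion with measurable coefficients that holds on almost every slice holds almost
everywhere. -/
lemma ae_prod_eq_sum {f₀ : E3 → E3 → C3} {z c : E3 → Fin 3 → ℂ} {B : Fin 3 → E3 → C3}
    (hΩR : Ω ⊆ Metric.ball 0 R)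
    (hf : MemLp (fun p : E3 × E3 => f₀ p.1 p.2) 2 (volume.restrict (Metric.ball 0 R ×ˢ cell)))
    (hz : ∀ k, AEStronglyMeasurable (fun x => z x k) (volume.restrict Ω))
    (hB : ∀ k, AEStronglyMeasurable (B k) volume) (hc : ∀ᵐ x ∂volume.restrict Ω, c x = z x)
    (h : ∀ᵐ x ∂volume.restrict Ω, f₀ x =ᵐ[volume] fun y => ∑ k, z x k • B k y) :
    ∀ᵐ p ∂volume.restrict (Ω ×ˢ cell), f₀ p.1 p.2 = ∑ k, c p.1 k • B k p.2 := by
  have hfm : AEStronglyMeasurable (fun p : E3 × E3 => f₀ p.1 p.2)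
      ((volume.restrict Ω).prod (volume.restrict cell)) := by
    rw [Measure.prod_restrict, ← Measure.volume_eq_prod]
    exact hf.1.mono_measure (Measure.restrict_mono (prod_mono hΩR subset_rfl) le_rfl)
  have hm : AEStronglyMeasurable (fun p : E3 × E3 => f₀ p.1 p.2 - ∑ k, z p.1 k • B k p.2)
      ((volume.restrict Ω).prod (volume.restrict cell)) :=
    hfm.sub (Finset.aestronglyMeasurable_fun_sum _ fun k _ =>
      (hz k).comp_fst.smul (hB k).restrict.comp_snd)
  have h1 := ae_prod_of_ae_ae hm (h.mono fun x hx => hx.mono fun y hy => by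
    simp only [hy, sub_self])
  have h2 : ∀ᵐ p ∂volume.restrict (Ω ×ˢ cell), c (p : E3 × E3).1 = z p.1 := by
    rw [Measure.volume_eq_prod, ← Measure.prod_restrict]
    exact Measure.quasiMeasurePreserving_fst.ae hc
  filter_upwards [h1, h2] with p hp hcp
  rw [hcp]
  exact sub_eq_zero.1 hp

lemma IsWeakCurl.weakCurlOn {U G : E3 → C3} (h : IsWeakCurl U G) : WeakCurlOn R U G := by
  intro φ hφ hs i
  have hz : ∀ x, x ∉ Metric.ball (0 : E3) R → φ x = 0 := fun x hx =>
    image_eq_zero_of_notMem_tsupport fun h => hx (hs h)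
  have hz' : ∀ j x, x ∉ Metric.ball (0 : E3) R → pderiv j φ x = 0 := fun j x hx =>
    image_eq_zero_of_notMem_tsupport fun h => hx (hs (tsupport_pderiv_subset φ j h))
  rw [integral_ball_eq_integral fun x hx => by
      rw [hz' _ x hx, hz' _ x hx, Complex.ofReal_zero, zero_mul, zero_mul, sub_zero],
    integral_ball_eq_integral fun x hx => by rw [hz x hx, Complex.ofReal_zero, zero_mul]]
  exact h φ hφ i

lemma permittivity_of_mem (hS : S ⊆ cell) {εe θ : ℝ} {x : E3} (hx : x ∈ scatterers S Ω θ) :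
    permittivity S Ω εr εe θ x = εr / (θ : ℂ) ^ 2 := by
  have hxΩ := scatterers_subset hS θ hx
  rw [permittivity, indicator_of_mem hx, indicator_of_notMem (notMem_sdiff_of_mem hx),
    indicator_of_notMem (notMem_compl_iff.2 hxΩ), add_zero, add_zero]

lemma permittivity_of_notMem {εe θ : ℝ} {x : E3} (hxΩ : x ∈ Ω) (hx : x ∉ scatterers S Ω θ) :
    permittivity S Ω εr εe θ x = εe := by
  rw [permittivity, indicator_of_notMem hx, indicator_of_mem (mem_sdiff_of_mem hxΩ hx),
    indicator_of_notMem (notMem_compl_iff.2 hxΩ), add_zero, zero_add]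

/-- Two-scale convergent solutions of the Maxwell system form a two-scale system. -/
lemma twoScaleSystem_of_maxwell (hS : S ⊆ cell) (hεr : εr ≠ 0) {ω ε₀ μ₀ εe : ℝ} {η : ℕ → ℝ}
    {E H : ℕ → E3 → C3} {E₀ H₀ J₀ : E3 → E3 → C3} (hΩ : IsOpen Ω)
    (hΩR : closure Ω ⊆ Metric.ball 0 R) (hη : ∀ n, 0 < η n) (hη0 : Tendsto η atTop (𝓝 0))
    (hM : ∀ n, Maxwell ω ε₀ μ₀ (permittivity S Ω εr εe (η n)) (E n) (H n))
    (bE : BoundedL2 (Metric.ball 0 R) E) (bH : BoundedL2 (Metric.ball 0 R) H)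
    (bJ : BoundedL2 (Metric.ball 0 R)
      fun n => current (η n) (permittivity S Ω εr εe (η n)) (E n))
    (cE : TwoScaleConv (Metric.ball 0 R) η E E₀) (cH : TwoScaleConv (Metric.ball 0 R) η H H₀)
    (cJ : TwoScaleConv (Metric.ball 0 R) η
      (fun n => current (η n) (permittivity S Ω εr εe (η n)) (E n)) J₀) :
    TwoScaleSystem S Ω R εr (Complex.I * ω * μ₀) (-(Complex.I * ω * ε₀)) εe η E H
      (fun n => current (η n) (permittivity S Ω εr εe (η n)) (E n)) E₀ H₀ J₀ where
  isOpen := hΩ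
  subset_ball := subset_closure.trans hΩR
  pos := hη
  tendsto_zero := hη0
  boundedE := bE
  boundedH := bH
  boundedJ := bJ
  convE := cE
  convH := cH
  convJ := cJ
  curlE n := (hM n).curl_E.weakCurlOn
  curlH n := by
    -- Since `J = η ε E`, the source `ε E` is `η⁻¹ J`.
    have e : (fun x => (-(Complex.I * ω * ε₀) * permittivity S Ω εr εe (η n) x) • E n x)
        = fun x => (((η n)⁻¹ : ℝ) * -(Complex.I * ω * ε₀)) •
          current (η n) (permittivity S Ω εr εe (η n)) (E n) x := by
      funext x
      have hn : (η n : ℂ) ≠ 0 := Complex.ofReal_ne_zero.2 (hη n).ne'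
      rw [current, smul_smul, Complex.ofReal_inv]
      congr 1
      field_simp
    rw [← e]
    exact (hM n).curl_H.weakCurlOn
  matrix n x hx hxS := by rw [current, permittivity_of_notMem hx hxS]
  inclusion n x hx := by
    have hn : (η n : ℂ) ≠ 0 := Complex.ofReal_ne_zero.2 (hη n).ne'
    rw [current, permittivity_of_mem hS hx, smul_smul]
    have : (η n : ℂ) * εr⁻¹ * ((η n : ℂ) * (εr / (η n : ℂ) ^ 2)) = 1 := by field_simp
    rw [this, one_smul]

end

end CellProblem

end

/-! ### The proposition -/

theorem proposition5p7 (S : Set E3) (hS : IsInclusion S) (εr : ℂ) (hεr : 0 < εr.im)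
    (ω ε₀ μ₀ : ℝ) (hω : 0 < ω) (hε₀ : 0 < ε₀) (hμ₀ : 0 < μ₀)
    (k₀ : ℝ) (hk₀ : k₀ = ω * √(ε₀ * μ₀)) :
    -- the correctors, hence the shape fields, are well defined
    (∀ k, IsCorrector S εr k₀ (stdVec k) (corrector S εr k₀ k) ∧
      ∀ u, IsCorrector S εr k₀ (stdVec k) u → u =ᵐ[volume] corrector S εr k₀ k) ∧
    -- the solutions form a three-dimensional space with basis the shape fields
    (∃ (V : Submodule ℂ (E3 →ₘ[volume] C3)) (b : Module.Basis (Fin 3) ℂ V),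
      (∀ f : E3 →ₘ[volume] C3, f ∈ V ↔ IsSolution S εr k₀ f) ∧ Module.finrank ℂ V = 3 ∧
      ∀ k, ((b k : E3 →ₘ[volume] C3) : E3 → C3) =ᵐ[volume] shapeH S εr k₀ k) ∧
    -- every solution has one circulation vector, and it gives the coordinates of the solution
    (∀ w, IsSolution S εr k₀ w → ∃ z, (∀ z', IsCirculation S w z' ↔ z' = z) ∧
      w =ᵐ[volume] fun y => ∑ k, z k • shapeH S εr k₀ k y) ∧
    -- every vector is the circulation vector of exactly one solution
    (∀ z, ∃ w, IsSolution S εr k₀ w ∧ IsCirculation S w z ∧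
      ∀ w', IsSolution S εr k₀ w' → IsCirculation S w' z → w' =ᵐ[volume] w) ∧
    -- the two-scale limits
    (∀ (Ω : Set E3) (R εe : ℝ) (η : ℕ → ℝ) (E H : ℕ → E3 → C3) (E₀ H₀ J₀ : E3 → E3 → C3),
      IsOpen Ω → closure Ω ⊆ Metric.ball 0 R → 0 < εe →
      (∀ n, 0 < η n) → Tendsto η atTop (𝓝 0) →
      (∀ n, Maxwell ω ε₀ μ₀ (permittivity S Ω εr εe (η n)) (E n) (H n)) →
      BoundedL2 (Metric.ball 0 R) E → BoundedL2 (Metric.ball 0 R) H →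
      BoundedL2 (Metric.ball 0 R)
        (fun n => current (η n) (permittivity S Ω εr εe (η n)) (E n)) →
      TwoScaleConv (Metric.ball 0 R) η E E₀ → TwoScaleConv (Metric.ball 0 R) η H H₀ →
      TwoScaleConv (Metric.ball 0 R) η
        (fun n => current (η n) (permittivity S Ω εr εe (η n)) (E n)) J₀ →
      (∀ᵐ x ∂volume.restrict Ω, ∀ z, IsCirculation S (H₀ x) z ↔ z = circulation S (H₀ x)) ∧
      (∀ᵐ p ∂volume.restrict (Ω ×ˢ cell),
        H₀ p.1 p.2 = ∑ k, circulation S (H₀ p.1) k • shapeH S εr k₀ k p.2) ∧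
      (∀ᵐ p ∂volume.restrict (Ω ×ˢ cell),
        J₀ p.1 p.2 = ∑ k, (-(1 / (Complex.I * ω * ε₀)) * circulation S (H₀ p.1) k) •
          shapeJ S εr k₀ k p.2)) := by
  have hk : k₀ ≠ 0 := by
    rw [hk₀]
    positivity
  refine ⟨fun k => ⟨corrector_spec hS hεr hk k, fun u hu => hu.unique hS hεr hk
      (corrector_spec hS hεr hk k)⟩, exists_solution_space hS hεr hk, fun w hw => ?_, fun z => ?_,
    fun Ω R εe η E H E₀ H₀ J₀ hΩ hΩR _ hη hη0 hM bE bH bJ cE cH cJ => ?_⟩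
  · obtain ⟨z, hz⟩ := (isSolution_iff hS hεr hk).1 hw
    exact ⟨z, isCirculation_iff_of_ae_eq hS hεr hk hz, hz⟩
  · refine ⟨shapeSum S εr k₀ z, (isSolution_iff hS hεr hk).2 ⟨z, EventuallyEq.rfl⟩,
      isCirculation_shapeSum hS hεr hk z, fun w' hw' hz => ?_⟩
    obtain ⟨z', hz'⟩ := (isSolution_iff hS hεr hk).1 hw'
    rw [(isCirculation_iff_of_ae_eq hS hεr hk hz' z).1 hz]
    exact hz'
  · obtain ⟨χ, hχ⟩ := exists_isCircWeight hS
    have hsys := twoScaleSystem_of_maxwell hS.subset_cell (fun h => by simp [h] at hεr) hΩ hΩR hη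
      hη0 hM bE bH bJ cE cH cJ
    have hI : ∀ r : ℝ, 0 < r → Complex.I * ω * r ≠ 0 := fun r hr =>
      mul_ne_zero (mul_ne_zero Complex.I_ne_zero (Complex.ofReal_ne_zero.2 hω.ne'))
        (Complex.ofReal_ne_zero.2 hr.ne')
    -- `c₁ c₂ = -i² ω² ε₀ μ₀ = k₀²`.
    have hcc : Complex.I * ω * μ₀ * -(Complex.I * ω * ε₀) = (k₀ : ℂ) ^ 2 := by
      have e : k₀ ^ 2 = ω ^ 2 * (ε₀ * μ₀) := by
        rw [hk₀, mul_pow, Real.sq_sqrt (mul_pos hε₀ hμ₀).le]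
      rw [← Complex.ofReal_pow, e]
      push_cast
      linear_combination (-(ω : ℂ) ^ 2 * ε₀ * μ₀) * Complex.I_sq
    have hslice := hsys.ae_slice hS hχ hεr (hI μ₀ hμ₀) (neg_ne_zero.2 (hI ε₀ hε₀)) hcc hk
    -- The chosen circulation vector is a genuine one, hence the weighted mean, which is the only
    -- one.
    have hcirc : ∀ᵐ x ∂volume.restrict Ω, circulation S (H₀ x) = weightMean χ (H₀ x) :=
      hslice.mono fun x hx => (hx.1 _).1 (Classical.epsilon_spec ⟨_, (hx.1 _).2 rfl⟩)
    have hmeas := aestronglyMeasurable_weightMean hχ hsys.subset_ball cH.memLp_limit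
    refine ⟨?_, ?_, ?_⟩
    · filter_upwards [hslice, hcirc] with x hx hc z
      rw [hx.1 z, hc]
    · exact ae_prod_eq_sum (c := fun x k => circulation S (H₀ x) k) hsys.subset_ball cH.memLp_limit
        hmeas (aestronglyMeasurable_shapeH hS hεr hk)
        (hcirc.mono fun x hx => by simp only [hx]) (hslice.mono fun x hx => hx.2.1)
    · refine ae_prod_eq_sum
        (c := fun x k => -(1 / (Complex.I * ω * ε₀)) * circulation S (H₀ x) k) hsys.subset_ball
        cJ.memLp_limit (fun k => (hmeas k).const_mul _) (aestronglyMeasurable_shapeJ hS hεr hk)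
        (hcirc.mono fun x hx => ?_) (hslice.mono fun x hx => hx.2.2)
      funext k
      -- The coefficient of the currents is `c₂⁻¹` with `c₂ = -iωε₀`.
      rw [hx, one_div, inv_neg]
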